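/- Let $B\subset\mathbb{R}^2$ be the open unit ball, let $0<z_1<z_2<\cdots$ be such that $z_n^2$ $(n\ge 1)$ are the eigenvalues of the Dirichlet Laplacian $-\Delta$ on $B$ that have radial eigenfunctions, and let $e_n$ be the corresponding radial eigenfunctions, normalized in $L^2(B)$. On radial functions put $e^{it\Delta}e_n=e^{-itz_n^2}e_n$ and $(\sqrt{-\Delta})^{\gamma}e_n=z_n^{\gamma}e_n$. Write $\langle x\rangle=(1+x^2)^{1/2}$ and $e(mt)=e^{-imt}$. For $0<T<\tfrac12$, $I=[0,T)$, and $s,b\ge 0$, let $X^{s,b}(I)$ be the space of functions $f:I\times B\to\mathbb{C}$ that are representable as $$f(t,x)=\sum_{n\ge1,\,m\in\mathbb{Z}} f_{n,m}\,e_n(x)\,e(mt),\qquad (t,x)\in I\times B$$ (convergence in $L^2(I\times B)$), with finite norm $$\|f\|_{s,b}=\inf\Big(\sum_{n,m}\langle z_n\rangle^{2s}\langle z_n^2-m\rangle^{2b}|f_{n,m}|^2\Big)^{1/2},$$ the infimum being taken over all such representations of $f$ on $I\times B$. **Proposition 4.1.** Let $0\le s\le 1$, $\tfrac12<b\le 1$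 and $\mu>0$. There is a constant $C$, depending only on $s,b,\mu$, such that for all $0<T<\tfrac12$ and all integers $N\ge 1$ the following holds. Let $f\in X^{s,b}(I)$ and $g\in L^2(I\times B)$ be representable on $I\times B$ as $$f(t,x)=\sum_{n>N,\,m\in\mathbb{Z}}\widehat f(n,m)\,e_n(x)\,e(mt),\qquad g(t,x)=\sum_{n\le N,\,m\in\mathbb{Z}}\widehat g(n,m)\,e_n(x)\,e(mt).$$ Then $(fg)(\tau)\in L^2(B)$ for almost every $\tau\in I$, the integral $\int_0^t e^{i(t-\tau)\Delta}(fg)(\tau)\,d\tau$ converges in $L^2(B)$ for every $t\in I$, and $$\Big\|\int_0^t e^{i(t-\tau)\Delta}(fg)(\tau)\,d\tau\Big\|_{s,b}\le C\,\|f\|_{s,b}\,\big\|(\sqrt{-\Delta})^{5(2b-1)+\mu}g\big\|_{L^2(I\times B)}.$$ -/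

import Mathlib

open MeasureTheory Filter Topology
open scoped ENNReal

noncomputable section

namespace RadialNLS

/-- The Euclidean plane. -/
abbrev Plane : Type := EuclideanSpace ℝ (Fin 2)

/-- Lebesgue measure on the unit ball `B` of the plane. -/
def ballMeasure : Measure Plane := volume.restrict (Metric.ball 0 1)

/-- The complex Hilbert space `L²(B)`. A function `f(t, x)` on `I × B` is treated as the
function `t ↦ f(t, ·)` with values in this space. -/
abbrev L2Ball : Type := Lp ℂ 2 ballMeasure

/-- `φ` is a radial eigenfunction, with `L²(B)`-norm one, of `-Δ` on the unit ball with Dirichlet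
boundary condition, for the eigenvalue `lam`. Values of `φ` outside the closed ball play no role. -/
structure IsRadialDirichletEigenfunction (lam : ℝ) (φ : Plane → ℝ) : Prop where
  contDiffOn : ContDiffOn ℝ 2 φ (Metric.ball 0 1)
  continuousOn : ContinuousOn φ (Metric.closedBall 0 1)
  eigen : ∀ x ∈ Metric.ball (0 : Plane) 1, -(Laplacian.laplacian φ x) = lam * φ x
  dirichlet : ∀ x ∈ Metric.sphere (0 : Plane) 1, φ x = 0
  radial : ∀ x ∈ Metric.closedBall (0 : Plane) 1, ∀ y ∈ Metric.closedBall (0 : Plane) 1,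
    ‖x‖ = ‖y‖ → φ x = φ y
  normalized : ∫ x in Metric.ball (0 : Plane) 1, φ x ^ 2 = 1

/-- The set of eigenvalues of the Dirichlet Laplacian that have a radial eigenfunction. -/
def radialEigenvalues : Set ℝ :=
  {lam | ∃ φ : Plane → ℝ, IsRadialDirichletEigenfunction lam φ}

/-- Increasing enumeration of the (positive) radial eigenvalues. The `n`-th eigenvalue, for `n ≥ 1`,
is `eigenvalue n`; the value `0` at `n = 0` only starts the recursion. -/
def eigenvalue : ℕ → ℝ
  | 0 => 0
  | n + 1 => sInf {lam ∈ radialEigenvalues | eigenvalue n < lam}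

/-- The frequency `z_n > 0`, where `z_n ^ 2` is the `n`-th radial eigenvalue, `n ≥ 1`. -/
def z (n : ℕ+) : ℝ := Real.sqrt (eigenvalue n)

/-- `h ∈ L²(B)` is (the class of) a normalized radial Dirichlet eigenfunction for `lam`. -/
def IsEigenmode (lam : ℝ) (h : L2Ball) : Prop :=
  ∃ φ : Plane → ℝ, IsRadialDirichletEigenfunction lam φ ∧
    (h : Plane → ℂ) =ᵐ[ballMeasure] fun x => (φ x : ℂ)

/-- The `n`-th radial eigenfunction `e_n`, normalized in `L²(B)` (it is determined up to sign; one
of the two is chosen). -/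
def e (n : ℕ+) : L2Ball := Classical.epsilon (IsEigenmode (eigenvalue n))

/-- The Schrödinger propagator `e^{itΔ}` of the Dirichlet Laplacian on radial functions in `L²(B)`:
`e^{itΔ} e_n = e^{-i t z_n ^ 2} e_n`. -/
def propagator (t : ℝ) (h : L2Ball) : L2Ball :=
  ∑' n : ℕ+, (Complex.exp (-(Complex.I * (t : ℂ) * ((z n ^ 2 : ℝ) : ℂ))) * inner ℂ (e n) h) • e n

/-- The fractional power `(√-Δ)^γ` on radial functions: `(√-Δ)^γ e_n = z_n ^ γ e_n`. -/
def sqrtNegLaplacianPow (γ : ℝ) (h : L2Ball) : L2Ball :=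
  ∑' n : ℕ+, (((z n ^ γ : ℝ) : ℂ) * inner ℂ (e n) h) • e n

/-- The pointwise product `u v` (with the value `0` if it fails to lie in `L²(B)`). -/
def mulL2 (u v : L2Ball) : L2Ball :=
  open Classical in
  if h : MemLp (fun x => u x * v x) 2 ballMeasure then h.toLp else 0

/-- The Duhamel term `∫_0^t e^{i(t-τ)Δ} (f g)(τ) dτ`. -/
def duhamel (f g : ℝ → L2Ball) (t : ℝ) : L2Ball :=
  ∫ τ in (0 : ℝ)..t, propagator (t - τ) (mulL2 (f τ) (g τ))

/-- Lebesgue measure on the time interval `I = [0, T)`. -/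
def timeMeasure (T : ℝ) : Measure ℝ := volume.restrict (Set.Ico 0 T)

/-- The `L²`-norm over `I × B`, `I = [0, T)`, as an extended nonnegative number. -/
def spaceTimeL2Norm (T : ℝ) (f : ℝ → L2Ball) : ℝ≥0∞ := eLpNorm f 2 (timeMeasure T)

/-- The periodic time factor `e(mt) = e^{-imt}`; with this sign it oscillates like the free solution
`e^{itΔ} e_n = e^{-i z_n ^ 2 t} e_n` when `m` is close to `z_n ^ 2`. -/
def timeMode (m : ℤ) (t : ℝ) : ℂ := Complex.exp (-(Complex.I * (m : ℂ) * (t : ℂ)))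

/-- `f(t, x) = ∑_{n, m} c_{n,m} e_n(x) e(mt)` on `I × B`, `I = [0, T)`: `f` is in `L²(I × B)` and the
series converges to it unconditionally in `L²(I × B)`. -/
def IsRepresentation (T : ℝ) (c : ℕ+ × ℤ → ℂ) (f : ℝ → L2Ball) : Prop :=
  MemLp f 2 (timeMeasure T) ∧
    Tendsto (fun S : Finset (ℕ+ × ℤ) =>
      spaceTimeL2Norm T (fun t => f t - ∑ p ∈ S, (c p * timeMode p.2 t) • e p.1)) atTop (𝓝 0)

/-- The bracket `⟨x⟩ = (1 + x ^ 2) ^ (1/2)`. -/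
def bracket (x : ℝ) : ℝ := Real.sqrt (1 + x ^ 2)

/-- The weighted `ℓ²`-norm
`(∑_{n, m} ⟨z_n⟩^{2s} ⟨z_n ^ 2 - m⟩^{2b} |c_{n,m}| ^ 2) ^ (1/2)` in `[0, ∞]`. -/
def coeffNorm (s b : ℝ) (c : ℕ+ × ℤ → ℂ) : ℝ≥0∞ :=
  (∑' p : ℕ+ × ℤ, ENNReal.ofReal
    (bracket (z p.1) ^ (2 * s) * bracket (z p.1 ^ 2 - (p.2 : ℝ)) ^ (2 * b) * ‖c p‖ ^ 2))
      ^ (1 / 2 : ℝ)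

/-- The norm of `X^{s,b}(I)`, `I = [0, T)`: the infimum of the weighted norms of the coefficients over
all representations of `f` on `I × B` (and `∞` if there is none). -/
def xsbNorm (T s b : ℝ) (f : ℝ → L2Ball) : ℝ≥0∞ :=
  ⨅ (c : ℕ+ × ℤ → ℂ) (_ : IsRepresentation T c f), coeffNorm s b c

end RadialNLS

end

open MeasureTheory Filter Topology
open scoped ENNReal

noncomputable section

namespace RadialNLS

/-! In the eigenbasis `e n` and the time modes the claim is a weighted `ℓ²` bound for a trilinear
sum. Let `freq n` be the integer nearest to `z n ^ 2`. The coefficient of the product along `e l` at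
time frequency `freq l + j'` is the sum over `n > N ≥ k` and over modulations `j` of `F n j * triple
n k l * G k (freq l + j' - freq n - j)`, where `triple n k l` is the integral of `e_n e_k e_l`.
Integrating against the propagator gains one power of the modulation (`exists_duhamel_expansion`),
so the product has to be bounded with `b - 1` in place of `b`. Since `2 b > 1`, Cauchy-Schwarz
disposes of the sum over `j`, and `j` may be fixed.

Let the low index `k` run up to `M`. For each single output modulation `j'` the squared bound costs
only `M ^ μ` (`exists_sum_resonant_le`); summed over `|j'| ≤ M ^ 5` with the weight `⟨j'⟩ ^ (2 b -
2)` this gives `M ^ (5 (2 b - 1) + μ)`. For `|j'| > M ^ 5` the weight is at most `M ^ (5 (2 b -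
2))`, and summing over all such `j'` without weight costs `M ^ 5` (`exists_sum_unweighted_le`),
because multiplication by a single `e_k` is a bounded operator. Dyadic blocks of `k` are then added
up.

The resonant estimate combines analysis and arithmetic. On the analytic side, Sonin's bound `r
e_n(r) ^ 2 ≤ 1 / π` and the fact that the `L¹(dr)` norm on the span of `e_k`, `k ≤ M`, exceeds the
`L²` norm at most by a logarithm give `∑_{k ≤ M} triple n k l ^ 2 ≲ (1 + log M) ^ 2`. Green's
identity moves the derivatives onto the low frequency factor and yields `|n - l| |triple n k l| ≲ k
^ 2` for `k ≤ n`. The ratio `(⟨z_l⟩ / ⟨z_n⟩) ^ s` does no harm for `s ≤ 1`: it is close to one near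
the diagonal and is absorbed by the decay away from it.

On the arithmetic side, `z_n ^ 2 = (π ^ 2 / 16) (4 n + q) ^ 2 + O(1)` with `q` odd, so `freq l -
freq n` is a multiple of a difference of integer squares up to a bounded error. Cauchy-Schwarz in
`k` leaves a kernel controlled by a summable function of `freq l - freq n`. With `D = M ^ 5` there
are four ranges (`NearQuadratic.exists_sum_sq_kernel_le`): the diagonal; `|l - n| > D`, handled by
decay; `n ≲ D ^ 3`, handled by the divisor bound; and large `n`, where `freq l - freq n = freq l' -
freq n'` with `n` and `l'` prescribed has boundedly many near-diagonal solutions.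

The spectral input comes from `J₀`. The radial eigenfunctions are multiples of `J₀(z_n r)`. A Hankel
integral solves the same equation and has explicit asymptotics at infinity; its behaviour at the
origin makes the Wronskian with `J₀` vanish, so it is a multiple of `J₀`, and the asymptotics locate
the zeros. -/

/-! ### Entire power series on the real line -/

/-- The coefficient sequence `a` defines an everywhere convergent power series. -/
def EntireSeq (a : ℕ → ℝ) : Prop := ∀ R : ℝ, 0 ≤ R → Summable fun k => |a k| * R ^ k

/-- The sum of the power series with coefficients `a`. -/
def powerSum (a : ℕ → ℝ) (x : ℝ) : ℝ := ∑' k, a k * x ^ k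

/-- Coefficients of the derivative of a power series. -/
def derivSeq (a : ℕ → ℝ) (k : ℕ) : ℝ := (k + 1) * a (k + 1)

lemma EntireSeq.summable {a : ℕ → ℝ} (ha : EntireSeq a) (x : ℝ) :
    Summable fun k => a k * x ^ k := by
  refine Summable.of_norm ?_
  simpa [abs_mul, abs_pow] using ha |x| (abs_nonneg x)

/-- The factor `k + 1` is at most `2 ^ (k + 1)`, so doubling the radius absorbs it. -/
lemma EntireSeq.derivSeq {a : ℕ → ℝ} (ha : EntireSeq a) : EntireSeq (derivSeq a) := by
  intro R hR
  have h := (summable_nat_add_iff 1).2 (ha (2 * (R + 1)) (by positivity))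
  refine Summable.of_nonneg_of_le (fun k => by positivity) (fun k => ?_) h
  have h1 : ((k : ℝ) + 1) ≤ 2 ^ (k + 1) := by
    exact_mod_cast (Nat.lt_two_pow_self (n := k + 1)).le
  have h2 : R ^ k ≤ (R + 1) ^ (k + 1) :=
    calc R ^ k ≤ (R + 1) ^ k := by gcongr; linarith
      _ ≤ (R + 1) ^ (k + 1) := pow_le_pow_right₀ (by linarith) (Nat.le_succ k)
  rw [RadialNLS.derivSeq, abs_mul, abs_of_nonneg (by positivity : (0 : ℝ) ≤ k + 1), mul_pow]
  calc ((k : ℝ) + 1) * |a (k + 1)| * R ^ k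
      ≤ 2 ^ (k + 1) * |a (k + 1)| * (R + 1) ^ (k + 1) := by gcongr
    _ = |a (k + 1)| * (2 ^ (k + 1) * (R + 1) ^ (k + 1)) := by ring

lemma EntireSeq.hasDerivAt {a : ℕ → ℝ} (ha : EntireSeq a) (x : ℝ) :
    HasDerivAt (powerSum a) (powerSum (RadialNLS.derivSeq a) x) x := by
  have hR : (0 : ℝ) ≤ |x| + 1 := by positivity
  have hu : Summable fun k : ℕ => |RadialNLS.derivSeq a k| * (|x| + 1) ^ k :=
    ha.derivSeq _ hR
  have h2 : HasDerivAt (fun y => ∑' k : ℕ, a (k + 1) * y ^ (k + 1))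
      (∑' k : ℕ, RadialNLS.derivSeq a k * x ^ k) x := by
    refine hasDerivAt_tsum_of_isPreconnected (F := ℝ) (g := fun k y => a (k + 1) * y ^ (k + 1))
      (g' := fun k y => RadialNLS.derivSeq a k * y ^ k) (t := Metric.ball (0 : ℝ) (|x| + 1)) (y₀ := (0 : ℝ)) hu
      Metric.isOpen_ball (convex_ball _ _).isPreconnected ?_ ?_ ?_ ?_ ?_
    · intro k y _
      refine ((hasDerivAt_pow (k + 1) y).const_mul (a (k + 1))).congr_deriv ?_
      simp only [RadialNLS.derivSeq, Nat.add_sub_cancel]; push_cast; ring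
    · intro k y hy
      rw [norm_mul, norm_pow, Real.norm_eq_abs, Real.norm_eq_abs]
      have : |y| ≤ |x| + 1 := by
        have := mem_ball_zero_iff.1 hy; rw [Real.norm_eq_abs] at this; exact this.le
      gcongr
    · simpa using by positivity
    · exact (summable_nat_add_iff 1).2 (ha.summable 0)
    · simp
  have h3 : powerSum a = fun y => a 0 + ∑' k : ℕ, a (k + 1) * y ^ (k + 1) := by
    funext y
    rw [powerSum, (ha.summable y).tsum_eq_zero_add]; simp
  rw [h3]
  exact h2.const_add _

lemma EntireSeq.contDiff {a : ℕ → ℝ} (ha : EntireSeq a) (n : ℕ) : ContDiff ℝ n (powerSum a) := by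
  induction n generalizing a with
  | zero =>
    exact contDiff_zero.2 (continuous_iff_continuousAt.2 fun x => (ha.hasDerivAt x).continuousAt)
  | succ n ih =>
    push_cast
    rw [contDiff_succ_iff_deriv]
    refine ⟨fun x => (ha.hasDerivAt x).differentiableAt, by simp, ?_⟩
    rw [show deriv (powerSum a) = powerSum (RadialNLS.derivSeq a) from
      funext fun x => (ha.hasDerivAt x).deriv]
    exact ih ha.derivSeq

/-! ### The Bessel function of order zero -/

/-- Coefficients of `J₀`, as a power series in the square of the variable. -/
def besselSeq (k : ℕ) : ℝ := (-1) ^ k / (4 ^ k * (k.factorial : ℝ) ^ 2)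

lemma entireSeq_besselSeq : EntireSeq besselSeq := by
  intro R hR
  refine Summable.of_nonneg_of_le (fun k => by positivity) (fun k => ?_)
    (Real.summable_pow_div_factorial R)
  have hk : (1 : ℝ) ≤ k.factorial := by exact_mod_cast Nat.one_le_iff_ne_zero.2 k.factorial_ne_zero
  rw [besselSeq, abs_div, abs_pow, abs_neg, abs_one, one_pow,
    abs_of_pos (by positivity : (0 : ℝ) < 4 ^ k * (k.factorial : ℝ) ^ 2), div_mul_eq_mul_div,
    one_mul]
  have h4 : (1 : ℝ) ≤ 4 ^ k := one_le_pow₀ (by norm_num)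
  gcongr
  nlinarith

/-- `bessel (x ^ 2) = J₀ x`. -/
def besselSq : ℝ → ℝ := powerSum besselSeq

/-- The Bessel function `J₀`. -/
def besselJ (x : ℝ) : ℝ := besselSq (x ^ 2)

/-- The derivative of `J₀`. -/
def besselJ' (x : ℝ) : ℝ := 2 * x * powerSum (derivSeq besselSeq) (x ^ 2)

lemma contDiff_besselSq : ContDiff ℝ 2 besselSq := by
  exact_mod_cast entireSeq_besselSeq.contDiff 2

/-- In the variable `y = x ^ 2` Bessel's equation has polynomial coefficients, and it amounts to the
recursion `4 (k + 1) ^ 2 a (k + 1) + a k = 0`. -/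
lemma besselSq_ode (y : ℝ) : 4 * y * powerSum (derivSeq (derivSeq besselSeq)) y
    + 4 * powerSum (derivSeq besselSeq) y + besselSq y = 0 := by
  have h0 := entireSeq_besselSeq
  have h1 : HasSum (fun k : ℕ => 4 * k * derivSeq besselSeq k * y ^ k)
      (4 * y * powerSum (derivSeq (derivSeq besselSeq)) y) := by
    rw [← hasSum_nat_add_iff' 1]
    simp only [Finset.range_one, Finset.sum_singleton, Nat.cast_zero, mul_zero, zero_mul, sub_zero]
    have hk := (h0.derivSeq.derivSeq.summable y).hasSum.mul_left (4 * y)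
    refine hk.congr_fun fun k => ?_
    simp only [derivSeq]; push_cast; ring
  have h2 := ((h0.derivSeq.summable y).hasSum.mul_left 4)
  have h3 := (h0.summable y).hasSum
  have h := (h1.add h2).add h3
  refine h.unique ?_
  convert hasSum_zero using 2 with k
  have hk : (k.factorial : ℝ) ≠ 0 := by exact_mod_cast k.factorial_ne_zero
  have hk1 : (k : ℝ) + 1 ≠ 0 := by positivity
  simp only [derivSeq, besselSeq, Nat.factorial_succ, pow_succ]
  push_cast
  field_simp
  ring

lemma hasDerivAt_besselSq (y : ℝ) :
    HasDerivAt besselSq (powerSum (derivSeq besselSeq) y) y :=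
  entireSeq_besselSeq.hasDerivAt y

lemma hasDerivAt_besselJ (x : ℝ) : HasDerivAt besselJ (besselJ' x) x := by
  refine ((hasDerivAt_besselSq (x ^ 2)).comp x (hasDerivAt_pow 2 x)).congr_deriv ?_
  simp only [besselJ']; push_cast; ring

/-- Bessel's equation in divergence form, which unlike the usual form makes sense at the origin too.
-/
lemma hasDerivAt_besselJ'_mul (x : ℝ) :
    HasDerivAt (fun x => x * besselJ' x) (-(x * besselJ x)) x := by
  have h := (entireSeq_besselSeq.derivSeq.hasDerivAt (x ^ 2)).comp x (hasDerivAt_pow 2 x)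
  have h2 := ((hasDerivAt_id x).pow 2 |>.const_mul 2).mul h
  have ode := besselSq_ode (x ^ 2)
  refine (h2.congr_deriv ?_).congr_of_eventuallyEq (Eventually.of_forall fun y => ?_)
  · simp only [besselJ, Function.comp, Pi.pow_apply, id]
    push_cast
    linear_combination x * ode
  · simp only [besselJ', Function.comp, Pi.mul_apply, Pi.pow_apply, id]; ring

lemma continuous_besselJ : Continuous besselJ :=
  continuous_iff_continuousAt.2 fun x => (hasDerivAt_besselJ x).continuousAt

lemma continuous_besselJ' : Continuous besselJ' := by
  unfold besselJ'
  have : Continuous (powerSum (derivSeq besselSeq)) :=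
    continuous_iff_continuousAt.2 fun x => (entireSeq_besselSeq.derivSeq.hasDerivAt x).continuousAt
  fun_prop

lemma hasDerivAt_besselJ' {x : ℝ} (hx : x ≠ 0) :
    HasDerivAt besselJ' (-(besselJ' x / x) - besselJ x) x := by
  have h := (hasDerivAt_besselJ'_mul x).div (hasDerivAt_id x) hx
  refine (h.congr_deriv ?_).congr_of_eventuallyEq ?_
  · simp only [id]; field_simp; ring
  · filter_upwards [isOpen_ne.mem_nhds hx] with y hy
    have : y ≠ 0 := hy
    simp only [Pi.div_apply, id]; field_simp

@[simp] lemma besselJ_zero : besselJ 0 = 1 := by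
  have : besselSq 0 = 1 := by
    rw [besselSq, powerSum, tsum_eq_single 0]
    · simp [besselSeq]
    · intro k hk; simp [hk]
  simpa [besselJ] using this

@[simp] lemma besselJ'_zero : besselJ' 0 = 0 := by simp [besselJ']

/-- The term `J₀' / x` of the equation acts as friction: the energy has derivative `-2 J₀' ^ 2 / x`.
As the energy is one at the origin, this bounds `J₀` and `J₀'`; it also makes the zeros simple. -/
lemma besselJ_energy_antitone :
    AntitoneOn (fun x => besselJ' x ^ 2 + besselJ x ^ 2) (Set.Ici 0) := by
  refine antitoneOn_of_hasDerivWithinAt_nonpos (f' := fun x => -(2 * besselJ' x ^ 2 / x))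
    (convex_Ici 0) ?_ ?_ ?_
  · exact ((continuous_besselJ'.pow 2).add (continuous_besselJ.pow 2)).continuousOn
  · intro x hx
    have hx0 : 0 < x := by simpa using hx
    have h := ((hasDerivAt_besselJ' hx0.ne').pow 2).add ((hasDerivAt_besselJ x).pow 2)
    refine (h.congr_deriv ?_).hasDerivWithinAt
    push_cast; field_simp; ring
  · intro x hx
    have hx0 : 0 < x := by simpa using hx
    have : 0 ≤ 2 * besselJ' x ^ 2 / x := by positivity
    linarith

lemma besselJ_sq_add_le {x : ℝ} (hx : 0 ≤ x) : besselJ' x ^ 2 + besselJ x ^ 2 ≤ 1 := by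
  have := besselJ_energy_antitone (Set.mem_Ici.2 le_rfl) (Set.mem_Ici.2 hx) hx
  simpa using this

lemma abs_besselJ_le {x : ℝ} (hx : 0 ≤ x) : |besselJ x| ≤ 1 := by
  rw [← sq_le_one_iff_abs_le_one]; nlinarith [besselJ_sq_add_le hx, sq_nonneg (besselJ' x)]

lemma abs_besselJ'_le {x : ℝ} (hx : 0 ≤ x) : |besselJ' x| ≤ 1 := by
  rw [← sq_le_one_iff_abs_le_one]; nlinarith [besselJ_sq_add_le hx, sq_nonneg (besselJ x)]

/-- The derivative of `x J₀' + x ^ 2 / 2` is `x (1 - J₀) ≥ 0`. One more integration gives the lower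
bound for `J₀` near the origin. -/
lemma neg_half_le_besselJ' {x : ℝ} (hx : 0 ≤ x) : -(x / 2) ≤ besselJ' x := by
  have hm : MonotoneOn (fun x => x * besselJ' x + x ^ 2 / 2) (Set.Ici 0) := by
    refine monotoneOn_of_hasDerivWithinAt_nonneg (f' := fun x => x * (1 - besselJ x))
      (convex_Ici 0) ?_ ?_ ?_
    · exact ((continuous_id.mul continuous_besselJ').add (by fun_prop)).continuousOn
    · intro x _
      have h := (hasDerivAt_besselJ'_mul x).add (((hasDerivAt_pow 2 x)).div_const 2)
      refine (h.congr_deriv ?_).hasDerivWithinAt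
      push_cast; ring
    · intro x hx
      have hx0 : 0 < x := by simpa using hx
      have := (abs_le.1 (abs_besselJ_le hx0.le)).2
      exact mul_nonneg hx0.le (by linarith)
  rcases hx.eq_or_lt with rfl | hx0
  · simp
  have := hm (Set.mem_Ici.2 le_rfl) (Set.mem_Ici.2 hx) hx
  simp only [zero_mul, ne_eq, OfNat.ofNat_ne_zero, not_false_eq_true, zero_pow, zero_div,
    add_zero] at this
  have h2 : 0 ≤ x * (besselJ' x + x / 2) := by nlinarith
  have := (mul_nonneg_iff_of_pos_left hx0).1 h2
  linarith

lemma one_sub_sq_le_besselJ {x : ℝ} (hx : 0 ≤ x) : 1 - x ^ 2 / 4 ≤ besselJ x := by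
  have hm : MonotoneOn (fun x => besselJ x + x ^ 2 / 4) (Set.Ici 0) := by
    refine monotoneOn_of_hasDerivWithinAt_nonneg (f' := fun x => besselJ' x + x / 2)
      (convex_Ici 0) ?_ ?_ ?_
    · exact (continuous_besselJ.add (by fun_prop)).continuousOn
    · intro x _
      have h := (hasDerivAt_besselJ x).add (((hasDerivAt_pow 2 x)).div_const 4)
      refine (h.congr_deriv ?_).hasDerivWithinAt
      push_cast; ring
    · intro x hx
      have hx0 : 0 < x := by simpa using hx
      linarith [neg_half_le_besselJ' hx0.le]
  have := hm (Set.mem_Ici.2 le_rfl) (Set.mem_Ici.2 hx) hx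
  simp only [besselJ_zero] at this
  linarith

/-- A solution of the radial eigenvalue equation whose energy vanishes at the origin is zero. -/
lemma radial_ode_unique {v v' : ℝ → ℝ} {lam R : ℝ} (hlam : 0 < lam)
    (hv : ∀ r ∈ Set.Ioo 0 R, HasDerivAt v (v' r) r)
    (hv' : ∀ r ∈ Set.Ioo 0 R, HasDerivAt v' (-(v' r / r) - lam * v r) r)
    (h0 : Tendsto (fun r => v' r ^ 2 + lam * v r ^ 2) (𝓝[>] 0) (𝓝 0)) :
    ∀ r ∈ Set.Ioo 0 R, v r = 0 := by
  have hE : ∀ r ∈ Set.Ioo 0 R, HasDerivAt (fun r => v' r ^ 2 + lam * v r ^ 2)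
      (-(2 * v' r ^ 2 / r)) r := by
    intro r hr
    have h := ((hv' r hr).pow 2).add (((hv r hr).pow 2).const_mul lam)
    refine h.congr_deriv ?_
    have : r ≠ 0 := hr.1.ne'
    push_cast; field_simp; ring
  have hanti : AntitoneOn (fun r => v' r ^ 2 + lam * v r ^ 2) (Set.Ioo 0 R) := by
    refine antitoneOn_of_hasDerivWithinAt_nonpos (f' := fun x => -(2 * v' x ^ 2 / x))
      (convex_Ioo 0 R) (fun r hr => (hE r hr).continuousAt.continuousWithinAt) ?_ ?_
    · intro x hx
      rw [interior_Ioo] at hx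
      exact (hE x hx).hasDerivWithinAt
    · intro x hx
      rw [interior_Ioo] at hx
      have := hx.1
      have : 0 ≤ 2 * v' x ^ 2 / x := by positivity
      linarith
  intro r hr
  -- The energy decreases from its limit zero at the origin, and it is a sum of nonnegative terms.
  have hle : v' r ^ 2 + lam * v r ^ 2 ≤ 0 := by
    refine ge_of_tendsto h0 ?_
    filter_upwards [Ioo_mem_nhdsGT hr.1] with s hs
    exact hanti ⟨hs.1, hs.2.trans hr.2⟩ hr hs.2.le
  have h1 : lam * v r ^ 2 ≤ 0 := by nlinarith [sq_nonneg (v' r)]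
  have h2 : v r ^ 2 ≤ 0 := by
    by_contra h
    push Not at h
    nlinarith
  exact pow_eq_zero_iff (two_ne_zero) |>.1 (le_antisymm h2 (sq_nonneg _))

/-! ### The Hankel representation -/

/-- The square root of `y ^ 2 / 2 - i`. -/
def hankelRoot (y : ℝ) : ℂ := ((y ^ 2 / 2 : ℝ) - Complex.I : ℂ) ^ (1 / 2 : ℂ)

lemma hankelRoot_sq (y : ℝ) : hankelRoot y ^ 2 = (y ^ 2 / 2 : ℝ) - Complex.I := by
  have := Complex.cpow_nat_inv_pow ((y ^ 2 / 2 : ℝ) - Complex.I : ℂ) (n := 2) two_ne_zero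
  simpa only [hankelRoot, one_div, Nat.cast_ofNat] using this

/-- The radicand has imaginary part `-1`, so its argument lies in `(-π, 0)` and half of it in `(-π /
2, 0)`. -/
lemma hankelRoot_re_pos (y : ℝ) : 0 < (hankelRoot y).re := by
  have him : ((y ^ 2 / 2 : ℝ) - Complex.I : ℂ).im = -1 := by
    rw [Complex.sub_im, Complex.ofReal_im, Complex.I_im]; norm_num
  have hne : ((y ^ 2 / 2 : ℝ) - Complex.I : ℂ) ≠ 0 := by
    intro h; rw [h] at him; simp at him
  rw [hankelRoot, Complex.cpow_def_of_ne_zero hne, Complex.exp_re]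
  refine mul_pos (Real.exp_pos _) (Real.cos_pos_of_mem_Ioo ?_)
  have h1 := Complex.neg_pi_lt_arg ((y ^ 2 / 2 : ℝ) - Complex.I : ℂ)
  have h2 : Complex.arg ((y ^ 2 / 2 : ℝ) - Complex.I : ℂ) < 0 := by
    rw [Complex.arg_neg_iff, him]; norm_num
  have h3 : (Complex.log ((y ^ 2 / 2 : ℝ) - Complex.I : ℂ) * (1 / 2 : ℂ)).im
      = Complex.arg ((y ^ 2 / 2 : ℝ) - Complex.I : ℂ) / 2 := by
    rw [Complex.mul_im, Complex.log_im]
    simp; ring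
  rw [h3]
  constructor <;> linarith [Real.pi_pos]

lemma hankelRoot_re_im (y : ℝ) :
    (hankelRoot y).re ^ 2 - (hankelRoot y).im ^ 2 = y ^ 2 / 2 ∧
      2 * (hankelRoot y).re * (hankelRoot y).im = -1 := by
  have h := hankelRoot_sq y
  have h1 := congrArg Complex.re h
  have h2 := congrArg Complex.im h
  rw [sq] at h1 h2
  simp only [Complex.mul_re, Complex.mul_im, Complex.sub_re, Complex.sub_im, Complex.ofReal_re,
    Complex.ofReal_im, Complex.I_re, Complex.I_im] at h1 h2
  constructor <;> linarith

lemma hankelRoot_ne_zero (y : ℝ) : hankelRoot y ≠ 0 := by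
  intro h; have := hankelRoot_re_pos y; rw [h] at this; simp at this

lemma half_le_hankelRoot_re_sq (y : ℝ) : 1 / 2 ≤ (hankelRoot y).re ^ 2 := by
  obtain ⟨h1, h2⟩ := hankelRoot_re_im y
  have h3 := hankelRoot_re_pos y
  have h4 : (hankelRoot y).re ^ 2 * (hankelRoot y).im ^ 2 = 1 / 4 := by
    nlinarith
  by_contra h
  push Not at h
  have : (hankelRoot y).im ^ 2 ≤ (hankelRoot y).re ^ 2 := by nlinarith [sq_nonneg y]
  nlinarith [sq_nonneg (hankelRoot y).im, sq_nonneg (hankelRoot y).re]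

lemma half_lt_hankelRoot_re (y : ℝ) : 1 / 2 < (hankelRoot y).re := by
  nlinarith [half_le_hankelRoot_re_sq y, hankelRoot_re_pos y]

lemma normSq_hankelRoot_ge (y : ℝ) : (1 + y ^ 2) / 3 ≤ Complex.normSq (hankelRoot y) := by
  obtain ⟨h1, h2⟩ := hankelRoot_re_im y
  rw [Complex.normSq_apply]
  have h4 : (hankelRoot y).re ^ 2 * (hankelRoot y).im ^ 2 = 1 / 4 := by
    nlinarith
  have h5 : (1 : ℝ) ≤ (hankelRoot y).re ^ 2 + (hankelRoot y).im ^ 2 := by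
    nlinarith [sq_nonneg ((hankelRoot y).re ^ 2 - (hankelRoot y).im ^ 2),
      sq_nonneg (hankelRoot y).im, sq_nonneg (hankelRoot y).re]
  nlinarith [sq_nonneg (hankelRoot y).im]

/-- The inverse square root of `y ^ 2 / 2 - i`. -/
def hankelChi (y : ℝ) : ℂ := (hankelRoot y)⁻¹

lemma norm_hankelChi_le (y : ℝ) : ‖hankelChi y‖ ≤ 1 := by
  rw [hankelChi, norm_inv]
  refine inv_le_one_of_one_le₀ ?_
  obtain ⟨h1, h2⟩ := hankelRoot_re_im y
  have h4 : (hankelRoot y).re ^ 2 * (hankelRoot y).im ^ 2 = 1 / 4 := by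
    nlinarith
  have h5 : (1 : ℝ) ≤ (hankelRoot y).re ^ 2 + (hankelRoot y).im ^ 2 := by
    nlinarith [sq_nonneg ((hankelRoot y).re ^ 2 - (hankelRoot y).im ^ 2),
      sq_nonneg (hankelRoot y).im, sq_nonneg (hankelRoot y).re]
  rw [Complex.norm_eq_sqrt_sq_add_sq]
  exact Real.one_le_sqrt.2 h5

/-- The imaginary part of the root stays bounded, so the imaginary part of the inverse decays like
`y ^ (-2)`, although the inverse itself decays only like `1 / |y|`. This difference is what makes
`hankelH` regular enough at the origin. -/
lemma abs_hankelChi_im_le (y : ℝ) : |(hankelChi y).im| ≤ 3 * (1 + y ^ 2)⁻¹ := by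
  obtain ⟨h1, h2⟩ := hankelRoot_re_im y
  have h3 := half_lt_hankelRoot_re y
  rw [hankelChi, Complex.inv_im, abs_div, abs_neg, abs_of_nonneg (Complex.normSq_nonneg _),
    ← div_eq_mul_inv]
  have h4 := normSq_hankelRoot_ge y
  have h5 : |(hankelRoot y).im| ≤ 1 := by
    rw [abs_le]; constructor <;> nlinarith
  have h6 : 0 < 1 + y ^ 2 := by positivity
  rw [div_le_div_iff₀ (by linarith) h6]
  nlinarith [abs_nonneg (hankelRoot y).im]

lemma hankelChi_zero : hankelChi 0 = Complex.exp (Complex.I * (Real.pi / 4 : ℝ)) := by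
  obtain ⟨h1, h2⟩ := hankelRoot_re_im 0
  have h3 := half_lt_hankelRoot_re 0
  have h4 : (hankelRoot 0).im = -(hankelRoot 0).re := by
    have : ((hankelRoot 0).re - (hankelRoot 0).im) * ((hankelRoot 0).im + (hankelRoot 0).re) = 0 := by
      nlinarith
    rcases mul_eq_zero.1 this with h | h
    · nlinarith
    · linarith
  have h5 : (hankelRoot 0).re = √2 / 2 := by
    have : (hankelRoot 0).re ^ 2 = (√2 / 2) ^ 2 := by
      rw [div_pow, Real.sq_sqrt (by norm_num)]; rw [h4] at h2; nlinarith
    exact (pow_left_inj₀ (by linarith) (by positivity) two_ne_zero).1 this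
  have h2' : (√2 : ℝ) * √2 = 2 := Real.mul_self_sqrt (by norm_num)
  have hn : Complex.normSq (hankelRoot 0) = 1 := by
    rw [Complex.normSq_apply, h4, h5]; nlinarith
  rw [mul_comm, hankelChi]
  apply Complex.ext
  · rw [Complex.inv_re, hn, h5, Complex.exp_ofReal_mul_I_re, Real.cos_pi_div_four]; simp
  · rw [Complex.inv_im, hn, h4, h5, Complex.exp_ofReal_mul_I_im, Real.sin_pi_div_four]; simp

/-- By the difference of squares, the two roots differ by `y ^ 2 / 2` divided by their sum, whose
real part is at least one. -/
lemma norm_hankelChi_sub_le (y : ℝ) : ‖hankelChi y - hankelChi 0‖ ≤ y ^ 2 := by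
  have h0 := hankelRoot_ne_zero 0
  have hy := hankelRoot_ne_zero y
  have hs : 1 ≤ ‖hankelRoot 0 + hankelRoot y‖ := by
    refine le_trans ?_ (Complex.re_le_norm _)
    rw [Complex.add_re]
    linarith [half_lt_hankelRoot_re 0, half_lt_hankelRoot_re y]
  have hs0 : hankelRoot 0 + hankelRoot y ≠ 0 := by
    intro h; rw [h] at hs; simp at hs; linarith
  have key : hankelChi y - hankelChi 0
      = -((y ^ 2 / 2 : ℝ) : ℂ) * (hankelRoot 0 + hankelRoot y)⁻¹ * hankelChi 0 * hankelChi y := by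
    have e1 := hankelRoot_sq y
    have e0 := hankelRoot_sq 0
    have e2 : ((y ^ 2 / 2 : ℝ) : ℂ) = hankelRoot y ^ 2 - hankelRoot 0 ^ 2 := by
      rw [e1, e0]; simp
    rw [e2, hankelChi, hankelChi]
    field_simp
    ring
  rw [key, norm_mul, norm_mul, norm_mul, norm_neg, norm_inv, Complex.norm_real, Real.norm_eq_abs,
    abs_of_nonneg (by positivity : 0 ≤ y ^ 2 / 2)]
  have hi : ‖hankelRoot 0 + hankelRoot y‖⁻¹ ≤ 1 := inv_le_one_of_one_le₀ hs
  calc y ^ 2 / 2 * ‖hankelRoot 0 + hankelRoot y‖⁻¹ * ‖hankelChi 0‖ * ‖hankelChi y‖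
      ≤ y ^ 2 / 2 * 1 * 1 * 1 := by
        gcongr
        · exact norm_hankelChi_le 0
        · exact norm_hankelChi_le y
    _ ≤ y ^ 2 := by nlinarith [sq_nonneg y]

lemma hasDerivAt_hankelRoot (y : ℝ) :
    HasDerivAt hankelRoot (((y / 2 : ℝ) : ℂ) * hankelChi y) y := by
  have h1 : HasDerivAt (fun y : ℝ => ((y ^ 2 / 2 : ℝ) : ℂ) - Complex.I) ((y : ℝ) : ℂ) y := by
    refine HasDerivAt.sub_const _ (HasDerivAt.ofReal_comp ?_)
    refine ((hasDerivAt_pow 2 y).div_const 2).congr_deriv ?_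
    push_cast; ring
  have hsl : ((y ^ 2 / 2 : ℝ) : ℂ) - Complex.I ∈ Complex.slitPlane := by
    right; rw [Complex.sub_im, Complex.ofReal_im, Complex.I_im]; norm_num
  have h3 := ((hasDerivAt_id _).cpow_const (c := 1 / 2) hsl).comp y h1
  refine h3.congr_deriv ?_
  have hne := Complex.slitPlane_ne_zero hsl
  rw [hankelChi, hankelRoot, ← Complex.cpow_neg, id]
  have : (1 / 2 - 1 : ℂ) = -(1 / 2) := by norm_num
  rw [this]; push_cast; ring

lemma continuous_hankelRoot : Continuous hankelRoot :=
  continuous_iff_continuousAt.2 fun y => (hasDerivAt_hankelRoot y).continuousAt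

lemma continuous_hankelChi : Continuous hankelChi :=
  continuous_hankelRoot.inv₀ hankelRoot_ne_zero

/-- Half of the Gaussian pays for the power, by `t ^ p / p! ≤ exp t` with `t = x y ^ 2 / 2`. -/
lemma pow_mul_exp_neg_le (p : ℕ) {x : ℝ} (hx : 0 < x) (y : ℝ) :
    y ^ (2 * p) * Real.exp (-x * y ^ 2) ≤
      p.factorial * (2 / x) ^ p * Real.exp (-(x / 2) * y ^ 2) := by
  have h1 := Real.pow_div_factorial_le_exp (x / 2 * y ^ 2) (by positivity) p
  have hf : (0 : ℝ) < p.factorial := by exact_mod_cast p.factorial_pos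
  rw [div_le_iff₀ hf] at h1
  have h2 : Real.exp (-x * y ^ 2) =
      Real.exp (-(x / 2) * y ^ 2) * (Real.exp (x / 2 * y ^ 2))⁻¹ := by
    rw [← Real.exp_neg, ← Real.exp_add]; ring_nf
  have h3 : y ^ (2 * p) = (2 / x) ^ p * (x / 2 * y ^ 2) ^ p := by
    rw [← mul_pow, pow_mul]; congr 1; field_simp
  rw [h2, h3]
  have he := Real.exp_pos (x / 2 * y ^ 2)
  calc (2 / x) ^ p * (x / 2 * y ^ 2) ^ p * (Real.exp (-(x / 2) * y ^ 2) * (Real.exp (x / 2 * y ^ 2))⁻¹)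
      ≤ (2 / x) ^ p * (Real.exp (x / 2 * y ^ 2) * p.factorial) *
        (Real.exp (-(x / 2) * y ^ 2) * (Real.exp (x / 2 * y ^ 2))⁻¹) := by gcongr
    _ = _ := by field_simp

lemma integrable_pow_mul_exp_neg (p : ℕ) {x : ℝ} (hx : 0 < x) :
    Integrable fun y : ℝ => y ^ (2 * p) * Real.exp (-x * y ^ 2) := by
  refine ((integrable_exp_neg_mul_sq (half_pos hx)).const_mul
    (p.factorial * (2 / x) ^ p)).mono' (by fun_prop) (Eventually.of_forall fun y => ?_)
  rw [Real.norm_eq_abs, abs_of_nonneg (by rw [pow_mul]; positivity)]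
  exact pow_mul_exp_neg_le p hx y

lemma integral_pow_mul_exp_neg_le (p : ℕ) {x : ℝ} (hx : 0 < x) :
    ∫ y : ℝ, y ^ (2 * p) * Real.exp (-x * y ^ 2) ≤ p.factorial * (2 / x) ^ p * √(2 * Real.pi / x) := by
  refine (integral_mono (integrable_pow_mul_exp_neg p hx)
    ((integrable_exp_neg_mul_sq (half_pos hx)).const_mul
    (p.factorial * (2 / x) ^ p)) fun y => pow_mul_exp_neg_le p hx y).trans_eq ?_
  rw [integral_const_mul, integral_gaussian]
  congr 2; field_simp

/-- The moments `∫ y ^ (2p) e^{-x y²} (y ^ 2 / 2 - i) ^ (-1/2) dy`. -/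
def hankelMoment (p : ℕ) (x : ℝ) : ℂ :=
  ∫ y : ℝ, ((y ^ (2 * p) * Real.exp (-x * y ^ 2) : ℝ) : ℂ) * hankelChi y

lemma norm_moment_integrand_le (p : ℕ) (x y : ℝ) :
    ‖((y ^ (2 * p) * Real.exp (-x * y ^ 2) : ℝ) : ℂ) * hankelChi y‖
      ≤ y ^ (2 * p) * Real.exp (-x * y ^ 2) := by
  rw [norm_mul, Complex.norm_real, Real.norm_eq_abs, abs_of_nonneg (by rw [pow_mul]; positivity)]
  exact mul_le_of_le_one_right (by rw [pow_mul]; positivity) (norm_hankelChi_le y)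

lemma integrable_moment (p : ℕ) {x : ℝ} (hx : 0 < x) :
    Integrable fun y : ℝ => ((y ^ (2 * p) * Real.exp (-x * y ^ 2) : ℝ) : ℂ) * hankelChi y := by
  refine (integrable_pow_mul_exp_neg p hx).mono' ?_
    (Eventually.of_forall fun y => norm_moment_integrand_le p x y)
  have := continuous_hankelChi
  exact Continuous.aestronglyMeasurable (by fun_prop)

lemma norm_hankelMoment_le (p : ℕ) {x : ℝ} (hx : 0 < x) :
    ‖hankelMoment p x‖ ≤ p.factorial * (2 / x) ^ p * √(2 * Real.pi / x) :=
  (norm_integral_le_of_norm_le (integrable_pow_mul_exp_neg p hx)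
    (Eventually.of_forall fun y => norm_moment_integrand_le p x y)).trans
    (integral_pow_mul_exp_neg_le p hx)

lemma hasDerivAt_hankelMoment (p : ℕ) {x : ℝ} (hx : 0 < x) :
    HasDerivAt (hankelMoment p) (-hankelMoment (p + 1) x) x := by
  have hc := continuous_hankelChi
  have h := hasDerivAt_integral_of_dominated_loc_of_deriv_le (μ := volume) (𝕜 := ℝ) (x₀ := x)
    (s := Metric.ball x (x / 2))
    (F := fun x y => ((y ^ (2 * p) * Real.exp (-x * y ^ 2) : ℝ) : ℂ) * hankelChi y)
    (F' := fun x y => -(((y ^ (2 * (p + 1)) * Real.exp (-x * y ^ 2) : ℝ) : ℂ) * hankelChi y))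
    (bound := fun y => y ^ (2 * (p + 1)) * Real.exp (-(x / 2) * y ^ 2))
    (Metric.ball_mem_nhds x (half_pos hx))
    (Eventually.of_forall fun x => Continuous.aestronglyMeasurable (by fun_prop))
    (integrable_moment p hx) (Continuous.aestronglyMeasurable (by fun_prop))
    (Eventually.of_forall fun y x' hx' => ?_)
    (integrable_pow_mul_exp_neg (p + 1) (half_pos hx))
    (Eventually.of_forall fun y x' hx' => ?_)
  · refine h.2.congr_deriv ?_
    rw [integral_neg]; rfl
  · rw [norm_neg]
    refine (norm_moment_integrand_le (p + 1) x' y).trans ?_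
    rw [Metric.mem_ball, Real.dist_eq, abs_lt] at hx'
    have : 0 ≤ y ^ (2 * (p + 1)) := by rw [pow_mul]; positivity
    gcongr
    nlinarith [sq_nonneg y]
  · have h1 : HasDerivAt (fun x : ℝ => y ^ (2 * p) * Real.exp (-x * y ^ 2))
        (-(y ^ (2 * (p + 1)) * Real.exp (-x' * y ^ 2))) x' := by
      have := (((hasDerivAt_id x').neg.mul_const (y ^ 2)).exp).const_mul (y ^ (2 * p))
      refine this.congr_deriv ?_
      simp only [id, Pi.neg_apply]; ring
    refine (h1.ofReal_comp.mul_const (hankelChi y)).congr_deriv ?_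
    push_cast; ring

/-- The combined integrand is minus the derivative in `y` of `y e^{-x y ^ 2} (y ^ 2 / 2 - i) ^ (1 /
2)`, an integrable function, so its integral vanishes. This is Bessel's equation with the factor
`e^{i x}` removed. -/
lemma hankelMoment_ode {x : ℝ} (hx : 0 < x) :
    (x : ℂ) * hankelMoment 2 x - (2 * Complex.I * x + 1) * hankelMoment 1 x
      + Complex.I * hankelMoment 0 x = 0 := by
  have hY : ∀ y : ℝ, HasDerivAt
      (fun y : ℝ => ((y * Real.exp (-x * y ^ 2) : ℝ) : ℂ) * hankelRoot y)
      (-((x : ℂ) * (((y ^ (2 * 2) * Real.exp (-x * y ^ 2) : ℝ) : ℂ) * hankelChi y)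
        - (2 * Complex.I * x + 1) * (((y ^ (2 * 1) * Real.exp (-x * y ^ 2) : ℝ) : ℂ) * hankelChi y)
        + Complex.I * (((y ^ (2 * 0) * Real.exp (-x * y ^ 2) : ℝ) : ℂ) * hankelChi y))) y := by
    intro y
    have h1 : HasDerivAt (fun y : ℝ => y * Real.exp (-x * y ^ 2))
        (Real.exp (-x * y ^ 2) * (1 - 2 * x * y ^ 2)) y := by
      have := (hasDerivAt_id y).mul (((hasDerivAt_pow 2 y).const_mul (-x)).exp)
      refine this.congr_deriv ?_
      simp only [id]; push_cast; ring
    refine (h1.ofReal_comp.mul (hasDerivAt_hankelRoot y)).congr_deriv ?_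
    have e : hankelRoot y = ((y ^ 2 / 2 : ℝ) - Complex.I) * hankelChi y := by
      rw [← hankelRoot_sq, hankelChi]; field_simp [hankelRoot_ne_zero y]
    rw [e]
    push_cast
    ring_nf
  have hi2 := (integrable_moment 2 hx).const_mul (x : ℂ)
  have hi1 := (integrable_moment 1 hx).const_mul (2 * Complex.I * x + 1)
  have hi0 := (integrable_moment 0 hx).const_mul Complex.I
  have hint := ((hi2.sub hi1).add hi0)
  have hYi : Integrable fun y : ℝ => ((y * Real.exp (-x * y ^ 2) : ℝ) : ℂ) * hankelRoot y := by
    have hd : Integrable fun y : ℝ => (1 + y ^ 2) ^ 2 * Real.exp (-x * y ^ 2) := by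
      have := ((integrable_pow_mul_exp_neg 0 hx).add
        ((integrable_pow_mul_exp_neg 1 hx).const_mul 2)).add (integrable_pow_mul_exp_neg 2 hx)
      refine this.congr (Eventually.of_forall fun y => ?_)
      simp only [Pi.add_apply]; ring
    refine hd.mono' ?_ (Eventually.of_forall fun y => ?_)
    · have := continuous_hankelRoot
      exact Continuous.aestronglyMeasurable (by fun_prop)
    · rw [norm_mul, Complex.norm_real, Real.norm_eq_abs, abs_mul, abs_of_pos (Real.exp_pos _)]
      have hr : ‖hankelRoot y‖ ≤ 1 + y ^ 2 := by
        have h2 : ‖hankelRoot y‖ ^ 2 ≤ 1 + y ^ 2 := by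
          rw [← norm_pow, hankelRoot_sq]
          refine (norm_sub_le _ _).trans ?_
          rw [Complex.norm_real, Complex.norm_I, Real.norm_eq_abs, abs_of_nonneg (by positivity)]
          nlinarith [sq_nonneg y]
        nlinarith [norm_nonneg (hankelRoot y), sq_nonneg y]
      have hy : |y| ≤ 1 + y ^ 2 := by
        rw [abs_le]; constructor <;> nlinarith [sq_nonneg (y - 1), sq_nonneg (y + 1)]
      calc |y| * Real.exp (-x * y ^ 2) * ‖hankelRoot y‖
          ≤ (1 + y ^ 2) * Real.exp (-x * y ^ 2) * (1 + y ^ 2) := by gcongr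
        _ = _ := by ring
  have := integral_eq_zero_of_hasDerivAt_of_integrable hY hint.neg hYi
  have e1 := integral_add (hi2.sub hi1) hi0
  simp only [Pi.sub_apply] at e1
  rw [integral_neg, neg_eq_zero, e1, integral_sub hi2 hi1,
    integral_const_mul, integral_const_mul, integral_const_mul] at this
  exact this

/-- A real solution of the Bessel equation, defined by the Hankel representation. -/
def hankelH (x : ℝ) : ℝ := (Complex.exp (Complex.I * x) * hankelMoment 0 x).im

/-- The derivative of `hankelH`. -/
def hankelH' (x : ℝ) : ℝ :=
  (Complex.exp (Complex.I * x) * (Complex.I * hankelMoment 0 x - hankelMoment 1 x)).im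

lemma hasDerivAt_exp_I_mul (x : ℝ) :
    HasDerivAt (fun x : ℝ => Complex.exp (Complex.I * x))
      (Complex.exp (Complex.I * x) * Complex.I) x := by
  have h : HasDerivAt (fun x : ℝ => Complex.I * (x : ℂ)) (Complex.I * 1) x :=
    (HasDerivAt.ofReal_comp (hasDerivAt_id x)).const_mul Complex.I
  simpa using h.cexp

lemma hasDerivAt_im {f : ℝ → ℂ} {f' : ℂ} {x : ℝ} (h : HasDerivAt f f' x) :
    HasDerivAt (fun x => (f x).im) f'.im x :=
  (Complex.imCLM.hasFDerivAt.comp_hasDerivAt x h)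

lemma hasDerivAt_hankelH {x : ℝ} (hx : 0 < x) : HasDerivAt hankelH (hankelH' x) x := by
  refine hasDerivAt_im (((hasDerivAt_exp_I_mul x).mul (hasDerivAt_hankelMoment 0 hx)).congr_deriv ?_)
  simp only [zero_add]; ring

lemma hasDerivAt_hankelH' {x : ℝ} (hx : 0 < x) :
    HasDerivAt hankelH' (-(hankelH' x / x) - hankelH x) x := by
  have hx0 : (x : ℂ) ≠ 0 := by exact_mod_cast hx.ne'
  have h := (hasDerivAt_exp_I_mul x).mul
    (((hasDerivAt_hankelMoment 0 hx).const_mul Complex.I).sub (hasDerivAt_hankelMoment 1 hx))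
  have h2 := hasDerivAt_im h
  refine h2.congr_deriv ?_
  have ode := hankelMoment_ode hx
  have e : hankelH' x / x = (Complex.exp (Complex.I * x) *
      (Complex.I * hankelMoment 0 x - hankelMoment 1 x) / x).im := by
    rw [Complex.div_ofReal_im]; rfl
  rw [e, hankelH, ← Complex.neg_im, ← Complex.sub_im]
  congr 1
  simp only [zero_add, one_add_one_eq_two, Pi.sub_apply]
  have hI := Complex.I_sq
  have : hankelMoment 2 x = ((2 * Complex.I * x + 1) * hankelMoment 1 x
      - Complex.I * hankelMoment 0 x) / x := by
    rw [eq_div_iff hx0]; linear_combination ode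
  rw [this]
  field_simp
  linear_combination (hankelMoment 0 x * x) * hI

/-! ### Asymptotics of the Hankel solution at infinity -/

lemma norm_exp_I_mul (x : ℝ) : ‖Complex.exp (Complex.I * x)‖ = 1 := by
  rw [mul_comm]; exact Complex.norm_exp_ofReal_mul_I x

/-- Laplace's method: freezing the inverse root at `y = 0` gives the main term, and the error, of
order `y ^ 2`, is paid by the second Gaussian moment. -/
lemma norm_hankelMoment_zero_sub_le {x : ℝ} (hx : 0 < x) :
    ‖hankelMoment 0 x - √(Real.pi / x) * Complex.exp (Complex.I * (Real.pi / 4 : ℝ))‖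
      ≤ 2 / x * √(2 * Real.pi / x) := by
  have e : (√(Real.pi / x) : ℂ) * Complex.exp (Complex.I * (Real.pi / 4 : ℝ))
      = ∫ y : ℝ, ((y ^ (2 * 0) * Real.exp (-x * y ^ 2) : ℝ) : ℂ) * hankelChi 0 := by
    rw [integral_mul_const, hankelChi_zero]
    congr 1
    rw [integral_complex_ofReal, ← integral_gaussian]; simp
  have hi : Integrable fun y : ℝ => ((y ^ (2 * 0) * Real.exp (-x * y ^ 2) : ℝ) : ℂ) * hankelChi 0 :=
    ((integrable_pow_mul_exp_neg 0 hx).ofReal).mul_const _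
  rw [e, hankelMoment, ← integral_sub (integrable_moment 0 hx) hi]
  refine (norm_integral_le_of_norm_le (integrable_pow_mul_exp_neg 1 hx)
    (Eventually.of_forall fun y => ?_)).trans ?_
  · rw [← mul_sub, norm_mul, Complex.norm_real, Real.norm_eq_abs, mul_zero, pow_zero, one_mul,
      abs_of_pos (Real.exp_pos _), mul_comm, mul_one]
    exact mul_le_mul_of_nonneg_right (norm_hankelChi_sub_le y) (Real.exp_pos _).le
  · simpa using integral_pow_mul_exp_neg_le 1 hx

lemma sqrt_div_mul_sqrt {x : ℝ} (hx : 0 < x) :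
    √(x / Real.pi) * √(Real.pi / x) = 1 ∧ √(x / Real.pi) * √(2 * Real.pi / x) ≤ 2 := by
  have hpi := Real.pi_pos
  constructor
  · rw [← Real.sqrt_mul (by positivity)]
    rw [show x / Real.pi * (Real.pi / x) = 1 by field_simp, Real.sqrt_one]
  · rw [← Real.sqrt_mul (by positivity), show x / Real.pi * (2 * Real.pi / x) = 2 by field_simp]
    rw [Real.sqrt_le_left (by norm_num)]; norm_num

lemma abs_hankelH_sub_le {x : ℝ} (hx : 0 < x) :
    |√(x / Real.pi) * hankelH x - Real.sin (x + Real.pi / 4)| ≤ 4 / x := by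
  obtain ⟨h1, h2⟩ := sqrt_div_mul_sqrt hx
  have e : √(x / Real.pi) * hankelH x - Real.sin (x + Real.pi / 4)
      = ((√(x / Real.pi) : ℂ) * (Complex.exp (Complex.I * x) * (hankelMoment 0 x -
        √(Real.pi / x) * Complex.exp (Complex.I * (Real.pi / 4 : ℝ))))).im := by
    have h3 : Complex.exp (Complex.I * x) * Complex.exp (Complex.I * (Real.pi / 4 : ℝ))
        = Complex.exp (((x + Real.pi / 4 : ℝ) : ℂ) * Complex.I) := by
      rw [← Complex.exp_add]; congr 1; push_cast; ring
    rw [mul_sub, show Complex.exp (Complex.I * x) * ((√(Real.pi / x) : ℂ) *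
        Complex.exp (Complex.I * (Real.pi / 4 : ℝ))) = (√(Real.pi / x) : ℂ) *
        Complex.exp (((x + Real.pi / 4 : ℝ) : ℂ) * Complex.I) by rw [← h3]; ring]
    rw [Complex.im_ofReal_mul, Complex.sub_im, Complex.im_ofReal_mul, Complex.exp_ofReal_mul_I_im,
      mul_sub, ← mul_assoc, h1, one_mul]; rfl
  rw [e]
  refine (Complex.abs_im_le_norm _).trans ?_
  rw [norm_mul, norm_mul, norm_exp_I_mul, one_mul, Complex.norm_real, Real.norm_eq_abs,
    abs_of_nonneg (Real.sqrt_nonneg _)]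
  calc √(x / Real.pi) * _ ≤ √(x / Real.pi) * (2 / x * √(2 * Real.pi / x)) := by
        gcongr; exact norm_hankelMoment_zero_sub_le hx
    _ = 2 / x * (√(x / Real.pi) * √(2 * Real.pi / x)) := by ring
    _ ≤ 2 / x * 2 := by gcongr
    _ = 4 / x := by ring

lemma abs_hankelH'_sub_le {x : ℝ} (hx : 0 < x) :
    |√(x / Real.pi) * hankelH' x - Real.cos (x + Real.pi / 4)| ≤ 8 / x := by
  obtain ⟨h1, h2⟩ := sqrt_div_mul_sqrt hx
  have e : √(x / Real.pi) * hankelH' x - Real.cos (x + Real.pi / 4)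
      = ((√(x / Real.pi) : ℂ) * (Complex.exp (Complex.I * x) * (Complex.I * (hankelMoment 0 x -
        √(Real.pi / x) * Complex.exp (Complex.I * (Real.pi / 4 : ℝ))) - hankelMoment 1 x))).im := by
    have h3 : Complex.exp (Complex.I * x) * Complex.exp (Complex.I * (Real.pi / 4 : ℝ))
        = Complex.exp (((x + Real.pi / 4 : ℝ) : ℂ) * Complex.I) := by
      rw [← Complex.exp_add]; congr 1; push_cast; ring
    rw [show Complex.exp (Complex.I * x) * (Complex.I * (hankelMoment 0 x -
        √(Real.pi / x) * Complex.exp (Complex.I * (Real.pi / 4 : ℝ))) - hankelMoment 1 x)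
        = Complex.exp (Complex.I * x) * (Complex.I * hankelMoment 0 x - hankelMoment 1 x)
        - (√(Real.pi / x) : ℂ) * (Complex.I *
        Complex.exp (((x + Real.pi / 4 : ℝ) : ℂ) * Complex.I)) by rw [← h3]; ring]
    rw [Complex.im_ofReal_mul, Complex.sub_im, Complex.im_ofReal_mul, Complex.I_mul_im,
      Complex.exp_ofReal_mul_I_re, mul_sub, ← mul_assoc, h1, one_mul]; rfl
  rw [e]
  refine (Complex.abs_im_le_norm _).trans ?_
  rw [norm_mul, norm_mul, norm_exp_I_mul, one_mul, Complex.norm_real, Real.norm_eq_abs,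
    abs_of_nonneg (Real.sqrt_nonneg _)]
  have h4 := norm_hankelMoment_zero_sub_le hx
  have h5 := norm_hankelMoment_le 1 hx
  calc √(x / Real.pi) * _ ≤ √(x / Real.pi) * (2 / x * √(2 * Real.pi / x) + 2 / x * √(2 * Real.pi / x)) := by
        gcongr
        refine (norm_sub_le _ _).trans (add_le_add ?_ (by simpa using h5))
        rwa [norm_mul, Complex.norm_I, one_mul]
    _ = 4 / x * (√(x / Real.pi) * √(2 * Real.pi / x)) := by ring
    _ ≤ 4 / x * 2 := by gcongr
    _ = 8 / x := by ring

/-! ### Behaviour at the origin and comparison with `J₀` -/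

lemma tendsto_mul_hankelMoment_one_im :
    Tendsto (fun x => x * |(hankelMoment 1 x).im|) (𝓝[>] 0) (𝓝 0) := by
  have hc := continuous_hankelChi
  -- Dominated convergence: `x y ^ 2 e^{-x y ^ 2} ≤ 1`, and the bound for the imaginary part of the
  -- inverse root is integrable. The inverse root itself would not give an integrable majorant.
  have key : Tendsto (fun x : ℝ => ∫ y : ℝ, (x * y ^ 2 * Real.exp (-x * y ^ 2)) * (3 * (1 + y ^ 2)⁻¹))
      (𝓝[>] 0) (𝓝 (∫ _ : ℝ, (0 : ℝ))) := by
    refine tendsto_integral_filter_of_dominated_convergence (fun y => 3 * (1 + y ^ 2)⁻¹) ?_ ?_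
      (integrable_inv_one_add_sq.const_mul 3) ?_
    · refine Eventually.of_forall fun x => Continuous.aestronglyMeasurable ?_
      have : Continuous fun y : ℝ => (1 + y ^ 2)⁻¹ :=
        Continuous.inv₀ (by fun_prop) fun y => by positivity
      fun_prop
    · filter_upwards [self_mem_nhdsWithin] with x hx
      refine Eventually.of_forall fun y => ?_
      have hx : 0 < x := hx
      rw [Real.norm_eq_abs, abs_of_nonneg (by positivity)]
      refine mul_le_of_le_one_left (by positivity) ?_
      have h1 := Real.add_one_le_exp (x * y ^ 2)
      rw [neg_mul, Real.exp_neg, ← div_eq_mul_inv, div_le_one (Real.exp_pos _)]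
      linarith
    · refine Eventually.of_forall fun y => ?_
      have : Continuous fun x : ℝ => (x * y ^ 2 * Real.exp (-x * y ^ 2)) * (3 * (1 + y ^ 2)⁻¹) := by
        fun_prop
      have h := (this.tendsto 0).mono_left (nhdsWithin_le_nhds (s := Set.Ioi 0))
      simpa using h
  rw [integral_zero] at key
  refine squeeze_zero' ?_ ?_ key
  · filter_upwards [self_mem_nhdsWithin] with x hx
    have hx : 0 < x := hx
    positivity
  · filter_upwards [self_mem_nhdsWithin] with x hx
    have hx : 0 < x := hx
    have hi := integrable_moment 1 hx
    have e : (hankelMoment 1 x).im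
        = ∫ y : ℝ, (((y ^ (2 * 1) * Real.exp (-x * y ^ 2) : ℝ) : ℂ) * hankelChi y).im :=
      (integral_im hi).symm
    have hi2 : Integrable fun y : ℝ => y ^ 2 * Real.exp (-x * y ^ 2) * (3 * (1 + y ^ 2)⁻¹) := by
      refine ((integrable_pow_mul_exp_neg 1 hx).mul_const 3).mono' ?_ (Eventually.of_forall fun y => ?_)
      · have : Continuous fun y : ℝ => (1 + y ^ 2)⁻¹ :=
          Continuous.inv₀ (by fun_prop) fun y => by positivity
        exact Continuous.aestronglyMeasurable (by fun_prop)
      · rw [Real.norm_eq_abs, abs_of_nonneg (by positivity)]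
        have : (1 + y ^ 2)⁻¹ ≤ 1 := inv_le_one_of_one_le₀ (by nlinarith [sq_nonneg y])
        rw [mul_one]
        gcongr
        linarith
    have h2 : |(hankelMoment 1 x).im| ≤ ∫ y : ℝ, y ^ 2 * Real.exp (-x * y ^ 2) * (3 * (1 + y ^ 2)⁻¹) := by
      rw [e, ← Real.norm_eq_abs]
      refine norm_integral_le_of_norm_le hi2 (Eventually.of_forall fun y => ?_)
      rw [Complex.im_ofReal_mul, norm_mul, Real.norm_eq_abs, Real.norm_eq_abs, mul_one,
        abs_of_nonneg (by positivity : 0 ≤ y ^ 2 * Real.exp (-x * y ^ 2))]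
      gcongr
      exact abs_hankelChi_im_le y
    calc x * |(hankelMoment 1 x).im|
        ≤ x * ∫ y : ℝ, y ^ 2 * Real.exp (-x * y ^ 2) * (3 * (1 + y ^ 2)⁻¹) := by gcongr
      _ = _ := by rw [← integral_const_mul]; congr 1; funext y; ring

lemma abs_hankelH_le {x : ℝ} (hx : 0 < x) : |hankelH x| ≤ √(2 * Real.pi / x) := by
  refine (Complex.abs_im_le_norm _).trans ?_
  rw [norm_mul, norm_exp_I_mul, one_mul]
  simpa using norm_hankelMoment_le 0 hx

lemma tendsto_mul_sqrt_div (c : ℝ) : Tendsto (fun x => x * √(c / x)) (𝓝[>] 0) (𝓝 0) := by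
  have h : Tendsto (fun x : ℝ => √(c * x)) (𝓝[>] 0) (𝓝 0) := by
    have : Continuous fun x : ℝ => √(c * x) := by fun_prop
    simpa using (this.tendsto 0).mono_left (nhdsWithin_le_nhds (s := Set.Ioi 0))
  refine h.congr' ?_
  filter_upwards [self_mem_nhdsWithin] with x hx
  have hx : 0 < x := hx
  rw [show c * x = x ^ 2 * (c / x) by field_simp, Real.sqrt_mul (by positivity),
    Real.sqrt_sq hx.le]

lemma tendsto_mul_hankelH' : Tendsto (fun x => x * |hankelH' x|) (𝓝[>] 0) (𝓝 0) := by
  have h1 := (((tendsto_mul_sqrt_div (2 * Real.pi)).mul_const 3)).add tendsto_mul_hankelMoment_one_im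
  rw [zero_mul, zero_add] at h1
  refine squeeze_zero' ?_ ?_ h1
  · filter_upwards [self_mem_nhdsWithin] with x hx
    have hx : 0 < x := hx
    positivity
  · filter_upwards [self_mem_nhdsWithin] with x hx
    have hx : 0 < x := hx
    have a0 := norm_hankelMoment_le 0 hx
    have a1 := norm_hankelMoment_le 1 hx
    simp only [Nat.factorial, Nat.cast_one, pow_zero, one_mul, mul_one, pow_one] at a0 a1
    have e : hankelH' x = (Complex.exp (Complex.I * x) * (Complex.I * hankelMoment 0 x)).im
        - (Real.cos x * (hankelMoment 1 x).im + Real.sin x * (hankelMoment 1 x).re) := by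
      rw [hankelH', mul_sub, Complex.sub_im]
      congr 1
      rw [mul_comm Complex.I, Complex.mul_im, Complex.exp_ofReal_mul_I_re,
        Complex.exp_ofReal_mul_I_im]
    have b0 : |(Complex.exp (Complex.I * x) * (Complex.I * hankelMoment 0 x)).im|
        ≤ √(2 * Real.pi / x) := by
      refine (Complex.abs_im_le_norm _).trans ?_
      rwa [norm_mul, norm_exp_I_mul, one_mul, norm_mul, Complex.norm_I, one_mul]
    have b1 : |Real.cos x * (hankelMoment 1 x).im| ≤ |(hankelMoment 1 x).im| := by
      rw [abs_mul]; exact mul_le_of_le_one_left (abs_nonneg _) (Real.abs_cos_le_one x)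
    -- The real part of the first moment is multiplied by `sin x ≤ x`, which compensates the extra
    -- factor `1 / x` in its bound.
    have b2 : |Real.sin x * (hankelMoment 1 x).re| ≤ 2 * √(2 * Real.pi / x) := by
      rw [abs_mul]
      have s1 : |Real.sin x| ≤ x := by
        have := Real.abs_sin_le_abs (x := x); rwa [abs_of_pos hx] at this
      calc |Real.sin x| * |(hankelMoment 1 x).re| ≤ x * (2 / x * √(2 * Real.pi / x)) := by
            gcongr; exact (Complex.abs_re_le_norm _).trans a1
        _ = _ := by field_simp
    have : |hankelH' x| ≤ 3 * √(2 * Real.pi / x) + |(hankelMoment 1 x).im| := by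
      rw [e]
      refine (abs_sub _ _).trans ?_
      have := abs_add_le (Real.cos x * (hankelMoment 1 x).im) (Real.sin x * (hankelMoment 1 x).re)
      linarith
    nlinarith

/-- The Wronskian of `hankelH` and `J₀` vanishes. -/
lemma hankelH_wronskian {x : ℝ} (hx : 0 < x) :
    hankelH' x * besselJ x - hankelH x * besselJ' x = 0 := by
  -- Abel's identity: `x` times the Wronskian is constant. The limits of `x H'` and `x H` at the
  -- origin force the constant to be zero.
  have hd : ∀ x ∈ Set.Ioi (0 : ℝ), HasDerivAt
      (fun x => x * (hankelH' x * besselJ x - hankelH x * besselJ' x)) 0 x := by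
    intro x hx
    have hx : 0 < x := hx
    have h := (hasDerivAt_id x).mul (((hasDerivAt_hankelH' hx).mul (hasDerivAt_besselJ x)).sub
      ((hasDerivAt_hankelH hx).mul (hasDerivAt_besselJ' hx.ne')))
    refine h.congr_deriv ?_
    simp only [id, Pi.sub_apply, Pi.mul_apply]; field_simp; ring
  have hconst : ∀ y ∈ Set.Ioi (0 : ℝ), y * (hankelH' y * besselJ y - hankelH y * besselJ' y)
      = x * (hankelH' x * besselJ x - hankelH x * besselJ' x) := by
    intro y hy
    refine (convex_Ioi (0 : ℝ)).is_const_of_fderivWithin_eq_zero (𝕜 := ℝ)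
      (f := fun x => x * (hankelH' x * besselJ x - hankelH x * besselJ' x))
      (fun t ht => (hd t ht).differentiableAt.differentiableWithinAt) (fun t ht => ?_) hy hx
    rw [fderivWithin_of_isOpen isOpen_Ioi ht, (hd t ht).hasFDerivAt.fderiv]
    ext; simp
  have hlim : Tendsto (fun y => y * (hankelH' y * besselJ y - hankelH y * besselJ' y))
      (𝓝[>] 0) (𝓝 0) := by
    refine squeeze_zero_norm' ?_ (a := fun y => y * |hankelH' y| + y * √(2 * Real.pi / y)) ?_
    · filter_upwards [self_mem_nhdsWithin] with y hy
      have hy : 0 < y := hy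
      rw [norm_mul, Real.norm_eq_abs, Real.norm_eq_abs, abs_of_pos hy, ← mul_add]
      gcongr
      refine (abs_sub _ _).trans (add_le_add ?_ ?_)
      · rw [abs_mul]; exact mul_le_of_le_one_right (abs_nonneg _) (abs_besselJ_le hy.le)
      · rw [abs_mul]
        exact (mul_le_of_le_one_right (abs_nonneg _) (abs_besselJ'_le hy.le)).trans (abs_hankelH_le hy)
    · simpa using tendsto_mul_hankelH'.add (tendsto_mul_sqrt_div (2 * Real.pi))
  have h0 : x * (hankelH' x * besselJ x - hankelH x * besselJ' x) = 0 := by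
    refine tendsto_nhds_unique (tendsto_const_nhds.congr' ?_) hlim
    filter_upwards [self_mem_nhdsWithin] with y hy
    exact (hconst y hy).symm
  exact (mul_eq_zero.1 h0).resolve_left hx.ne'

/-- `hankelH` is a nonzero multiple of `J₀`. -/
lemma exists_hankelH_eq : ∃ c : ℝ, c ≠ 0 ∧ ∀ x, 0 < x →
    hankelH x = c * besselJ x ∧ hankelH' x = c * besselJ' x := by
  -- Since `J₀` has no zero in `(0, 1)`, the vanishing Wronskian makes the quotient constant there.
  have hJ : ∀ x ∈ Set.Ioo (0 : ℝ) 1, 0 < besselJ x := fun x hx => by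
    have := one_sub_sq_le_besselJ hx.1.le
    nlinarith [hx.1, hx.2]
  have hhalf : (1 / 2 : ℝ) ∈ Set.Ioo (0 : ℝ) 1 := by constructor <;> norm_num
  set c := hankelH (1 / 2) / besselJ (1 / 2) with hc
  have hd : ∀ x ∈ Set.Ioo (0 : ℝ) 1, HasDerivAt (fun x => hankelH x / besselJ x) 0 x := by
    intro x hx
    refine ((hasDerivAt_hankelH hx.1).div (hasDerivAt_besselJ x) (hJ x hx).ne').congr_deriv ?_
    rw [hankelH_wronskian hx.1, zero_div]
  have h1 : ∀ x ∈ Set.Ioo (0 : ℝ) 1, hankelH x = c * besselJ x := by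
    intro x hx
    have : hankelH x / besselJ x = c := by
      refine (convex_Ioo (0 : ℝ) 1).is_const_of_fderivWithin_eq_zero (𝕜 := ℝ)
        (f := fun x => hankelH x / besselJ x)
        (fun t ht => (hd t ht).differentiableAt.differentiableWithinAt) (fun t ht => ?_) hx hhalf
      rw [fderivWithin_of_isOpen isOpen_Ioo ht, (hd t ht).hasFDerivAt.fderiv]
      ext; simp
    rw [← this]; field_simp [(hJ x hx).ne']
  have h1' : ∀ x ∈ Set.Ioo (0 : ℝ) 1, hankelH' x = c * besselJ' x := by
    intro x hx
    refine (hasDerivAt_hankelH hx.1).unique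
      (((hasDerivAt_besselJ x).const_mul c).congr_of_eventuallyEq ?_)
    filter_upwards [isOpen_Ioo.mem_nhds hx] with y hy using h1 y hy
  -- The difference `H - c J₀` vanishes on `(0, 1)`, so its energy tends to zero at the origin and
  -- uniqueness extends the identity to the half line.
  have hall : ∀ x, 0 < x → hankelH x = c * besselJ x := by
    intro x hx
    have := radial_ode_unique (v := fun x => hankelH x - c * besselJ x)
      (v' := fun x => hankelH' x - c * besselJ' x) (R := x + 1) one_pos
      (fun r hr => (hasDerivAt_hankelH hr.1).sub ((hasDerivAt_besselJ r).const_mul c))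
      (fun r hr => ((hasDerivAt_hankelH' hr.1).sub
        ((hasDerivAt_besselJ' hr.1.ne').const_mul c)).congr_deriv (by ring)) ?_ x ⟨hx, by linarith⟩
    · linarith
    · refine tendsto_const_nhds.congr' ?_
      filter_upwards [Ioo_mem_nhdsGT one_pos] with y hy
      rw [h1 y hy, h1' y hy]; ring
  refine ⟨c, ?_, fun x hx => ⟨hall x hx, ?_⟩⟩
  · intro h0
    -- A point where the sine in the asymptotics equals one while the error `4 / x` is less than
    -- one; hence `H` is not identically zero.
    have hx : (0 : ℝ) < 2 * Real.pi + Real.pi / 4 := by positivity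
    have h2 := abs_hankelH_sub_le hx
    rw [hall _ hx, h0, zero_mul, mul_zero, zero_sub, abs_neg,
      show 2 * Real.pi + Real.pi / 4 + Real.pi / 4 = Real.pi / 2 + 2 * Real.pi by ring,
      Real.sin_add_two_pi, Real.sin_pi_div_two, abs_one, le_div_iff₀ hx] at h2
    nlinarith [Real.pi_gt_three]
  · refine (hasDerivAt_hankelH hx).unique
      (((hasDerivAt_besselJ x).const_mul c).congr_of_eventuallyEq ?_)
    filter_upwards [isOpen_Ioi.mem_nhds hx] with y hy using hall y hy

/-! ### The positive zeros of `J₀` -/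

/-- The value of `c` is irrelevant: the position of the zeros depends only on `c ≠ 0`. -/
lemma exists_besselJ_asymptotics : ∃ c : ℝ, c ≠ 0 ∧ ∀ x, 0 < x →
    |c * √(x / Real.pi) * besselJ x - Real.sin (x + Real.pi / 4)| ≤ 4 / x ∧
    |c * √(x / Real.pi) * besselJ' x - Real.cos (x + Real.pi / 4)| ≤ 8 / x := by
  obtain ⟨c, hc, h⟩ := exists_hankelH_eq
  refine ⟨c, hc, fun x hx => ?_⟩
  obtain ⟨h1, h2⟩ := h x hx
  have a1 := abs_hankelH_sub_le hx
  have a2 := abs_hankelH'_sub_le hx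
  rw [h1] at a1
  rw [h2] at a2
  constructor
  · rwa [show c * √(x / Real.pi) * besselJ x = √(x / Real.pi) * (c * besselJ x) by ring]
  · rwa [show c * √(x / Real.pi) * besselJ' x = √(x / Real.pi) * (c * besselJ' x) by ring]

lemma sin_add_quarter (k : ℕ) (x : ℝ) :
    Real.sin (x + Real.pi / 4) = (-1) ^ k * Real.sin (x + Real.pi / 4 - k * Real.pi) := by
  rw [Real.sin_sub_nat_mul_pi, ← mul_assoc, ← mul_pow]; simp

lemma cos_add_quarter (k : ℕ) (x : ℝ) :
    Real.cos (x + Real.pi / 4) = (-1) ^ k * Real.cos (x + Real.pi / 4 - k * Real.pi) := by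
  rw [Real.cos_sub_nat_mul_pi, ← mul_assoc, ← mul_pow]; simp

lemma abs_sign_mul_sub {ε A B : ℝ} (h : ε * ε = 1) (ha : |ε| = 1) :
    |ε * A - B| = |A - ε * B| := by
  have e : ε * A - B = ε * (A - ε * B) := by linear_combination B * h
  rw [e, abs_mul, ha, one_mul]

/-- There is `c ≠ 0`, depending on the parity of `k`, such that `c √x J₀` is close to a sine centred at
the expected position of a zero. -/
lemma exists_besselJ_local (k : ℕ) : ∃ c : ℝ, c ≠ 0 ∧ ∀ x, 0 < x →
    |c * √(x / Real.pi) * besselJ x - Real.sin (x + Real.pi / 4 - k * Real.pi)| ≤ 4 / x ∧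
    |c * √(x / Real.pi) * besselJ' x - Real.cos (x + Real.pi / 4 - k * Real.pi)| ≤ 8 / x := by
  obtain ⟨c, hc, h⟩ := exists_besselJ_asymptotics
  refine ⟨(-1) ^ k * c, mul_ne_zero (by simp) hc, fun x hx => ?_⟩
  obtain ⟨h1, h2⟩ := h x hx
  rw [sin_add_quarter k] at h1
  rw [cos_add_quarter k] at h2
  have e : ((-1 : ℝ) ^ k) * (-1) ^ k = 1 := by rw [← mul_pow]; simp
  have ea : |(-1 : ℝ) ^ k| = 1 := by simp
  constructor
  · rw [mul_assoc, mul_assoc, abs_sign_mul_sub e ea, ← mul_assoc]; exact h1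
  · rw [mul_assoc, mul_assoc, abs_sign_mul_sub e ea, ← mul_assoc]; exact h2

lemma exists_besselJ_ne_zero_gt (a : ℝ) : ∃ x, a < x ∧ 0 < x ∧ besselJ x ≠ 0 := by
  obtain ⟨n, hn⟩ := exists_nat_gt (max a 5)
  have h3 := Real.pi_gt_three
  have hn1 := (le_max_left _ _).trans_lt hn
  have hn2 := (le_max_right _ _).trans_lt hn
  obtain ⟨c, hc, h⟩ := exists_besselJ_local n
  have hx : (n : ℝ) < n * Real.pi + Real.pi / 4 := by nlinarith
  refine ⟨n * Real.pi + Real.pi / 4, by linarith, by linarith, fun h0 => ?_⟩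
  have h1 := (h _ (by linarith : 0 < n * Real.pi + Real.pi / 4)).1
  rw [h0, mul_zero, zero_sub, abs_neg,
    show n * Real.pi + Real.pi / 4 + Real.pi / 4 - n * Real.pi = Real.pi / 2 by ring,
    Real.sin_pi_div_two, abs_one, le_div_iff₀ (by linarith)] at h1
  linarith

/-- At a double zero the energy would vanish, and being nonincreasing it would vanish from there on.
-/
lemma besselJ'_ne_zero {x : ℝ} (hx : 0 ≤ x) (h : besselJ x = 0) : besselJ' x ≠ 0 := by
  intro h'
  obtain ⟨y, hy, hy0, hJ⟩ := exists_besselJ_ne_zero_gt x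
  have := besselJ_energy_antitone (Set.mem_Ici.2 hx) (Set.mem_Ici.2 hy0.le) hy.le
  simp only [h, h'] at this
  have h2 : 0 < besselJ y ^ 2 := by positivity
  nlinarith [sq_nonneg (besselJ' y)]

lemma eventually_besselJ_ne_zero {x : ℝ} (hx : 0 ≤ x) : ∀ᶠ y in 𝓝[≠] x, besselJ y ≠ 0 := by
  by_cases h : besselJ x = 0
  · have := (hasDerivAt_besselJ x).eventually_ne (c := 0) (besselJ'_ne_zero hx h)
    exact this
  · exact nhdsWithin_le_nhds (continuous_besselJ.continuousAt.eventually_ne h)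

/-- The positive zeros of `J₀`. -/
def besselZeros : Set ℝ := {x | 0 < x ∧ besselJ x = 0}

lemma local_phase_abs_le {k : ℕ} {x : ℝ} (hx : 0 < x) (h0 : besselJ x = 0) :
    |Real.sin (x + Real.pi / 4 - k * Real.pi)| ≤ 4 / x := by
  obtain ⟨c, hc, h⟩ := exists_besselJ_local k
  have := (h x hx).1
  rwa [h0, mul_zero, zero_sub, abs_neg] at this

/-- The interval around `k π - π / 4` of length `π`. -/
def zeroInterval (k : ℕ) : Set ℝ :=
  Set.Ioo (k * Real.pi - 3 * Real.pi / 4) (k * Real.pi + Real.pi / 4)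

/-- The threshold `40` has no meaning beyond making the errors `4 / x` and `8 / x` small. -/
lemma zeroInterval_gt {k : ℕ} (hk : 40 ≤ k) {x : ℝ} (hx : k * Real.pi - 3 * Real.pi / 4 ≤ x) :
    100 < x := by
  have h3 := Real.pi_gt_three
  have hk' : (40 : ℝ) ≤ k := by exact_mod_cast hk
  nlinarith

lemma exists_zero_mem_zeroInterval {k : ℕ} (hk : 40 ≤ k) :
    ∃ x ∈ zeroInterval k, x ∈ besselZeros := by
  obtain ⟨c, hc, h⟩ := exists_besselJ_local k
  set F := fun x => c * √(x / Real.pi) * besselJ x with hF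
  have hpi := Real.pi_pos
  have hle : (k : ℝ) * Real.pi - 3 * Real.pi / 4 ≤ k * Real.pi + Real.pi / 4 := by linarith
  have hFc : ContinuousOn F (Set.Icc (k * Real.pi - 3 * Real.pi / 4) (k * Real.pi + Real.pi / 4)) := by
    have := continuous_besselJ
    exact Continuous.continuousOn (by fun_prop)
  have h1 : F (k * Real.pi - 3 * Real.pi / 4) < 0 := by
    have hx := zeroInterval_gt hk le_rfl
    have := (abs_le.1 (h (k * Real.pi - 3 * Real.pi / 4) (by linarith)).1).2
    rw [show (k : ℝ) * Real.pi - 3 * Real.pi / 4 + Real.pi / 4 - k * Real.pi = -(Real.pi / 2) by ring,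
      Real.sin_neg, Real.sin_pi_div_two] at this
    have h4 : 4 / (k * Real.pi - 3 * Real.pi / 4) < 1 := by rw [div_lt_one (by linarith)]; linarith
    simp only [hF]; linarith
  have h2 : 0 < F (k * Real.pi + Real.pi / 4) := by
    have hx := zeroInterval_gt hk hle
    have := (abs_le.1 (h (k * Real.pi + Real.pi / 4) (by linarith)).1).1
    rw [show (k : ℝ) * Real.pi + Real.pi / 4 + Real.pi / 4 - k * Real.pi = (Real.pi / 2) by ring,
      Real.sin_pi_div_two] at this
    have h4 : 4 / (k * Real.pi + Real.pi / 4) < 1 := by rw [div_lt_one (by linarith)]; linarith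
    simp only [hF]; linarith
  obtain ⟨x, hx, hx0⟩ := intermediate_value_Ioo hle hFc ⟨h1, h2⟩
  have hx100 := zeroInterval_gt hk hx.1.le
  refine ⟨x, hx, by linarith, ?_⟩
  have : √(x / Real.pi) ≠ 0 := (Real.sqrt_pos.2 (div_pos (by linarith) hpi)).ne'
  simpa [hF, hc, this] using hx0

lemma besselJ_ne_zero_endpoint {k : ℕ} (hk : 40 ≤ k) : besselJ (k * Real.pi + Real.pi / 4) ≠ 0 := by
  intro h0
  have hx := zeroInterval_gt hk (x := k * Real.pi + Real.pi / 4) (by linarith [Real.pi_pos])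
  have := local_phase_abs_le (k := k) (by linarith) h0
  rw [show (k : ℝ) * Real.pi + Real.pi / 4 + Real.pi / 4 - k * Real.pi = (Real.pi / 2) by ring,
      Real.sin_pi_div_two, abs_one, le_div_iff₀ (by linarith)] at this
  linarith

/-- Rolle's theorem gives a critical point between the zeros, where the cosine is small. The sine is
monotone on the interval and small at both zeros, hence small at the critical point as well, against
`sin ^ 2 + cos ^ 2 = 1`. -/
lemma zeroInterval_unique {k : ℕ} (hk : 40 ≤ k) {x y : ℝ} (hx : x ∈ zeroInterval k)
    (hy : y ∈ zeroInterval k) (hxy : x < y) (hx0 : besselJ x = 0) (hy0 : besselJ y = 0) : False := by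
  obtain ⟨w, hw, hw0⟩ := exists_hasDerivAt_eq_zero hxy continuous_besselJ.continuousOn
    (hx0.trans hy0.symm) (fun t _ => hasDerivAt_besselJ t)
  obtain ⟨c, hc, h⟩ := exists_besselJ_local k
  have hx100 := zeroInterval_gt hk hx.1.le
  have hw100 : 100 < w := hx100.trans hw.1
  have h1 := (h w (by linarith)).2
  rw [hw0, mul_zero, zero_sub, abs_neg] at h1
  have sx := local_phase_abs_le (k := k) (by linarith) hx0
  have sy := local_phase_abs_le (k := k) (by linarith) hy0
  set t := w + Real.pi / 4 - k * Real.pi with ht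
  have b1 : Real.sin (x + Real.pi / 4 - k * Real.pi) ≤ Real.sin t :=
    Real.sin_le_sin_of_le_of_le_pi_div_two (by linarith [hx.1]) (by linarith [hy.2, hw.2])
      (by linarith [hw.1])
  have b2 : Real.sin t ≤ Real.sin (y + Real.pi / 4 - k * Real.pi) :=
    Real.sin_le_sin_of_le_of_le_pi_div_two (by linarith [hx.1, hw.1]) (by linarith [hy.2])
      (by linarith [hw.2])
  have e1 : 4 / x ≤ 4 / 100 := by gcongr
  have e2 : 4 / y ≤ 4 / 100 := by gcongr; linarith
  have e3 : 8 / w ≤ 8 / 100 := by gcongr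
  have c1 : |Real.sin t| ≤ 4 / 100 := by
    rw [abs_le] at *
    constructor <;> linarith
  have c2 : |Real.cos t| ≤ 8 / 100 := h1.trans e3
  have := Real.sin_sq_add_cos_sq t
  nlinarith [sq_abs (Real.sin t), sq_abs (Real.cos t), abs_nonneg (Real.sin t),
    abs_nonneg (Real.cos t)]

/-- Jordan's inequality `|sin t| ≥ 2 |t| / π` turns the smallness of the sine into closeness to `k π
- π / 4`. -/
lemma zeroInterval_location {k : ℕ} (hk : 40 ≤ k) {x : ℝ} (hx : x ∈ zeroInterval k)
    (h0 : besselJ x = 0) : |x - (k * Real.pi - Real.pi / 4)| ≤ 2 * Real.pi / x := by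
  have hx100 := zeroInterval_gt hk hx.1.le
  have h1 := local_phase_abs_le (k := k) (by linarith) h0
  have h2 := Real.mul_abs_le_abs_sin (x := x + Real.pi / 4 - k * Real.pi)
    (by rw [abs_le]; constructor <;> linarith [hx.1, hx.2])
  have h3 := h2.trans h1
  have hpi := Real.pi_pos
  rw [show x - (k * Real.pi - Real.pi / 4) = x + Real.pi / 4 - k * Real.pi by ring]
  rw [div_mul_eq_mul_div, div_le_iff₀ hpi] at h3
  have : 2 * Real.pi / x = (4 / x * Real.pi) / 2 := by ring
  linarith

/-- Zeros are isolated, also from the right of `a`, so those above `a` form a closed set. The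
recursion defining `eigenvalue` by an infimum needs this minimum to be attained. -/
lemma exists_isLeast_besselZeros {a : ℝ} (ha : 0 ≤ a) :
    ∃ m, IsLeast {x | x ∈ besselZeros ∧ a < x} m := by
  have h1 : ∀ᶠ y in 𝓝[>] a, besselJ y ≠ 0 :=
    (eventually_besselJ_ne_zero ha).filter_mono (nhdsWithin_mono _ fun y hy => ne_of_gt hy)
  obtain ⟨b, hb, hab⟩ := (mem_nhdsGT_iff_exists_Ioo_subset).1 h1
  have hb : a < b := hb
  have hset : {x | x ∈ besselZeros ∧ a < x} = {x | b ≤ x} ∩ {x | besselJ x = 0} := by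
    ext x
    constructor
    · rintro ⟨⟨_, hx0⟩, hax⟩
      refine ⟨?_, hx0⟩
      by_contra h
      exact hab ⟨hax, not_le.1 h⟩ hx0
    · rintro ⟨hbx, hx0⟩
      have hbx : b ≤ x := hbx
      exact ⟨⟨by linarith, hx0⟩, by linarith⟩
  rw [hset]
  have hcl : IsClosed ({x | b ≤ x} ∩ {x | besselJ x = 0}) :=
    (isClosed_le continuous_const continuous_id).inter
      (isClosed_eq continuous_besselJ continuous_const)
  have hbdd : BddBelow ({x | b ≤ x} ∩ {x | besselJ x = 0}) := ⟨b, fun x hx => hx.1⟩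
  refine ⟨_, hcl.csInf_mem ?_ hbdd, fun x hx => csInf_le hbdd hx⟩
  obtain ⟨n, hn⟩ := exists_nat_gt (max b 40)
  have hn1 := (le_max_left _ _).trans_lt hn
  have hn2 := (le_max_right _ _).trans_lt hn
  obtain ⟨x, hx, hx0⟩ := exists_zero_mem_zeroInterval (k := n) (by exact_mod_cast hn2.le)
  refine ⟨x, ?_, hx0.2⟩
  have := hx.1
  have h3 := Real.pi_gt_three
  show b ≤ x
  nlinarith [Real.pi_le_four]

/-- `ζ` enumerates the positive zeros of `J₀` in increasing order, starting with `ζ 0 = 0`. -/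
structure IsZeroEnum (ζ : ℕ → ℝ) : Prop where
  zero : ζ 0 = 0
  isLeast : ∀ n, IsLeast {x | x ∈ besselZeros ∧ ζ n < x} (ζ (n + 1))

namespace IsZeroEnum

variable {ζ : ℕ → ℝ}

lemma strictMono (h : IsZeroEnum ζ) : StrictMono ζ :=
  strictMono_nat_of_lt_succ fun n => (h.isLeast n).1.2

lemma mem (h : IsZeroEnum ζ) (n : ℕ) : ζ (n + 1) ∈ besselZeros := (h.isLeast n).1.1

lemma nonneg (h : IsZeroEnum ζ) (n : ℕ) : 0 ≤ ζ n := by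
  rw [← h.zero]; exact h.strictMono.monotone (Nat.zero_le n)

lemma tendsto_atTop (h : IsZeroEnum ζ) : Tendsto ζ atTop atTop := by
  rcases tendsto_atTop_of_monotone h.strictMono.monotone with h1 | ⟨L, hL⟩
  · exact h1
  · exfalso
    have hlt : ∀ n, ζ n < L := fun n =>
      (h.strictMono (Nat.lt_succ_self n)).trans_le (h.strictMono.monotone.ge_of_tendsto hL _)
    have hL0 : 0 ≤ L := (h.nonneg 0).trans (hlt 0).le
    have h2 : Tendsto ζ atTop (𝓝[≠] L) :=
      tendsto_nhdsWithin_iff.2 ⟨hL, Eventually.of_forall fun n => (hlt n).ne⟩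
    have h3 := h2.eventually (eventually_besselJ_ne_zero hL0)
    obtain ⟨N, hN⟩ := eventually_atTop.1 h3
    exact hN (N + 1) (Nat.le_succ N) (h.mem N).2

/-- From a certain index on, consecutive zeros occupy consecutive intervals, one zero in each. The
number of earlier zeros is never computed; it survives as the unknown integer `p` in the
asymptotics. -/
lemma exists_shift (h : IsZeroEnum ζ) : ∃ n₀ : ℕ, 0 < n₀ ∧ ∀ i : ℕ, ζ (n₀ + i) ∈ zeroInterval (40 + i) := by
  have hpi := Real.pi_pos
  have hex : ∃ n, (40 : ℕ) * Real.pi - 3 * Real.pi / 4 < ζ n :=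
    (h.tendsto_atTop.eventually_gt_atTop _).exists
  classical
  obtain ⟨m, hm⟩ : ∃ m, Nat.find hex = m + 1 := by
    refine Nat.exists_eq_succ_of_ne_zero fun h0 => ?_
    have := Nat.find_spec hex
    rw [h0, h.zero] at this
    push_cast at this; linarith
  have hm1 : (40 : ℕ) * Real.pi - 3 * Real.pi / 4 < ζ (m + 1) := hm ▸ Nat.find_spec hex
  have hm2 : ζ m ≤ (40 : ℕ) * Real.pi - 3 * Real.pi / 4 :=
    not_lt.1 (Nat.find_min hex (m := m) (by omega))
  refine ⟨m + 1, Nat.succ_pos m, fun i => ?_⟩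
  induction i with
  | zero =>
    obtain ⟨x, hx, hx0⟩ := exists_zero_mem_zeroInterval (k := 40) le_rfl
    exact ⟨hm1, ((h.isLeast m).2 ⟨hx0, hm2.trans_lt hx.1⟩).trans_lt hx.2⟩
  | succ i ih =>
    obtain ⟨x, hx, hx0⟩ := exists_zero_mem_zeroInterval (k := 40 + (i + 1)) (by omega)
    have e1 : ((40 + (i + 1) : ℕ) : ℝ) * Real.pi - 3 * Real.pi / 4
        = ((40 + i : ℕ) : ℝ) * Real.pi + Real.pi / 4 := by push_cast; ring
    have hle : ζ (m + 1 + (i + 1)) ≤ x :=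
      (h.isLeast (m + 1 + i)).2 ⟨hx0, by have := hx.1; rw [e1] at this; exact ih.2.trans this⟩
    have hlt : ζ (m + 1 + i) < ζ (m + 1 + (i + 1)) := h.strictMono (by omega)
    refine ⟨?_, hle.trans_lt hx.2⟩
    rw [e1]
    by_contra hcon
    rcases (not_lt.1 hcon).lt_or_eq with h1 | h1
    · exact zeroInterval_unique (k := 40 + i) (by omega) ih ⟨ih.1.trans hlt, h1⟩ hlt
        (h.mem (m + i) |>.2 |> fun h => by rwa [show m + 1 + i = m + i + 1 by omega])
        (h.mem (m + 1 + i)).2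
    · exact besselJ_ne_zero_endpoint (k := 40 + i) (by omega) (h1 ▸ (h.mem (m + 1 + i)).2)

lemma exists_asymptotics (h : IsZeroEnum ζ) : ∃ p : ℤ, ∀ᶠ n : ℕ in atTop,
    |ζ n - (((n : ℝ) + p) * Real.pi - Real.pi / 4)| ≤ 2 * Real.pi / ζ n := by
  obtain ⟨n₀, hn₀, hi⟩ := h.exists_shift
  refine ⟨40 - n₀, ?_⟩
  filter_upwards [eventually_ge_atTop n₀] with n hn
  obtain ⟨i, rfl⟩ := Nat.exists_eq_add_of_le hn
  have h1 := zeroInterval_location (k := 40 + i) (by omega) (hi i)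
    (by obtain ⟨m, rfl⟩ := Nat.exists_eq_succ_of_ne_zero hn₀.ne'
        have := (h.mem (m + i)).2
        rwa [show m.succ + i = m + i + 1 by omega])
  convert h1 using 4
  push_cast; ring

lemma exists_abs_sub_le (h : IsZeroEnum ζ) : ∃ C : ℝ, ∀ n : ℕ, |ζ n - n * Real.pi| ≤ C := by
  obtain ⟨p, hp⟩ := h.exists_asymptotics
  obtain ⟨N, hN⟩ := eventually_atTop.1 (hp.and (h.tendsto_atTop.eventually_ge_atTop 1))
  have hpi := Real.pi_pos
  refine ⟨(∑ n ∈ Finset.range N, |ζ n - n * Real.pi|) + (2 * Real.pi + |p * Real.pi - Real.pi / 4|),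
    fun n => ?_⟩
  rcases lt_or_ge n N with hn | hn
  · have := Finset.single_le_sum (f := fun n : ℕ => |ζ n - n * Real.pi|)
      (fun i _ => abs_nonneg _) (Finset.mem_range.2 hn)
    have h2 := abs_nonneg (p * Real.pi - Real.pi / 4)
    linarith
  · obtain ⟨h1, h2⟩ := hN n hn
    have h3 : 2 * Real.pi / ζ n ≤ 2 * Real.pi := div_le_self (by positivity) h2
    have h4 : 0 ≤ ∑ n ∈ Finset.range N, |ζ n - n * Real.pi| :=
      Finset.sum_nonneg fun i _ => abs_nonneg _
    have h5 := abs_add_le (ζ n - (((n : ℝ) + p) * Real.pi - Real.pi / 4))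
      (p * Real.pi - Real.pi / 4)
    rw [show ζ n - (((n : ℝ) + p) * Real.pi - Real.pi / 4) + (p * Real.pi - Real.pi / 4)
      = ζ n - n * Real.pi by ring] at h5
    linarith

/-- With `q = 4 p - 1` the expected position `(n + p) π - π / 4` is `(π / 4) (4 n + q)`, and
squaring turns the error `O(1 / ζ n)` into `O(1)`. Oddness of `q` later excludes `2 (l + n) + q = 0`
in a factorization. -/
lemma exists_sq_asymptotics (h : IsZeroEnum ζ) : ∃ (q : ℤ) (C : ℝ), Odd q ∧
    ∀ n : ℕ, |ζ n ^ 2 - Real.pi ^ 2 / 16 * ((4 * n + q : ℤ) : ℝ) ^ 2| ≤ C := by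
  obtain ⟨p, hp⟩ := h.exists_asymptotics
  obtain ⟨N, hN⟩ := eventually_atTop.1 (hp.and (h.tendsto_atTop.eventually_ge_atTop 1))
  have hpi := Real.pi_pos
  set F : ℕ → ℝ := fun n => |ζ n ^ 2 - Real.pi ^ 2 / 16 * ((4 * n + (4 * p - 1) : ℤ) : ℝ) ^ 2|
  refine ⟨4 * p - 1, (∑ n ∈ Finset.range N, F n) + (4 * Real.pi + (2 * Real.pi) ^ 2),
    ⟨2 * p - 1, by ring⟩, fun n => ?_⟩
  change F n ≤ _
  have h4 : 0 ≤ ∑ n ∈ Finset.range N, F n := Finset.sum_nonneg fun i _ => abs_nonneg _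
  rcases lt_or_ge n N with hn | hn
  · have := Finset.single_le_sum (f := F) (fun i _ => abs_nonneg _) (Finset.mem_range.2 hn)
    have : 0 ≤ 4 * Real.pi + (2 * Real.pi) ^ 2 := by positivity
    linarith
  · obtain ⟨h1, h2⟩ := hN n hn
    set δ := ζ n - (((n : ℝ) + p) * Real.pi - Real.pi / 4) with hδ
    have hz : 0 < ζ n := by linarith
    have e : ζ n ^ 2 - Real.pi ^ 2 / 16 * ((4 * n + (4 * p - 1) : ℤ) : ℝ) ^ 2
        = δ * (2 * ζ n) - δ ^ 2 := by
      rw [hδ]; push_cast; ring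
    have h5 : |δ| * (2 * ζ n) ≤ 4 * Real.pi := by
      calc |δ| * (2 * ζ n) ≤ 2 * Real.pi / ζ n * (2 * ζ n) := by gcongr
        _ = _ := by field_simp; ring
    have h6 : |δ| ≤ 2 * Real.pi := h1.trans (div_le_self (by positivity) h2)
    have h7 : F n ≤ |δ| * (2 * ζ n) + |δ| ^ 2 := by
      change |_| ≤ _
      rw [e]
      refine (abs_sub _ _).trans_eq ?_
      rw [abs_mul, abs_pow, abs_of_pos (by linarith : 0 < 2 * ζ n)]
    have h8 : |δ| ^ 2 ≤ (2 * Real.pi) ^ 2 := by gcongr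
    linarith

lemma exists_gap (h : IsZeroEnum ζ) : ∃ c : ℝ, 0 < c ∧ ∀ n : ℕ, c ≤ ζ (n + 1) - ζ n := by
  obtain ⟨p, hp⟩ := h.exists_asymptotics
  have hpi := Real.pi_gt_three
  obtain ⟨N, hN⟩ := eventually_atTop.1 (hp.and (h.tendsto_atTop.eventually_ge_atTop (4 * Real.pi)))
  have hpos : ∀ n, 0 < ζ (n + 1) - ζ n := fun n => sub_pos.2 (h.strictMono (Nat.lt_succ_self n))
  obtain ⟨c, hc, hcN⟩ : ∃ c : ℝ, 0 < c ∧ ∀ n < N, c ≤ ζ (n + 1) - ζ n := by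
    clear hN
    induction N with
    | zero => exact ⟨1, one_pos, by simp⟩
    | succ N ih =>
      obtain ⟨c, hc, h1⟩ := ih
      refine ⟨min c (ζ (N + 1) - ζ N), lt_min hc (hpos N), fun n hn => ?_⟩
      rcases Nat.lt_succ_iff_lt_or_eq.1 hn with h2 | rfl
      · exact (min_le_left _ _).trans (h1 n h2)
      · exact min_le_right _ _
  refine ⟨min c 1, lt_min hc one_pos, fun n => ?_⟩
  rcases lt_or_ge n N with hn | hn
  · exact (min_le_left _ _).trans (hcN n hn)
  · obtain ⟨h1, h2⟩ := hN n hn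
    obtain ⟨h3, h4⟩ := hN (n + 1) (by omega)
    have b1 : 2 * Real.pi / ζ n ≤ 1 / 2 := by rw [div_le_iff₀ (by linarith)]; linarith
    have b2 : 2 * Real.pi / ζ (n + 1) ≤ 1 / 2 := by rw [div_le_iff₀ (by linarith)]; linarith
    have a1 := abs_le.1 (h1.trans b1)
    have a2 := abs_le.1 (h3.trans b2)
    push_cast at a2
    refine (min_le_right _ _).trans ?_
    linarith [a1.2, a2.1]

lemma exists_gap_mul (h : IsZeroEnum ζ) :
    ∃ c : ℝ, 0 < c ∧ ∀ m n : ℕ, c * |(m : ℝ) - n| ≤ |ζ m - ζ n| := by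
  obtain ⟨c, hc, hgap⟩ := h.exists_gap
  have key : ∀ n d : ℕ, c * d ≤ ζ (n + d) - ζ n := by
    intro n d
    induction d with
    | zero => simp
    | succ d ih =>
      have := hgap (n + d)
      rw [← add_assoc]; push_cast; linarith
  refine ⟨c, hc, fun m n => ?_⟩
  rcases le_total n m with hle | hle
  · obtain ⟨d, rfl⟩ := Nat.exists_eq_add_of_le hle
    have := key n d
    rw [abs_of_nonneg (sub_nonneg.2 (h.strictMono.monotone hle))]
    push_cast
    rw [add_sub_cancel_left, abs_of_nonneg (Nat.cast_nonneg d)]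
    exact this
  · obtain ⟨d, rfl⟩ := Nat.exists_eq_add_of_le hle
    have := key m d
    rw [abs_sub_comm, abs_sub_comm (ζ m), abs_of_nonneg (sub_nonneg.2 (h.strictMono.monotone hle))]
    push_cast
    rw [add_sub_cancel_left, abs_of_nonneg (Nat.cast_nonneg d)]
    exact this

lemma exists_le_mul (h : IsZeroEnum ζ) : ∃ C : ℝ, 0 < C ∧ ∀ n : ℕ, 1 ≤ n → ζ n ≤ C * n := by
  obtain ⟨C, hC⟩ := h.exists_abs_sub_le
  have hC0 : 0 ≤ C := (abs_nonneg _).trans (hC 0)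
  refine ⟨C + Real.pi, by linarith [Real.pi_pos], fun n hn => ?_⟩
  have h1 := (abs_le.1 (hC n)).2
  have hn' : (1 : ℝ) ≤ n := by exact_mod_cast hn
  nlinarith

lemma one_lt (h : IsZeroEnum ζ) (n : ℕ) : 1 < ζ (n + 1) := by
  by_contra hcon
  obtain ⟨h1, h2⟩ := h.mem n
  have := one_sub_sq_le_besselJ h1.le
  rw [h2] at this
  nlinarith [not_lt.1 hcon]

end IsZeroEnum

/-! ### Radial Dirichlet eigenfunctions -/

/-- The standard orthonormal basis of the plane. -/
def planeBasis : OrthonormalBasis (Fin 2) ℝ Plane := EuclideanSpace.basisFun (Fin 2) ℝ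

lemma planeBasis_norm (i : Fin 2) : ‖planeBasis i‖ = 1 := planeBasis.norm_eq_one i

lemma laplacian_eq_sum_fderiv (f : Plane → ℝ) (x : Plane) :
    Laplacian.laplacian f x = fderiv ℝ (fderiv ℝ f) x (planeBasis 0) (planeBasis 0)
      + fderiv ℝ (fderiv ℝ f) x (planeBasis 1) (planeBasis 1) := by
  rw [InnerProductSpace.laplacian_eq_iteratedFDeriv_orthonormalBasis f planeBasis]
  simp only [Fin.sum_univ_two, iteratedFDeriv_two_apply, Matrix.cons_val_zero, Matrix.cons_val_one]

section Line

variable {E : Type*} [NormedAddCommGroup E] [NormedSpace ℝ E]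

lemma hasDerivAt_line (x v : E) (t : ℝ) : HasDerivAt (fun s : ℝ => x + s • v) v t := by
  simpa using ((hasDerivAt_id t).smul_const v).const_add x

lemma hasDerivAt_fderiv_line {f : E → ℝ} {x v : E} {t : ℝ} (hf : ContDiffAt ℝ 2 f (x + t • v)) :
    HasDerivAt (fun s : ℝ => fderiv ℝ f (x + s • v) v)
      (fderiv ℝ (fderiv ℝ f) (x + t • v) v v) t := by
  have hfd : HasFDerivAt (fderiv ℝ f) (fderiv ℝ (fderiv ℝ f) (x + t • v)) (x + t • v) :=
    ((hf.fderiv_right (m := 1) (by norm_num)).differentiableAt (by norm_num)).hasFDerivAt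
  have h3 : HasDerivAt (fun s : ℝ => fderiv ℝ f (x + s • v))
      (fderiv ℝ (fderiv ℝ f) (x + t • v) v) t :=
    hfd.comp_hasDerivAt t (hasDerivAt_line x v t)
  exact (ContinuousLinearMap.apply ℝ ℝ v).hasFDerivAt.comp_hasDerivAt t h3

/-- Allows the Laplacian of a radial function to be computed from one-variable derivatives along
lines. -/
lemma fderiv_fderiv_eq_of_line {f : E → ℝ} {x v : E} (hf : ContDiffAt ℝ 2 f x)
    {g' : ℝ → ℝ} {g'' : ℝ} (h1 : ∀ᶠ t in 𝓝 (0 : ℝ), HasDerivAt (fun s : ℝ => f (x + s • v)) (g' t) t)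
    (h2 : HasDerivAt g' g'' 0) : fderiv ℝ (fderiv ℝ f) x v v = g'' := by
  have hd : ∀ᶠ y in 𝓝 x, DifferentiableAt ℝ f y := by
    filter_upwards [hf.eventually (by simp)] with y hy using hy.differentiableAt (by norm_num)
  have hx0 : x + (0 : ℝ) • v = x := by rw [zero_smul, add_zero]
  have hcont : Tendsto (fun s : ℝ => x + s • v) (𝓝 0) (𝓝 x) := by
    have := (hasDerivAt_line x v 0).continuousAt.tendsto
    rwa [hx0] at this
  have hg : ∀ᶠ t in 𝓝 (0 : ℝ), fderiv ℝ f (x + t • v) v = g' t := by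
    filter_upwards [h1, hcont.eventually hd] with t ht hdt
    exact (hdt.hasFDerivAt.comp_hasDerivAt t (hasDerivAt_line x v t)).unique ht
  have hf0 : ContDiffAt ℝ 2 f (x + (0 : ℝ) • v) := by rwa [hx0]
  have h3 := (hasDerivAt_fderiv_line hf0).unique (h2.congr_of_eventuallyEq hg)
  rwa [hx0] at h3

end Line

/-- Writing the function in terms of `‖x‖ ^ 2` keeps the formula valid at the origin, where `‖x‖` is
not differentiable. -/
lemma laplacian_comp_norm_sq (G : ℝ → ℝ) (G1 G2 : ℝ → ℝ) (hG : ContDiff ℝ 2 G)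
    (h1 : ∀ y, HasDerivAt G (G1 y) y) (h2 : ∀ y, HasDerivAt G1 (G2 y) y) (x : Plane) :
    Laplacian.laplacian (fun x : Plane => G (‖x‖ ^ 2)) x
      = 4 * ‖x‖ ^ 2 * G2 (‖x‖ ^ 2) + 4 * G1 (‖x‖ ^ 2) := by
  have hf : ContDiffAt ℝ 2 (fun x : Plane => G (‖x‖ ^ 2)) x :=
    (hG.comp (contDiff_norm_sq ℝ)).contDiffAt
  have key : ∀ i, fderiv ℝ (fderiv ℝ (fun x : Plane => G (‖x‖ ^ 2))) x (planeBasis i) (planeBasis i)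
      = 4 * inner ℝ x (planeBasis i) ^ 2 * G2 (‖x‖ ^ 2) + 2 * G1 (‖x‖ ^ 2) := by
    intro i
    have hn : ∀ s : ℝ, ‖x + s • planeBasis i‖ ^ 2
        = ‖x‖ ^ 2 + 2 * s * inner ℝ x (planeBasis i) + s ^ 2 := by
      intro s
      rw [norm_add_sq_real, inner_smul_right, norm_smul, planeBasis_norm, mul_one, Real.norm_eq_abs,
        sq_abs]; ring
    have hq : ∀ t : ℝ, HasDerivAt (fun s : ℝ => ‖x‖ ^ 2 + 2 * s * inner ℝ x (planeBasis i) + s ^ 2)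
        (2 * inner ℝ x (planeBasis i) + 2 * t) t := by
      intro t
      have := ((((hasDerivAt_id t).const_mul 2).mul_const (inner ℝ x (planeBasis i))).const_add
        (‖x‖ ^ 2)).add (hasDerivAt_pow 2 t)
      refine this.congr_deriv ?_
      push_cast; ring
    refine fderiv_fderiv_eq_of_line hf (g' := fun t => G1 (‖x‖ ^ 2 + 2 * t * inner ℝ x (planeBasis i)
      + t ^ 2) * (2 * inner ℝ x (planeBasis i) + 2 * t)) (Eventually.of_forall fun t => ?_) ?_
    · simp only [hn]
      exact (h1 _).comp t (hq t)
    · have h3 := ((h2 _).comp 0 (hq 0)).mul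
        (((hasDerivAt_id (0 : ℝ)).const_mul 2).const_add (2 * inner ℝ x (planeBasis i)))
      refine h3.congr_deriv ?_
      simp only [Function.comp]
      norm_num
      ring
  rw [laplacian_eq_sum_fderiv, key, key]
  have hs := planeBasis.sum_sq_norm_inner_left x
  rw [Fin.sum_univ_two, Real.norm_eq_abs, Real.norm_eq_abs, sq_abs, sq_abs] at hs
  rw [← hs]; ring

lemma finrank_plane : Module.finrank ℝ Plane = 2 := by simp

/-- Integration of radial functions over the unit disc in polar coordinates. -/
lemma integral_ball_radial {E : Type*} [NormedAddCommGroup E] [NormedSpace ℝ E] (F : ℝ → E) :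
    ∫ x in Metric.ball (0 : Plane) 1, F ‖x‖ = (2 * Real.pi) • ∫ r in (0 : ℝ)..1, r • F r := by
  have h1 := integral_fun_norm_addHaar (volume : Measure Plane) ((Set.Iio (1 : ℝ)).indicator F)
  have hvol : (volume : Measure Plane).real (Metric.ball 0 1) = Real.pi := by
    rw [Measure.real, EuclideanSpace.volume_ball_fin_two]
    simp [Real.pi_pos.le]
  rw [finrank_plane, hvol] at h1
  have e1 : (fun x : Plane => (Set.Iio (1 : ℝ)).indicator F ‖x‖)
      = (Metric.ball (0 : Plane) 1).indicator fun x => F ‖x‖ := by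
    funext x
    by_cases hx : ‖x‖ < 1
    · rw [Set.indicator_of_mem (by simpa using hx), Set.indicator_of_mem (by simpa using hx)]
    · rw [Set.indicator_of_notMem (by simpa using hx), Set.indicator_of_notMem (by simpa using hx)]
  rw [e1, integral_indicator Metric.isOpen_ball.measurableSet] at h1
  rw [h1, intervalIntegral.integral_of_le zero_le_one, ← integral_Ioc_eq_integral_Ioo.symm,
    ← Nat.cast_smul_eq_nsmul ℝ, smul_smul, Nat.cast_ofNat]
  congr 1
  have e2 : (fun y : ℝ => y ^ (2 - 1) • (Set.Iio (1 : ℝ)).indicator F y)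
      = (Set.Iio (1 : ℝ)).indicator fun y => y • F y := by
    funext y
    by_cases hy : y < 1
    · rw [Set.indicator_of_mem (by simpa using hy), Set.indicator_of_mem (by simpa using hy)]; simp
    · rw [Set.indicator_of_notMem (by simpa using hy), Set.indicator_of_notMem (by simpa using hy)]
      simp
  rw [e2, setIntegral_indicator measurableSet_Iio, Set.Ioi_inter_Iio]

lemma isRadialDirichletEigenfunction_bessel {w A : ℝ} (hw : w ∈ besselZeros)
    (hA : ∫ x in Metric.ball (0 : Plane) 1, (A * besselJ (w * ‖x‖)) ^ 2 = 1) :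
    IsRadialDirichletEigenfunction (w ^ 2) fun x => A * besselJ (w * ‖x‖) := by
  have e : (fun x : Plane => A * besselJ (w * ‖x‖))
      = fun x : Plane => A * besselSq (w ^ 2 * ‖x‖ ^ 2) := by
    funext x; rw [besselJ, mul_pow]
  have hG : ContDiff ℝ 2 fun y => A * besselSq (w ^ 2 * y) :=
    contDiff_const.mul (contDiff_besselSq.comp (contDiff_const.mul contDiff_id))
  refine ⟨?_, ?_, ?_, ?_, ?_, hA⟩
  · rw [e]; exact (hG.comp (contDiff_norm_sq ℝ)).contDiffOn
  · have := continuous_besselJ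
    exact Continuous.continuousOn (by fun_prop)
  · intro x _
    have hlin : ∀ y : ℝ, HasDerivAt (fun y : ℝ => w ^ 2 * y) (w ^ 2) y := fun y => by
      simpa using (hasDerivAt_id y).const_mul (w ^ 2)
    have := laplacian_comp_norm_sq (fun y => A * besselSq (w ^ 2 * y))
      (fun y => A * (powerSum (derivSeq besselSeq) (w ^ 2 * y) * w ^ 2))
      (fun y => A * (powerSum (derivSeq (derivSeq besselSeq)) (w ^ 2 * y) * w ^ 2 * w ^ 2)) hG
      (fun y => ((hasDerivAt_besselSq _).comp y (hlin y)).const_mul A)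
      (fun y => (((entireSeq_besselSeq.derivSeq.hasDerivAt _).comp y (hlin y)).mul_const
        (w ^ 2)).const_mul A) x
    rw [e, this, besselJ, mul_pow]
    have ode := besselSq_ode (w ^ 2 * ‖x‖ ^ 2)
    linear_combination (-A * w ^ 2) * ode
  · intro x hx
    rw [mem_sphere_zero_iff_norm.1 hx, mul_one, hw.2, mul_zero]
  · intro x _ y _ hxy
    simp only [hxy]

/-- A radial Dirichlet eigenfunction with positive eigenvalue is a multiple of a dilate of `J₀`. -/
lemma IsRadialDirichletEigenfunction.eq_bessel {lam : ℝ} {φ : Plane → ℝ}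
    (h : IsRadialDirichletEigenfunction lam φ) (hlam : 0 < lam) :
    √lam ∈ besselZeros ∧ ∀ x ∈ Metric.ball (0 : Plane) 1, φ x = φ 0 * besselJ (√lam * ‖x‖) := by
  set ρ : ℝ → ℝ := fun t => φ (t • planeBasis 0) with hρ
  have hnorm : ∀ (t : ℝ) (i : Fin 2), ‖t • planeBasis i‖ = |t| := fun t i => by
    rw [norm_smul, planeBasis_norm, mul_one, Real.norm_eq_abs]
  have hball : ∀ t : ℝ, |t| < 1 → t • planeBasis 0 ∈ Metric.ball (0 : Plane) 1 := fun t ht => by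
    rw [mem_ball_zero_iff, hnorm]; exact ht
  have hrad : ∀ x ∈ Metric.closedBall (0 : Plane) 1, φ x = ρ ‖x‖ := by
    intro x hx
    refine h.radial x hx _ ?_ ?_
    · rw [mem_closedBall_zero_iff, hnorm, abs_norm]; exact mem_closedBall_zero_iff.1 hx
    · rw [hnorm, abs_norm]
  have hc2 : ∀ x ∈ Metric.ball (0 : Plane) 1, ContDiffAt ℝ 2 φ x := fun x hx =>
    h.contDiffOn.contDiffAt (Metric.isOpen_ball.mem_nhds hx)
  set ρ1 : ℝ → ℝ := fun t => fderiv ℝ φ (0 + t • planeBasis 0) (planeBasis 0) with hρ1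
  have hd1 : ∀ t : ℝ, |t| < 1 → HasDerivAt ρ (ρ1 t) t := fun t ht => by
    have hb := hball t ht
    have hl := hasDerivAt_line (0 : Plane) (planeBasis 0) t
    rw [← zero_add (t • planeBasis 0)] at hb
    have := (((hc2 _ hb).differentiableAt (by norm_num)).hasFDerivAt).comp_hasDerivAt t hl
    refine this.congr_of_eventuallyEq (Eventually.of_forall fun s => ?_)
    simp only [hρ, Function.comp, zero_add]
  have hd2 : ∀ t : ℝ, |t| < 1 → HasDerivAt ρ1
      (fderiv ℝ (fderiv ℝ φ) (t • planeBasis 0) (planeBasis 0) (planeBasis 0)) t := by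
    intro t ht
    have h3 := hasDerivAt_fderiv_line (x := (0 : Plane)) (v := planeBasis 0) (t := t)
      (hc2 _ (by rw [zero_add]; exact hball t ht))
    refine h3.congr_deriv ?_
    rw [zero_add]
  have hort : inner ℝ (planeBasis 0) (planeBasis 1) = (0 : ℝ) :=
    planeBasis.orthonormal.2 (by decide)
  have hode : ∀ r ∈ Set.Ioo (0 : ℝ) 1, HasDerivAt ρ1 (-(ρ1 r / r) - lam * ρ r) r := by
    intro r hr
    have hr1 : |r| < 1 := by rw [abs_of_pos hr.1]; exact hr.2
    have hx := hball r hr1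
    have heig := h.eigen _ hx
    rw [laplacian_eq_sum_fderiv] at heig
    have hn : ∀ s : ℝ, ‖r • planeBasis 0 + s • planeBasis 1‖ = √(r ^ 2 + s ^ 2) := by
      intro s
      rw [← Real.sqrt_sq (norm_nonneg (r • planeBasis 0 + s • planeBasis 1))]
      congr 1
      rw [norm_add_sq_real, hnorm, hnorm, inner_smul_left, inner_smul_right, hort, sq_abs, sq_abs]
      simp
    have hpos : ∀ s : ℝ, 0 < r ^ 2 + s ^ 2 := fun s => by have := hr.1; positivity
    have hsq : ∀ s : ℝ, HasDerivAt (fun s : ℝ => √(r ^ 2 + s ^ 2)) (s / √(r ^ 2 + s ^ 2)) s := by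
      intro s
      have h1 : HasDerivAt (fun s : ℝ => r ^ 2 + s ^ 2) (2 * s) s := by
        simpa using (hasDerivAt_pow 2 s).const_add (r ^ 2)
      refine (h1.sqrt (hpos s).ne').congr_deriv ?_
      field_simp
    have hsmall : ∀ᶠ s in 𝓝 (0 : ℝ), √(r ^ 2 + s ^ 2) < 1 := by
      have hcont : Continuous fun s : ℝ => √(r ^ 2 + s ^ 2) := by fun_prop
      refine hcont.continuousAt.eventually_lt continuousAt_const ?_
      simp [Real.sqrt_sq hr.1.le, hr.2]
    -- By radial symmetry `φ` on the transversal line is `ρ √(r ^ 2 + s ^ 2)`, whose second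
    -- derivative at `s = 0` is `ρ'(r) / r`.
    have h11 : fderiv ℝ (fderiv ℝ φ) (r • planeBasis 0) (planeBasis 1) (planeBasis 1) = ρ1 r / r := by
      refine fderiv_fderiv_eq_of_line (hc2 _ hx)
        (g' := fun s => s * (ρ1 √(r ^ 2 + s ^ 2) / √(r ^ 2 + s ^ 2))) ?_ ?_
      · filter_upwards [hsmall.eventually_nhds] with s hs
        have hs0 := hs.self_of_nhds
        have h1 : HasDerivAt (fun s => ρ √(r ^ 2 + s ^ 2))
            (ρ1 √(r ^ 2 + s ^ 2) * (s / √(r ^ 2 + s ^ 2))) s :=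
          (hd1 _ (by rwa [abs_of_nonneg (Real.sqrt_nonneg _)])).comp s (hsq s)
        refine (h1.congr_of_eventuallyEq ?_).congr_deriv (by ring)
        filter_upwards [hs] with s' hs'
        rw [hrad _ (by rw [mem_closedBall_zero_iff, hn]; exact hs'.le), hn]
      · have hK : HasDerivAt (fun s => ρ1 √(r ^ 2 + s ^ 2) / √(r ^ 2 + s ^ 2)) 0 0 := by
          have e0 : √(r ^ 2 + (0 : ℝ) ^ 2) = r := by simp [Real.sqrt_sq hr.1.le]
          have h1 := hsq 0
          rw [zero_div] at h1
          have h2 : HasDerivAt (fun s => ρ1 √(r ^ 2 + s ^ 2)) (_ * 0) 0 :=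
            (hd2 _ (by rwa [e0])).comp 0 h1
          refine (h2.div h1 (by rw [e0]; exact hr.1.ne')).congr_deriv ?_
          simp
        refine ((hasDerivAt_id (0 : ℝ)).mul hK).congr_deriv ?_
        simp [Real.sqrt_sq hr.1.le]
    refine (hd2 r hr1).congr_deriv ?_
    rw [h11] at heig
    change -(_ + _) = lam * ρ r at heig
    linarith
  have hw : 0 < √lam := Real.sqrt_pos.2 hlam
  have hwsq : √lam ^ 2 = lam := Real.sq_sqrt hlam.le
  -- The restriction to a diameter is even. Thus `ρ` and `ρ 0 * J₀` have equal value and slope at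
  -- the origin, and the energy of their difference starts at zero.
  have hρ10 : ρ1 0 = 0 := by
    have heven : ∀ᶠ t in 𝓝 (0 : ℝ), ρ (-t) = ρ t := by
      filter_upwards [Ioo_mem_nhds (show (-1 : ℝ) < 0 by norm_num) one_pos] with t ht
      have hm : |t| ≤ 1 := abs_le.2 ⟨ht.1.le, ht.2.le⟩
      refine h.radial _ ?_ _ ?_ ?_
      · rw [mem_closedBall_zero_iff, hnorm, abs_neg]; exact hm
      · rw [mem_closedBall_zero_iff, hnorm]; exact hm
      · rw [hnorm, hnorm, abs_neg]
    have h0 := hd1 0 (by simp)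
    have h1 : HasDerivAt (fun t => ρ (-t)) (ρ1 0 * (-1)) 0 := by
      have h0' : HasDerivAt ρ (ρ1 0) (-0) := by rwa [neg_zero]
      exact h0'.comp 0 (hasDerivAt_neg (0 : ℝ))
    have := (h1.congr_of_eventuallyEq (heven.mono fun t ht => ht.symm)).unique h0
    linarith
  have hJd : ∀ r : ℝ, HasDerivAt (fun r => ρ 0 * besselJ (√lam * r))
      (ρ 0 * (besselJ' (√lam * r) * √lam)) r := fun r => by
    have hl : HasDerivAt (fun r : ℝ => √lam * r) √lam r := by
      simpa using (hasDerivAt_id r).const_mul √lam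
    exact ((hasDerivAt_besselJ _).comp r hl).const_mul _
  have huniq : ∀ r ∈ Set.Ioo (0 : ℝ) 1, ρ r - ρ 0 * besselJ (√lam * r) = 0 := by
    refine radial_ode_unique (v := fun r => ρ r - ρ 0 * besselJ (√lam * r))
      (v' := fun r => ρ1 r - ρ 0 * (besselJ' (√lam * r) * √lam)) hlam ?_ ?_ ?_
    · intro r hr
      exact (hd1 r (by rw [abs_of_pos hr.1]; exact hr.2)).sub (hJd r)
    · intro r hr
      have hl : HasDerivAt (fun r : ℝ => √lam * r) √lam r := by
        simpa using (hasDerivAt_id r).const_mul √lam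
      have h1 := (((hasDerivAt_besselJ' (mul_pos hw hr.1).ne').comp r hl).mul_const √lam).const_mul
        (ρ 0)
      refine ((hode r hr).sub h1).congr_deriv ?_
      have := hr.1.ne'
      have := hw.ne'
      generalize besselJ (√lam * r) = a
      generalize besselJ' (√lam * r) = b
      field_simp
      linear_combination (ρ 0 * r * a) * hwsq
    · have hc : ContinuousAt (fun r => (ρ1 r - ρ 0 * (besselJ' (√lam * r) * √lam)) ^ 2
          + lam * (ρ r - ρ 0 * besselJ (√lam * r)) ^ 2) 0 := by
        have c1 := (hd2 0 (by simp)).continuousAt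
        have c2 := (hd1 0 (by simp)).continuousAt
        have c3 := continuous_besselJ
        have c4 := continuous_besselJ'
        have c5 : ContinuousAt (fun r : ℝ => besselJ (√lam * r)) 0 :=
          Continuous.continuousAt (by fun_prop)
        have c6 : ContinuousAt (fun r : ℝ => besselJ' (√lam * r)) 0 :=
          Continuous.continuousAt (by fun_prop)
        fun_prop
      have := hc.tendsto.mono_left (nhdsWithin_le_nhds (s := Set.Ioi 0))
      simpa [hρ10] using this
  have hρ0 : ρ 0 = φ 0 := by simp [hρ]
  have hmain : ∀ x ∈ Metric.ball (0 : Plane) 1, φ x = φ 0 * besselJ (√lam * ‖x‖) := by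
    intro x hx
    rcases (norm_nonneg x).eq_or_lt with h0 | h0
    · rw [norm_eq_zero.1 h0.symm]; simp
    · rw [hrad x (Metric.ball_subset_closedBall hx), ← hρ0]
      have := huniq ‖x‖ ⟨h0, mem_ball_zero_iff.1 hx⟩
      linarith
  refine ⟨⟨hw, ?_⟩, hmain⟩
  -- If the central value vanished, so would `φ`, against the normalization. The Dirichlet condition
  -- therefore falls on `J₀`.
  have hφ0 : φ 0 ≠ 0 := by
    intro h0
    have hn := h.normalized
    rw [setIntegral_congr_fun (g := fun _ => (0 : ℝ)) Metric.isOpen_ball.measurableSet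
      (fun x hx => by simp only [hmain x hx, h0]; ring)] at hn
    simp at hn
  have hρc : ContinuousWithinAt ρ (Set.Iic 1) 1 := by
    have hc := h.continuousOn (planeBasis 0) (by
      rw [mem_closedBall_zero_iff, planeBasis_norm])
    have hm : (1 : ℝ) • planeBasis 0 = planeBasis 0 := one_smul _ _
    have hc' : ContinuousWithinAt φ (Metric.closedBall 0 1) ((1 : ℝ) • planeBasis 0) := by rwa [hm]
    have h1 : ContinuousWithinAt ρ (Set.Icc 0 1) 1 := by
      refine ContinuousWithinAt.comp (g := φ) (t := Metric.closedBall 0 1) hc'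
        (show Continuous fun t : ℝ => t • planeBasis 0 by fun_prop).continuousAt.continuousWithinAt ?_
      intro t ht
      rw [mem_closedBall_zero_iff, hnorm, abs_of_nonneg ht.1]; exact ht.2
    exact h1.mono_of_mem_nhdsWithin (Icc_mem_nhdsLE zero_lt_one)
  have hlim1 : Tendsto ρ (𝓝[<] 1) (𝓝 (ρ 1)) := hρc.tendsto.mono_left (nhdsWithin_mono _ Set.Iio_subset_Iic_self)
  have hlim2 : Tendsto ρ (𝓝[<] 1) (𝓝 (ρ 0 * besselJ (√lam * 1))) := by
    refine ((hJd 1).continuousAt.tendsto.mono_left nhdsWithin_le_nhds).congr' ?_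
    filter_upwards [Ioo_mem_nhdsLT zero_lt_one] with r hr
    have := huniq r hr
    linarith
  have h1 := tendsto_nhds_unique hlim1 hlim2
  have h2 : ρ 1 = 0 := by
    refine h.dirichlet _ ?_
    rw [mem_sphere_zero_iff_norm, hnorm, abs_one]
  rw [h2, mul_one, hρ0] at h1
  exact (mul_eq_zero.1 h1.symm).resolve_left hφ0

lemma isRadialDirichletEigenfunction_exists {w : ℝ} (hw : w ∈ besselZeros) :
    w ^ 2 ∈ radialEigenvalues := by
  have hJ := continuous_besselJ
  have hint : ∫ x in Metric.ball (0 : Plane) 1, (besselJ (w * ‖x‖)) ^ 2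
      = (2 * Real.pi) * ∫ r in (0 : ℝ)..1, r * besselJ (w * r) ^ 2 := by
    simpa using integral_ball_radial (fun r => besselJ (w * r) ^ 2)
  have hpos : 0 < ∫ x in Metric.ball (0 : Plane) 1, (besselJ (w * ‖x‖)) ^ 2 := by
    rw [hint]
    refine mul_pos (by positivity) ?_
    refine intervalIntegral.integral_pos zero_lt_one (by fun_prop)
      (fun r hr => by have := hr.1.le; positivity) ?_
    have hw0 := hw.1
    -- At this radius the argument of `J₀` is at most one, where `J₀ ≥ 3 / 4`.
    refine ⟨min 1 w⁻¹, ⟨by positivity, min_le_left _ _⟩, ?_⟩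
    have h0 : 0 < min 1 w⁻¹ := by positivity
    have h1 : w * min 1 w⁻¹ ≤ 1 := by
      calc w * min 1 w⁻¹ ≤ w * w⁻¹ := by gcongr; exact min_le_right _ _
        _ = 1 := by field_simp
    have h2 := one_sub_sq_le_besselJ (x := w * min 1 w⁻¹) (by positivity)
    have h3 : 0 ≤ w * min 1 w⁻¹ := by positivity
    have : 0 < besselJ (w * min 1 w⁻¹) := by nlinarith
    positivity
  set I := ∫ x in Metric.ball (0 : Plane) 1, (besselJ (w * ‖x‖)) ^ 2 with hI
  refine ⟨_, isRadialDirichletEigenfunction_bessel (A := (√I)⁻¹) hw ?_⟩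
  simp_rw [mul_pow]
  rw [integral_const_mul, inv_pow, Real.sq_sqrt hpos.le]
  exact inv_mul_cancel₀ hpos.ne'

/-- Squaring is a bijection between the positive zeros and the positive radial eigenvalues. Starting
the recursion at `0` guarantees that only positive eigenvalues are compared, as the Bessel
representation requires. -/
lemma eigenvalue_succ_isLeast {n : ℕ} (h0 : 0 ≤ eigenvalue n) :
    0 ≤ eigenvalue (n + 1) ∧
      IsLeast {x | x ∈ besselZeros ∧ √(eigenvalue n) < x} √(eigenvalue (n + 1)) ∧
      eigenvalue (n + 1) ∈ radialEigenvalues := by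
  obtain ⟨m, hm⟩ := exists_isLeast_besselZeros (Real.sqrt_nonneg (eigenvalue n))
  have hm0 : 0 < m := hm.1.1.1
  have hleast : IsLeast {lam ∈ radialEigenvalues | eigenvalue n < lam} (m ^ 2) := by
    refine ⟨⟨isRadialDirichletEigenfunction_exists hm.1.1, ?_⟩, ?_⟩
    · exact (Real.sqrt_lt' hm0).1 hm.1.2
    · rintro lam ⟨⟨φ, hφ⟩, hlam⟩
      have hpos : 0 < lam := h0.trans_lt hlam
      have := hm.2 ⟨(hφ.eq_bessel hpos).1, Real.sqrt_lt_sqrt h0 hlam⟩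
      exact (Real.le_sqrt hm0.le hpos.le).1 this
  have he : eigenvalue (n + 1) = m ^ 2 := hleast.csInf_eq
  rw [he, Real.sqrt_sq hm0.le]
  exact ⟨by positivity, hm, hleast.1.1⟩

lemma eigenvalue_nonneg (n : ℕ) : 0 ≤ eigenvalue n := by
  induction n with
  | zero => simp [eigenvalue]
  | succ n ih => exact (eigenvalue_succ_isLeast ih).1

/-- The enumeration of the zeros of `J₀`, starting with the value `0`. -/
def zeroSeq (n : ℕ) : ℝ := √(eigenvalue n)

lemma isZeroEnum_zeroSeq : IsZeroEnum zeroSeq where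
  zero := by simp [zeroSeq, eigenvalue]
  isLeast n := (eigenvalue_succ_isLeast (eigenvalue_nonneg n)).2.1

lemma z_eq (n : ℕ+) : z n = zeroSeq n := rfl

lemma z_mem (n : ℕ+) : z n ∈ besselZeros := by
  have := isZeroEnum_zeroSeq.mem (n.natPred)
  rw [PNat.natPred_add_one n] at this
  exact this

lemma one_lt_z (n : ℕ+) : 1 < z n := by
  have := isZeroEnum_zeroSeq.one_lt (n.natPred)
  rw [PNat.natPred_add_one n] at this
  exact this

lemma z_pos (n : ℕ+) : 0 < z n := one_pos.trans (one_lt_z n)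

lemma z_sq (n : ℕ+) : z n ^ 2 = eigenvalue n := Real.sq_sqrt (eigenvalue_nonneg n)

lemma z_strictMono : StrictMono z := fun m n h =>
  isZeroEnum_zeroSeq.strictMono (show (m : ℕ) < n from h)

lemma besselJ_z (n : ℕ+) : besselJ (z n) = 0 := (z_mem n).2

lemma eigenvalue_mem (n : ℕ+) : eigenvalue n ∈ radialEigenvalues := by
  have := (eigenvalue_succ_isLeast (eigenvalue_nonneg n.natPred)).2.2
  rwa [PNat.natPred_add_one n] at this

instance : IsFiniteMeasure ballMeasure :=
  ⟨by rw [ballMeasure, Measure.restrict_apply_univ]; exact measure_ball_lt_top⟩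

lemma memLp_of_continuous {p : ℝ≥0∞} {φ : Plane → ℂ} (hφ : Continuous φ) : MemLp φ p ballMeasure := by
  obtain ⟨C, hC⟩ := (isCompact_closedBall (0 : Plane) 1).exists_bound_of_continuousOn hφ.continuousOn
  refine MemLp.of_bound hφ.aestronglyMeasurable C ?_
  refine (ae_restrict_iff' Metric.isOpen_ball.measurableSet).2 (Eventually.of_forall fun x hx => ?_)
  exact hC x (Metric.ball_subset_closedBall hx)

lemma isEigenmode_e (n : ℕ+) : IsEigenmode (eigenvalue n) (e n) := by
  refine Classical.epsilon_spec (p := IsEigenmode (eigenvalue n)) ?_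
  obtain ⟨φ, hφ⟩ := eigenvalue_mem n
  have hpos : 0 < eigenvalue n := by rw [← z_sq]; have := z_pos n; positivity
  have hc : Continuous fun x : Plane => ((φ 0 * besselJ (√(eigenvalue n) * ‖x‖) : ℝ) : ℂ) := by
    have := continuous_besselJ
    fun_prop
  refine ⟨(memLp_of_continuous hc).toLp, φ, hφ, (MemLp.coeFn_toLp _).trans ?_⟩
  refine (ae_restrict_iff' Metric.isOpen_ball.measurableSet).2 (Eventually.of_forall fun x hx => ?_)
  simp only [(hφ.eq_bessel hpos).2 x hx]

lemma exists_amplitude (n : ℕ+) : ∃ A : ℝ,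
    ((e n : Plane → ℂ) =ᵐ[ballMeasure] fun x => ((A * besselJ (z n * ‖x‖) : ℝ) : ℂ)) ∧
    ∫ x in Metric.ball (0 : Plane) 1, (A * besselJ (z n * ‖x‖)) ^ 2 = 1 := by
  obtain ⟨φ, hφ, he⟩ := isEigenmode_e n
  have hpos : 0 < eigenvalue n := by rw [← z_sq]; have := z_pos n; positivity
  have hb := (hφ.eq_bessel hpos).2
  refine ⟨φ 0, he.trans ?_, ?_⟩
  · refine (ae_restrict_iff' Metric.isOpen_ball.measurableSet).2 (Eventually.of_forall fun x hx => ?_)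
    simp only [hb x hx]; rfl
  · refine Eq.trans (setIntegral_congr_fun (Metric.isOpen_ball (x := (0 : Plane)) (ε := 1)).measurableSet
      fun x hx => ?_) hφ.normalized
    simp only [hb x hx]; rfl

/-- The amplitude of the `n`-th normalized eigenfunction. -/
def amplitude (n : ℕ+) : ℝ := Classical.choose (exists_amplitude n)

/-- The radial profile of the `n`-th normalized eigenfunction. -/
def profile (n : ℕ+) (r : ℝ) : ℝ := amplitude n * besselJ (z n * r)

/-- The derivative of the radial profile. -/
def profile' (n : ℕ+) (r : ℝ) : ℝ := amplitude n * z n * besselJ' (z n * r)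

lemma e_ae_eq (n : ℕ+) :
    (e n : Plane → ℂ) =ᵐ[ballMeasure] fun x => ((profile n ‖x‖ : ℝ) : ℂ) :=
  (Classical.choose_spec (exists_amplitude n)).1

lemma hasDerivAt_profile (n : ℕ+) (r : ℝ) : HasDerivAt (profile n) (profile' n r) r := by
  have hl : HasDerivAt (fun r : ℝ => z n * r) (z n) r := by
    simpa using (hasDerivAt_id r).const_mul (z n)
  refine (((hasDerivAt_besselJ _).comp r hl).const_mul (amplitude n)).congr_deriv ?_
  simp only [profile']; ring

lemma hasDerivAt_profile'_mul (n : ℕ+) (r : ℝ) :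
    HasDerivAt (fun r => r * profile' n r) (-(z n ^ 2 * (r * profile n r))) r := by
  have hl : HasDerivAt (fun r : ℝ => z n * r) (z n) r := by
    simpa using (hasDerivAt_id r).const_mul (z n)
  have h := (((hasDerivAt_besselJ'_mul _).comp r hl).const_mul (amplitude n))
  refine (h.congr_deriv ?_).congr_of_eventuallyEq (Eventually.of_forall fun s => ?_)
  · simp only [profile]; ring
  · simp only [profile', Function.comp]; ring

lemma continuous_profile (n : ℕ+) : Continuous (profile n) :=
  continuous_iff_continuousAt.2 fun r => (hasDerivAt_profile n r).continuousAt

lemma continuous_profile' (n : ℕ+) : Continuous (profile' n) := by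
  have := continuous_besselJ'
  unfold profile'
  fun_prop

lemma profile_one (n : ℕ+) : profile n 1 = 0 := by
  rw [profile, mul_one, besselJ_z, mul_zero]

lemma profile_normalized (n : ℕ+) : 2 * Real.pi * ∫ r in (0 : ℝ)..1, r * profile n r ^ 2 = 1 := by
  have := integral_ball_radial (fun r => profile n r ^ 2)
  simp only [smul_eq_mul] at this
  exact this.symm.trans (Classical.choose_spec (exists_amplitude n)).2

/-! ### Bounds for the eigenfunction profiles -/

lemma integral_eq_zero_of_boundary {F f : ℝ → ℝ} (hF : ∀ r, HasDerivAt F (f r) r)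
    (hf : Continuous f) (h0 : F 0 = 0) : ∫ r in (0 : ℝ)..1, f r = F 1 := by
  rw [intervalIntegral.integral_eq_sub_of_hasDerivAt (fun r _ => hF r)
    (hf.intervalIntegrable _ _), h0, sub_zero]

/-- Rellich's identity: integrate the derivative of `(r e_n') ^ 2 + z_n ^ 2 (r e_n) ^ 2` over `[0,
1]`. The Dirichlet condition removes one boundary term and the normalization evaluates the integral.
-/
lemma profile'_one_sq (n : ℕ+) : profile' n 1 ^ 2 = z n ^ 2 / Real.pi := by
  have hc := continuous_profile n
  have h := integral_eq_zero_of_boundary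
    (F := fun r => (r * profile' n r) ^ 2 + z n ^ 2 * (r * profile n r) ^ 2)
    (f := fun r => 2 * z n ^ 2 * (r * profile n r ^ 2)) (fun r => ?_) (by fun_prop) (by simp)
  · rw [intervalIntegral.integral_const_mul] at h
    have hn := profile_normalized n
    simp only [one_mul, profile_one] at h
    have hpi := Real.pi_pos.ne'
    rw [eq_div_iff hpi]
    linear_combination (-Real.pi) * h + z n ^ 2 * hn
  · have h1 := ((hasDerivAt_profile'_mul n r).pow 2).add
      ((((hasDerivAt_id r).mul (hasDerivAt_profile n r)).pow 2).const_mul (z n ^ 2))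
    refine h1.congr_deriv ?_
    simp only [id, Pi.mul_apply]; push_cast; ring

lemma integral_profile'_mul (k l : ℕ+) : ∫ r in (0 : ℝ)..1, r * profile' k r * profile' l r
    = z k ^ 2 * ∫ r in (0 : ℝ)..1, r * profile k r * profile l r := by
  have hc := continuous_profile k
  have hc' := continuous_profile' k
  have hl := continuous_profile l
  have hl' := continuous_profile' l
  have h := integral_eq_zero_of_boundary (F := fun r => r * profile' k r * profile l r)
    (f := fun r => r * profile' k r * profile' l r - z k ^ 2 * (r * profile k r * profile l r))
    (fun r => ?_) (by fun_prop) (by simp)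
  · rw [intervalIntegral.integral_sub (Continuous.intervalIntegrable (by fun_prop) _ _)
      (Continuous.intervalIntegrable (by fun_prop) _ _), intervalIntegral.integral_const_mul,
      profile_one] at h
    linarith
  · refine ((hasDerivAt_profile'_mul k r).mul (hasDerivAt_profile l r)).congr_deriv ?_
    ring

lemma profile_orthonormal (k l : ℕ+) :
    2 * Real.pi * ∫ r in (0 : ℝ)..1, r * profile k r * profile l r = if k = l then 1 else 0 := by
  split_ifs with hkl
  · subst hkl
    refine Eq.trans ?_ (profile_normalized k)
    congr 2; ext r; ring
  · have h1 := integral_profile'_mul k l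
    have h2 := integral_profile'_mul l k
    have e1 : ∫ r in (0 : ℝ)..1, r * profile' l r * profile' k r
        = ∫ r in (0 : ℝ)..1, r * profile' k r * profile' l r := by congr 1; ext r; ring
    have e2 : ∫ r in (0 : ℝ)..1, r * profile l r * profile k r
        = ∫ r in (0 : ℝ)..1, r * profile k r * profile l r := by congr 1; ext r; ring
    rw [e1, e2, h1, ← sub_eq_zero, ← sub_mul] at h2
    have hne : z k ^ 2 - z l ^ 2 ≠ 0 := by
      intro h0
      have : z k = z l := by
        have := z_pos k
        have := z_pos l
        nlinarith
      exact hkl (z_strictMono.injective this)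
    rw [(mul_eq_zero.1 h2).resolve_left hne, mul_zero]

/-- The monotone quantity of Sonin. -/
def sonin (n : ℕ+) (r : ℝ) : ℝ :=
  4 * r * (r * profile' n r + profile n r / 2) ^ 2 / (4 * z n ^ 2 * r ^ 2 + 1) + r * profile n r ^ 2

/-- Put `v = √r e_n`, so that `v'' + Q v = 0` with `Q = z_n ^ 2 + 1 / (4 r ^ 2)`. The quantity is `v
^ 2 + v' ^ 2 / Q`, whose derivative `-Q' v' ^ 2 / Q ^ 2` is nonnegative because `Q` decreases.
Clearing powers of `r` keeps it meaningful at the origin. -/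
lemma sonin_monotoneOn (n : ℕ+) : Monotone (sonin n) := by
  refine monotone_of_hasDerivAt_nonneg
    (f' := fun r => 8 * (r * profile' n r + profile n r / 2) ^ 2 / (4 * z n ^ 2 * r ^ 2 + 1) ^ 2)
    (fun r => ?_) fun r => by positivity
  have hp := (hasDerivAt_profile'_mul n r).add ((hasDerivAt_profile n r).div_const 2)
  have hq : HasDerivAt (fun r : ℝ => 4 * z n ^ 2 * r ^ 2 + 1) (8 * z n ^ 2 * r) r := by
    refine (((hasDerivAt_pow 2 r).const_mul (4 * z n ^ 2)).add_const 1).congr_deriv ?_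
    push_cast; ring
  have hne : 4 * z n ^ 2 * r ^ 2 + 1 ≠ 0 := by positivity
  have h := ((((hasDerivAt_id r).const_mul 4).mul (hp.pow 2)).div hq hne).add
    ((hasDerivAt_id r).mul ((hasDerivAt_profile n r).pow 2))
  refine h.congr_deriv ?_
  simp only [id, Pi.add_apply, Pi.mul_apply, Pi.pow_apply]
  push_cast
  field_simp
  ring

/-- The value at `r = 1` is known from the boundary derivative. The resulting constant does not
depend on `n`, which is the essential point for all bounds on triple products. -/
lemma sonin_le {n : ℕ+} {r : ℝ} (hr : r ≤ 1) : sonin n r ≤ 1 / Real.pi := by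
  refine (sonin_monotoneOn n hr).trans ?_
  have hz := z_pos n
  have hpi := Real.pi_pos
  rw [sonin, profile_one]
  have := profile'_one_sq n
  simp only [one_mul, mul_one, zero_div, add_zero, one_pow, ne_eq, OfNat.ofNat_ne_zero,
    not_false_eq_true, zero_pow]
  rw [this, div_le_div_iff₀ (by positivity) hpi]
  have : 4 * (z n ^ 2 / Real.pi) * Real.pi = 4 * z n ^ 2 := by field_simp
  linarith

lemma mul_profile_sq_le' {n : ℕ+} {r : ℝ} (h0 : 0 ≤ r) (h1 : r ≤ 1) :
    r * profile n r ^ 2 ≤ 1 / Real.pi := by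
  refine le_trans ?_ (sonin_le (n := n) h1)
  rw [sonin]
  have : 0 ≤ 4 * r * (r * profile' n r + profile n r / 2) ^ 2 / (4 * z n ^ 2 * r ^ 2 + 1) := by
    positivity
  linarith

lemma one_div_pi_le : 1 / Real.pi ≤ 1 / 3 := by
  have := Real.pi_gt_three
  gcongr

lemma mul_profile_sq_le {n : ℕ+} {r : ℝ} (h0 : 0 ≤ r) (h1 : r ≤ 1) :
    r * profile n r ^ 2 ≤ 1 := by
  linarith [mul_profile_sq_le' (n := n) h0 h1, one_div_pi_le]

/-- Evaluate the uniform bound at `r = 1 / z_n`, where the Bessel factor is `J₀ 1 ≥ 3 / 4`. -/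
lemma amplitude_sq_le (n : ℕ+) : amplitude n ^ 2 ≤ z n := by
  have hz := z_pos n
  have hz1 := one_lt_z n
  have h := mul_profile_sq_le' (n := n) (r := (z n)⁻¹) (by positivity) (inv_le_one_of_one_le₀ hz1.le)
  rw [profile, mul_inv_cancel₀ hz.ne', mul_pow] at h
  have hJ := one_sub_sq_le_besselJ (x := 1) zero_le_one
  have h3 := h.trans one_div_pi_le
  rw [inv_mul_le_iff₀ hz] at h3
  have hJ2 : (9 : ℝ) / 16 ≤ besselJ 1 ^ 2 := by nlinarith
  nlinarith [sq_nonneg (amplitude n)]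

lemma profile_sq_le {n : ℕ+} {r : ℝ} (h0 : 0 ≤ r) : profile n r ^ 2 ≤ z n := by
  have hz := z_pos n
  rw [profile, mul_pow]
  have h1 : besselJ (z n * r) ^ 2 ≤ 1 := by
    rw [sq_le_one_iff_abs_le_one]; exact abs_besselJ_le (by positivity)
  exact (mul_le_of_le_one_right (sq_nonneg _) h1).trans (amplitude_sq_le n)

lemma profile'_sq_le {n : ℕ+} {r : ℝ} (h0 : 0 ≤ r) : profile' n r ^ 2 ≤ z n ^ 3 := by
  have hz := z_pos n
  rw [profile', mul_pow, mul_pow]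
  have h1 : besselJ' (z n * r) ^ 2 ≤ 1 := by
    rw [sq_le_one_iff_abs_le_one]; exact abs_besselJ'_le (by positivity)
  calc amplitude n ^ 2 * z n ^ 2 * besselJ' (z n * r) ^ 2 ≤ z n * z n ^ 2 * 1 := by
        gcongr; exact amplitude_sq_le n
    _ = z n ^ 3 := by ring

lemma abs_profile_le {n : ℕ+} {r : ℝ} (h0 : 0 ≤ r) : |profile n r| ≤ √(z n) :=
  Real.abs_le_sqrt (profile_sq_le h0)

lemma abs_profile'_le {n : ℕ+} {r : ℝ} (h0 : 0 ≤ r) : |profile' n r| ≤ z n ^ 2 := by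
  have h1 := one_lt_z n
  refine abs_le_of_sq_le_sq ((profile'_sq_le h0).trans ?_) (by positivity)
  rw [← pow_mul]
  exact pow_le_pow_right₀ h1.le (by norm_num)

/-- For `z_n r ≤ 1` the pointwise derivative bound suffices. Beyond, Sonin's quantity controls `r
e_n' + e_n / 2`, and `e_n / 2` is of lower order. -/
lemma mul_profile'_sq_le {n : ℕ+} {r : ℝ} (h0 : 0 ≤ r) (h1 : r ≤ 1) :
    r * profile' n r ^ 2 ≤ z n ^ 2 := by
  have hz := z_pos n
  rcases le_or_gt (z n * r) 1 with h | h
  · calc r * profile' n r ^ 2 ≤ r * z n ^ 3 := by gcongr; exact profile'_sq_le h0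
      _ = (z n * r) * z n ^ 2 := by ring
      _ ≤ 1 * z n ^ 2 := by gcongr
      _ = _ := one_mul _
  · have hr : 0 < r := by
      rcases h0.eq_or_lt with rfl | hr
      · simp at h; linarith
      · exact hr
    have hs := (sonin_le (n := n) h1).trans one_div_pi_le
    rw [sonin] at hs
    set p := r * profile' n r + profile n r / 2 with hp
    have hu : r * profile n r ^ 2 ≤ 1 / 3 :=
      (mul_profile_sq_le' (n := n) h0 h1).trans one_div_pi_le
    have hq : 0 < 4 * z n ^ 2 * r ^ 2 + 1 := by positivity
    have hA : 4 * r * p ^ 2 ≤ (4 * z n ^ 2 * r ^ 2 + 1) * (1 / 3) := by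
      have h5 : 4 * r * p ^ 2 / (4 * z n ^ 2 * r ^ 2 + 1) ≤ 1 / 3 := by
        have : 0 ≤ r * profile n r ^ 2 := by positivity
        linarith
      rw [div_le_iff₀ hq] at h5
      linarith
    have h2 : 1 ≤ z n ^ 2 * r ^ 2 := by nlinarith
    have h3 : (r * profile' n r) ^ 2 ≤ 2 * p ^ 2 + profile n r ^ 2 / 2 := by
      have : r * profile' n r = p - profile n r / 2 := by rw [hp]; ring
      rw [this]
      nlinarith [sq_nonneg (p + profile n r / 2)]
    have h4 : r * (r * profile' n r) ^ 2 ≤ z n ^ 2 * r ^ 2 := by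
      have := mul_le_mul_of_nonneg_left h3 h0
      nlinarith
    have h5 : r ^ 2 * (r * profile' n r ^ 2) ≤ r ^ 2 * z n ^ 2 := by nlinarith
    exact le_of_mul_le_mul_left h5 (by positivity)

lemma abs_mul_mul_le {r a b A B : ℝ} (hr : 0 ≤ r) (hA : 0 ≤ A) (hB : 0 ≤ B)
    (ha : r * a ^ 2 ≤ A ^ 2) (hb : r * b ^ 2 ≤ B ^ 2) : |r * a * b| ≤ A * B := by
  refine abs_le_of_sq_le_sq ?_ (by positivity)
  calc (r * a * b) ^ 2 = (r * a ^ 2) * (r * b ^ 2) := by ring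
    _ ≤ A ^ 2 * B ^ 2 := by gcongr
    _ = (A * B) ^ 2 := by ring

lemma abs_mul_profile_mul_profile_le {n l : ℕ+} {r : ℝ} (h0 : 0 ≤ r) (h1 : r ≤ 1) :
    |r * profile n r * profile l r| ≤ 1 := by
  simpa using abs_mul_mul_le h0 zero_le_one zero_le_one
    (by simpa using mul_profile_sq_le (n := n) h0 h1) (by simpa using mul_profile_sq_le (n := l) h0 h1)

lemma abs_mul_profile'_mul_profile_le {n l : ℕ+} {r : ℝ} (h0 : 0 ≤ r) (h1 : r ≤ 1) :
    |r * profile' n r * profile l r| ≤ z n := by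
  simpa using abs_mul_mul_le h0 (z_pos n).le zero_le_one (mul_profile'_sq_le (n := n) h0 h1)
    (by simpa using mul_profile_sq_le (n := l) h0 h1)

/-! ### Triple products of eigenfunctions -/

/-- The integral over the disc of `e_n e_k e_l`. -/
def triple (n k l : ℕ+) : ℝ :=
  2 * Real.pi * ∫ r in (0 : ℝ)..1, r * profile n r * profile l r * profile k r

/-- The integral over the disc of `(∇e_k ⋅ ∇e_l) e_n`. -/
def gradTriple (k l n : ℕ+) : ℝ :=
  2 * Real.pi * ∫ r in (0 : ℝ)..1, r * profile' l r * profile n r * profile' k r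

lemma gradTriple_comm (k l n : ℕ+) : gradTriple k l n = gradTriple l k n := by
  rw [gradTriple, gradTriple]; congr 2; ext r; ring

lemma triple_comm (n k l : ℕ+) : triple n k l = triple l k n := by
  rw [triple, triple]; congr 2; ext r; ring

lemma triple_comm' (n k l : ℕ+) : triple n k l = triple k n l := by
  rw [triple, triple]; congr 2; ext r; ring

/-- Green's identity for `-Δ e_l = z_l ^ 2 e_l` tested with `e_n e_k`, which vanishes on the
boundary. -/
lemma z_sq_mul_triple (n k l : ℕ+) :
    z l ^ 2 * triple n k l = gradTriple n l k + gradTriple k l n := by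
  have hn := continuous_profile n
  have hk := continuous_profile k
  have hl := continuous_profile l
  have hn' := continuous_profile' n
  have hk' := continuous_profile' k
  have hl' := continuous_profile' l
  have h := integral_eq_zero_of_boundary
    (F := fun r => r * profile' l r * (profile n r * profile k r))
    (f := fun r => (r * profile' l r * profile k r * profile' n r
      + r * profile' l r * profile n r * profile' k r)
      - z l ^ 2 * (r * profile n r * profile l r * profile k r))
    (fun r => ?_) (by fun_prop) (by simp)
  · rw [intervalIntegral.integral_sub (Continuous.intervalIntegrable (by fun_prop) _ _)
      (Continuous.intervalIntegrable (by fun_prop) _ _),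
      intervalIntegral.integral_add (Continuous.intervalIntegrable (by fun_prop) _ _)
      (Continuous.intervalIntegrable (by fun_prop) _ _), intervalIntegral.integral_const_mul,
      profile_one] at h
    rw [triple, gradTriple, gradTriple]
    linear_combination (-2 * Real.pi) * h
  · refine ((hasDerivAt_profile'_mul l r).mul
      ((hasDerivAt_profile n r).mul (hasDerivAt_profile k r))).congr_deriv ?_
    simp only [Pi.mul_apply]; ring

/-- Subtracting two Green identities cancels the product of the two high frequency gradients. Each
remaining term has a derivative on the low factor `e_k`, which produces decay in `|z_l - z_n|`. -/
lemma sub_mul_triple (n k l : ℕ+) :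
    (z l ^ 2 - z n ^ 2) * triple n k l = gradTriple k l n - gradTriple k n l := by
  have h1 := z_sq_mul_triple n k l
  have h2 := z_sq_mul_triple l k n
  rw [triple_comm l k n, gradTriple_comm l n k] at h2
  linear_combination h1 - h2

/-- The product rule for `Δ (e_n e_k)`. The right side contains no derivative of `e_l`, so for `z_l
≥ 2 z_n` it yields decay like `z_l ^ (-2)`. -/
lemma sub_sub_mul_triple (n k l : ℕ+) :
    (z l ^ 2 - z n ^ 2 - z k ^ 2) * triple n k l = -2 * gradTriple k n l := by
  have h1 := z_sq_mul_triple n k l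
  have h2 := z_sq_mul_triple l k n
  have h3 := z_sq_mul_triple n l k
  rw [triple_comm l k n, gradTriple_comm l n k] at h2
  rw [triple_comm' n l k, triple_comm l n k, triple_comm' k n l, gradTriple_comm n k l,
    gradTriple_comm l k n] at h3
  linear_combination h1 - h2 - h3

/-! ### Size and decay of the triple products -/

lemma abs_integral_mul_le {f V : ℝ → ℝ} {A : ℝ} (hf : Continuous f) (hV : Continuous V)
    (hA : ∀ r, 0 ≤ r → r ≤ 1 → |f r| ≤ A) :
    |∫ r in (0 : ℝ)..1, f r * V r| ≤ A * ∫ r in (0 : ℝ)..1, |V r| := by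
  refine (intervalIntegral.abs_integral_le_integral_abs zero_le_one).trans ?_
  rw [← intervalIntegral.integral_const_mul]
  refine intervalIntegral.integral_mono_on zero_le_one
    (Continuous.intervalIntegrable (by fun_prop) _ _)
    (Continuous.intervalIntegrable (by fun_prop) _ _) fun r hr => ?_
  rw [abs_mul]
  exact mul_le_mul_of_nonneg_right (hA r hr.1 hr.2) (abs_nonneg _)

lemma abs_gradTriple_le (k l n : ℕ+) : |gradTriple k l n| ≤ 2 * Real.pi * (z l * z k ^ 2) := by
  have hn := continuous_profile n
  have hk' := continuous_profile' k
  have hl' := continuous_profile' l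
  rw [gradTriple, abs_mul, abs_of_pos (by positivity : 0 < 2 * Real.pi)]
  have h := abs_integral_mul_le (f := fun r => r * profile' l r * profile n r) (V := profile' k)
    (by fun_prop) hk' (fun r h0 h1 => abs_mul_profile'_mul_profile_le (n := l) (l := n) h0 h1)
  have h2 : ∫ r in (0 : ℝ)..1, |profile' k r| ≤ ∫ _ in (0 : ℝ)..1, z k ^ 2 :=
    intervalIntegral.integral_mono_on zero_le_one (Continuous.intervalIntegrable (by fun_prop) _ _)
      (by simp) fun r hr => abs_profile'_le hr.1
  simp only [intervalIntegral.integral_const, sub_zero, one_smul] at h2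
  gcongr
  exact h.trans (mul_le_mul_of_nonneg_left h2 (z_pos l).le)

/-- The high frequency derivatives in the two gradient terms contribute `z_l + z_n` in total, which
cancels one factor of `z_l ^ 2 - z_n ^ 2`. -/
lemma abs_sub_mul_abs_triple_le (n k l : ℕ+) :
    |z l - z n| * |triple n k l| ≤ 2 * Real.pi * z k ^ 2 := by
  have h := sub_mul_triple n k l
  have h1 := abs_gradTriple_le k l n
  have h2 := abs_gradTriple_le k n l
  have hs : 0 < z l + z n := add_pos (z_pos l) (z_pos n)
  have h3 : |(z l ^ 2 - z n ^ 2) * triple n k l| ≤ 2 * Real.pi * (z l * z k ^ 2)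
      + 2 * Real.pi * (z n * z k ^ 2) := by
    rw [h]; exact (abs_sub _ _).trans (add_le_add h1 h2)
  rw [show z l ^ 2 - z n ^ 2 = (z l + z n) * (z l - z n) by ring, abs_mul, abs_mul,
    abs_of_pos hs, mul_assoc] at h3
  refine le_of_mul_le_mul_left (h3.trans_eq ?_) hs
  ring

lemma abs_triple_le_of_two_mul_le {n k l : ℕ+} (hkn : k ≤ n) (hl : 2 * z n ≤ z l) :
    z l ^ 2 * |triple n k l| ≤ 8 * Real.pi * (z n * z k ^ 2) := by
  have h := congrArg abs (sub_sub_mul_triple n k l)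
  have h1 := abs_gradTriple_le k n l
  have hk : z k ≤ z n := z_strictMono.monotone hkn
  have hk0 := z_pos k
  have hn0 := z_pos n
  have hge : z l ^ 2 / 2 ≤ z l ^ 2 - z n ^ 2 - z k ^ 2 := by nlinarith
  rw [abs_mul, abs_mul, abs_of_nonneg (by nlinarith [sq_nonneg (z l)] : 0 ≤ z l ^ 2 - z n ^ 2 - z k ^ 2)] at h
  have : |(-2 : ℝ)| = 2 := by norm_num
  rw [this] at h
  have h3 := mul_le_mul_of_nonneg_right hge (abs_nonneg (triple n k l))
  nlinarith

/-- Passing from the measure `r dr` to `dr` costs a logarithm: on `[δ, 1]` one has `2 |V| ≤ E⁻¹ r V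
^ 2 + E / r`, and below `δ` the supremum bound is used. -/
lemma integral_abs_le_of_weighted {V : ℝ → ℝ} (hV : Continuous V) {B E δ : ℝ} (hδ : 0 < δ)
    (hδ1 : δ ≤ 1) (hE : 0 < E) (hB : ∀ r, 0 ≤ r → r ≤ 1 → |V r| ≤ B)
    (hint : ∫ r in (0 : ℝ)..1, r * V r ^ 2 ≤ E ^ 2) :
    ∫ r in (0 : ℝ)..1, |V r| ≤ δ * B + E * (1 + Real.log δ⁻¹) := by
  have hVi : ∀ a b, IntervalIntegrable (fun r => |V r|) volume a b := fun a b =>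
    Continuous.intervalIntegrable (by fun_prop) _ _
  have hWi : ∀ a b, IntervalIntegrable (fun r => r * V r ^ 2) volume a b := fun a b =>
    Continuous.intervalIntegrable (by fun_prop) _ _
  rw [← intervalIntegral.integral_add_adjacent_intervals (hVi 0 δ) (hVi δ 1)]
  have h1 : ∫ r in (0 : ℝ)..δ, |V r| ≤ ∫ _ in (0 : ℝ)..δ, B :=
    intervalIntegral.integral_mono_on hδ.le (hVi 0 δ) (by simp)
      fun r hr => hB r hr.1 (hr.2.trans hδ1)
  simp only [intervalIntegral.integral_const, sub_zero, smul_eq_mul] at h1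
  have hinv : IntervalIntegrable (fun r : ℝ => r⁻¹) volume δ 1 := by
    refine intervalIntegral.intervalIntegrable_inv (fun r hr => ?_) continuousOn_id
    rw [Set.uIcc_of_le hδ1] at hr
    exact (hδ.trans_le hr.1).ne'
  have h2 : ∫ r in δ..1, |V r| ≤ ∫ r in δ..1, (E⁻¹ * (r * V r ^ 2) + E * r⁻¹) := by
    refine intervalIntegral.integral_mono_on hδ1 (hVi δ 1)
      (((hWi δ 1).const_mul _).add (hinv.const_mul _)) fun r hr => ?_
    have hr0 : 0 < r := hδ.trans_le hr.1
    have hk : 2 * |V r| ≤ E⁻¹ * (r * V r ^ 2) + E * r⁻¹ := by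
      have e : E⁻¹ * (r * V r ^ 2) + E * r⁻¹ - 2 * |V r|
          = E⁻¹ * r⁻¹ * (r * |V r| - E) ^ 2 := by
        rw [← sq_abs (V r)]; field_simp; ring
      have : 0 ≤ E⁻¹ * r⁻¹ * (r * |V r| - E) ^ 2 := by positivity
      linarith
    linarith [abs_nonneg (V r)]
  rw [intervalIntegral.integral_add ((hWi δ 1).const_mul _) (hinv.const_mul _),
    intervalIntegral.integral_const_mul, intervalIntegral.integral_const_mul,
    integral_inv_of_pos hδ one_pos, one_div] at h2
  have h3 : ∫ r in δ..1, r * V r ^ 2 ≤ E ^ 2 := by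
    refine le_trans ?_ hint
    rw [← intervalIntegral.integral_add_adjacent_intervals (hWi 0 δ) (hWi δ 1)]
    have : 0 ≤ ∫ r in (0 : ℝ)..δ, r * V r ^ 2 :=
      intervalIntegral.integral_nonneg hδ.le fun r hr => mul_nonneg hr.1 (sq_nonneg _)
    linarith
  have h4 : E⁻¹ * ∫ r in δ..1, r * V r ^ 2 ≤ E := by
    rw [inv_mul_le_iff₀ hE]; nlinarith
  linarith

lemma exists_z_le : ∃ C : ℝ, 1 ≤ C ∧ ∀ n : ℕ+, z n ≤ C * n := by
  obtain ⟨C, hC, h⟩ := isZeroEnum_zeroSeq.exists_le_mul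
  refine ⟨max C 1, le_max_right _ _, fun n => (h n n.pos).trans ?_⟩
  exact mul_le_mul_of_nonneg_right (le_max_left _ _) (Nat.cast_nonneg _)

lemma integral_sum_sq (K : Finset ℕ+) (β : ℕ+ → ℝ) (f : ℕ+ → ℝ → ℝ) (hf : ∀ k, Continuous (f k))
    (g : ℕ+ → ℝ) (hort : ∀ k l, 2 * Real.pi * ∫ r in (0 : ℝ)..1, r * f k r * f l r
      = if k = l then g k else 0) :
    2 * Real.pi * ∫ r in (0 : ℝ)..1, r * (∑ k ∈ K, β k * f k r) ^ 2 = ∑ k ∈ K, β k ^ 2 * g k := by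
  have e : ∀ r : ℝ, r * (∑ k ∈ K, β k * f k r) ^ 2
      = ∑ k ∈ K, ∑ l ∈ K, β k * β l * (r * f k r * f l r) := by
    intro r
    rw [sq, Finset.sum_mul_sum, Finset.mul_sum]
    refine Finset.sum_congr rfl fun k _ => ?_
    rw [Finset.mul_sum]
    exact Finset.sum_congr rfl fun l _ => by ring
  simp_rw [e]
  rw [intervalIntegral.integral_finsetSum fun k _ => Continuous.intervalIntegrable (by fun_prop) _ _,
    Finset.mul_sum]
  refine Finset.sum_congr rfl fun k hk => ?_
  rw [intervalIntegral.integral_finsetSum fun k _ => Continuous.intervalIntegrable (by fun_prop) _ _,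
    Finset.mul_sum]
  simp_rw [intervalIntegral.integral_const_mul]
  calc ∑ l ∈ K, 2 * Real.pi * (β k * β l * ∫ r in (0 : ℝ)..1, r * f k r * f l r)
      = ∑ l ∈ K, β k * β l * (if k = l then g k else 0) :=
        Finset.sum_congr rfl fun l _ => by rw [← hort]; ring
    _ = β k ^ 2 * g k := by simp [hk, sq]

lemma integral_sum_profile_sq (K : Finset ℕ+) (β : ℕ+ → ℝ) :
    2 * Real.pi * ∫ r in (0 : ℝ)..1, r * (∑ k ∈ K, β k * profile k r) ^ 2 = ∑ k ∈ K, β k ^ 2 := by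
  simpa using integral_sum_sq K β profile continuous_profile (fun _ => 1) profile_orthonormal

lemma integral_sum_profile'_sq (K : Finset ℕ+) (β : ℕ+ → ℝ) :
    2 * Real.pi * ∫ r in (0 : ℝ)..1, r * (∑ k ∈ K, β k * profile' k r) ^ 2
      = ∑ k ∈ K, β k ^ 2 * z k ^ 2 := by
  refine integral_sum_sq K β profile' continuous_profile' (fun k => z k ^ 2) fun k l => ?_
  rw [integral_profile'_mul, ← mul_assoc, mul_comm _ (z k ^ 2), mul_assoc, profile_orthonormal]
  simp

lemma abs_sum_le_sqrt_card {K : Finset ℕ+} {β f : ℕ+ → ℝ} {A M : ℝ} (hM : (K.card : ℝ) ≤ M)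
    (hA : 0 ≤ A) (hf : ∀ k ∈ K, |f k| ≤ A) :
    |∑ k ∈ K, β k * f k| ≤ √M * √(∑ k ∈ K, β k ^ 2) * A := by
  have h1 : |∑ k ∈ K, β k * f k| ≤ (∑ k ∈ K, |β k|) * A := by
    refine (Finset.abs_sum_le_sum_abs _ _).trans ?_
    rw [Finset.sum_mul]
    exact Finset.sum_le_sum fun k hk => by
      rw [abs_mul]; exact mul_le_mul_of_nonneg_left (hf k hk) (abs_nonneg _)
  have h2 : ∑ k ∈ K, |β k| ≤ √M * √(∑ k ∈ K, β k ^ 2) := by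
    have h3 := sq_sum_le_card_mul_sum_sq (s := K) (f := fun k => |β k|)
    simp only [sq_abs] at h3
    have hM0 : 0 ≤ M := (Nat.cast_nonneg _).trans hM
    rw [← Real.sqrt_mul hM0]
    refine Real.le_sqrt_of_sq_le (h3.trans ?_)
    exact mul_le_mul_of_nonneg_right hM (Finset.sum_nonneg fun _ _ => sq_nonneg _)
  exact h1.trans (mul_le_mul_of_nonneg_right h2 hA)

lemma sum_mul_triple (K : Finset ℕ+) (β : ℕ+ → ℝ) (n l : ℕ+) :
    ∑ k ∈ K, β k * triple n k l = 2 * Real.pi * ∫ r in (0 : ℝ)..1, (r * profile n r * profile l r)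
      * ∑ k ∈ K, β k * profile k r := by
  have hcn := continuous_profile n
  have hcl := continuous_profile l
  simp_rw [Finset.mul_sum]
  rw [intervalIntegral.integral_finsetSum fun k _ => Continuous.intervalIntegrable
    (by have := continuous_profile k; fun_prop) _ _, Finset.mul_sum]
  refine Finset.sum_congr rfl fun k _ => ?_
  rw [triple, show (fun r : ℝ => r * profile n r * profile l r * (β k * profile k r))
    = fun r => β k * (r * profile n r * profile l r * profile k r) by ext r; ring,
    intervalIntegral.integral_const_mul]
  ring

lemma sub_mul_sum_triple (K : Finset ℕ+) (β : ℕ+ → ℝ) (n l : ℕ+) :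
    (z l ^ 2 - z n ^ 2) * ∑ k ∈ K, β k * triple n k l = 2 * Real.pi * ∫ r in (0 : ℝ)..1,
      (r * profile' l r * profile n r - r * profile' n r * profile l r)
      * ∑ k ∈ K, β k * profile' k r := by
  have hcn := continuous_profile n
  have hcl := continuous_profile l
  have hcn' := continuous_profile' n
  have hcl' := continuous_profile' l
  simp_rw [Finset.mul_sum]
  rw [intervalIntegral.integral_finsetSum fun k _ => Continuous.intervalIntegrable
    (by have := continuous_profile' k; fun_prop) _ _, Finset.mul_sum]
  refine Finset.sum_congr rfl fun k _ => ?_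
  have hk' := continuous_profile' k
  rw [mul_left_comm, sub_mul_triple n k l, gradTriple, gradTriple,
    show (fun r : ℝ => (r * profile' l r * profile n r - r * profile' n r * profile l r) *
      (β k * profile' k r)) = fun r => β k * ((r * profile' l r * profile n r * profile' k r)
      - (r * profile' n r * profile l r * profile' k r)) by ext r; ring,
    intervalIntegral.integral_const_mul, intervalIntegral.integral_sub
    (Continuous.intervalIntegrable (by fun_prop) _ _)
    (Continuous.intervalIntegrable (by fun_prop) _ _)]
  ring

lemma card_Iic_le (M : ℕ+) : ((Finset.Iic M).card : ℝ) ≤ ((M : ℕ) : ℝ) := by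
  have : Finset.Iic M = Finset.Icc 1 M := by
    ext k; simp
  rw [this, PNat.card_Icc]
  simp

lemma z_le_of_mem_Iic {C : ℝ} (hC : 1 ≤ C) (hz : ∀ n : ℕ+, z n ≤ C * n) {M k : ℕ+}
    (hk : k ∈ Finset.Iic M) : z k ≤ C * ((M : ℕ) : ℝ) := by
  refine (hz k).trans ?_
  have : ((k : ℕ) : ℝ) ≤ ((M : ℕ) : ℝ) := by
    exact_mod_cast Finset.mem_Iic.1 hk
  gcongr

/-- `L¹` bounds, in the one dimensional measure, for low frequency functions. -/
lemma exists_integral_abs_sum_le : ∃ C : ℝ, 0 < C ∧ ∀ (M : ℕ+) (β : ℕ+ → ℝ),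
    0 < ∑ k ∈ Finset.Iic M, β k ^ 2 →
    (∫ r in (0 : ℝ)..1, |∑ k ∈ Finset.Iic M, β k * profile k r|
      ≤ √(∑ k ∈ Finset.Iic M, β k ^ 2) * (C * (1 + Real.log M))) ∧
    (∫ r in (0 : ℝ)..1, |∑ k ∈ Finset.Iic M, β k * profile' k r|
      ≤ √(∑ k ∈ Finset.Iic M, β k ^ 2) * (C * M * (1 + Real.log M))) := by
  obtain ⟨Cz, hCz, hz⟩ := exists_z_le
  have hpi := Real.pi_pos
  refine ⟨Cz ^ 2 * 5, by positivity, fun M β hSpos => ?_⟩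
  have hM : (1 : ℝ) ≤ ((M : ℕ) : ℝ) := by exact_mod_cast M.pos
  have hzk : ∀ k ∈ Finset.Iic M, z k ≤ Cz * ((M : ℕ) : ℝ) := fun k hk => z_le_of_mem_Iic hCz hz hk
  have hcard := card_Iic_le M
  have hU := integral_sum_profile_sq (Finset.Iic M) β
  have hU' := integral_sum_profile'_sq (Finset.Iic M) β
  generalize ((M : ℕ) : ℝ) = m at *
  generalize Finset.Iic M = K at *
  have hlog : 0 ≤ Real.log m := Real.log_nonneg hM
  have hcU : Continuous fun r => ∑ k ∈ K, β k * profile k r :=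
    continuous_finsetSum _ fun k _ => continuous_const.mul (continuous_profile k)
  have hcU' : Continuous fun r => ∑ k ∈ K, β k * profile' k r :=
    continuous_finsetSum _ fun k _ => continuous_const.mul (continuous_profile' k)
  have hZ1 : 1 ≤ Cz * m := by nlinarith
  have hbU : ∀ r : ℝ, 0 ≤ r → r ≤ 1 → |∑ k ∈ K, β k * profile k r|
      ≤ √m * √(∑ k ∈ K, β k ^ 2) * (Cz * m) := fun r h0 _ =>
    abs_sum_le_sqrt_card hcard (by positivity) fun k hk => (abs_profile_le h0).trans
        ((Real.sqrt_le_sqrt (hzk k hk)).trans ((Real.sqrt_le_left (by positivity)).2 (by nlinarith)))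
  have hbU' : ∀ r : ℝ, 0 ≤ r → r ≤ 1 → |∑ k ∈ K, β k * profile' k r|
      ≤ √m * √(∑ k ∈ K, β k ^ 2) * (Cz * m) ^ 2 := fun r h0 _ =>
    abs_sum_le_sqrt_card hcard (by positivity) fun k hk => (abs_profile'_le h0).trans
        (pow_le_pow_left₀ (z_pos k).le (hzk k hk) 2)
  have hI0 : 0 ≤ ∫ r in (0 : ℝ)..1, r * (∑ k ∈ K, β k * profile k r) ^ 2 :=
    intervalIntegral.integral_nonneg zero_le_one fun r hr => mul_nonneg hr.1 (sq_nonneg _)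
  have hI0' : 0 ≤ ∫ r in (0 : ℝ)..1, r * (∑ k ∈ K, β k * profile' k r) ^ 2 :=
    intervalIntegral.integral_nonneg zero_le_one fun r hr => mul_nonneg hr.1 (sq_nonneg _)
  have h3 : ∑ k ∈ K, β k ^ 2 * z k ^ 2 ≤ (∑ k ∈ K, β k ^ 2) * (Cz * m) ^ 2 := by
    rw [Finset.sum_mul]
    refine Finset.sum_le_sum fun k hk => ?_
    have := z_pos k
    have := hzk k hk
    gcongr
  generalize ∑ k ∈ K, β k ^ 2 = S at *
  have hB : 0 < √S := Real.sqrt_pos.2 hSpos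
  have hBB : √S * √S = S := Real.mul_self_sqrt hSpos.le
  -- The cut-off `m ^ (-3)` outweighs the polynomial supremum bounds, while its logarithm is only `3
  -- log m`.
  have hδ : (0 : ℝ) < (m ^ 3)⁻¹ := by positivity
  have hδ1 : (m ^ 3)⁻¹ ≤ 1 := inv_le_one_of_one_le₀ (one_le_pow₀ hM)
  have hlogδ : Real.log ((m ^ 3)⁻¹)⁻¹ = 3 * Real.log m := by
    rw [inv_inv, Real.log_pow]; norm_num
  have hsm : √m ≤ m := by
    rw [Real.sqrt_le_left (by linarith)]; nlinarith
  have hpi3 := Real.pi_gt_three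
  constructor
  · have h := integral_abs_le_of_weighted hcU (E := √S) hδ hδ1 hB hbU (by rw [sq, hBB]; nlinarith)
    rw [hlogδ] at h
    refine h.trans ?_
    have h1 : (m ^ 3)⁻¹ * (√m * √S * (Cz * m)) ≤ √S * Cz ^ 2 := by
      rw [inv_mul_le_iff₀ (by positivity)]
      calc √m * √S * (Cz * m) ≤ m * √S * (Cz ^ 2 * m) := by
            gcongr
            nlinarith
        _ = m ^ 2 * (√S * Cz ^ 2) := by ring
        _ ≤ m ^ 3 * (√S * Cz ^ 2) := by gcongr <;> norm_num [hM]
    have h2 : √S * (1 + 3 * Real.log m) ≤ √S * (Cz ^ 2 * (4 + 5 * Real.log m)) := by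
      have : 1 ≤ Cz ^ 2 := one_le_pow₀ hCz
      gcongr
      nlinarith
    calc _ ≤ √S * Cz ^ 2 + √S * (Cz ^ 2 * (4 + 5 * Real.log m)) := add_le_add h1 h2
      _ = _ := by ring
  · have hE : 0 < Cz * m * √S := by positivity
    have h := integral_abs_le_of_weighted hcU' (E := Cz * m * √S) hδ hδ1 hE hbU' ?_
    · rw [hlogδ] at h
      refine h.trans ?_
      have h1 : (m ^ 3)⁻¹ * (√m * √S * (Cz * m) ^ 2) ≤ √S * (Cz ^ 2 * m) := by
        rw [inv_mul_le_iff₀ (by positivity)]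
        calc √m * √S * (Cz * m) ^ 2 ≤ m * √S * (Cz * m) ^ 2 := by gcongr
          _ = m ^ 3 * (√S * Cz ^ 2) := by ring
          _ ≤ m ^ 3 * (√S * (Cz ^ 2 * m)) := by
            gcongr
            exact le_mul_of_one_le_right (by positivity) hM
      have h2 : Cz * m * √S * (1 + 3 * Real.log m) ≤ √S * (Cz ^ 2 * m * (4 + 5 * Real.log m)) := by
        calc Cz * m * √S * (1 + 3 * Real.log m) = √S * (Cz * m * (1 + 3 * Real.log m)) := by ring
          _ ≤ √S * (Cz ^ 2 * m * (4 + 5 * Real.log m)) := by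
            gcongr
            · nlinarith
            · linarith
            · linarith
      calc _ ≤ √S * (Cz ^ 2 * m) + √S * (Cz ^ 2 * m * (4 + 5 * Real.log m)) := add_le_add h1 h2
        _ = _ := by ring
    · rw [← hU'] at h3
      have : (Cz * m * √S) ^ 2 = S * (Cz * m) ^ 2 := by rw [mul_pow, sq √S, hBB]; ring
      rw [this]
      nlinarith

/-- The `ℓ²` sizes, in the low frequency, of the triple products. -/
lemma exists_sum_triple_sq_le : ∃ C : ℝ, 0 < C ∧ ∀ M n l : ℕ+,
    (∑ k ∈ Finset.Iic M, triple n k l ^ 2 ≤ (C * (1 + Real.log M)) ^ 2) ∧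
    (z l - z n) ^ 2 * ∑ k ∈ Finset.Iic M, triple n k l ^ 2 ≤ (C * M * (1 + Real.log M)) ^ 2 := by
  obtain ⟨C, hC, hI⟩ := exists_integral_abs_sum_le
  have hpi := Real.pi_pos
  refine ⟨2 * Real.pi * C, by positivity, fun M n l => ?_⟩
  have hM : (1 : ℝ) ≤ ((M : ℕ) : ℝ) := by exact_mod_cast M.pos
  have hlog : 0 ≤ Real.log ((M : ℕ) : ℝ) := Real.log_nonneg hM
  -- Duality: with the triple products themselves as coefficients, their square sum `S` is an
  -- integral of `r e_n e_l`, bounded by one, against a function of norm `√S`. Dividing by `√S`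
  -- gives the claim; the gradient identity gives the second bound in the same way.
  have hI' := hI M fun k => triple n k l
  have t1 := sum_mul_triple (Finset.Iic M) (fun k => triple n k l) n l
  have t2 := sub_mul_sum_triple (Finset.Iic M) (fun k => triple n k l) n l
  have hcU : Continuous fun r => ∑ k ∈ Finset.Iic M, triple n k l * profile k r :=
    continuous_finsetSum _ fun k _ => continuous_const.mul (continuous_profile k)
  have hcU' : Continuous fun r => ∑ k ∈ Finset.Iic M, triple n k l * profile' k r :=
    continuous_finsetSum _ fun k _ => continuous_const.mul (continuous_profile' k)
  have hcn := continuous_profile n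
  have hcl := continuous_profile l
  have hcn' := continuous_profile' n
  have hcl' := continuous_profile' l
  have hs : 0 < z l + z n := add_pos (z_pos l) (z_pos n)
  have h1 := abs_integral_mul_le (f := fun r => r * profile n r * profile l r) (A := 1)
    (by fun_prop) hcU (fun r h0 h1 => abs_mul_profile_mul_profile_le h0 h1)
  have h1' := abs_integral_mul_le
    (f := fun r => r * profile' l r * profile n r - r * profile' n r * profile l r) (A := z l + z n)
    (by fun_prop) hcU' (fun r h0 h1 => (abs_sub _ _).trans (add_le_add
      (abs_mul_profile'_mul_profile_le h0 h1) (abs_mul_profile'_mul_profile_le h0 h1)))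
  simp only [← sq] at t1 t2
  have hS0 : 0 ≤ ∑ k ∈ Finset.Iic M, triple n k l ^ 2 := Finset.sum_nonneg fun _ _ => sq_nonneg _
  generalize ∑ k ∈ Finset.Iic M, triple n k l ^ 2 = S at *
  generalize ((M : ℕ) : ℝ) = m at *
  rcases hS0.eq_or_lt with h0 | hSpos
  · rw [← h0]; constructor <;> [skip; rw [mul_zero]] <;> positivity
  obtain ⟨b1, b2⟩ := hI' hSpos
  have hB : 0 < √S := Real.sqrt_pos.2 hSpos
  have hBB : √S * √S = S := Real.mul_self_sqrt hS0
  constructor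
  · rw [one_mul] at h1
    have h2 : √S * √S ≤ 2 * Real.pi * (√S * (C * (1 + Real.log m))) := by
      rw [hBB]
      refine t1.le.trans ?_
      exact mul_le_mul_of_nonneg_left ((le_abs_self _).trans (h1.trans b1)) (by positivity)
    have h3 : √S ≤ 2 * Real.pi * C * (1 + Real.log m) := by
      refine le_of_mul_le_mul_left (h2.trans_eq ?_) hB
      ring
    calc S = √S ^ 2 := by rw [sq, hBB]
      _ ≤ _ := pow_le_pow_left₀ hB.le h3 2
  · have h2 : (z l + z n) * (|z l - z n| * √S) * √S ≤
        (z l + z n) * (2 * Real.pi * C * m * (1 + Real.log m)) * √S := by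
      have e1 : (z l + z n) * (|z l - z n| * √S) * √S = |(z l ^ 2 - z n ^ 2) * S| := by
        rw [show z l ^ 2 - z n ^ 2 = (z l + z n) * (z l - z n) by ring, abs_mul, abs_mul,
          abs_of_pos hs, abs_of_nonneg hS0, mul_assoc, mul_assoc, hBB, mul_assoc]
      rw [e1, t2, abs_mul, abs_of_pos (by positivity : 0 < 2 * Real.pi)]
      refine (mul_le_mul_of_nonneg_left (h1'.trans (mul_le_mul_of_nonneg_left b2 hs.le))
        (by positivity)).trans_eq ?_
      ring
    have h3 := le_of_mul_le_mul_left (le_of_mul_le_mul_right h2 hB) hs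
    calc (z l - z n) ^ 2 * S = (|z l - z n| * √S) ^ 2 := by
          rw [mul_pow, sq_abs, sq √S, hBB]
      _ ≤ _ := pow_le_pow_left₀ (by positivity) h3 2

/-! ### Counting lemmas -/

lemma nat_succ_le_rpow {ε : ℝ} (hε : 0 < ε) (a : ℕ) :
    ((a : ℝ) + 1) ≤ (1 + (ε * Real.log 2)⁻¹) * (2 : ℝ) ^ (a * ε) := by
  have hl : 0 < Real.log 2 := Real.log_pos one_lt_two
  have hd : 0 < ε * Real.log 2 := by positivity
  have h1 : 1 + a * (ε * Real.log 2) ≤ (2 : ℝ) ^ (a * ε) := by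
    rw [Real.rpow_def_of_pos two_pos]
    have := Real.add_one_le_exp (Real.log 2 * (a * ε))
    linarith
  have h2 : (a : ℝ) = (ε * Real.log 2)⁻¹ * (a * (ε * Real.log 2)) := by field_simp
  have h3 : 0 < (ε * Real.log 2)⁻¹ := by positivity
  have h4 : 0 ≤ a * (ε * Real.log 2) := by positivity
  nlinarith

/-- The divisor bound. -/
lemma exists_card_divisors_le {ε : ℝ} (hε : 0 < ε) :
    ∃ C : ℝ, 1 ≤ C ∧ ∀ n : ℕ, n ≠ 0 → (n.divisors.card : ℝ) ≤ C * (n : ℝ) ^ ε := by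
  -- For primes `p ≥ P` one has `p ^ ε ≥ 2`, hence `a + 1 ≤ 2 ^ a ≤ p ^ (a ε)`. The fewer than `P`
  -- smaller primes cost a factor `K` each.
  obtain ⟨P, hP⟩ := exists_nat_gt ((2 : ℝ) ^ (1 / ε))
  set K : ℝ := 1 + (ε * Real.log 2)⁻¹ with hK
  have hl : 0 < Real.log 2 := Real.log_pos one_lt_two
  have hK1 : 1 ≤ K := by
    have : 0 < (ε * Real.log 2)⁻¹ := by positivity
    linarith
  refine ⟨K ^ P, one_le_pow₀ hK1, fun n hn => ?_⟩
  have hn' : (n : ℝ) ^ ε = ∏ p ∈ n.primeFactors, ((p : ℝ) ^ (n.factorization p * ε)) := by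
    conv_lhs => rw [← Nat.prod_factorization_pow_eq_self hn]
    rw [Finsupp.prod, Nat.support_factorization]
    push_cast
    rw [← Real.finsetProd_rpow _ _ fun p _ => by positivity]
    refine Finset.prod_congr rfl fun p _ => ?_
    rw [← Real.rpow_natCast, ← Real.rpow_mul (Nat.cast_nonneg p)]
  rw [Nat.card_divisors hn, hn']
  push_cast
  have hterm : ∀ p ∈ n.primeFactors, ((n.factorization p : ℝ) + 1)
      ≤ (if p < P then K else 1) * (p : ℝ) ^ (n.factorization p * ε) := by
    intro p hp
    have hp2 : (2 : ℝ) ≤ p := by exact_mod_cast (Nat.prime_of_mem_primeFactors hp).two_le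
    split_ifs with h
    · refine (nat_succ_le_rpow hε _).trans ?_
      gcongr
    · have hpP : (2 : ℝ) ^ (1 / ε) ≤ p := hP.le.trans (by exact_mod_cast not_lt.1 h)
      have h2 : (2 : ℝ) ≤ (p : ℝ) ^ ε := by
        have := Real.rpow_le_rpow (by positivity) hpP hε.le
        rwa [← Real.rpow_mul two_pos.le, one_div_mul_cancel hε.ne', Real.rpow_one] at this
      rw [one_mul, mul_comm, Real.rpow_mul (by positivity), Real.rpow_natCast]
      calc ((n.factorization p : ℝ) + 1) ≤ 2 ^ (n.factorization p) := by
            exact_mod_cast Nat.lt_two_pow_self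
        _ ≤ _ := by gcongr
  refine (Finset.prod_le_prod (fun p _ => by positivity) hterm).trans ?_
  rw [Finset.prod_mul_distrib]
  refine mul_le_mul_of_nonneg_right ?_ (Finset.prod_nonneg fun p _ => by positivity)
  rw [← Finset.prod_filter, Finset.prod_const]
  refine pow_le_pow_right₀ hK1 ?_
  calc (n.primeFactors.filter (· < P)).card ≤ (Finset.range P).card :=
        Finset.card_le_card fun p hp => Finset.mem_range.2 (Finset.mem_filter.1 hp).2
    _ = P := Finset.card_range P

lemma card_le_of_pairwise_abs_sub_le {S : Finset ℤ} {H : ℕ} (h : ∀ a ∈ S, ∀ b ∈ S, |a - b| ≤ H) :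
    S.card ≤ H + 1 := by
  rcases S.eq_empty_or_nonempty with rfl | hne
  · simp
  · have hsub : S ⊆ Finset.Icc (S.min' hne) (S.min' hne + H) := fun a ha => by
      have h1 := S.min'_le a ha
      have h2 := (abs_le.1 (h a ha _ (S.min'_mem hne))).2
      rw [Finset.mem_Icc]; constructor <;> linarith
    refine (Finset.card_le_card hsub).trans ?_
    rw [Int.card_Icc]; omega

lemma card_le_of_image_int {α : Type*} [DecidableEq α] {P : Finset α} (f : α → ℤ) {H : ℕ}
    (hinj : Set.InjOn f P) (h : ∀ a ∈ P, ∀ b ∈ P, |f a - f b| ≤ H) : P.card ≤ H + 1 := by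
  classical
  rw [← Finset.card_image_of_injOn hinj]
  refine card_le_of_pairwise_abs_sub_le ?_
  intro a ha b hb
  obtain ⟨x, hx, rfl⟩ := Finset.mem_image.1 ha
  obtain ⟨y, hy, rfl⟩ := Finset.mem_image.1 hb
  exact h x hx y hy

lemma sum_comp_le_of_fiber {X Y : Type*} [DecidableEq Y] {s : Finset X} {t : Finset Y} {ψ : X → Y}
    (hmaps : ∀ x ∈ s, ψ x ∈ t) {F : Y → ℝ} (hF : ∀ y, 0 ≤ F y) {C : ℝ}
    (hfib : ∀ y ∈ t, ((s.filter fun x => ψ x = y).card : ℝ) ≤ C) :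
    ∑ x ∈ s, F (ψ x) ≤ C * ∑ y ∈ t, F y := by
  rw [← Finset.sum_fiberwise_of_maps_to hmaps, Finset.mul_sum]
  refine Finset.sum_le_sum fun y hy => ?_
  rw [Finset.sum_congr rfl (g := fun _ => F y) fun x hx => by rw [(Finset.mem_filter.1 hx).2],
    Finset.sum_const, nsmul_eq_mul]
  exact mul_le_mul_of_nonneg_right (hfib y hy) (hF y)

/-- An integer valued sequence that stays close to a quadratic sequence. -/
structure NearQuadratic (ν : ℕ+ → ℤ) (q : ℤ) (κ C : ℝ) : Prop where
  odd : Odd q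
  pos : 0 < κ
  approx : ∀ n : ℕ+, |(ν n : ℝ) - κ * ((4 * (n : ℕ) + q : ℤ) : ℝ) ^ 2| ≤ C

namespace NearQuadratic

variable {ν : ℕ+ → ℤ} {q : ℤ} {κ C : ℝ}

/-- The quadratic sequence is the square of `4 n + q`. -/
def base (q : ℤ) (n : ℕ+) : ℤ := 4 * (n : ℕ) + q

lemma diff_le (h : NearQuadratic ν q κ C) (n l : ℕ+) :
    |((ν l - ν n : ℤ) : ℝ) - κ * ((base q l ^ 2 - base q n ^ 2 : ℤ) : ℝ)| ≤ 2 * C := by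
  have h1 := h.approx n
  have h2 := h.approx l
  have e : ((ν l - ν n : ℤ) : ℝ) - κ * ((base q l ^ 2 - base q n ^ 2 : ℤ) : ℝ)
      = ((ν l : ℝ) - κ * ((4 * (l : ℕ) + q : ℤ) : ℝ) ^ 2)
        - ((ν n : ℝ) - κ * ((4 * (n : ℕ) + q : ℤ) : ℝ) ^ 2) := by
    simp only [base]; push_cast; ring
  rw [e]
  refine (abs_sub _ _).trans (by linarith)

/-- Two pairs with the same frequency difference. -/
lemma abs_base_le (h : NearQuadratic ν q κ C) {n l n' l' : ℕ+} (he : ν l - ν n = ν l' - ν n') :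
    |(((base q l ^ 2 - base q n ^ 2) - (base q l' ^ 2 - base q n' ^ 2) : ℤ) : ℝ)| ≤ 4 * C / κ := by
  have h1 := h.diff_le n l
  have h2 := h.diff_le n' l'
  rw [← he] at h2
  rw [le_div_iff₀ h.pos]
  have e : |(((base q l ^ 2 - base q n ^ 2) - (base q l' ^ 2 - base q n' ^ 2) : ℤ) : ℝ)| * κ
      = |(((ν l - ν n : ℤ) : ℝ) - κ * ((base q l' ^ 2 - base q n' ^ 2 : ℤ) : ℝ))
      - (((ν l - ν n : ℤ) : ℝ) - κ * ((base q l ^ 2 - base q n ^ 2 : ℤ) : ℝ))| := by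
    rw [← abs_of_pos h.pos, ← abs_mul, abs_of_pos h.pos]
    congr 1; push_cast; ring
  rw [e]
  exact (abs_sub _ _).trans (by linarith)

/-- Replaces equality of frequency differences by near equality of differences of integer squares,
with a bounded integer error. All the counting below is done for these squares. -/
lemma exists_abs_base_le (h : NearQuadratic ν q κ C) : ∃ H : ℕ, ∀ n l n' l' : ℕ+,
    ν l - ν n = ν l' - ν n' →
    |(base q l ^ 2 - base q n ^ 2) - (base q l' ^ 2 - base q n' ^ 2)| ≤ H := by
  obtain ⟨H, hH⟩ := exists_nat_ge (4 * C / κ)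
  refine ⟨H, fun n l n' l' he => ?_⟩
  have := (h.abs_base_le he).trans hH
  exact_mod_cast this

/-- For a fixed nonzero index difference, a frequency difference is attained boundedly often. -/
lemma exists_card_fixed_diff_le (h : NearQuadratic ν q κ C) : ∃ B : ℕ, ∀ (d m : ℤ), d ≠ 0 →
    ∀ P : Finset (ℕ+ × ℕ+), (∀ p ∈ P, ((p.2 : ℕ) : ℤ) - ((p.1 : ℕ) : ℤ) = d ∧ ν p.2 - ν p.1 = m) →
      P.card ≤ B := by
  obtain ⟨H, hH⟩ := h.exists_abs_base_le
  refine ⟨H + 1, fun d m hd P hP => ?_⟩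
  refine card_le_of_image_int (fun p => ((p.1 : ℕ) : ℤ)) ?_ ?_
  · intro p hp p' hp' hpp
    have h1 := (hP p hp).1
    have h2 := (hP p' hp').1
    simp only at hpp
    have e1 : p.1 = p'.1 := PNat.coe_injective (by exact_mod_cast hpp)
    have e2 : p.2 = p'.2 := PNat.coe_injective (by zify; linarith)
    exact Prod.ext e1 e2
  · intro p hp p' hp'
    have h1 := (hP p hp).1
    have h2 := (hP p' hp').1
    have h3 := hH p.1 p.2 p'.1 p'.2 ((hP p hp).2.trans (hP p' hp').2.symm)
    -- For a fixed index difference `d` the difference of squares is affine in the index with slope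
    -- `32 d`, so near equality confines the index to a bounded range.
    have e : (base q p.2 ^ 2 - base q p.1 ^ 2) - (base q p'.2 ^ 2 - base q p'.1 ^ 2)
        = (32 * d) * (((p.1 : ℕ) : ℤ) - ((p'.1 : ℕ) : ℤ)) := by
      have e1 : ((p.2 : ℕ) : ℤ) = ((p.1 : ℕ) : ℤ) + d := by linarith
      have e2 : ((p'.2 : ℕ) : ℤ) = ((p'.1 : ℕ) : ℤ) + d := by linarith
      simp only [base, e1, e2]; ring
    rw [e, abs_mul] at h3
    have hd1 : 1 ≤ |32 * d| := by
      rw [abs_mul]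
      have := Int.one_le_abs hd
      simp only [Nat.abs_ofNat]; linarith
    nlinarith [abs_nonneg (((p.1 : ℕ) : ℤ) - ((p'.1 : ℕ) : ℤ))]

lemma card_filter_dvd_le (w : ℤ) (hw : w ≠ 0) (S : Finset ℤ) (hS : ∀ d ∈ S, d ∣ w) :
    S.card ≤ 2 * w.natAbs.divisors.card := by
  classical
  have hsub : S ⊆ (w.natAbs.divisors.image fun d : ℕ => (d : ℤ)) ∪
      (w.natAbs.divisors.image fun d : ℕ => -(d : ℤ)) := by
    intro d hd
    have h1 : d.natAbs ∈ w.natAbs.divisors :=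
      Nat.mem_divisors.2 ⟨Int.natAbs_dvd_natAbs.2 (hS d hd), by simpa using hw⟩
    rw [Finset.mem_union, Finset.mem_image, Finset.mem_image]
    rcases Int.natAbs_eq d with h | h
    · exact Or.inl ⟨_, h1, h.symm⟩
    · exact Or.inr ⟨_, h1, h.symm⟩
  refine (Finset.card_le_card hsub).trans ((Finset.card_union_le _ _).trans ?_)
  have h1 := Finset.card_image_le (s := w.natAbs.divisors) (f := fun d : ℕ => (d : ℤ))
  have h2 := Finset.card_image_le (s := w.natAbs.divisors) (f := fun d : ℕ => -(d : ℤ))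
  omega

/-- The number of pairs of bounded indices with a given frequency difference. -/
lemma exists_card_small_le (h : NearQuadratic ν q κ C) {ε : ℝ} (hε : 0 < ε) :
    ∃ B : ℝ, 0 < B ∧ ∀ (m : ℤ) (R : ℝ), 1 ≤ R → ∀ P : Finset (ℕ+ × ℕ+),
      (∀ p ∈ P, p.1 ≠ p.2 ∧ ((p.1 : ℕ) : ℝ) ≤ R ∧ ((p.2 : ℕ) : ℝ) ≤ R ∧ ν p.2 - ν p.1 = m) →
      (P.card : ℝ) ≤ B * R ^ ε := by
  classical
  obtain ⟨H, hH⟩ := h.exists_abs_base_le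
  -- The numbers whose divisors are counted have size `R ^ 2`, hence the exponent `ε / 2`.
  obtain ⟨Cd, hCd, hdiv⟩ := exists_card_divisors_le (half_pos hε)
  set A : ℝ := 4 + |(q : ℝ)| with hA
  have hA0 : 0 < A := by positivity
  refine ⟨(H + 1) * (2 * (Cd * ((2 * A ^ 2) ^ (ε / 2)))), by positivity, fun m R hR P hP => ?_⟩
  set W : ℕ+ × ℕ+ → ℤ := fun p => base q p.2 ^ 2 - base q p.1 ^ 2 with hW
  have himg : (P.image W).card ≤ H + 1 := by
    refine card_le_of_pairwise_abs_sub_le ?_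
    intro a ha b hb
    obtain ⟨p, hp, rfl⟩ := Finset.mem_image.1 ha
    obtain ⟨p', hp', rfl⟩ := Finset.mem_image.1 hb
    exact hH p.1 p.2 p'.1 p'.2 ((hP p hp).2.2.2.trans (hP p' hp').2.2.2.symm)
  -- `W` takes boundedly many values on `P`. For a given nonzero value the pair is determined by the
  -- divisor `p.2 - p.1`; the cofactor does not vanish because `q` is odd.
  have hfac : ∀ p : ℕ+ × ℕ+, W p = (((p.2 : ℕ) : ℤ) - ((p.1 : ℕ) : ℤ)) *
      (8 * (2 * (((p.2 : ℕ) : ℤ) + ((p.1 : ℕ) : ℤ)) + q)) := by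
    intro p; simp only [hW, base]; ring
  have hne2 : ∀ p : ℕ+ × ℕ+, 2 * (((p.2 : ℕ) : ℤ) + ((p.1 : ℕ) : ℤ)) + q ≠ 0 := by
    intro p hp0
    obtain ⟨t, ht⟩ := h.odd
    omega
  have hne1 : ∀ p ∈ P, ((p.2 : ℕ) : ℤ) - ((p.1 : ℕ) : ℤ) ≠ 0 := by
    intro p hp h0
    refine (hP p hp).1 (PNat.coe_injective ?_)
    zify; linarith
  have hfib : ∀ w ∈ P.image W, ((P.filter fun p => W p = w).card : ℝ)
      ≤ 2 * (Cd * ((2 * A ^ 2) ^ (ε / 2))) * R ^ ε := by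
    intro w hw
    obtain ⟨p₀, hp₀, rfl⟩ := Finset.mem_image.1 hw
    have hw0 : W p₀ ≠ 0 := by
      rw [hfac]; exact mul_ne_zero (hne1 p₀ hp₀) (mul_ne_zero (by norm_num) (hne2 p₀))
    have h1 : (P.filter fun p => W p = W p₀).card ≤ 2 * (W p₀).natAbs.divisors.card := by
      rw [← Finset.card_image_of_injOn (f := fun p : ℕ+ × ℕ+ => ((p.2 : ℕ) : ℤ) - ((p.1 : ℕ) : ℤ))]
      · refine card_filter_dvd_le _ hw0 _ fun d hd => ?_
        obtain ⟨p, hp, rfl⟩ := Finset.mem_image.1 hd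
        rw [← (Finset.mem_filter.1 hp).2, hfac]
        exact dvd_mul_right _ _
      · intro p hp p' hp' hpp
        have hp := Finset.mem_filter.1 hp
        have hp' := Finset.mem_filter.1 hp'
        simp only at hpp
        have e : W p = W p' := hp.2.trans hp'.2.symm
        rw [hfac, hfac, ← hpp] at e
        have e2 := mul_left_cancel₀ (hne1 p hp.1) e
        have e3 : p.1 = p'.1 := PNat.coe_injective (by zify; linarith)
        have e4 : p.2 = p'.2 := PNat.coe_injective (by zify; linarith)
        exact Prod.ext e3 e4
    have h2 := hdiv (W p₀).natAbs (by simpa using hw0)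
    have h3 : ((W p₀).natAbs : ℝ) ≤ 2 * A ^ 2 * R ^ 2 := by
      rw [Nat.cast_natAbs, Int.cast_abs]
      obtain ⟨-, hr1, hr2, -⟩ := hP p₀ hp₀
      have hb : ∀ n : ℕ+, ((n : ℕ) : ℝ) ≤ R → |(base q n : ℝ)| ≤ A * R := by
        intro n hn
        have e : (base q n : ℝ) = 4 * ((n : ℕ) : ℝ) + q := by simp [base]
        rw [e]
        refine (abs_add_le _ _).trans ?_
        rw [abs_of_nonneg (by positivity)]
        have := abs_nonneg (q : ℝ)
        nlinarith
      have e : ((W p₀ : ℤ) : ℝ) = (base q p₀.2 : ℝ) ^ 2 - (base q p₀.1 : ℝ) ^ 2 := by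
        simp [hW]
      rw [e]
      refine (abs_sub _ _).trans ?_
      rw [abs_pow, abs_pow]
      have b1 := pow_le_pow_left₀ (abs_nonneg _) (hb _ hr1) 2
      have b2 := pow_le_pow_left₀ (abs_nonneg _) (hb _ hr2) 2
      calc _ ≤ (A * R) ^ 2 + (A * R) ^ 2 := add_le_add b2 b1
        _ = _ := by ring
    have h4 : ((W p₀).natAbs : ℝ) ^ (ε / 2) ≤ (2 * A ^ 2) ^ (ε / 2) * R ^ ε := by
      refine (Real.rpow_le_rpow (Nat.cast_nonneg _) h3 (by positivity)).trans_eq ?_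
      rw [Real.mul_rpow (by positivity) (by positivity)]
      congr 1
      rw [← Real.rpow_natCast, ← Real.rpow_mul (by positivity)]
      congr 1; push_cast; ring
    calc ((P.filter fun p => W p = W p₀).card : ℝ) ≤ 2 * ((W p₀).natAbs.divisors.card : ℝ) := by
          exact_mod_cast h1
      _ ≤ 2 * (Cd * ((2 * A ^ 2) ^ (ε / 2) * R ^ ε)) := by
          gcongr
          exact h2.trans (by gcongr)
      _ = _ := by ring
  have := sum_comp_le_of_fiber (s := P) (t := P.image W) (ψ := W) (F := fun _ => 1)
    (fun p hp => Finset.mem_image_of_mem _ hp) (fun _ => zero_le_one) hfib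
  simp only [Finset.sum_const, nsmul_eq_mul, mul_one] at this
  refine this.trans ?_
  have hc : ((P.image W).card : ℝ) ≤ H + 1 := by exact_mod_cast himg
  have h0 : 0 ≤ 2 * (Cd * ((2 * A ^ 2) ^ (ε / 2))) * R ^ ε := by positivity
  calc _ ≤ 2 * (Cd * ((2 * A ^ 2) ^ (ε / 2))) * R ^ ε * (H + 1) := by gcongr
    _ = _ := by ring

/-- Two solutions of a quadratic equation with large linear coefficient are proportional and close
to each other. -/
lemma int_solutions_close {X X' D d₁ d₁' d₂ d₂' : ℤ} {H : ℤ} (hH0 : 0 ≤ H) (hX : 8 * D ^ 3 + 2 * D * H < X)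
    (h1 : d₁ ≠ 0) (h1' : d₁' ≠ 0) (h2 : d₂ ≠ 0) (h2' : d₂' ≠ 0)
    (b1 : |d₁| ≤ D) (b1' : |d₁'| ≤ D) (b2 : |d₂| ≤ D) (b2' : |d₂'| ≤ D)
    (e1 : |d₁ * X - d₁' * X' + 2 * (d₁ ^ 2 + d₁' ^ 2)| ≤ H)
    (e2 : |d₂ * X - d₂' * X' + 2 * (d₂ ^ 2 + d₂' ^ 2)| ≤ H) :
    d₁ * d₂' = d₂ * d₁' ∧ |d₁ - d₂| ≤ H := by
  set F₁ := d₁ * X - d₁' * X' + 2 * (d₁ ^ 2 + d₁' ^ 2) with hF₁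
  set F₂ := d₂ * X - d₂' * X' + 2 * (d₂ ^ 2 + d₂' ^ 2) with hF₂
  have hD : 1 ≤ D := (Int.one_le_abs h1).trans b1
  have hsq : ∀ d : ℤ, |d| ≤ D → d ^ 2 ≤ D ^ 2 := fun d hd => by
    rw [← sq_abs]; exact pow_le_pow_left₀ (abs_nonneg d) hd 2
  -- Eliminating `X'` between the two relations bounds the determinant times `X`. A nonzero integer
  -- determinant is then impossible for large `X`.
  have hdet : d₁ * d₂' = d₂ * d₁' := by
    by_contra hne
    have hne' : d₁ * d₂' - d₂ * d₁' ≠ 0 := sub_ne_zero.2 hne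
    have k1 : (d₁ * d₂' - d₂ * d₁') * X = F₁ * d₂' - F₂ * d₁' - 2 * (d₁ ^ 2 + d₁' ^ 2) * d₂'
        + 2 * (d₂ ^ 2 + d₂' ^ 2) * d₁' := by rw [hF₁, hF₂]; ring
    have k2 : |(d₁ * d₂' - d₂ * d₁') * X| ≤ 2 * D * H + 8 * D ^ 3 := by
      rw [k1]
      have t1 : |F₁ * d₂'| ≤ H * D := by rw [abs_mul]; gcongr
      have t2 : |F₂ * d₁'| ≤ H * D := by rw [abs_mul]; gcongr
      have t3 : |2 * (d₁ ^ 2 + d₁' ^ 2) * d₂'| ≤ 2 * (D ^ 2 + D ^ 2) * D := by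
        rw [abs_mul, abs_of_nonneg (by positivity : 0 ≤ 2 * (d₁ ^ 2 + d₁' ^ 2))]
        have := hsq _ b1
        have := hsq _ b1'
        gcongr
      have t4 : |2 * (d₂ ^ 2 + d₂' ^ 2) * d₁'| ≤ 2 * (D ^ 2 + D ^ 2) * D := by
        rw [abs_mul, abs_of_nonneg (by positivity : 0 ≤ 2 * (d₂ ^ 2 + d₂' ^ 2))]
        have := hsq _ b2
        have := hsq _ b2'
        gcongr
      calc _ ≤ |F₁ * d₂'| + |F₂ * d₁'| + |2 * (d₁ ^ 2 + d₁' ^ 2) * d₂'|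
            + |2 * (d₂ ^ 2 + d₂' ^ 2) * d₁'| := by
            refine (abs_add_le _ _).trans ?_
            gcongr
            refine (abs_sub _ _).trans ?_
            gcongr
            exact abs_sub _ _
        _ ≤ _ := by nlinarith
    have hX0 : 0 < X := by
      have : 0 ≤ 8 * D ^ 3 + 2 * D * H := by positivity
      linarith
    rw [abs_mul, abs_of_pos hX0] at k2
    have := Int.one_le_abs hne'
    nlinarith
  refine ⟨hdet, ?_⟩
  -- For proportional solutions the terms linear in `X` and `X'` drop out of `d₁ F₂ - d₂ F₁`, and
  -- the quadratic part factors.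
  have k3 : 2 * (d₂ - d₁) * (d₁ * d₂ + d₁' * d₂') = d₁ * F₂ - d₂ * F₁ := by
    rw [hF₁, hF₂]
    linear_combination (X' - 2 * (d₂' + d₁')) * hdet
  have k4 : 0 < d₁' * d₂' * (d₁ * d₂) := by
    have : d₁' * d₂' * (d₁ * d₂) = (d₁ * d₂') ^ 2 := by linear_combination (-(d₁ * d₂')) * hdet
    rw [this]; positivity
  -- Proportionality gives `d₁ d₂` and `d₁' d₂'` the same sign, so there is no cancellation in their
  -- sum.
  have k5 : |d₁| * |d₂| ≤ |d₁ * d₂ + d₁' * d₂'| := by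
    rw [← abs_mul]
    rcases lt_or_ge 0 (d₁ * d₂) with hp | hp
    · have : 0 < d₁' * d₂' := pos_of_mul_pos_left k4 hp.le
      rw [abs_of_pos hp, abs_of_pos (by linarith)]; linarith
    · have hp' : d₁ * d₂ < 0 := lt_of_le_of_ne hp (mul_ne_zero h1 h2)
      have : d₁' * d₂' < 0 := by
        by_contra hcon
        nlinarith
      rw [abs_of_neg hp', abs_of_neg (by linarith)]; linarith
  have k6 : 2 * |d₁ - d₂| * (|d₁| * |d₂|) ≤ (|d₁| + |d₂|) * H := by
    calc 2 * |d₁ - d₂| * (|d₁| * |d₂|) ≤ 2 * |d₁ - d₂| * |d₁ * d₂ + d₁' * d₂'| := by gcongr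
      _ = |d₁ * F₂ - d₂ * F₁| := by
        rw [← k3, abs_mul, abs_mul, abs_sub_comm d₂]; simp
      _ ≤ |d₁| * H + |d₂| * H := by
        refine (abs_sub _ _).trans ?_
        rw [abs_mul, abs_mul]
        gcongr
      _ = _ := by ring
  have a1 := Int.one_le_abs h1
  have a2 := Int.one_le_abs h2
  by_contra hcon
  push Not at hcon
  have a3 : |d₁| + |d₂| ≤ 2 * (|d₁| * |d₂|) := by nlinarith
  have a4 : 0 < |d₁| * |d₂| := by positivity
  nlinarith

/-- For large indices, pairs with equal frequency differences and prescribed outer indices are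
boundedly many. -/
lemma exists_card_large_le (h : NearQuadratic ν q κ C) : ∃ B : ℕ, 0 < B ∧ ∀ (D : ℕ) (n l' : ℕ+),
    B * D ^ 3 < (n : ℕ) → ∀ P : Finset (ℕ+ × ℕ+), (∀ p ∈ P, p.1 ≠ n ∧ p.2 ≠ l' ∧
      |((p.1 : ℕ) : ℤ) - ((n : ℕ) : ℤ)| ≤ D ∧ |((l' : ℕ) : ℤ) - ((p.2 : ℕ) : ℤ)| ≤ D ∧
      ν p.1 - ν n = ν l' - ν p.2) → P.card ≤ B := by
  obtain ⟨H, hH⟩ := h.exists_abs_base_le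
  refine ⟨8 + 2 * H + q.natAbs, by positivity, fun D n l' hn P hP => ?_⟩
  rcases P.eq_empty_or_nonempty with rfl | hne
  · simp
  have hX : 8 * (D : ℤ) ^ 3 + 2 * D * H < base q n := by
    have hD : 1 ≤ D := by
      by_contra hD
      obtain ⟨p, hp⟩ := hne
      obtain ⟨h1, -, h3, -⟩ := hP p hp
      have hD0 : D = 0 := by omega
      rw [hD0] at h3
      have : ((p.1 : ℕ) : ℤ) - ((n : ℕ) : ℤ) = 0 := by simpa using h3
      exact h1 (PNat.coe_injective (by zify; linarith))
    have h1 : D ≤ D ^ 3 := Nat.le_self_pow (by norm_num) D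
    have h2 : 1 ≤ D ^ 3 := Nat.one_le_pow _ _ hD
    have h6 : D * H ≤ D ^ 3 * H := Nat.mul_le_mul_right _ h1
    have h7 : q.natAbs * 1 ≤ q.natAbs * D ^ 3 := Nat.mul_le_mul_left _ h2
    have h3 : 8 * D ^ 3 + 2 * D * H + q.natAbs < (n : ℕ) := by linarith
    have h4 : -(q.natAbs : ℤ) ≤ q := by omega
    have h5 : (8 * (D : ℤ) ^ 3 + 2 * D * H + q.natAbs) < ((n : ℕ) : ℤ) := by exact_mod_cast h3
    rw [base]
    have : (0 : ℤ) < ((n : ℕ) : ℤ) := by exact_mod_cast n.pos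
    linarith
  -- In the displacements `p.1 - n` and `l' - p.2` the condition becomes a linear relation with
  -- coefficients `base q n` and `base q l'` and a quadratic correction, up to the error `H`.
  have hsol : ∀ p ∈ P, |(((p.1 : ℕ) : ℤ) - ((n : ℕ) : ℤ)) * base q n
      - (((l' : ℕ) : ℤ) - ((p.2 : ℕ) : ℤ)) * base q l'
      + 2 * ((((p.1 : ℕ) : ℤ) - ((n : ℕ) : ℤ)) ^ 2 + (((l' : ℕ) : ℤ) - ((p.2 : ℕ) : ℤ)) ^ 2)| ≤ (H : ℤ) := by
    intro p hp
    have h1 := hH n p.1 p.2 l' (hP p hp).2.2.2.2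
    have e : (base q p.1 ^ 2 - base q n ^ 2) - (base q l' ^ 2 - base q p.2 ^ 2)
        = 8 * ((((p.1 : ℕ) : ℤ) - ((n : ℕ) : ℤ)) * base q n
      - (((l' : ℕ) : ℤ) - ((p.2 : ℕ) : ℤ)) * base q l'
      + 2 * ((((p.1 : ℕ) : ℤ) - ((n : ℕ) : ℤ)) ^ 2 + (((l' : ℕ) : ℤ) - ((p.2 : ℕ) : ℤ)) ^ 2)) := by
      simp only [base]; ring
    rw [e, abs_mul] at h1
    simp only [Nat.abs_ofNat] at h1
    linarith [abs_nonneg ((((p.1 : ℕ) : ℤ) - ((n : ℕ) : ℤ)) * base q n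
      - (((l' : ℕ) : ℤ) - ((p.2 : ℕ) : ℤ)) * base q l'
      + 2 * ((((p.1 : ℕ) : ℤ) - ((n : ℕ) : ℤ)) ^ 2 + (((l' : ℕ) : ℤ) - ((p.2 : ℕ) : ℤ)) ^ 2))]
  have hd1 : ∀ p ∈ P, ((p.1 : ℕ) : ℤ) - ((n : ℕ) : ℤ) ≠ 0 := fun p hp h0 =>
    (hP p hp).1 (PNat.coe_injective (by zify; linarith))
  have hd2 : ∀ p ∈ P, ((l' : ℕ) : ℤ) - ((p.2 : ℕ) : ℤ) ≠ 0 := fun p hp h0 =>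
    (hP p hp).2.1 (PNat.coe_injective (by zify; linarith))
  have key := fun p (hp : p ∈ P) p' (hp' : p' ∈ P) => int_solutions_close (Int.natCast_nonneg H) hX (hd1 p hp) (hd2 p hp)
    (hd1 p' hp') (hd2 p' hp') (hP p hp).2.2.1 (hP p hp).2.2.2.1 (hP p' hp').2.2.1
    (hP p' hp').2.2.2.1 (hsol p hp) (hsol p' hp')
  have hcard : P.card ≤ H + 1 := by
    refine card_le_of_image_int (fun p => ((p.1 : ℕ) : ℤ)) ?_ ?_
    · intro p hp p' hp' hpp
      simp only at hpp
      have e := (key p hp p' hp').1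
      rw [← hpp] at e
      have e2 := mul_left_cancel₀ (hd1 p hp) e
      have e3 : p.1 = p'.1 := PNat.coe_injective (by zify; linarith)
      have e4 : p.2 = p'.2 := PNat.coe_injective (by zify; linarith)
      exact Prod.ext e3 e4
    · intro p hp p' hp'
      have := (key p hp p' hp').2
      rwa [show ((p.1 : ℕ) : ℤ) - ((n : ℕ) : ℤ) - (((p'.1 : ℕ) : ℤ) - ((n : ℕ) : ℤ))
        = ((p.1 : ℕ) : ℤ) - ((p'.1 : ℕ) : ℤ) by ring] at this
  omega

end NearQuadratic

/-! ### The weighted triple products -/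

lemma le_bracket (x : ℝ) : |x| ≤ bracket x := by
  rw [bracket, ← Real.sqrt_sq_eq_abs]
  exact Real.sqrt_le_sqrt (by linarith)

lemma one_le_bracket (x : ℝ) : 1 ≤ bracket x := by
  rw [bracket, Real.one_le_sqrt]; nlinarith [sq_nonneg x]

lemma bracket_pos (x : ℝ) : 0 < bracket x := one_pos.trans_le (one_le_bracket x)

lemma bracket_sq (x : ℝ) : bracket x ^ 2 = 1 + x ^ 2 := Real.sq_sqrt (by positivity)

lemma abs_bracket_sub_le (x y : ℝ) : |bracket x - bracket y| ≤ |x - y| := by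
  have hx := bracket_pos x
  have hy := bracket_pos y
  have e : (bracket x - bracket y) * (bracket x + bracket y) = (x - y) * (x + y) := by
    have := bracket_sq x
    have := bracket_sq y
    linear_combination bracket_sq x - bracket_sq y
  have h := congrArg abs e
  rw [abs_mul, abs_mul, abs_of_pos (by linarith : 0 < bracket x + bracket y)] at h
  have h2 : |x + y| ≤ bracket x + bracket y :=
    (abs_add_le x y).trans (add_le_add (le_bracket x) (le_bracket y))
  refine le_of_mul_le_mul_right ?_ (by linarith : 0 < bracket x + bracket y)
  rw [h]
  gcongr

/-- The ratio of the Sobolev weights. -/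
def weight (s : ℝ) (n l : ℕ+) : ℝ := (bracket (z l) / bracket (z n)) ^ s

lemma weight_nonneg (s : ℝ) (n l : ℕ+) : 0 ≤ weight s n l :=
  Real.rpow_nonneg (div_nonneg (bracket_pos _).le (bracket_pos _).le) s

lemma rpow_le_max_one {x s : ℝ} (hx : 0 ≤ x) (hs0 : 0 ≤ s) (hs1 : s ≤ 1) : x ^ s ≤ max 1 x := by
  rcases le_total x 1 with h | h
  · exact (Real.rpow_le_one hx h hs0).trans (le_max_left _ _)
  · exact ((Real.rpow_le_rpow_of_exponent_le h hs1).trans_eq (Real.rpow_one x)).trans (le_max_right _ _)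

lemma abs_rpow_sub_one_le {x s : ℝ} (hx : 0 ≤ x) (hs0 : 0 ≤ s) (hs1 : s ≤ 1) :
    |x ^ s - 1| ≤ |x - 1| := by
  rcases le_total x 1 with h | h
  · have h1 := Real.rpow_le_one hx h hs0
    have h2 : x ≤ x ^ s := by
      rcases hx.eq_or_lt with rfl | hx
      · exact Real.rpow_nonneg le_rfl _
      · simpa using Real.rpow_le_rpow_of_exponent_ge hx h hs1
    rw [abs_of_nonpos (by linarith), abs_of_nonpos (by linarith)]; linarith
  · have h1 := Real.one_le_rpow h hs0
    have h2 : x ^ s ≤ x := by simpa using Real.rpow_le_rpow_of_exponent_le h hs1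
    rw [abs_of_nonneg (by linarith), abs_of_nonneg (by linarith)]; linarith

section
variable {s : ℝ}

lemma weight_le_two (hs0 : 0 ≤ s) (hs1 : s ≤ 1) {n l : ℕ+} (h : z l < 2 * z n) :
    weight s n l ≤ 2 := by
  refine (rpow_le_max_one (div_nonneg (bracket_pos _).le (bracket_pos _).le) hs0 hs1).trans
    (max_le one_le_two ?_)
  rw [div_le_iff₀ (bracket_pos _), bracket, bracket, Real.sqrt_le_left
    (by have := Real.sqrt_nonneg (1 + z n ^ 2); linarith), mul_pow, Real.sq_sqrt (by positivity)]
  have := z_pos l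
  nlinarith [z_pos n]

lemma weight_le_div (hs0 : 0 ≤ s) (hs1 : s ≤ 1) {n l : ℕ+} (h : 2 * z n ≤ z l) :
    weight s n l ≤ z l / z n := by
  have hn := z_pos n
  have hl := z_pos l
  refine (rpow_le_max_one (div_nonneg (bracket_pos _).le (bracket_pos _).le) hs0 hs1).trans
    (max_le ?_ ?_)
  · rw [le_div_iff₀ hn]; linarith
  · rw [div_le_div_iff₀ (bracket_pos _) hn]
    refine (sq_le_sq₀ (mul_nonneg (bracket_pos _).le hn.le)
      (mul_nonneg hl.le (bracket_pos _).le)).1 ?_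
    rw [mul_pow, mul_pow, bracket_sq, bracket_sq]
    nlinarith [mul_pos hn hl]

lemma abs_weight_sub_one_le (hs0 : 0 ≤ s) (hs1 : s ≤ 1) (n l : ℕ+) :
    |weight s n l - 1| ≤ |z l - z n| / z n := by
  have hn := z_pos n
  refine (abs_rpow_sub_one_le (div_nonneg (bracket_pos _).le (bracket_pos _).le) hs0 hs1).trans ?_
  have e : bracket (z l) / bracket (z n) - 1 = (bracket (z l) - bracket (z n)) / bracket (z n) := by
    have := (bracket_pos (z n)).ne'
    field_simp
  rw [e, abs_div, abs_of_pos (bracket_pos (z n))]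
  have h1 : z n ≤ bracket (z n) := (le_abs_self _).trans (le_bracket _)
  have := abs_bracket_sub_le (z l) (z n)
  gcongr

lemma exists_gap_z : ∃ c : ℝ, 0 < c ∧ (∀ n l : ℕ+, c * |((n : ℕ) : ℝ) - ((l : ℕ) : ℝ)| ≤ |z l - z n|)
    ∧ ∀ n : ℕ+, c * ((n : ℕ) : ℝ) ≤ z n := by
  obtain ⟨c, hc, h⟩ := isZeroEnum_zeroSeq.exists_gap_mul
  refine ⟨c, hc, fun n l => ?_, fun n => ?_⟩
  · rw [abs_sub_comm (z l)]; exact h n l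
  · have := h n 0
    rw [isZeroEnum_zeroSeq.zero] at this
    simp only [Nat.cast_zero, sub_zero] at this
    rwa [abs_of_nonneg (by positivity), abs_of_nonneg (isZeroEnum_zeroSeq.nonneg _)] at this

/-- For `z_l < 2 z_n` the weight is bounded. Otherwise it is at most `z_l / z_n`, while the triple
products gain `M / z_l`; the product is bounded since `M ≤ 2 n`. -/
lemma exists_sum_weight_triple_sq_le (hs0 : 0 ≤ s) (hs1 : s ≤ 1) : ∃ C : ℝ, 0 < C ∧ ∀ M n l : ℕ+,
    ((M : ℕ) : ℝ) ≤ 2 * ((n : ℕ) : ℝ) →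
    ∑ k ∈ Finset.Iic M, (weight s n l * triple n k l) ^ 2 ≤ C * (1 + Real.log M) ^ 2 := by
  obtain ⟨C, hC, h⟩ := exists_sum_triple_sq_le
  obtain ⟨c, hc, -, hz⟩ := exists_gap_z
  refine ⟨4 * C ^ 2 + (4 * C / c) ^ 2, by positivity, fun M n l hMn => ?_⟩
  obtain ⟨h1, h2⟩ := h M n l
  simp_rw [mul_pow]
  rw [← Finset.mul_sum]
  have hw := weight_nonneg s n l
  set S := ∑ k ∈ Finset.Iic M, triple n k l ^ 2 with hS
  have hS0 : 0 ≤ S := Finset.sum_nonneg fun _ _ => sq_nonneg _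
  set Lg := 1 + Real.log M with hLg
  rcases lt_or_ge (z l) (2 * z n) with hl | hl
  · have w2 : weight s n l ^ 2 ≤ 4 := by
      have := weight_le_two hs0 hs1 hl
      nlinarith
    calc _ ≤ 4 * (C * Lg) ^ 2 := by gcongr
      _ ≤ _ := by nlinarith [mul_nonneg (sq_nonneg (4 * C / c)) (sq_nonneg Lg)]
  · have w2 := pow_le_pow_left₀ hw (weight_le_div hs0 hs1 hl) 2
    have hn := z_pos n
    have hlp := z_pos l
    have k1 : (z l / 2) ^ 2 * S ≤ (C * M * Lg) ^ 2 := by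
      refine le_trans (mul_le_mul_of_nonneg_right ?_ hS0) h2
      exact pow_le_pow_left₀ (by positivity) (by linarith) 2
    have k2 : ((M : ℕ) : ℝ) / z n ≤ 2 / c := by
      rw [div_le_div_iff₀ hn hc]
      have := hz n
      nlinarith
    calc weight s n l ^ 2 * S ≤ (z l / z n) ^ 2 * S := by gcongr
      _ = ((z l / 2) ^ 2 * S) * (4 / z n ^ 2) := by field_simp; ring
      _ ≤ (C * M * Lg) ^ 2 * (4 / z n ^ 2) := by gcongr
      _ = 4 * C ^ 2 * Lg ^ 2 * (((M : ℕ) : ℝ) / z n) ^ 2 := by field_simp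
      _ ≤ 4 * C ^ 2 * Lg ^ 2 * (2 / c) ^ 2 := by gcongr
      _ = (4 * C / c) ^ 2 * Lg ^ 2 := by ring
      _ ≤ _ := by nlinarith [mul_nonneg (sq_nonneg C) (sq_nonneg Lg)]

/-- The second bound says that the weighted kernel differs from multiplication by `e_k` only by a
Hilbert kernel `1 / (n + l)`: near the diagonal `|weight - 1| ≤ |z_l - z_n| / z_n` cancels against
the decay of the triple product. -/
lemma exists_weight_triple_decay (hs0 : 0 ≤ s) (hs1 : s ≤ 1) : ∃ C : ℝ, 0 < C ∧ ∀ n k l : ℕ+, k ≤ n →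
    |((n : ℕ) : ℝ) - ((l : ℕ) : ℝ)| * |weight s n l * triple n k l| ≤ C * ((k : ℕ) : ℝ) ^ 2 ∧
    (((n : ℕ) : ℝ) + ((l : ℕ) : ℝ)) * |weight s n l * triple n k l - triple n k l|
      ≤ C * ((k : ℕ) : ℝ) ^ 2 := by
  obtain ⟨Cz, hCz, hzle⟩ := exists_z_le
  obtain ⟨c, hc, hgap, hz⟩ := exists_gap_z
  refine ⟨16 * Real.pi * Cz ^ 2 / c, by positivity, fun n k l hkn => ?_⟩
  have hn := z_pos n
  have hl := z_pos l
  have hk := z_pos k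
  have hπ := Real.pi_pos
  have hk2 : z k ^ 2 ≤ Cz ^ 2 * ((k : ℕ) : ℝ) ^ 2 := by
    rw [← mul_pow]; exact pow_le_pow_left₀ hk.le (hzle k) 2
  have hfin : 16 * Real.pi * z k ^ 2 / c ≤ 16 * Real.pi * Cz ^ 2 / c * ((k : ℕ) : ℝ) ^ 2 := by
    calc _ ≤ 16 * Real.pi * (Cz ^ 2 * ((k : ℕ) : ℝ) ^ 2) / c := by gcongr
      _ = _ := by ring
  have hw := weight_nonneg s n l
  have h1 := abs_sub_mul_abs_triple_le n k l
  have ha : |weight s n l * triple n k l| = weight s n l * |triple n k l| := by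
    rw [abs_mul, abs_of_nonneg hw]
  have hb : |weight s n l * triple n k l - triple n k l|
      = |weight s n l - 1| * |triple n k l| := by rw [← abs_mul]; ring_nf
  have hw1 := abs_weight_sub_one_le hs0 hs1 n l
  have hg := hgap n l
  have hzn := hz n
  have hzl := hz l
  have ht := abs_nonneg (triple n k l)
  have h2 := fun h => abs_triple_le_of_two_mul_le (l := l) hkn h
  have hd0 := abs_nonneg (((n : ℕ) : ℝ) - ((l : ℕ) : ℝ))
  rw [ha, hb]
  generalize |triple n k l| = τ at *
  generalize |((n : ℕ) : ℝ) - ((l : ℕ) : ℝ)| = d at *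
  rcases lt_or_ge (z l) (2 * z n) with hln | hln
  · have w2 := weight_le_two hs0 hs1 hln
    constructor
    · refine le_trans ?_ hfin
      rw [le_div_iff₀ hc]
      have hd : 0 ≤ |z l - z n| := abs_nonneg _
      calc d * (weight s n l * τ) * c = weight s n l * (c * d) * τ := by ring
        _ ≤ 2 * |z l - z n| * τ := by gcongr
        _ ≤ _ := by nlinarith [mul_pos hπ (pow_pos hk 2)]
    · refine le_trans ?_ hfin
      rw [le_div_iff₀ hc]
      calc (((n : ℕ) : ℝ) + ((l : ℕ) : ℝ)) * (|weight s n l - 1| * τ) * c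
          = (c * ((n : ℕ) : ℝ) + c * ((l : ℕ) : ℝ)) * (|weight s n l - 1| * τ) := by ring
        _ ≤ (z n + 2 * z n) * (|z l - z n| / z n * τ) := by
            have := hzl.trans hln.le
            gcongr
        _ = 3 * (|z l - z n| * τ) := by field_simp; ring
        _ ≤ _ := by nlinarith [mul_pos hπ (pow_pos hk 2)]
  · have w2 := weight_le_div hs0 hs1 hln
    have hd : |z l - z n| ≤ z l := by rw [abs_of_nonneg (by linarith)]; linarith
    have h3 := h2 hln
    have h4 : z l / z n * (z l * τ) ≤ 8 * Real.pi * z k ^ 2 := by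
      calc z l / z n * (z l * τ) = (z l ^ 2 * τ) / z n := by ring
        _ ≤ (8 * Real.pi * (z n * z k ^ 2)) / z n := by gcongr
        _ = _ := by field_simp
    constructor
    · refine le_trans ?_ hfin
      rw [le_div_iff₀ hc]
      calc d * (weight s n l * τ) * c = (c * d) * (weight s n l * τ) := by ring
        _ ≤ z l * (z l / z n * τ) := by
            have := hg.trans hd
            gcongr
        _ = z l / z n * (z l * τ) := by ring
        _ ≤ _ := by nlinarith [mul_pos hπ (pow_pos hk 2)]
    · refine le_trans ?_ hfin
      rw [le_div_iff₀ hc]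
      calc (((n : ℕ) : ℝ) + ((l : ℕ) : ℝ)) * (|weight s n l - 1| * τ) * c
          = (c * ((n : ℕ) : ℝ) + c * ((l : ℕ) : ℝ)) * (|weight s n l - 1| * τ) := by ring
        _ ≤ (z l + z l) * (z l / z n * τ) := by
            gcongr
            · linarith
            · exact hw1.trans (by gcongr)
        _ = 2 * (z l / z n * (z l * τ)) := by ring
        _ ≤ _ := by nlinarith [mul_pos hπ (pow_pos hk 2)]

end

/-- The integer nearest to the eigenvalue. -/
def freq (n : ℕ+) : ℤ := round (z n ^ 2)

lemma abs_sub_freq_le (n : ℕ+) : |z n ^ 2 - freq n| ≤ 1 / 2 := abs_sub_round _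

lemma exists_nearQuadratic : ∃ (q : ℤ) (κ C : ℝ), NearQuadratic freq q κ C := by
  obtain ⟨q, C, hq, h⟩ := isZeroEnum_zeroSeq.exists_sq_asymptotics
  refine ⟨q, Real.pi ^ 2 / 16, C + 1 / 2, hq, by positivity, fun n => ?_⟩
  have h1 := h n
  have h2 := abs_sub_freq_le n
  rw [abs_sub_comm] at h2
  rw [← z_eq] at h1
  push_cast at h1 ⊢
  refine (abs_sub_le _ (z n ^ 2) _).trans ?_
  linarith

/-! ### Sums over frequency differences -/

lemma sum_int_inv_sq_le {D : ℕ} (hD : 0 < D) (E : Finset ℤ) (hE : ∀ d ∈ E, (D : ℤ) < |d|) :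
    ∑ d ∈ E, (1 : ℝ) / (d : ℝ) ^ 2 ≤ 2 / D := by
  classical
  have h1 := sum_comp_le_of_fiber (s := E) (t := E.image Int.natAbs) (ψ := Int.natAbs)
    (F := fun m : ℕ => ((m : ℝ) ^ 2)⁻¹) (fun d hd => Finset.mem_image_of_mem _ hd)
    (fun m => by positivity) (C := 2) (fun m _ => by
      have : (E.filter fun d => d.natAbs = m) ⊆ {(m : ℤ), -(m : ℤ)} := by
        intro d hd
        have := (Finset.mem_filter.1 hd).2
        rw [Finset.mem_insert, Finset.mem_singleton]; omega
      exact_mod_cast (Finset.card_le_card this).trans Finset.card_le_two)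
  have e : ∀ d : ℤ, (1 : ℝ) / (d : ℝ) ^ 2 = ((d.natAbs : ℝ) ^ 2)⁻¹ := fun d => by
    rw [Nat.cast_natAbs, Int.cast_abs, sq_abs, one_div]
  simp_rw [e]
  refine h1.trans ?_
  obtain ⟨m, hm⟩ := (E.image Int.natAbs).bddAbove
  have hsub : E.image Int.natAbs ⊆ Finset.Ioc D (max D m) := by
    intro x hx
    have h2 : x ≤ m := hm hx
    obtain ⟨d, hd, rfl⟩ := Finset.mem_image.1 hx
    have := hE d hd
    rw [Int.abs_eq_natAbs] at this
    rw [Finset.mem_Ioc]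
    constructor <;> omega
  have h3 := sum_Ioc_inv_sq_le_sub (α := ℝ) hD.ne' (le_max_left D m)
  have h4 := Finset.sum_le_sum_of_subset_of_nonneg (f := fun m : ℕ => ((m : ℝ) ^ 2)⁻¹) hsub
    fun _ _ _ => by positivity
  have h5 : (0 : ℝ) ≤ ((max D m : ℕ) : ℝ)⁻¹ := by positivity
  calc _ ≤ 2 * (D : ℝ)⁻¹ := by linarith
    _ = _ := by ring

/-- The operator norm is bounded by the Hilbert-Schmidt norm. -/
lemma sum_sq_sum_mul_le {α β : Type*} (S : Finset α) (L : Finset β) (a : α → ℝ) (t : α → β → ℝ) :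
    ∑ l ∈ L, (∑ n ∈ S, a n * t n l) ^ 2
      ≤ (∑ n ∈ S, a n ^ 2) * ∑ p ∈ S ×ˢ L, t p.1 p.2 ^ 2 := by
  rw [Finset.sum_product_right, Finset.mul_sum]
  exact Finset.sum_le_sum fun l _ => Finset.sum_mul_sq_le_sq_mul_sq _ _ _

namespace NearQuadratic

variable {ν : ℕ+ → ℤ} {q : ℤ} {κ C : ℝ}

/-- Contribution of index pairs far from the diagonal. -/
lemma exists_sum_far_le (h : NearQuadratic ν q κ C) : ∃ B : ℝ, 0 < B ∧
    ∀ (D : ℕ), 0 < D → ∀ (γ : ℤ → ℝ) (Γ : ℝ), (∀ m, 0 ≤ γ m) → (∀ Q : Finset ℤ, ∑ m ∈ Q, γ m ≤ Γ) →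
    ∀ P : Finset (ℕ+ × ℕ+), (∀ p ∈ P, (D : ℤ) < |((p.2 : ℕ) : ℤ) - ((p.1 : ℕ) : ℤ)|) →
      ∑ p ∈ P, γ (ν p.2 - ν p.1) / (((p.2 : ℕ) : ℝ) - ((p.1 : ℕ) : ℝ)) ^ 2 ≤ B * Γ / D := by
  classical
  obtain ⟨B, hB⟩ := h.exists_card_fixed_diff_le
  refine ⟨2 * (B + 1), by positivity, fun D hD γ Γ hγ hΓ P hP => ?_⟩
  have hΓ0 : 0 ≤ Γ := by simpa using hΓ ∅
  set δ : ℕ+ × ℕ+ → ℤ := fun p => ((p.2 : ℕ) : ℤ) - ((p.1 : ℕ) : ℤ) with hδ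
  -- Group the pairs by the index difference `d`. Each group costs a bounded multiple of `Γ / d ^
  -- 2`, and the sum of `d ^ (-2)` over `|d| > D` is at most `2 / D`.
  rw [← Finset.sum_fiberwise_of_maps_to (t := P.image δ) (g := δ)
    (fun p hp => Finset.mem_image_of_mem _ hp)]
  have hin : ∀ d ∈ P.image δ, ∑ p ∈ P with δ p = d,
      γ (ν p.2 - ν p.1) / (((p.2 : ℕ) : ℝ) - ((p.1 : ℕ) : ℝ)) ^ 2
        ≤ 1 / (d : ℝ) ^ 2 * ((B + 1) * Γ) := by
    intro d hd
    have hd0 : d ≠ 0 := by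
      obtain ⟨p, hp, rfl⟩ := Finset.mem_image.1 hd
      have := hP p hp
      intro h0
      rw [hδ] at h0
      simp only at h0
      rw [h0] at this
      simp at this
      omega
    have e : ∀ p ∈ P.filter (fun p => δ p = d),
        γ (ν p.2 - ν p.1) / (((p.2 : ℕ) : ℝ) - ((p.1 : ℕ) : ℝ)) ^ 2
          = 1 / (d : ℝ) ^ 2 * γ (ν p.2 - ν p.1) := by
      intro p hp
      rw [← (Finset.mem_filter.1 hp).2, hδ]
      push_cast; ring
    rw [Finset.sum_congr rfl e, ← Finset.mul_sum]
    refine mul_le_mul_of_nonneg_left ?_ (by positivity)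
    refine (sum_comp_le_of_fiber (s := P.filter (fun p => δ p = d))
      (t := (P.filter (fun p => δ p = d)).image fun p => ν p.2 - ν p.1)
      (ψ := fun p => ν p.2 - ν p.1) (F := γ) (C := B) (fun p hp => Finset.mem_image_of_mem _ hp)
      hγ ?_).trans ?_
    · intro m _
      refine Nat.cast_le.2 (hB d m hd0 _ fun p hp => ?_)
      obtain ⟨h1, h2⟩ := Finset.mem_filter.1 hp
      exact ⟨(Finset.mem_filter.1 h1).2, h2⟩
    · have := hΓ ((P.filter (fun p => δ p = d)).image fun p => ν p.2 - ν p.1)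
      have h1 : (0 : ℝ) ≤ B := by positivity
      nlinarith
  refine (Finset.sum_le_sum hin).trans ?_
  rw [← Finset.sum_mul]
  have := sum_int_inv_sq_le hD (P.image δ) fun d hd => by
    obtain ⟨p, hp, rfl⟩ := Finset.mem_image.1 hd
    exact hP p hp
  calc _ ≤ 2 / D * ((B + 1) * Γ) := by gcongr
    _ = _ := by ring

/-- Contribution of pairs of small indices. -/
lemma exists_sum_small_le (h : NearQuadratic ν q κ C) {ε : ℝ} (hε : 0 < ε) (B₀ : ℕ) :
    ∃ B : ℝ, 0 < B ∧ ∀ (D : ℕ), 0 < D → ∀ (γ : ℤ → ℝ) (Γ : ℝ), (∀ m, 0 ≤ γ m) →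
    (∀ Q : Finset ℤ, ∑ m ∈ Q, γ m ≤ Γ) → ∀ P : Finset (ℕ+ × ℕ+), (∀ p ∈ P, p.1 ≠ p.2 ∧
      (p.1 : ℕ) ≤ B₀ * D ^ 3 ∧ |((p.2 : ℕ) : ℤ) - ((p.1 : ℕ) : ℤ)| ≤ D) →
      ∑ p ∈ P, γ (ν p.2 - ν p.1) ≤ B * (D : ℝ) ^ ε * Γ := by
  classical
  -- The indices reach a multiple of `D ^ 3`, hence the exponent `ε / 3`.
  obtain ⟨B, hB, hcard⟩ := h.exists_card_small_le (div_pos hε three_pos)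
  refine ⟨B * ((B₀ : ℝ) + 1) ^ (ε / 3), by positivity, fun D hD γ Γ hγ hΓ P hP => ?_⟩
  have hΓ0 : 0 ≤ Γ := by simpa using hΓ ∅
  have hD1 : (1 : ℝ) ≤ D := by exact_mod_cast hD
  set R : ℝ := ((B₀ : ℝ) + 1) * (D : ℝ) ^ 3 with hR
  have hD3 : (D : ℝ) ≤ (D : ℝ) ^ 3 := le_self_pow₀ hD1 (by norm_num)
  have hR1 : 1 ≤ R := by
    have : (0 : ℝ) ≤ B₀ := by positivity
    nlinarith
  have hRe : R ^ (ε / 3) = ((B₀ : ℝ) + 1) ^ (ε / 3) * (D : ℝ) ^ ε := by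
    rw [hR, Real.mul_rpow (by positivity) (by positivity), ← Real.rpow_natCast,
      ← Real.rpow_mul (by positivity)]
    congr 2; push_cast; ring
  refine (sum_comp_le_of_fiber (s := P) (t := P.image fun p => ν p.2 - ν p.1)
    (ψ := fun p => ν p.2 - ν p.1) (F := γ) (C := B * R ^ (ε / 3))
    (fun p hp => Finset.mem_image_of_mem _ hp) hγ ?_).trans ?_
  · intro m _
    refine hcard m R hR1 _ fun p hp => ?_
    obtain ⟨h1, h2⟩ := Finset.mem_filter.1 hp
    obtain ⟨h3, h4, h5⟩ := hP p h1
    have h6 : ((p.1 : ℕ) : ℝ) ≤ B₀ * (D : ℝ) ^ 3 := by exact_mod_cast h4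
    have h7 : ((p.2 : ℕ) : ℝ) ≤ ((p.1 : ℕ) : ℝ) + D := by
      have : ((p.2 : ℕ) : ℤ) ≤ ((p.1 : ℕ) : ℤ) + D := by linarith [(abs_le.1 h5).2]
      exact_mod_cast this
    refine ⟨h3, ?_, ?_, h2⟩ <;> nlinarith
  · rw [hRe]
    have := hΓ (P.image fun p => ν p.2 - ν p.1)
    calc _ ≤ B * (((B₀ : ℝ) + 1) ^ (ε / 3) * (D : ℝ) ^ ε) * Γ := by gcongr
      _ = _ := by ring

/-- A quadrilinear bound by counting pairs of index pairs with equal frequency differences. -/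
lemma sum_quad_le {B D : ℕ} (hB : ∀ (n l' : ℕ+), B * D ^ 3 < (n : ℕ) → ∀ P : Finset (ℕ+ × ℕ+),
      (∀ p ∈ P, p.1 ≠ n ∧ p.2 ≠ l' ∧ |((p.1 : ℕ) : ℤ) - ((n : ℕ) : ℤ)| ≤ D ∧
      |((l' : ℕ) : ℤ) - ((p.2 : ℕ) : ℤ)| ≤ D ∧ ν p.1 - ν n = ν l' - ν p.2) → P.card ≤ B)
    {γ : ℤ → ℝ} {Γ : ℝ} (hγ : ∀ m, 0 ≤ γ m) (hΓ : ∀ Q : Finset ℤ, ∑ m ∈ Q, γ m ≤ Γ)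
    {S L : Finset ℕ+} {P : Finset (ℕ+ × ℕ+)} (hPS : P ⊆ S ×ˢ L) (hP : ∀ p ∈ P, p.1 ≠ p.2 ∧
      B * D ^ 3 < (p.1 : ℕ) ∧ |((p.2 : ℕ) : ℤ) - ((p.1 : ℕ) : ℤ)| ≤ D) (a x : ℕ+ → ℝ) :
    (∑ p ∈ P, √(γ (ν p.2 - ν p.1)) * (a p.1 * x p.2)) ^ 2
      ≤ Γ * (B * ((∑ n ∈ S, a n ^ 2) * ∑ l ∈ L, x l ^ 2)) := by
  classical
  have hΓ0 : 0 ≤ Γ := by simpa using hΓ ∅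
  set ψ : ℕ+ × ℕ+ → ℤ := fun p => ν p.2 - ν p.1 with hψ
  have hmaps : ∀ p ∈ P, ψ p ∈ P.image ψ := fun p hp => Finset.mem_image_of_mem _ hp
  have h1 : ∑ p ∈ P, √(γ (ν p.2 - ν p.1)) * (a p.1 * x p.2)
      = ∑ m ∈ P.image ψ, √(γ m) * ∑ p ∈ P with ψ p = m, a p.1 * x p.2 := by
    rw [← Finset.sum_fiberwise_of_maps_to hmaps]
    refine Finset.sum_congr rfl fun m _ => ?_
    rw [Finset.mul_sum]
    refine Finset.sum_congr rfl fun p hp => ?_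
    rw [← (Finset.mem_filter.1 hp).2]
  rw [h1]
  -- Cauchy-Schwarz over the frequency difference `m` separates `γ` from `a` and `x`.
  refine (Finset.sum_mul_sq_le_sq_mul_sq _ _ _).trans ?_
  have h2 : ∑ m ∈ P.image ψ, √(γ m) ^ 2 ≤ Γ := by
    simp_rw [Real.sq_sqrt (hγ _)]
    exact hΓ _
  refine mul_le_mul h2 ?_ (Finset.sum_nonneg fun _ _ => sq_nonneg _) hΓ0
  -- The square is opened into pairs of pairs with equal frequency difference, and `2 a x a' x' ≤ a
  -- ^ 2 x' ^ 2 + a' ^ 2 x ^ 2` leaves only the outer indices `n` and `l'`. The counting hypothesis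
  -- bounds how often these are hit.
  have h3 : ∀ m ∈ P.image ψ, (∑ p ∈ P with ψ p = m, a p.1 * x p.2) ^ 2
      ≤ ∑ pp ∈ (P ×ˢ P).filter (fun pp => ψ pp.1 = ψ pp.2) with ψ pp.1 = m,
        a pp.1.1 ^ 2 * x pp.2.2 ^ 2 := by
    intro m _
    have e : ((P ×ˢ P).filter (fun pp => ψ pp.1 = ψ pp.2)).filter (fun pp => ψ pp.1 = m)
        = (P.filter fun p => ψ p = m) ×ˢ (P.filter fun p => ψ p = m) := by
      ext pp
      simp only [Finset.mem_filter, Finset.mem_product]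
      constructor
      · rintro ⟨⟨⟨h1, h2⟩, h3⟩, h4⟩
        exact ⟨⟨h1, h4⟩, h2, h3 ▸ h4⟩
      · rintro ⟨⟨h1, h2⟩, h3, h4⟩
        exact ⟨⟨⟨h1, h3⟩, h2.trans h4.symm⟩, h2⟩
    rw [e]
    set Pm := P.filter fun p => ψ p = m
    have sym : ∑ pp ∈ Pm ×ˢ Pm, a pp.2.1 ^ 2 * x pp.1.2 ^ 2
        = ∑ pp ∈ Pm ×ˢ Pm, a pp.1.1 ^ 2 * x pp.2.2 ^ 2 := by
      rw [Finset.sum_product, Finset.sum_comm, ← Finset.sum_product']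
    rw [sq, Finset.sum_mul_sum, ← Finset.sum_product']
    have : ∑ pp ∈ Pm ×ˢ Pm, a pp.1.1 * x pp.1.2 * (a pp.2.1 * x pp.2.2)
        ≤ ∑ pp ∈ Pm ×ˢ Pm, (a pp.1.1 ^ 2 * x pp.2.2 ^ 2 + a pp.2.1 ^ 2 * x pp.1.2 ^ 2) / 2 :=
      Finset.sum_le_sum fun pp _ => by
        nlinarith [sq_nonneg (a pp.1.1 * x pp.2.2 - a pp.2.1 * x pp.1.2)]
    refine this.trans_eq ?_
    rw [← Finset.sum_div, Finset.sum_add_distrib, sym]; ring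
  refine (Finset.sum_le_sum h3).trans ?_
  rw [Finset.sum_fiberwise_of_maps_to (fun pp hpp =>
    hmaps _ (Finset.mem_product.1 (Finset.mem_filter.1 hpp).1).1), Finset.sum_mul_sum,
    ← Finset.sum_product']
  refine sum_comp_le_of_fiber (ψ := fun pp : (ℕ+ × ℕ+) × (ℕ+ × ℕ+) => (pp.1.1, pp.2.2))
    (F := fun p => a p.1 ^ 2 * x p.2 ^ 2) ?_ (fun _ => by positivity) ?_
  · intro pp hpp
    obtain ⟨h1, h2⟩ := Finset.mem_product.1 (Finset.mem_filter.1 hpp).1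
    exact Finset.mem_product.2 ⟨(Finset.mem_product.1 (hPS h1)).1, (Finset.mem_product.1 (hPS h2)).2⟩
  · rintro ⟨n, l'⟩ -
    refine Nat.cast_le.2 ?_
    set U := ((P ×ˢ P).filter (fun pp => ψ pp.1 = ψ pp.2)).filter fun pp => (pp.1.1, pp.2.2) = (n, l')
    have hU : ∀ pp ∈ U, pp.1 ∈ P ∧ pp.2 ∈ P ∧ ψ pp.1 = ψ pp.2 ∧ pp.1.1 = n ∧ pp.2.2 = l' := by
      intro pp hpp
      obtain ⟨h1, h2⟩ := Finset.mem_filter.1 hpp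
      obtain ⟨h3, h4⟩ := Finset.mem_filter.1 h1
      obtain ⟨h5, h6⟩ := Finset.mem_product.1 h3
      rw [Prod.mk.injEq] at h2
      exact ⟨h5, h6, h4, h2.1, h2.2⟩
    rcases U.eq_empty_or_nonempty with hU0 | ⟨pp₀, hpp₀⟩
    · rw [hU0]; simp
    have hn : B * D ^ 3 < (n : ℕ) := by
      obtain ⟨h1, -, -, h4, -⟩ := hU pp₀ hpp₀
      rw [← h4]; exact (hP _ h1).2.1
    rw [← Finset.card_image_of_injOn
      (f := fun pp : (ℕ+ × ℕ+) × (ℕ+ × ℕ+) => (pp.1.2, pp.2.1))]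
    · refine hB n l' hn _ fun p hp => ?_
      obtain ⟨pp, hpp, rfl⟩ := Finset.mem_image.1 hp
      obtain ⟨h1, h2, h3, rfl, rfl⟩ := hU pp hpp
      exact ⟨(hP _ h1).1.symm, (hP _ h2).1, (hP _ h1).2.2, (hP _ h2).2.2, h3⟩
    · intro pp hpp pp' hpp' e
      obtain ⟨-, -, -, h4, h5⟩ := hU pp hpp
      obtain ⟨-, -, -, h4', h5'⟩ := hU pp' hpp'
      simp only [Prod.mk.injEq] at e
      ext1 <;> ext1
      · exact h4.trans h4'.symm
      · exact e.1
      · exact e.2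
      · exact h5.trans h5'.symm

/-- The trilinear estimate on the resonant set: a row-wise bound for a kernel dominated by a
function of the frequency difference and decaying off the diagonal. -/
theorem exists_sum_sq_kernel_le (h : NearQuadratic ν q κ C) {ε : ℝ} (hε : 0 < ε) :
    ∃ B : ℝ, 0 < B ∧ ∀ (D : ℕ), 0 < D → ∀ (γ : ℤ → ℝ) (Γ W : ℝ), (∀ m, 0 ≤ γ m) →
    (∀ Q : Finset ℤ, ∑ m ∈ Q, γ m ≤ Γ) → 0 ≤ W → ∀ (S L : Finset ℕ+) (a : ℕ+ → ℝ)
    (t : ℕ+ → ℕ+ → ℝ), (∀ n, 0 ≤ a n) → (∀ n l, 0 ≤ t n l) →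
    (∀ n ∈ S, ∀ l ∈ L, t n l ^ 2 ≤ W * γ (ν l - ν n)) →
    (∀ n ∈ S, ∀ l ∈ L, (((l : ℕ) : ℝ) - ((n : ℕ) : ℝ)) ^ 2 * t n l ^ 2 ≤ W * D * γ (ν l - ν n)) →
    ∑ l ∈ L, (∑ n ∈ S, a n * t n l) ^ 2 ≤ B * (D : ℝ) ^ ε * W * Γ * ∑ n ∈ S, a n ^ 2 := by
  classical
  obtain ⟨B₁, hB₁, hfar⟩ := h.exists_sum_far_le
  obtain ⟨B₀, hB₀, hquad⟩ := h.exists_card_large_le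
  obtain ⟨B₂, hB₂, hsmall⟩ := h.exists_sum_small_le hε B₀
  refine ⟨4 * (1 + B₁ + B₂ + B₀), by positivity, fun D hD γ Γ W hγ hΓ hW S L a t ha ht hWt hDt => ?_⟩
  have hΓ0 : 0 ≤ Γ := by simpa using hΓ ∅
  have hD1 : (1 : ℝ) ≤ D := by exact_mod_cast hD
  have hDε : 1 ≤ (D : ℝ) ^ ε := Real.one_le_rpow hD1 hε.le
  set Δ : ℕ+ × ℕ+ → ℤ := fun p => ((p.2 : ℕ) : ℤ) - ((p.1 : ℕ) : ℤ) with hΔ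
  -- Four regions: the diagonal, pairs at distance more than `D`, and near pairs with `n` at most or
  -- beyond `B₀ D ^ 3`. Hilbert-Schmidt bounds settle the second and third. In the last one the
  -- number of pairs with a given frequency difference is not bounded, and the quadrilinear count is
  -- used instead.
  obtain ⟨c₁, hc₁⟩ : ∃ c : ℕ+ × ℕ+ → Prop, ∀ p, c p ↔ (p.1 = p.2) :=
    ⟨_, fun _ => Iff.rfl⟩
  obtain ⟨c₂, hc₂⟩ : ∃ c : ℕ+ × ℕ+ → Prop, ∀ p, c p ↔ ((D : ℤ) < |Δ p|) :=
    ⟨_, fun _ => Iff.rfl⟩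
  obtain ⟨c₃, hc₃⟩ : ∃ c : ℕ+ × ℕ+ → Prop, ∀ p, c p ↔ (p.1 ≠ p.2 ∧ (p.1 : ℕ) ≤ B₀ * D ^ 3 ∧ |Δ p| ≤ D) :=
    ⟨_, fun _ => Iff.rfl⟩
  obtain ⟨c₄, hc₄⟩ : ∃ c : ℕ+ × ℕ+ → Prop, ∀ p, c p ↔ (p.1 ≠ p.2 ∧ B₀ * D ^ 3 < (p.1 : ℕ) ∧ |Δ p| ≤ D) :=
    ⟨_, fun _ => Iff.rfl⟩
  set A := ∑ n ∈ S, a n ^ 2 with hA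
  have hA0 : 0 ≤ A := Finset.sum_nonneg fun _ _ => sq_nonneg _
  set r : (ℕ+ × ℕ+ → Prop) → ℕ+ → ℝ := fun c l => ∑ n ∈ S, a n * (if c (n, l) then t n l else 0)
    with hr
  have hr0 : ∀ c l, 0 ≤ r c l := fun c l => Finset.sum_nonneg fun n _ => by
    have := ha n; have := ht n l
    positivity
  have hsplit : ∀ l, ∑ n ∈ S, a n * t n l ≤ r c₁ l + r c₂ l + r c₃ l + r c₄ l := by
    intro l
    simp only [hr]
    rw [← Finset.sum_add_distrib, ← Finset.sum_add_distrib, ← Finset.sum_add_distrib]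
    refine Finset.sum_le_sum fun n _ => ?_
    rw [← mul_add, ← mul_add, ← mul_add]
    refine mul_le_mul_of_nonneg_left ?_ (ha n)
    have h0 := ht n l
    have hi : ∀ c : ℕ+ × ℕ+ → Prop, 0 ≤ if c (n, l) then t n l else 0 := fun c => by
      split_ifs; exacts [h0, le_rfl]
    have i1 := hi c₁
    have i2 := hi c₂
    have i3 := hi c₃
    have i4 := hi c₄
    by_cases h1 : c₁ (n, l)
    · rw [if_pos h1] at i1 ⊢; linarith
    by_cases h2 : c₂ (n, l)
    · rw [if_pos h2] at i2 ⊢; linarith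
    by_cases h3 : (n : ℕ) ≤ B₀ * D ^ 3
    · rw [if_pos ((hc₃ (n, l)).2 ⟨mt (hc₁ _).2 h1, h3, not_lt.1 (mt (hc₂ _).2 h2)⟩)] at i3 ⊢; linarith
    · rw [if_pos ((hc₄ (n, l)).2 ⟨mt (hc₁ _).2 h1, not_le.1 h3, not_lt.1 (mt (hc₂ _).2 h2)⟩)] at i4 ⊢; linarith
  have hHS : ∀ c : ℕ+ × ℕ+ → Prop, ∑ l ∈ L, r c l ^ 2
      ≤ A * ∑ p ∈ (S ×ˢ L).filter c, t p.1 p.2 ^ 2 := by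
    intro c
    refine (sum_sq_sum_mul_le S L a fun n l => if c (n, l) then t n l else 0).trans_eq ?_
    rw [Finset.sum_filter]
    congr 1
    refine Finset.sum_congr rfl fun p _ => ?_
    split_ifs <;> simp
  have b₁ : ∑ l ∈ L, r c₁ l ^ 2 ≤ W * Γ * A := by
    have e : ∀ l ∈ L, r c₁ l ^ 2 ≤ if l ∈ S then a l ^ 2 * (W * Γ) else 0 := by
      intro l hl
      have : r c₁ l = if l ∈ S then a l * t l l else 0 := by
        simp only [hr, hc₁, mul_ite, mul_zero]
        exact Finset.sum_ite_eq' S l fun n => a n * t n l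
      rw [this]
      split_ifs with hS
      · rw [mul_pow]
        refine mul_le_mul_of_nonneg_left ((hWt l hS l hl).trans ?_) (sq_nonneg _)
        refine mul_le_mul_of_nonneg_left ?_ hW
        simpa using hΓ {ν l - ν l}
      · simp
    refine (Finset.sum_le_sum e).trans ?_
    rw [← Finset.sum_filter, ← Finset.sum_mul, mul_comm]
    refine mul_le_mul_of_nonneg_left ?_ (by positivity)
    exact Finset.sum_le_sum_of_subset_of_nonneg
      (fun l hl => (Finset.mem_filter.1 hl).2) fun _ _ _ => sq_nonneg _
  have b₂ : ∑ l ∈ L, r c₂ l ^ 2 ≤ B₁ * W * Γ * A := by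
    refine (hHS c₂).trans ?_
    have e : ∀ p ∈ (S ×ˢ L).filter c₂, t p.1 p.2 ^ 2
        ≤ W * D * (γ (ν p.2 - ν p.1) / (((p.2 : ℕ) : ℝ) - ((p.1 : ℕ) : ℝ)) ^ 2) := by
      intro p hp
      obtain ⟨h1, h2⟩ := Finset.mem_filter.1 hp
      obtain ⟨h3, h4⟩ := Finset.mem_product.1 h1
      have h5 : ((p.2 : ℕ) : ℝ) - ((p.1 : ℕ) : ℝ) ≠ 0 := by
        intro h0
        have : Δ p = 0 := by rw [hΔ]; exact_mod_cast h0
        have h2 := (hc₂ p).1 h2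
        simp only [this, abs_zero] at h2
        omega
      rw [← mul_div_assoc, le_div_iff₀ (by positivity), mul_comm]
      exact hDt _ h3 _ h4
    have := hfar D hD γ Γ hγ hΓ ((S ×ˢ L).filter c₂) fun p hp => (hc₂ p).1 (Finset.mem_filter.1 hp).2
    calc _ ≤ A * (W * D * (B₁ * Γ / D)) := by
          refine mul_le_mul_of_nonneg_left ((Finset.sum_le_sum e).trans ?_) hA0
          rw [← Finset.mul_sum]
          gcongr
      _ = _ := by field_simp
  have b₃ : ∑ l ∈ L, r c₃ l ^ 2 ≤ B₂ * (D : ℝ) ^ ε * W * Γ * A := by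
    refine (hHS c₃).trans ?_
    have e : ∀ p ∈ (S ×ˢ L).filter c₃, t p.1 p.2 ^ 2 ≤ W * γ (ν p.2 - ν p.1) := by
      intro p hp
      obtain ⟨h3, h4⟩ := Finset.mem_product.1 (Finset.mem_filter.1 hp).1
      exact hWt _ h3 _ h4
    have := hsmall D hD γ Γ hγ hΓ ((S ×ˢ L).filter c₃) fun p hp => (hc₃ p).1 (Finset.mem_filter.1 hp).2
    calc _ ≤ A * (W * (B₂ * (D : ℝ) ^ ε * Γ)) := by
          refine mul_le_mul_of_nonneg_left ((Finset.sum_le_sum e).trans ?_) hA0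
          rw [← Finset.mul_sum]
          gcongr
      _ = _ := by ring
  -- Duality: `V` is the kernel paired with `a` and with its own output `r c₄`, so the quadrilinear
  -- bound gives `V ^ 2 ≤ W Γ B₀ A V`.
  have b₄ : ∑ l ∈ L, r c₄ l ^ 2 ≤ B₀ * W * Γ * A := by
    set V := ∑ l ∈ L, r c₄ l ^ 2 with hV
    have hV0 : 0 ≤ V := Finset.sum_nonneg fun _ _ => sq_nonneg _
    have e1 : V = ∑ p ∈ (S ×ˢ L).filter c₄, a p.1 * r c₄ p.2 * t p.1 p.2 := by
      rw [Finset.sum_filter, Finset.sum_product_right, hV]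
      refine Finset.sum_congr rfl fun l _ => ?_
      rw [sq]
      conv_lhs => enter [1]; rw [hr]
      simp only
      rw [Finset.sum_mul]
      refine Finset.sum_congr rfl fun n _ => ?_
      split_ifs <;> ring
    have e2 : V ≤ √W * ∑ p ∈ (S ×ˢ L).filter c₄, √(γ (ν p.2 - ν p.1)) * (a p.1 * r c₄ p.2) := by
      rw [e1, Finset.mul_sum]
      refine Finset.sum_le_sum fun p hp => ?_
      obtain ⟨h3, h4⟩ := Finset.mem_product.1 (Finset.mem_filter.1 hp).1
      have h5 : t p.1 p.2 ≤ √W * √(γ (ν p.2 - ν p.1)) := by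
        rw [← Real.sqrt_mul hW]
        exact Real.le_sqrt_of_sq_le (hWt _ h3 _ h4)
      have h6 := mul_nonneg (ha p.1) (hr0 c₄ p.2)
      nlinarith
    have e3 := sum_quad_le (fun n l' hn P hP => hquad D n l' hn P hP) hγ hΓ
      (Finset.filter_subset c₄ (S ×ˢ L)) (fun p hp => (hc₄ p).1 (Finset.mem_filter.1 hp).2) a (r c₄)
    have e4 : V ^ 2 ≤ W * (Γ * (B₀ * (A * V))) := by
      refine (pow_le_pow_left₀ hV0 e2 2).trans ?_
      rw [mul_pow, Real.sq_sqrt hW]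
      exact mul_le_mul_of_nonneg_left e3 hW
    rcases hV0.eq_or_lt with h0 | hpos
    · rw [← h0]; positivity
    · refine le_of_mul_le_mul_right ?_ hpos
      calc V * V = V ^ 2 := (sq V).symm
        _ ≤ _ := e4
        _ = _ := by ring
  have hsum : ∑ l ∈ L, (∑ n ∈ S, a n * t n l) ^ 2
      ≤ 4 * (∑ l ∈ L, r c₁ l ^ 2 + ∑ l ∈ L, r c₂ l ^ 2 + ∑ l ∈ L, r c₃ l ^ 2
        + ∑ l ∈ L, r c₄ l ^ 2) := by
    rw [← Finset.sum_add_distrib, ← Finset.sum_add_distrib, ← Finset.sum_add_distrib,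
      Finset.mul_sum]
    refine Finset.sum_le_sum fun l _ => ?_
    have h0 : 0 ≤ ∑ n ∈ S, a n * t n l := Finset.sum_nonneg fun n _ => mul_nonneg (ha n) (ht n l)
    refine (pow_le_pow_left₀ h0 (hsplit l) 2).trans ?_
    generalize r c₁ l = x₁
    generalize r c₂ l = x₂
    generalize r c₃ l = x₃
    generalize r c₄ l = x₄
    nlinarith [sq_nonneg (x₁ - x₂), sq_nonneg (x₁ - x₃), sq_nonneg (x₁ - x₄), sq_nonneg (x₂ - x₃),
      sq_nonneg (x₂ - x₄), sq_nonneg (x₃ - x₄)]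
  refine hsum.trans ?_
  have hX : 0 ≤ W * Γ * A := by positivity
  have hY : W * Γ * A ≤ (D : ℝ) ^ ε * (W * Γ * A) := le_mul_of_one_le_left hX hDε
  have hB0 : (0 : ℝ) ≤ B₀ := by positivity
  calc _ ≤ 4 * (W * Γ * A + B₁ * W * Γ * A + B₂ * (D : ℝ) ^ ε * W * Γ * A + B₀ * W * Γ * A) := by
        gcongr
    _ = 4 * ((1 + B₁ + B₀) * (W * Γ * A) + B₂ * ((D : ℝ) ^ ε * (W * Γ * A))) := by ring
    _ ≤ 4 * ((1 + B₁ + B₀) * ((D : ℝ) ^ ε * (W * Γ * A)) + B₂ * ((D : ℝ) ^ ε * (W * Γ * A))) := by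
        gcongr
    _ = _ := by ring

end NearQuadratic

/-! ### Multiplication by an eigenfunction on `L²(B)` -/

lemma inner_eq_integral_of_ae_eq {f g : L2Ball} {u v : ℝ → ℝ}
    (hf : (f : Plane → ℂ) =ᵐ[ballMeasure] fun x => ((u ‖x‖ : ℝ) : ℂ))
    (hg : (g : Plane → ℂ) =ᵐ[ballMeasure] fun x => ((v ‖x‖ : ℝ) : ℂ)) :
    inner ℂ f g = ((2 * Real.pi * ∫ r in (0 : ℝ)..1, r * u r * v r : ℝ) : ℂ) := by
  rw [MeasureTheory.L2.inner_def]
  have h1 : ∫ x, inner ℂ (f x) (g x) ∂ballMeasure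
      = ∫ x, (((u ‖x‖ * v ‖x‖ : ℝ)) : ℂ) ∂ballMeasure := by
    refine integral_congr_ae ?_
    filter_upwards [hf, hg] with x hx hy
    rw [hx, hy]
    simp [mul_comm]
  rw [h1]
  refine (integral_ofReal (𝕜 := ℂ) (f := fun x : Plane => u ‖x‖ * v ‖x‖)).trans ?_
  refine congrArg _ ?_
  have := integral_ball_radial (fun r => u r * v r)
  rw [ballMeasure, this, smul_eq_mul]
  congr 1
  refine intervalIntegral.integral_congr fun r _ => ?_
  simp only [smul_eq_mul]; ring

lemma orthonormal_e : Orthonormal ℂ e := by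
  rw [orthonormal_iff_ite]
  intro k l
  rw [inner_eq_integral_of_ae_eq (e_ae_eq k) (e_ae_eq l), profile_orthonormal]
  split_ifs <;> simp

lemma ae_norm_profile_mul_le (k : ℕ+) (f : L2Ball) :
    ∀ᵐ x ∂ballMeasure, ‖((profile k ‖x‖ : ℝ) : ℂ) * f x‖ ≤ √(z k) * ‖f x‖ :=
  Eventually.of_forall fun x => by
    rw [norm_mul, Complex.norm_real, Real.norm_eq_abs]
    have := abs_profile_le (n := k) (norm_nonneg x)
    gcongr

lemma aestronglyMeasurable_profile_mul (k : ℕ+) (f : L2Ball) :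
    AEStronglyMeasurable (fun x => ((profile k ‖x‖ : ℝ) : ℂ) * f x) ballMeasure := by
  have : Continuous fun x : Plane => ((profile k ‖x‖ : ℝ) : ℂ) :=
    Complex.continuous_ofReal.comp ((continuous_profile k).comp continuous_norm)
  exact this.aestronglyMeasurable.mul (Lp.aestronglyMeasurable f)

lemma memLp_profile_mul (k : ℕ+) (f : L2Ball) :
    MemLp (fun x => ((profile k ‖x‖ : ℝ) : ℂ) * f x) 2 ballMeasure :=
  (Lp.memLp f).of_le_mul (aestronglyMeasurable_profile_mul k f) (ae_norm_profile_mul_le k f)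

/-- Multiplication by the eigenfunction `e k` as an operator on `L²(B)`. -/
def mulE (k : ℕ+) : L2Ball →L[ℂ] L2Ball :=
  LinearMap.mkContinuous
    { toFun := fun f => (memLp_profile_mul k f).toLp
      map_add' := fun f g => by
        rw [← MemLp.toLp_add]
        refine MemLp.toLp_congr _ _ ?_
        filter_upwards [Lp.coeFn_add f g] with x hx
        simp only [hx, Pi.add_apply]; ring
      map_smul' := fun c f => by
        rw [RingHom.id_apply, ← MemLp.toLp_const_smul]
        refine MemLp.toLp_congr _ _ ?_
        filter_upwards [Lp.coeFn_smul c f] with x hx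
        simp only [hx, Pi.smul_apply, smul_eq_mul]; ring }
    √(z k) fun f => by
      refine Lp.norm_le_mul_norm_of_ae_le_mul ?_
      filter_upwards [MemLp.coeFn_toLp (memLp_profile_mul k f), ae_norm_profile_mul_le k f] with x h1 h2
      simpa [h1] using h2

lemma mulE_ae_eq (k : ℕ+) (f : L2Ball) :
    (mulE k f : Plane → ℂ) =ᵐ[ballMeasure] fun x => ((profile k ‖x‖ : ℝ) : ℂ) * f x :=
  MemLp.coeFn_toLp (memLp_profile_mul k f)

lemma norm_mulE_le (k : ℕ+) (f : L2Ball) : ‖mulE k f‖ ≤ √(z k) * ‖f‖ := by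
  refine Lp.norm_le_mul_norm_of_ae_le_mul ?_
  filter_upwards [mulE_ae_eq k f, ae_norm_profile_mul_le k f] with x h1 h2
  rwa [h1]

lemma inner_e_mulE (n k l : ℕ+) : inner ℂ (e l) (mulE k (e n)) = (triple n k l : ℂ) := by
  have h : (mulE k (e n) : Plane → ℂ)
      =ᵐ[ballMeasure] fun x => (((fun r => profile k r * profile n r) ‖x‖ : ℝ) : ℂ) := by
    filter_upwards [mulE_ae_eq k (e n), e_ae_eq n] with x h1 h2
    rw [h1, h2]; push_cast; rfl
  rw [inner_eq_integral_of_ae_eq (v := fun r => profile k r * profile n r) (e_ae_eq l) h, triple]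
  refine congrArg (fun y : ℝ => ((2 * Real.pi * y : ℝ) : ℂ))
    (intervalIntegral.integral_congr fun r _ => ?_)
  ring

/-- Bessel's inequality: the triple products are matrix entries of multiplication by `e_k`, whose
norm is at most the supremum bound `√(z k)`. -/
lemma sum_norm_sq_sum_triple_le (k : ℕ+) (S L : Finset ℕ+) (x : ℕ+ → ℂ) :
    ∑ l ∈ L, ‖∑ n ∈ S, x n * (triple n k l : ℂ)‖ ^ 2 ≤ z k * ∑ n ∈ S, ‖x n‖ ^ 2 := by
  set v : L2Ball := ∑ n ∈ S, x n • e n with hv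
  have h1 : ∀ l, inner ℂ (e l) (mulE k v) = ∑ n ∈ S, x n * (triple n k l : ℂ) := fun l => by
    rw [hv, map_sum, inner_sum]
    refine Finset.sum_congr rfl fun n _ => ?_
    rw [map_smul, inner_smul_right, inner_e_mulE]
  simp_rw [← h1]
  refine (orthonormal_e.sum_inner_products_le _).trans ?_
  have h2 : ‖v‖ ^ 2 = ∑ n ∈ S, ‖x n‖ ^ 2 := by
    have := orthonormal_e.inner_sum x x S
    rw [← hv, inner_self_eq_norm_sq_to_K] at this
    have h3 : ((‖v‖ ^ 2 : ℝ) : ℂ) = ((∑ n ∈ S, ‖x n‖ ^ 2 : ℝ) : ℂ) := by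
      push_cast
      refine (by simpa using this : ((‖v‖ : ℂ)) ^ 2 = _).trans ?_
      refine Finset.sum_congr rfl fun n _ => ?_
      rw [Complex.conj_mul']
    exact_mod_cast h3
  calc ‖mulE k v‖ ^ 2 ≤ (√(z k) * ‖v‖) ^ 2 := by
        have := norm_mulE_le k v
        gcongr
    _ = _ := by rw [mul_pow, Real.sq_sqrt (z_pos k).le, h2]

/-! ### The Hilbert kernel -/

lemma sum_range_hilbert_le (l : ℕ) (hl : 0 < l) (m : ℕ) :
    ∑ n ∈ Finset.range m, 1 / (((n + 1 : ℕ) : ℝ) + l) * (√((n + 1 : ℕ) : ℝ))⁻¹ ≤ 4 * (√(l : ℝ))⁻¹ := by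
  have hl0 : (0 : ℝ) < l := by exact_mod_cast hl
  have hsl : 0 < √(l : ℝ) := Real.sqrt_pos.2 hl0
  have hsl2 : √(l : ℝ) * √(l : ℝ) = l := Real.mul_self_sqrt hl0.le
  -- The stronger claim that makes the induction run: up to `l` the sum is compared with the
  -- integral of `x ^ (-1/2) / l`, beyond `l` with that of `x ^ (-3/2)`. The two expressions agree
  -- at `m = l`.
  have key : ∑ n ∈ Finset.range m, 1 / (((n + 1 : ℕ) : ℝ) + l) * (√((n + 1 : ℕ) : ℝ))⁻¹
      ≤ if m ≤ l then 2 * √(m : ℝ) / l else 4 * (√(l : ℝ))⁻¹ - 2 * (√(m : ℝ))⁻¹ := by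
    induction m with
    | zero => simp
    | succ m ih =>
      rw [Finset.sum_range_succ]
      have hm1 : (0 : ℝ) < ((m + 1 : ℕ) : ℝ) := by positivity
      set y := √((m + 1 : ℕ) : ℝ) with hy
      set x := √(m : ℝ) with hx
      have hy0 : 0 < y := Real.sqrt_pos.2 hm1
      have hx0 : 0 ≤ x := Real.sqrt_nonneg _
      have hyy : y * y = m + 1 := by rw [hy, Real.mul_self_sqrt hm1.le]; push_cast; ring
      have hxx : x * x = m := Real.mul_self_sqrt (Nat.cast_nonneg m)
      have hxy : x ≤ y := Real.sqrt_le_sqrt (by push_cast; linarith)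
      have e1 : ((m + 1 : ℕ) : ℝ) = y * y := by rw [hyy]; push_cast; ring
      rw [e1]
      have hstep1 : y⁻¹ ≤ 2 * (y - x) := by
        rw [inv_le_iff_one_le_mul₀ hy0]; nlinarith
      by_cases h1 : m + 1 ≤ l
      · rw [if_pos h1]
        rw [if_pos (by omega)] at ih
        have h2 : 1 / (y * y + l) * y⁻¹ ≤ 1 / l * (2 * (y - x)) := by
          have : 1 / (y * y + l) ≤ 1 / (l : ℝ) := by
            apply one_div_le_one_div_of_le hl0; nlinarith
          gcongr
        calc _ ≤ 2 * x / l + 1 / l * (2 * (y - x)) := add_le_add ih h2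
          _ = _ := by ring
      · rw [if_neg h1]
        have hm : l ≤ m := by omega
        have hm0 : (0 : ℝ) < m := hl0.trans_le (by exact_mod_cast hm)
        have hxp : 0 < x := Real.sqrt_pos.2 hm0
        have h2 : 1 / (y * y + l) * y⁻¹ ≤ 2 * (x⁻¹ - y⁻¹) := by
          have h3 : 1 / (y * y + l) ≤ 1 / (y * y) :=
            one_div_le_one_div_of_le (by positivity) (by linarith)
          calc _ ≤ 1 / (y * y) * y⁻¹ := by gcongr
            _ ≤ 1 / (x * y) * (2 * (y - x)) := by gcongr
            _ = _ := by field_simp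
        by_cases h4 : m ≤ l
        · have hml : m = l := by omega
          rw [if_pos h4] at ih
          have h5 : 2 * x / l = 2 * x⁻¹ := by
            have e2 : (l : ℝ) = x * x := by rw [hxx, hml]
            rw [e2]; field_simp
          have h6 : (√(l : ℝ))⁻¹ = x⁻¹ := by rw [hx, hml]
          rw [h6]
          linarith
        · rw [if_neg h4] at ih
          linarith
  refine key.trans ?_
  split_ifs with h
  · have h1 : √(m : ℝ) ≤ √(l : ℝ) := Real.sqrt_le_sqrt (by exact_mod_cast h)
    rw [div_le_iff₀ hl0]
    have : 4 * (√(l : ℝ))⁻¹ * l = 4 * √(l : ℝ) := by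
      rw [mul_assoc, inv_mul_eq_div, Real.div_sqrt]
    linarith
  · have : 0 ≤ (√(m : ℝ))⁻¹ := by positivity
    linarith

lemma sum_hilbert_le (l : ℕ+) (S : Finset ℕ+) :
    ∑ n ∈ S, 1 / (((n : ℕ) : ℝ) + ((l : ℕ) : ℝ)) * (√((n : ℕ) : ℝ))⁻¹ ≤ 4 * (√((l : ℕ) : ℝ))⁻¹ := by
  obtain ⟨m, hm⟩ := (S.image fun n : ℕ+ => n.natPred).bddAbove
  refine le_trans ?_ (sum_range_hilbert_le l l.pos (m + 1))
  have e : ∀ n ∈ S, 1 / (((n : ℕ) : ℝ) + ((l : ℕ) : ℝ)) * (√((n : ℕ) : ℝ))⁻¹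
      = (fun i : ℕ => 1 / (((i + 1 : ℕ) : ℝ) + ((l : ℕ) : ℝ)) * (√((i + 1 : ℕ) : ℝ))⁻¹) n.natPred :=
    fun n _ => by simp only [PNat.natPred_add_one]
  rw [Finset.sum_congr rfl e, ← Finset.sum_image (s := S) (g := fun n : ℕ+ => n.natPred)
    (f := fun i : ℕ => 1 / (((i + 1 : ℕ) : ℝ) + ((l : ℕ) : ℝ)) * (√((i + 1 : ℕ) : ℝ))⁻¹)
    (fun a _ b _ hab => PNat.natPred_injective hab)]
  refine Finset.sum_le_sum_of_subset_of_nonneg (fun i hi => ?_) fun _ _ _ => by positivity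
  exact Finset.mem_range.2 (Nat.lt_succ_of_le (hm hi))

/-- Hilbert's inequality, by the Schur test. -/
lemma sum_sq_sum_hilbert_le (S L : Finset ℕ+) (x : ℕ+ → ℝ) :
    ∑ l ∈ L, (∑ n ∈ S, x n * (1 / (((n : ℕ) : ℝ) + ((l : ℕ) : ℝ)))) ^ 2 ≤ 16 * ∑ n ∈ S, x n ^ 2 := by
  set w : ℕ+ → ℝ := fun n => √((n : ℕ) : ℝ) with hw
  have hw0 : ∀ n, 0 < w n := fun n => Real.sqrt_pos.2 (by exact_mod_cast n.pos)
  set H : ℕ+ → ℕ+ → ℝ := fun n l => 1 / (((n : ℕ) : ℝ) + ((l : ℕ) : ℝ)) with hH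
  have hH0 : ∀ n l, 0 ≤ H n l := fun n l => by simp only [hH]; positivity
  have hHc : ∀ n l, H n l = H l n := fun n l => by simp only [hH, add_comm]
  have h1 : ∀ l, (∑ n ∈ S, x n * H n l) ^ 2
      ≤ 4 * (w l)⁻¹ * ∑ n ∈ S, x n ^ 2 * w n * H n l := by
    intro l
    have e : ∀ n, x n * H n l = √(H n l * (w n)⁻¹) * (x n * √(H n l * w n)) := fun n => by
      have : √(H n l * (w n)⁻¹) * √(H n l * w n) = H n l := by
        rw [← Real.sqrt_mul (mul_nonneg (hH0 n l) (inv_nonneg.2 (hw0 n).le))]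
        rw [show H n l * (w n)⁻¹ * (H n l * w n) = H n l ^ 2 * ((w n)⁻¹ * w n) by ring,
          inv_mul_cancel₀ (hw0 n).ne', mul_one, Real.sqrt_sq (hH0 n l)]
      calc x n * H n l = x n * (√(H n l * (w n)⁻¹) * √(H n l * w n)) := by rw [this]
        _ = _ := by ring
    simp_rw [e]
    refine (Finset.sum_mul_sq_le_sq_mul_sq _ _ _).trans ?_
    have e1 : ∀ n, √(H n l * (w n)⁻¹) ^ 2 = H n l * (w n)⁻¹ := fun n =>
      Real.sq_sqrt (mul_nonneg (hH0 n l) (inv_nonneg.2 (hw0 n).le))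
    have e2 : ∀ n, (x n * √(H n l * w n)) ^ 2 = x n ^ 2 * w n * H n l := fun n => by
      rw [mul_pow, Real.sq_sqrt (mul_nonneg (hH0 n l) (hw0 n).le)]; ring
    simp_rw [e1, e2]
    refine mul_le_mul_of_nonneg_right (sum_hilbert_le l S) (Finset.sum_nonneg fun n _ => ?_)
    have := (hw0 n).le
    have := hH0 n l
    positivity
  calc _ ≤ ∑ l ∈ L, 4 * (w l)⁻¹ * ∑ n ∈ S, x n ^ 2 * w n * H n l := Finset.sum_le_sum fun l _ => h1 l
    _ = ∑ n ∈ S, 4 * (x n ^ 2 * w n) * ∑ l ∈ L, H l n * (w l)⁻¹ := by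
        simp_rw [Finset.mul_sum]
        rw [Finset.sum_comm]
        refine Finset.sum_congr rfl fun n _ => Finset.sum_congr rfl fun l _ => ?_
        rw [hHc n l]; ring
    _ ≤ ∑ n ∈ S, 4 * (x n ^ 2 * w n) * (4 * (w n)⁻¹) := by
        refine Finset.sum_le_sum fun n _ => ?_
        have h2 := sum_hilbert_le n L
        have := (hw0 n).le
        exact mul_le_mul_of_nonneg_left h2 (by positivity)
    _ = _ := by
        rw [Finset.mul_sum]
        refine Finset.sum_congr rfl fun n _ => ?_
        have := (hw0 n).ne'
        field_simp; ring

/-! ### The bilinear estimate for coefficients -/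

lemma exists_sum_bracket_rpow_neg_le {β : ℝ} (hβ : 1 < β) : ∃ B : ℝ, 0 < B ∧ ∀ J : Finset ℤ,
    ∑ j ∈ J, bracket (j : ℝ) ^ (-β) ≤ B := by
  have hs := Real.summable_abs_int_rpow hβ
  have h0 : 0 ≤ ∑' j : ℤ, |(j : ℝ)| ^ (-β) := tsum_nonneg fun j => by positivity
  refine ⟨1 + ∑' j : ℤ, |(j : ℝ)| ^ (-β), by positivity, fun J => ?_⟩
  have hle : ∀ j : ℤ, bracket (j : ℝ) ^ (-β) ≤ (if j = 0 then 1 else 0) + |(j : ℝ)| ^ (-β) := by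
    intro j
    split_ifs with hj
    · subst hj
      have : bracket ((0 : ℤ) : ℝ) = 1 := by simp [bracket]
      rw [this, Real.one_rpow]
      have : 0 ≤ |((0 : ℤ) : ℝ)| ^ (-β) := by positivity
      linarith
    · rw [zero_add]
      exact Real.rpow_le_rpow_of_nonpos (by positivity) (le_bracket _) (by linarith)
  calc _ ≤ ∑ j ∈ J, ((if j = 0 then (1 : ℝ) else 0) + |(j : ℝ)| ^ (-β)) :=
        Finset.sum_le_sum fun j _ => hle j
    _ = (∑ j ∈ J, if j = 0 then (1 : ℝ) else 0) + ∑ j ∈ J, |(j : ℝ)| ^ (-β) :=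
        Finset.sum_add_distrib
    _ ≤ _ := by
        refine add_le_add ?_ (hs.sum_le_tsum J fun j _ => by positivity)
        rw [Finset.sum_ite_eq' J 0 fun _ => (1 : ℝ)]
        split_ifs <;> norm_num

/-- Bernoulli's inequality for the exponent `p ≤ 1` makes the right side grow at least by the added
term. -/
lemma sum_range_rpow_sub_one_le {p : ℝ} (hp0 : 0 < p) (hp1 : p ≤ 1) (R : ℕ) :
    ∑ m ∈ Finset.range R, ((m + 1 : ℕ) : ℝ) ^ (p - 1) ≤ (R : ℝ) ^ p / p := by
  induction R with
  | zero => simp [Real.zero_rpow hp0.ne']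
  | succ R ih =>
    rw [Finset.sum_range_succ]
    have hR : (0 : ℝ) < ((R + 1 : ℕ) : ℝ) := by positivity
    have h1 := rpow_one_add_le_one_add_mul_self (s := -(((R + 1 : ℕ) : ℝ))⁻¹) (p := p)
      (by rw [neg_le_neg_iff]; exact inv_le_one_of_one_le₀ (by push_cast; linarith [Nat.cast_nonneg (α := ℝ) R])) hp0.le hp1
    have h2 : (R : ℝ) ^ p ≤ ((R + 1 : ℕ) : ℝ) ^ p * (1 + p * -(((R + 1 : ℕ) : ℝ))⁻¹) := by
      refine le_trans (le_of_eq ?_) (mul_le_mul_of_nonneg_left h1 (by positivity))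
      rw [← Real.mul_rpow hR.le ?_]
      · congr 1
        rw [mul_add, mul_neg, mul_inv_cancel₀ hR.ne']; push_cast; ring
      · have : (((R + 1 : ℕ) : ℝ))⁻¹ ≤ 1 :=
          inv_le_one_of_one_le₀ (by push_cast; linarith [Nat.cast_nonneg (α := ℝ) R])
        linarith
    have h3 : ((R + 1 : ℕ) : ℝ) ^ (p - 1) = ((R + 1 : ℕ) : ℝ) ^ p * (((R + 1 : ℕ) : ℝ))⁻¹ := by
      rw [Real.rpow_sub hR, Real.rpow_one, div_eq_mul_inv]
    rw [le_div_iff₀ hp0] at ih ⊢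
    rw [add_mul, h3]
    linarith

lemma exists_sum_bracket_rpow_le {p : ℝ} (hp0 : 0 < p) (hp1 : p ≤ 1) : ∃ B : ℝ, 0 < B ∧
    ∀ (R : ℕ), 0 < R → ∀ J : Finset ℤ, (∀ j ∈ J, |j| ≤ R) →
      ∑ j ∈ J, bracket (j : ℝ) ^ (p - 1) ≤ B * (R : ℝ) ^ p := by
  classical
  refine ⟨2 * (1 + 1 / p), by positivity, fun R hR J hJ => ?_⟩
  have hR1 : (1 : ℝ) ≤ (R : ℝ) ^ p := Real.one_le_rpow (by exact_mod_cast hR) hp0.le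
  have e : ∀ j : ℤ, bracket (j : ℝ) ^ (p - 1) = (fun m : ℕ => bracket (m : ℝ) ^ (p - 1)) j.natAbs := by
    intro j
    simp only [bracket, Nat.cast_natAbs, Int.cast_abs, sq_abs]
  simp_rw [e]
  have hpos : ∀ m : ℕ, 0 ≤ bracket (m : ℝ) ^ (p - 1) := fun m =>
    Real.rpow_nonneg (bracket_pos _).le _
  refine (sum_comp_le_of_fiber (s := J) (t := Finset.range (R + 1)) (ψ := Int.natAbs)
    (F := fun m : ℕ => bracket (m : ℝ) ^ (p - 1)) (C := 2) (fun j hj => ?_) hpos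
    (fun m _ => ?_)).trans ?_
  · have := hJ j hj
    rw [Int.abs_eq_natAbs] at this
    rw [Finset.mem_range]; omega
  · have : (J.filter fun d => d.natAbs = m) ⊆ {(m : ℤ), -(m : ℤ)} := by
      intro d hd
      have := (Finset.mem_filter.1 hd).2
      rw [Finset.mem_insert, Finset.mem_singleton]; omega
    exact_mod_cast (Finset.card_le_card this).trans Finset.card_le_two
  · have h1 : ∑ m ∈ Finset.range (R + 1), bracket (m : ℝ) ^ (p - 1) ≤ 1 + (R : ℝ) ^ p / p := by
      rw [Finset.sum_range_succ', add_comm]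
      refine add_le_add ?_ ((Finset.sum_le_sum fun m _ => ?_).trans
        (sum_range_rpow_sub_one_le hp0 hp1 R))
      · simp [bracket]
      · refine Real.rpow_le_rpow_of_nonpos (by positivity) ?_ (by linarith)
        exact (le_abs_self _).trans (le_bracket _)
    calc _ ≤ 2 * (1 + (R : ℝ) ^ p / p) := by gcongr
      _ ≤ 2 * ((R : ℝ) ^ p + (R : ℝ) ^ p / p) := by gcongr
      _ = _ := by ring

section
variable {s : ℝ}

/-- The weighted triple products form a bounded kernel. -/
lemma exists_sum_norm_sq_weight_triple_le (hs0 : 0 ≤ s) (hs1 : s ≤ 1) : ∃ B : ℝ, 0 < B ∧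
    ∀ (k : ℕ+) (S L : Finset ℕ+), (∀ n ∈ S, k ≤ n) → ∀ x : ℕ+ → ℂ,
    ∑ l ∈ L, ‖∑ n ∈ S, x n * ((weight s n l * triple n k l : ℝ) : ℂ)‖ ^ 2
      ≤ B * ((k : ℕ) : ℝ) ^ 4 * ∑ n ∈ S, ‖x n‖ ^ 2 := by
  obtain ⟨C, hC, hdec⟩ := exists_weight_triple_decay hs0 hs1
  obtain ⟨Cz, hCz, hz⟩ := exists_z_le
  refine ⟨2 * Cz + 32 * C ^ 2, by positivity, fun k S L hS x => ?_⟩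
  have hk : (1 : ℝ) ≤ ((k : ℕ) : ℝ) := by exact_mod_cast k.pos
  set X := ∑ n ∈ S, ‖x n‖ ^ 2 with hX
  have hX0 : 0 ≤ X := Finset.sum_nonneg fun _ _ => sq_nonneg _
  set H : ℕ+ → ℕ+ → ℝ := fun n l => 1 / (((n : ℕ) : ℝ) + ((l : ℕ) : ℝ)) with hH
  have h1 := sum_norm_sq_sum_triple_le k S L x
  have h2 := sum_sq_sum_hilbert_le S L fun n => ‖x n‖ * (C * ((k : ℕ) : ℝ) ^ 2)
  -- The kernel is split into the unweighted one, handled by the multiplication operator, and the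
  -- difference, handled by Hilbert's inequality.
  have h3 : ∀ l ∈ L, ‖∑ n ∈ S, x n * ((weight s n l * triple n k l : ℝ) : ℂ)‖ ^ 2
      ≤ 2 * ‖∑ n ∈ S, x n * (triple n k l : ℂ)‖ ^ 2
        + 2 * (∑ n ∈ S, ‖x n‖ * (C * ((k : ℕ) : ℝ) ^ 2) * H n l) ^ 2 := by
    intro l _
    have e : ∑ n ∈ S, x n * ((weight s n l * triple n k l : ℝ) : ℂ)
        = ∑ n ∈ S, x n * (triple n k l : ℂ)
          + ∑ n ∈ S, x n * ((weight s n l * triple n k l - triple n k l : ℝ) : ℂ) := by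
      rw [← Finset.sum_add_distrib]
      refine Finset.sum_congr rfl fun n _ => ?_
      push_cast; ring
    have h4 : ‖∑ n ∈ S, x n * ((weight s n l * triple n k l - triple n k l : ℝ) : ℂ)‖
        ≤ ∑ n ∈ S, ‖x n‖ * (C * ((k : ℕ) : ℝ) ^ 2) * H n l := by
      refine (norm_sum_le _ _).trans (Finset.sum_le_sum fun n hn => ?_)
      rw [norm_mul, Complex.norm_real, Real.norm_eq_abs, mul_assoc]
      refine mul_le_mul_of_nonneg_left ?_ (norm_nonneg _)
      rw [hH, mul_one_div, le_div_iff₀ (by positivity), mul_comm]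
      exact (hdec n k l (hS n hn)).2
    rw [e]
    have h5 := norm_add_le (∑ n ∈ S, x n * (triple n k l : ℂ))
      (∑ n ∈ S, x n * ((weight s n l * triple n k l - triple n k l : ℝ) : ℂ))
    have h6 := pow_le_pow_left₀ (norm_nonneg _) (h5.trans (add_le_add le_rfl h4)) 2
    refine h6.trans ?_
    nlinarith [sq_nonneg (‖∑ n ∈ S, x n * (triple n k l : ℂ)‖
      - ∑ n ∈ S, ‖x n‖ * (C * ((k : ℕ) : ℝ) ^ 2) * H n l)]
  refine (Finset.sum_le_sum h3).trans ?_
  rw [Finset.sum_add_distrib, ← Finset.mul_sum, ← Finset.mul_sum]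
  have e2 : ∑ n ∈ S, (‖x n‖ * (C * ((k : ℕ) : ℝ) ^ 2)) ^ 2 = C ^ 2 * ((k : ℕ) : ℝ) ^ 4 * X := by
    rw [hX, Finset.mul_sum]
    refine Finset.sum_congr rfl fun n _ => ?_
    ring
  rw [e2] at h2
  have h7 : z k ≤ Cz * ((k : ℕ) : ℝ) ^ 4 := (hz k).trans
    (mul_le_mul_of_nonneg_left (le_self_pow₀ hk (by norm_num)) (by positivity))
  calc _ ≤ 2 * (z k * X) + 2 * (16 * (C ^ 2 * ((k : ℕ) : ℝ) ^ 4 * X)) := by gcongr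
    _ ≤ 2 * (Cz * ((k : ℕ) : ℝ) ^ 4 * X) + 2 * (16 * (C ^ 2 * ((k : ℕ) : ℝ) ^ 4 * X)) := by gcongr
    _ = _ := by ring

/-- A bounded kernel stays bounded after modulation by a square summable sequence. -/
lemma sum_norm_sq_modulated_le {S L : Finset ℕ+} {κ : ℕ+ → ℕ+ → ℂ} {E : ℝ} (hE : 0 ≤ E)
    (hκ : ∀ x : ℕ+ → ℂ, ∑ l ∈ L, ‖∑ n ∈ S, x n * κ n l‖ ^ 2 ≤ E * ∑ n ∈ S, ‖x n‖ ^ 2)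
    {G : ℤ → ℂ} {Γ : ℝ} (hG : ∀ Q : Finset ℤ, ∑ m ∈ Q, ‖G m‖ ^ 2 ≤ Γ) (ν : ℕ+ → ℤ) (J : Finset ℤ)
    (a : ℕ+ → ℂ) :
    ∑ l ∈ L, ∑ j ∈ J, ‖∑ n ∈ S, a n * (κ n l * G (ν l + j - ν n))‖ ^ 2
      ≤ E * ((∑ n ∈ S, ‖a n‖ ^ 2) * Γ) := by
  classical
  -- For a fixed total frequency `m = ν l + j` the inner sum is the kernel applied to `a n * G (m -
  -- ν n)`. Letting `m` range over one set common to all `l` permits summing over `l` first.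
  set Q : Finset ℤ := L.biUnion fun l => J.image fun j => ν l + j with hQ
  have h1 : ∀ l ∈ L, ∑ j ∈ J, ‖∑ n ∈ S, a n * (κ n l * G (ν l + j - ν n))‖ ^ 2
      ≤ ∑ m ∈ Q, ‖∑ n ∈ S, a n * G (m - ν n) * κ n l‖ ^ 2 := by
    intro l hl
    have e : ∑ j ∈ J, ‖∑ n ∈ S, a n * (κ n l * G (ν l + j - ν n))‖ ^ 2
        = ∑ m ∈ J.image (fun j => ν l + j), ‖∑ n ∈ S, a n * G (m - ν n) * κ n l‖ ^ 2 := by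
      rw [Finset.sum_image fun i _ j _ h => add_left_cancel h]
      refine Finset.sum_congr rfl fun j _ => ?_
      congr 2
      refine Finset.sum_congr rfl fun n _ => ?_
      ring
    rw [e]
    exact Finset.sum_le_sum_of_subset_of_nonneg
      (Finset.subset_biUnion_of_mem (fun l => J.image fun j => ν l + j) hl) fun _ _ _ => sq_nonneg _
  refine (Finset.sum_le_sum h1).trans ?_
  rw [Finset.sum_comm]
  refine (Finset.sum_le_sum fun m _ => hκ fun n => a n * G (m - ν n)).trans ?_
  rw [← Finset.mul_sum, Finset.sum_comm, Finset.sum_mul]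
  refine mul_le_mul_of_nonneg_left (Finset.sum_le_sum fun n _ => ?_) hE
  simp_rw [norm_mul, mul_pow]
  rw [← Finset.mul_sum]
  refine mul_le_mul_of_nonneg_left ?_ (sq_nonneg _)
  rw [← Finset.sum_image (s := Q) (g := fun m => m - ν n) (f := fun m => ‖G m‖ ^ 2)
    fun i _ j _ h => sub_left_injective h]
  exact hG _

lemma norm_sum_sq_le_card {α : Type*} (K : Finset α) (f : α → ℂ) :
    ‖∑ k ∈ K, f k‖ ^ 2 ≤ K.card * ∑ k ∈ K, ‖f k‖ ^ 2 := by
  calc ‖∑ k ∈ K, f k‖ ^ 2 ≤ (∑ k ∈ K, ‖f k‖) ^ 2 := by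
        gcongr; exact norm_sum_le _ _
    _ ≤ _ := sq_sum_le_card_mul_sum_sq

/-- The estimate without the modulation weight. -/
lemma exists_sum_unweighted_le (hs0 : 0 ≤ s) (hs1 : s ≤ 1) : ∃ B : ℝ, 0 < B ∧
    ∀ (M : ℕ+) (K S L : Finset ℕ+) (J : Finset ℤ), K ⊆ Finset.Iic M → (∀ n ∈ S, ∀ k ∈ K, k ≤ n) →
    ∀ (a : ℕ+ → ℂ) (G : ℕ+ → ℤ → ℂ) (Γ : ℕ+ → ℝ),
    (∀ k ∈ K, ∀ Q : Finset ℤ, ∑ m ∈ Q, ‖G k m‖ ^ 2 ≤ Γ k) →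
    ∑ l ∈ L, ∑ j ∈ J, ‖∑ n ∈ S, a n * ∑ k ∈ K, ((weight s n l * triple n k l : ℝ) : ℂ)
        * G k (freq l + j - freq n)‖ ^ 2
      ≤ B * ((M : ℕ) : ℝ) ^ 5 * ((∑ n ∈ S, ‖a n‖ ^ 2) * ∑ k ∈ K, Γ k) := by
  obtain ⟨B, hB, hker⟩ := exists_sum_norm_sq_weight_triple_le hs0 hs1
  refine ⟨B, hB, fun M K S L J hKM hKS a G Γ hΓ => ?_⟩
  set A := ∑ n ∈ S, ‖a n‖ ^ 2 with hA
  have hA0 : 0 ≤ A := Finset.sum_nonneg fun _ _ => sq_nonneg _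
  have hcard : (K.card : ℝ) ≤ ((M : ℕ) : ℝ) :=
    (Nat.cast_le.2 (Finset.card_le_card hKM)).trans (card_Iic_le M)
  set y : ℕ+ → ℕ+ → ℤ → ℂ := fun k l j => ∑ n ∈ S, a n * (((weight s n l * triple n k l : ℝ) : ℂ)
        * G k (freq l + j - freq n)) with hy
  have h1 : ∀ l j, ‖∑ n ∈ S, a n * ∑ k ∈ K, ((weight s n l * triple n k l : ℝ) : ℂ)
        * G k (freq l + j - freq n)‖ ^ 2 ≤ ((M : ℕ) : ℝ) * ∑ k ∈ K, ‖y k l j‖ ^ 2 := by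
    intro l j
    have e : ∑ n ∈ S, a n * ∑ k ∈ K, ((weight s n l * triple n k l : ℝ) : ℂ)
        * G k (freq l + j - freq n) = ∑ k ∈ K, y k l j := by
      simp only [hy, Finset.mul_sum]
      exact Finset.sum_comm
    rw [e]
    refine (norm_sum_sq_le_card K _).trans ?_
    gcongr
  have h2 : ∀ k ∈ K, ∑ l ∈ L, ∑ j ∈ J, ‖y k l j‖ ^ 2 ≤ B * ((M : ℕ) : ℝ) ^ 4 * (A * Γ k) := by
    intro k hk
    have hΓ0 : 0 ≤ Γ k := by simpa using hΓ k hk ∅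
    have hkM : ((k : ℕ) : ℝ) ≤ ((M : ℕ) : ℝ) := by
      exact_mod_cast PNat.coe_le_coe _ _ |>.2 (Finset.mem_Iic.1 (hKM hk))
    refine (sum_norm_sq_modulated_le (by positivity)
      (fun x => hker k S L (fun n hn => hKS n hn k hk) x) (hΓ k hk) freq J a).trans ?_
    gcongr
  calc _ ≤ ∑ l ∈ L, ∑ j ∈ J, ((M : ℕ) : ℝ) * ∑ k ∈ K, ‖y k l j‖ ^ 2 :=
        Finset.sum_le_sum fun l _ => Finset.sum_le_sum fun j _ => h1 l j
    _ = ((M : ℕ) : ℝ) * ∑ k ∈ K, ∑ l ∈ L, ∑ j ∈ J, ‖y k l j‖ ^ 2 := by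
        simp_rw [← Finset.mul_sum]
        congr 1
        rw [Finset.sum_comm (s := K)]
        exact Finset.sum_congr rfl fun l _ => Finset.sum_comm
    _ ≤ ((M : ℕ) : ℝ) * ∑ k ∈ K, B * ((M : ℕ) : ℝ) ^ 4 * (A * Γ k) := by
        gcongr with k hk; exact h2 k hk
    _ = _ := by rw [← Finset.mul_sum, ← Finset.mul_sum]; ring

end

/-! ### The resonant estimate and the splitting of the output modulation -/

section
variable {s : ℝ}

lemma one_add_log_sq_le {ε : ℝ} (hε : 0 < ε) {x : ℝ} (hx : 1 ≤ x) :
    (1 + Real.log x) ^ 2 ≤ (1 + 2 / ε) ^ 2 * x ^ ε := by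
  have h1 := Real.log_le_rpow_div (by linarith : 0 ≤ x) (half_pos hε)
  have h2 : 1 ≤ x ^ (ε / 2) := Real.one_le_rpow hx (by positivity)
  have h3 := Real.log_nonneg hx
  have h4 : 1 + Real.log x ≤ (1 + 2 / ε) * x ^ (ε / 2) := by
    calc 1 + Real.log x ≤ x ^ (ε / 2) + x ^ (ε / 2) / (ε / 2) := add_le_add h2 h1
      _ = _ := by field_simp
  calc (1 + Real.log x) ^ 2 ≤ ((1 + 2 / ε) * x ^ (ε / 2)) ^ 2 := by gcongr
    _ = (1 + 2 / ε) ^ 2 * (x ^ (ε / 2) * x ^ (ε / 2)) := by ring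
    _ = _ := by rw [← Real.rpow_add (by linarith)]; ring_nf

/-- The estimate for a single modulation. -/
lemma exists_sum_resonant_le (hs0 : 0 ≤ s) (hs1 : s ≤ 1) {μ : ℝ} (hμ : 0 < μ) : ∃ B : ℝ, 0 < B ∧
    ∀ (M : ℕ+) (K S L : Finset ℕ+), K ⊆ Finset.Iic M → (∀ n ∈ S, ∀ k ∈ K, k ≤ n) →
    (∀ n ∈ S, ((M : ℕ) : ℝ) ≤ 2 * ((n : ℕ) : ℝ)) →
    ∀ (a : ℕ+ → ℂ) (G : ℕ+ → ℤ → ℂ) (Γ : ℕ+ → ℝ),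
    (∀ k ∈ K, ∀ Q : Finset ℤ, ∑ m ∈ Q, ‖G k m‖ ^ 2 ≤ Γ k) →
    ∑ l ∈ L, ‖∑ n ∈ S, a n * ∑ k ∈ K, ((weight s n l * triple n k l : ℝ) : ℂ)
        * G k (freq l - freq n)‖ ^ 2
      ≤ B * ((M : ℕ) : ℝ) ^ μ * ((∑ n ∈ S, ‖a n‖ ^ 2) * ∑ k ∈ K, Γ k) := by
  obtain ⟨q, κ, C, hν⟩ := exists_nearQuadratic
  -- With `D = M ^ 5` the loss `D ^ (μ / 10)` is `M ^ (μ / 2)`; the other half of `μ` pays for the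
  -- logarithms.
  obtain ⟨B, hB, hmain⟩ := hν.exists_sum_sq_kernel_le (ε := μ / 10) (by positivity)
  obtain ⟨C₁, hC₁, hsq⟩ := exists_sum_weight_triple_sq_le hs0 hs1
  obtain ⟨C₂, hC₂, hdec⟩ := exists_weight_triple_decay hs0 hs1
  refine ⟨B * (C₁ * (1 + 2 / (μ / 2)) ^ 2 + C₂ ^ 2), by positivity,
    fun M K S L hKM hKS hMS a G Γ hΓ => ?_⟩
  have hM1 : (1 : ℝ) ≤ ((M : ℕ) : ℝ) := by exact_mod_cast M.pos
  set W : ℝ := C₁ * (1 + Real.log M) ^ 2 + C₂ ^ 2 with hW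
  have hW0 : 0 ≤ W := by positivity
  have hWle : W ≤ (C₁ * (1 + 2 / (μ / 2)) ^ 2 + C₂ ^ 2) * ((M : ℕ) : ℝ) ^ (μ / 2) := by
    have h1 := one_add_log_sq_le (half_pos hμ) hM1
    have h2 : 1 ≤ ((M : ℕ) : ℝ) ^ (μ / 2) := Real.one_le_rpow hM1 (by positivity)
    rw [hW, add_mul, mul_assoc]
    exact add_le_add (by gcongr) (le_mul_of_one_le_right (by positivity) h2)
  have hcard : (K.card : ℝ) ≤ ((M : ℕ) : ℝ) :=
    (Nat.cast_le.2 (Finset.card_le_card hKM)).trans (card_Iic_le M)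
  have hΓ0 : ∀ k ∈ K, 0 ≤ Γ k := fun k hk => by simpa using hΓ k hk ∅
  set γ : ℤ → ℝ := fun m => ∑ k ∈ K, ‖G k m‖ ^ 2 with hγ
  have hγ0 : ∀ m, 0 ≤ γ m := fun m => Finset.sum_nonneg fun _ _ => sq_nonneg _
  have hγΓ : ∀ Q : Finset ℤ, ∑ m ∈ Q, γ m ≤ ∑ k ∈ K, Γ k := fun Q => by
    simp only [hγ]
    rw [Finset.sum_comm]
    exact Finset.sum_le_sum fun k hk => hΓ k hk Q
  set T : ℕ+ → ℕ+ → ℂ := fun n l => ∑ k ∈ K, ((weight s n l * triple n k l : ℝ) : ℂ)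
        * G k (freq l - freq n) with hT
  have hTle : ∀ n l, ‖T n l‖ ^ 2
      ≤ (∑ k ∈ K, (weight s n l * triple n k l) ^ 2) * γ (freq l - freq n) := by
    intro n l
    have h1 : ‖T n l‖ ≤ ∑ k ∈ K, |weight s n l * triple n k l| * ‖G k (freq l - freq n)‖ := by
      refine (norm_sum_le _ _).trans_eq (Finset.sum_congr rfl fun k _ => ?_)
      rw [norm_mul, Complex.norm_real, Real.norm_eq_abs]
    refine (pow_le_pow_left₀ (norm_nonneg _) h1 2).trans
      ((Finset.sum_mul_sq_le_sq_mul_sq _ _ _).trans_eq ?_)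
    simp_rw [sq_abs]
    rfl
  have hMD : (((M : ℕ) ^ 5 : ℕ) : ℝ) = ((M : ℕ) : ℝ) ^ 5 := by push_cast; rfl
  -- The choice `D = M ^ 5`: the squared decay bound is a multiple of `M ^ 4` for each of at most
  -- `M` low indices.
  have key := hmain ((M : ℕ) ^ 5) (pow_pos M.pos 5) γ (∑ k ∈ K, Γ k) W hγ0 hγΓ hW0 S L
    (fun n => ‖a n‖) (fun n l => ‖T n l‖) (fun _ => norm_nonneg _) (fun _ _ => norm_nonneg _)
    (fun n hn l hl => (hTle n l).trans (mul_le_mul_of_nonneg_right ?_ (hγ0 _)))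
    (fun n hn l hl => ?_)
  · have hA0 : 0 ≤ ∑ n ∈ S, ‖a n‖ ^ 2 := Finset.sum_nonneg fun _ _ => sq_nonneg _
    have hG0 : 0 ≤ ∑ k ∈ K, Γ k := Finset.sum_nonneg hΓ0
    have hMε : (((M : ℕ) ^ 5 : ℕ) : ℝ) ^ (μ / 10) = ((M : ℕ) : ℝ) ^ (μ / 2) := by
      rw [hMD, ← Real.rpow_natCast, ← Real.rpow_mul (by positivity)]
      congr 1; push_cast; ring
    have hMM : ((M : ℕ) : ℝ) ^ (μ / 2) * ((M : ℕ) : ℝ) ^ (μ / 2) = ((M : ℕ) : ℝ) ^ μ := by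
      rw [← Real.rpow_add (by positivity)]; ring_nf
    calc _ ≤ ∑ l ∈ L, (∑ n ∈ S, ‖a n‖ * ‖T n l‖) ^ 2 := by
          refine Finset.sum_le_sum fun l _ => pow_le_pow_left₀ (norm_nonneg _) ?_ 2
          exact (norm_sum_le _ _).trans_eq (Finset.sum_congr rfl fun n _ => norm_mul _ _)
      _ ≤ _ := key
      _ ≤ B * ((M : ℕ) : ℝ) ^ (μ / 2) * ((C₁ * (1 + 2 / (μ / 2)) ^ 2 + C₂ ^ 2)
            * ((M : ℕ) : ℝ) ^ (μ / 2)) * (∑ k ∈ K, Γ k) * ∑ n ∈ S, ‖a n‖ ^ 2 := by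
          rw [hMε]
          gcongr
      _ = _ := by rw [← hMM]; ring
  · refine (Finset.sum_le_sum_of_subset_of_nonneg hKM fun _ _ _ => sq_nonneg _).trans
      ((hsq M n l (hMS n hn)).trans ?_)
    rw [hW]; linarith [sq_nonneg C₂]
  · have h1 : (((l : ℕ) : ℝ) - ((n : ℕ) : ℝ)) ^ 2 * ∑ k ∈ K, (weight s n l * triple n k l) ^ 2
        ≤ W * (((M : ℕ) ^ 5 : ℕ) : ℝ) := by
      rw [Finset.mul_sum]
      have h2 : ∀ k ∈ K, (((l : ℕ) : ℝ) - ((n : ℕ) : ℝ)) ^ 2 * (weight s n l * triple n k l) ^ 2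
          ≤ C₂ ^ 2 * ((M : ℕ) : ℝ) ^ 4 := by
        intro k hk
        have h3 := (hdec n k l (hKS n hn k hk)).1
        have hkM : ((k : ℕ) : ℝ) ≤ ((M : ℕ) : ℝ) := by
          exact_mod_cast PNat.coe_le_coe _ _ |>.2 (Finset.mem_Iic.1 (hKM hk))
        rw [← mul_pow, ← sq_abs, abs_mul, abs_sub_comm]
        calc _ ≤ (C₂ * ((k : ℕ) : ℝ) ^ 2) ^ 2 := pow_le_pow_left₀ (by positivity) h3 2
          _ = C₂ ^ 2 * ((k : ℕ) : ℝ) ^ 4 := by ring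
          _ ≤ _ := by gcongr
      refine (Finset.sum_le_card_nsmul _ _ _ h2).trans ?_
      rw [nsmul_eq_mul, hMD]
      calc (K.card : ℝ) * (C₂ ^ 2 * ((M : ℕ) : ℝ) ^ 4) ≤ ((M : ℕ) : ℝ) * (C₂ ^ 2 * ((M : ℕ) : ℝ) ^ 4) := by
            gcongr
        _ = C₂ ^ 2 * ((M : ℕ) : ℝ) ^ 5 := by ring
        _ ≤ _ := by
            rw [hW]
            gcongr
            linarith [mul_nonneg hC₁.le (sq_nonneg (1 + Real.log M))]
    calc _ ≤ (((l : ℕ) : ℝ) - ((n : ℕ) : ℝ)) ^ 2 * ((∑ k ∈ K, (weight s n l * triple n k l) ^ 2)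
          * γ (freq l - freq n)) := mul_le_mul_of_nonneg_left (hTle n l) (sq_nonneg _)
      _ = ((((l : ℕ) : ℝ) - ((n : ℕ) : ℝ)) ^ 2 * ∑ k ∈ K, (weight s n l * triple n k l) ^ 2)
          * γ (freq l - freq n) := by ring
      _ ≤ _ := mul_le_mul_of_nonneg_right h1 (hγ0 _)

lemma sum_shift_le {G : ℤ → ℂ} {Γ : ℝ} (hG : ∀ Q : Finset ℤ, ∑ m ∈ Q, ‖G m‖ ^ 2 ≤ Γ) (j : ℤ)
    (Q : Finset ℤ) : ∑ m ∈ Q, ‖G (m + j)‖ ^ 2 ≤ Γ := by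
  classical
  rw [← Finset.sum_image (s := Q) (g := fun m => m + j) (f := fun m => ‖G m‖ ^ 2)
    fun i _ j _ h => add_right_cancel h]
  exact hG _

/-- The weighted estimate for a block of low frequencies. -/
lemma exists_sum_block_le (hs0 : 0 ≤ s) (hs1 : s ≤ 1) {b μ : ℝ} (hb : 1 / 2 < b) (hb1 : b ≤ 1)
    (hμ : 0 < μ) : ∃ B : ℝ, 0 < B ∧
    ∀ (M : ℕ+) (K S L : Finset ℕ+) (J : Finset ℤ), K ⊆ Finset.Iic M → (∀ n ∈ S, ∀ k ∈ K, k ≤ n) →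
    (∀ n ∈ S, ((M : ℕ) : ℝ) ≤ 2 * ((n : ℕ) : ℝ)) →
    ∀ (a : ℕ+ → ℂ) (G : ℕ+ → ℤ → ℂ) (Γ : ℕ+ → ℝ),
    (∀ k ∈ K, ∀ Q : Finset ℤ, ∑ m ∈ Q, ‖G k m‖ ^ 2 ≤ Γ k) →
    ∑ l ∈ L, ∑ j ∈ J, bracket (j : ℝ) ^ (2 * b - 2) *
      ‖∑ n ∈ S, a n * ∑ k ∈ K, ((weight s n l * triple n k l : ℝ) : ℂ)
        * G k (freq l + j - freq n)‖ ^ 2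
      ≤ B * ((M : ℕ) : ℝ) ^ (5 * (2 * b - 1) + μ) * ((∑ n ∈ S, ‖a n‖ ^ 2) * ∑ k ∈ K, Γ k) := by
  classical
  obtain ⟨B₁, hB₁, hres⟩ := exists_sum_resonant_le hs0 hs1 hμ
  obtain ⟨B₂, hB₂, hunw⟩ := exists_sum_unweighted_le hs0 hs1
  obtain ⟨B₃, hB₃, hbr⟩ := exists_sum_bracket_rpow_le (p := 2 * b - 1) (by linarith) (by linarith)
  refine ⟨B₁ * B₃ + B₂, by positivity, fun M K S L J hKM hKS hMS a G Γ hΓ => ?_⟩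
  have hM1 : (1 : ℝ) ≤ ((M : ℕ) : ℝ) := by exact_mod_cast M.pos
  have hM0 : (0 : ℝ) < ((M : ℕ) : ℝ) := one_pos.trans_le hM1
  have hA0 : 0 ≤ ∑ n ∈ S, ‖a n‖ ^ 2 := Finset.sum_nonneg fun _ _ => sq_nonneg _
  have hG0 : 0 ≤ ∑ k ∈ K, Γ k := Finset.sum_nonneg fun k hk => by simpa using hΓ k hk ∅
  set X := (∑ n ∈ S, ‖a n‖ ^ 2) * ∑ k ∈ K, Γ k with hX
  have hX0 : 0 ≤ X := mul_nonneg hA0 hG0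
  set Y : ℕ+ → ℤ → ℝ := fun l j => ‖∑ n ∈ S, a n * ∑ k ∈ K,
    ((weight s n l * triple n k l : ℝ) : ℂ) * G k (freq l + j - freq n)‖ ^ 2 with hY
  have hY0 : ∀ l j, 0 ≤ Y l j := fun l j => sq_nonneg _
  have hMD : (((M : ℕ) ^ 5 : ℕ) : ℝ) = ((M : ℕ) : ℝ) ^ (5 : ℝ) := by push_cast; norm_cast
  change ∑ l ∈ L, ∑ j ∈ J, bracket (j : ℝ) ^ (2 * b - 2) * Y l j ≤ _
  -- Split at `|j| = M ^ 5`. Below, the resonant bound holds for each `j` and the weights sum to `M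
  -- ^ (5 (2 b - 1))`. Above, the weight is at most `M ^ (5 (2 b - 2))` and the unweighted bound
  -- costs `M ^ 5`: the two powers balance.
  rw [Finset.sum_comm, ← Finset.sum_filter_add_sum_filter_not J fun j => |j| ≤ (((M : ℕ) ^ 5 : ℕ) : ℤ)]
  set J₁ := J.filter fun j => |j| ≤ (((M : ℕ) ^ 5 : ℕ) : ℤ)
  set J₂ := J.filter fun j => ¬ |j| ≤ (((M : ℕ) ^ 5 : ℕ) : ℤ)
  have p₁ : ∑ j ∈ J₁, ∑ l ∈ L, bracket (j : ℝ) ^ (2 * b - 2) * Y l j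
      ≤ B₁ * B₃ * (((M : ℕ) : ℝ) ^ (5 * (2 * b - 1) + μ) * X) := by
    have h1 : ∀ j ∈ J₁, ∑ l ∈ L, bracket (j : ℝ) ^ (2 * b - 2) * Y l j
        ≤ bracket (j : ℝ) ^ (2 * b - 1 - 1) * (B₁ * ((M : ℕ) : ℝ) ^ μ * X) := by
      intro j _
      rw [← Finset.mul_sum, show 2 * b - 1 - 1 = 2 * b - 2 by ring]
      refine mul_le_mul_of_nonneg_left ?_ (Real.rpow_nonneg (bracket_pos _).le _)
      have := hres M K S L hKM hKS hMS a (fun k m => G k (m + j)) Γ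
        fun k hk Q => sum_shift_le (hΓ k hk) j Q
      refine le_trans (le_of_eq ?_) this
      simp only [hY]
      refine Finset.sum_congr rfl fun l _ => ?_
      simp only [sub_add_eq_add_sub]
    refine (Finset.sum_le_sum h1).trans ?_
    rw [← Finset.sum_mul]
    have h2 := hbr ((M : ℕ) ^ 5) (pow_pos M.pos 5) J₁ fun j hj => (Finset.mem_filter.1 hj).2
    calc _ ≤ B₃ * (((M : ℕ) ^ 5 : ℕ) : ℝ) ^ (2 * b - 1) * (B₁ * ((M : ℕ) : ℝ) ^ μ * X) := by
          gcongr
      _ = _ := by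
          rw [hMD, ← Real.rpow_mul hM0.le, Real.rpow_add hM0]; ring
  have p₂ : ∑ j ∈ J₂, ∑ l ∈ L, bracket (j : ℝ) ^ (2 * b - 2) * Y l j
      ≤ B₂ * (((M : ℕ) : ℝ) ^ (5 * (2 * b - 1) + μ) * X) := by
    have h1 : ∀ j ∈ J₂, ∑ l ∈ L, bracket (j : ℝ) ^ (2 * b - 2) * Y l j
        ≤ (((M : ℕ) ^ 5 : ℕ) : ℝ) ^ (2 * b - 2) * ∑ l ∈ L, Y l j := by
      intro j hj
      rw [← Finset.mul_sum]
      refine mul_le_mul_of_nonneg_right ?_ (Finset.sum_nonneg fun _ _ => hY0 _ _)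
      refine Real.rpow_le_rpow_of_nonpos (by positivity) ?_ (by linarith)
      refine le_trans ?_ (le_bracket _)
      have := not_le.1 (Finset.mem_filter.1 hj).2
      exact_mod_cast this.le
    refine (Finset.sum_le_sum h1).trans ?_
    rw [← Finset.mul_sum, Finset.sum_comm]
    calc _ ≤ (((M : ℕ) ^ 5 : ℕ) : ℝ) ^ (2 * b - 2) * (B₂ * ((M : ℕ) : ℝ) ^ 5 * X) := by
          gcongr
          exact hunw M K S L J₂ hKM hKS a G Γ hΓ
      _ = B₂ * (((M : ℕ) : ℝ) ^ (5 * (2 * b - 1)) * X) := by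
          rw [show ((M : ℕ) : ℝ) ^ 5 = ((M : ℕ) : ℝ) ^ (5 : ℝ) by norm_cast, hMD,
            ← Real.rpow_mul hM0.le, show 5 * (2 * b - 1) = 5 * (2 * b - 2) + 5 by ring,
            Real.rpow_add hM0]
          ring
      _ ≤ _ := by
          gcongr
          linarith
  calc _ ≤ _ := add_le_add p₁ p₂
    _ = _ := by ring

end

/-! ### Dyadic summation in the low frequency and in the modulation of the high frequency factor -/

section
variable {s : ℝ}

lemma norm_sum_sq_le_weighted {α : Type*} (K : Finset α) {w : α → ℝ} (hw : ∀ k, 0 < w k) (f : α → ℂ) :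
    ‖∑ k ∈ K, f k‖ ^ 2 ≤ (∑ k ∈ K, (w k)⁻¹) * ∑ k ∈ K, w k * ‖f k‖ ^ 2 := by
  have e : ∀ k, ‖f k‖ = √(w k)⁻¹ * (√(w k) * ‖f k‖) := fun k => by
    rw [← mul_assoc, ← Real.sqrt_mul (inv_nonneg.2 (hw k).le), inv_mul_cancel₀ (hw k).ne',
      Real.sqrt_one, one_mul]
  calc ‖∑ k ∈ K, f k‖ ^ 2 ≤ (∑ k ∈ K, ‖f k‖) ^ 2 := by gcongr; exact norm_sum_le _ _
    _ = (∑ k ∈ K, √(w k)⁻¹ * (√(w k) * ‖f k‖)) ^ 2 := by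
        rw [Finset.sum_congr rfl fun k _ => e k]
    _ ≤ _ := Finset.sum_mul_sq_le_sq_mul_sq _ _ _
    _ = _ := by
        congr 1 <;> refine Finset.sum_congr rfl fun k _ => ?_
        · exact Real.sq_sqrt (inv_nonneg.2 (hw k).le)
        · rw [mul_pow, Real.sq_sqrt (hw k).le]

lemma sum_inv_pow_le {r : ℝ} (hr : 1 < r) (U : Finset ℕ) : ∑ p ∈ U, (r ^ p)⁻¹ ≤ (1 - r⁻¹)⁻¹ := by
  have h0 : 0 ≤ r⁻¹ := by positivity
  have h1 : r⁻¹ < 1 := inv_lt_one_of_one_lt₀ hr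
  rw [← tsum_geometric_of_lt_one h0 h1]
  simp_rw [← inv_pow]
  exact (summable_geometric_of_lt_one h0 h1).sum_le_tsum U fun _ _ => by positivity

/-- The estimate for a fixed modulation of the high frequency factor. -/
lemma exists_sum_fixed_modulation_le (hs0 : 0 ≤ s) (hs1 : s ≤ 1) {b μ : ℝ} (hb : 1 / 2 < b)
    (hb1 : b ≤ 1) (hμ : 0 < μ) : ∃ B : ℝ, 0 < B ∧
    ∀ (K S L : Finset ℕ+) (J : Finset ℤ), (∀ n ∈ S, ∀ k ∈ K, k < n) →
    ∀ (a : ℕ+ → ℂ) (G : ℕ+ → ℤ → ℂ) (Γ : ℕ+ → ℝ),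
    (∀ k ∈ K, ∀ Q : Finset ℤ, ∑ m ∈ Q, ‖G k m‖ ^ 2 ≤ Γ k) →
    ∑ l ∈ L, ∑ j ∈ J, bracket (j : ℝ) ^ (2 * b - 2) *
      ‖∑ n ∈ S, a n * ∑ k ∈ K, ((weight s n l * triple n k l : ℝ) : ℂ)
        * G k (freq l + j - freq n)‖ ^ 2
      ≤ B * ((∑ n ∈ S, ‖a n‖ ^ 2) * ∑ k ∈ K, ((k : ℕ) : ℝ) ^ (10 * (2 * b - 1) + 2 * μ) * Γ k) := by
  classical
  obtain ⟨B, hB, hblock⟩ := exists_sum_block_le hs0 hs1 hb hb1 hμ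
  -- The weights `r ^ p` reduce the Cauchy-Schwarz inequality over dyadic blocks to a geometric
  -- series; their cost is at most `k ^ μ`.
  set r : ℝ := (2 : ℝ) ^ μ with hr
  have hr1 : 1 < r := Real.one_lt_rpow one_lt_two hμ
  have hr0 : 0 < r := one_pos.trans hr1
  set e := 5 * (2 * b - 1) + μ with he
  have he0 : 0 ≤ e := by rw [he]; linarith
  have hgeom : 0 < (1 - r⁻¹)⁻¹ := inv_pos.2 (sub_pos.2 (inv_lt_one_of_one_lt₀ hr1))
  refine ⟨(1 - r⁻¹)⁻¹ * (B * 2 ^ e), by positivity, fun K S L J hKS a G Γ hΓ => ?_⟩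
  have hA0 : 0 ≤ ∑ n ∈ S, ‖a n‖ ^ 2 := Finset.sum_nonneg fun _ _ => sq_nonneg _
  set A := ∑ n ∈ S, ‖a n‖ ^ 2 with hA
  have hΓ0 : ∀ k ∈ K, 0 ≤ Γ k := fun k hk => by simpa using hΓ k hk ∅
  set lg : ℕ+ → ℕ := fun k => Nat.log 2 (k : ℕ) with hlg
  set U := K.image lg with hU
  have hmaps : ∀ k ∈ K, lg k ∈ U := fun k hk => Finset.mem_image_of_mem _ hk
  set y : ℕ → ℕ+ → ℤ → ℂ := fun p l j => ∑ n ∈ S, a n * ∑ k ∈ K with lg k = p,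
    ((weight s n l * triple n k l : ℝ) : ℂ) * G k (freq l + j - freq n) with hy
  have hsum : ∀ l j, ∑ n ∈ S, a n * ∑ k ∈ K, ((weight s n l * triple n k l : ℝ) : ℂ)
        * G k (freq l + j - freq n) = ∑ p ∈ U, y p l j := by
    intro l j
    simp only [hy]
    rw [Finset.sum_comm]
    refine Finset.sum_congr rfl fun n _ => ?_
    rw [← Finset.mul_sum, Finset.sum_fiberwise_of_maps_to hmaps]
  have hp : ∀ p ∈ U, r ^ p * ∑ l ∈ L, ∑ j ∈ J, bracket (j : ℝ) ^ (2 * b - 2) * ‖y p l j‖ ^ 2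
      ≤ B * 2 ^ e * A * ∑ k ∈ K with lg k = p,
        ((k : ℕ) : ℝ) ^ (10 * (2 * b - 1) + 2 * μ) * Γ k := by
    intro p hp
    have hkp : ∀ k ∈ K.filter (fun k => lg k = p), 2 ^ p ≤ (k : ℕ) ∧ (k : ℕ) < 2 ^ (p + 1) := by
      intro k hk
      rw [← (Finset.mem_filter.1 hk).2]
      exact ⟨Nat.pow_log_le_self 2 k.pos.ne', Nat.lt_pow_succ_log_self one_lt_two _⟩
    have hM : (((2 : ℕ+) ^ (p + 1) : ℕ+) : ℕ) = 2 ^ (p + 1) := by simp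
    have h1 := hblock ((2 : ℕ+) ^ (p + 1)) (K.filter fun k => lg k = p) S L J
      (fun k hk => Finset.mem_Iic.2 (PNat.coe_le_coe _ _ |>.1 (by rw [hM]; exact (hkp k hk).2.le)))
      (fun n hn k hk => (hKS n hn k (Finset.mem_filter.1 hk).1).le) (fun n hn => ?_) a G Γ
      (fun k hk => hΓ k (Finset.mem_filter.1 hk).1)
    · refine (mul_le_mul_of_nonneg_left h1 (by positivity)).trans ?_
      rw [hM, ← hA]
      calc r ^ p * (B * ((2 ^ (p + 1) : ℕ) : ℝ) ^ e * (A * ∑ k ∈ K with lg k = p, Γ k))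
          = B * A * ∑ k ∈ K with lg k = p, r ^ p * ((2 ^ (p + 1) : ℕ) : ℝ) ^ e * Γ k := by
            rw [← Finset.mul_sum]; ring
        _ ≤ B * A * ∑ k ∈ K with lg k = p,
              2 ^ e * (((k : ℕ) : ℝ) ^ (10 * (2 * b - 1) + 2 * μ) * Γ k) := by
            refine mul_le_mul_of_nonneg_left (Finset.sum_le_sum fun k hk => ?_) (by positivity)
            obtain ⟨h2, -⟩ := hkp k hk
            have h2' : (2 : ℝ) ^ p ≤ ((k : ℕ) : ℝ) := by exact_mod_cast h2
            have hk1 : (1 : ℝ) ≤ ((k : ℕ) : ℝ) := by exact_mod_cast k.pos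
            have h3 : r ^ p ≤ ((k : ℕ) : ℝ) ^ μ := by
              rw [hr, ← Real.rpow_natCast, ← Real.rpow_mul two_pos.le, mul_comm,
                Real.rpow_mul two_pos.le, Real.rpow_natCast]
              gcongr
            have h4 : ((2 ^ (p + 1) : ℕ) : ℝ) ^ e ≤ 2 ^ e * ((k : ℕ) : ℝ) ^ e := by
              rw [← Real.mul_rpow two_pos.le (by positivity)]
              refine Real.rpow_le_rpow (by positivity) ?_ he0
              push_cast; rw [pow_succ]; linarith
            rw [← mul_assoc]
            refine mul_le_mul_of_nonneg_right ?_ (hΓ0 k (Finset.mem_filter.1 hk).1)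
            calc _ ≤ ((k : ℕ) : ℝ) ^ μ * (2 ^ e * ((k : ℕ) : ℝ) ^ e) := by gcongr
              _ = 2 ^ e * ((k : ℕ) : ℝ) ^ (μ + e) := by
                  rw [Real.rpow_add (one_pos.trans_le hk1) μ e]; ring
              -- The exponent has room here: `5 (2 b - 1) + 2 μ` would do. The larger one is the
              -- square of the weight in the final statement.
              _ ≤ _ := by
                  refine mul_le_mul_of_nonneg_left (Real.rpow_le_rpow_of_exponent_le hk1 ?_)
                    (by positivity)
                  rw [he]; linarith
        _ = _ := by rw [← Finset.mul_sum]; ring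
    -- Block `p` is nonempty, so `2 ^ p ≤ k < n` for some `k`, and `M = 2 ^ (p + 1)` is at most `2
    -- n`.
    · obtain ⟨k, hk, hkp'⟩ := Finset.mem_image.1 hp
      have h2 := (hkp k (Finset.mem_filter.2 ⟨hk, hkp'⟩)).1
      have h3 : (k : ℕ) < n := PNat.coe_lt_coe _ _ |>.2 (hKS n hn k hk)
      rw [hM]
      have : 2 ^ (p + 1) ≤ 2 * (n : ℕ) := by rw [pow_succ]; omega
      exact_mod_cast this
  calc ∑ l ∈ L, ∑ j ∈ J, bracket (j : ℝ) ^ (2 * b - 2) *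
      ‖∑ n ∈ S, a n * ∑ k ∈ K, ((weight s n l * triple n k l : ℝ) : ℂ)
        * G k (freq l + j - freq n)‖ ^ 2
      ≤ ∑ l ∈ L, ∑ j ∈ J, bracket (j : ℝ) ^ (2 * b - 2) *
        ((1 - r⁻¹)⁻¹ * ∑ p ∈ U, r ^ p * ‖y p l j‖ ^ 2) := by
        refine Finset.sum_le_sum fun l _ => Finset.sum_le_sum fun j _ =>
          mul_le_mul_of_nonneg_left ?_ (Real.rpow_nonneg (bracket_pos _).le _)
        rw [hsum]
        refine (norm_sum_sq_le_weighted U (fun p => pow_pos hr0 p) _).trans ?_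
        exact mul_le_mul_of_nonneg_right (sum_inv_pow_le hr1 U)
          (Finset.sum_nonneg fun _ _ => by positivity)
    _ = (1 - r⁻¹)⁻¹ * ∑ p ∈ U, r ^ p * ∑ l ∈ L, ∑ j ∈ J,
        bracket (j : ℝ) ^ (2 * b - 2) * ‖y p l j‖ ^ 2 := by
        simp_rw [Finset.mul_sum]
        rw [Finset.sum_comm (s := U)]
        refine Finset.sum_congr rfl fun l _ => ?_
        rw [Finset.sum_comm (s := U)]
        refine Finset.sum_congr rfl fun j _ => Finset.sum_congr rfl fun p _ => ?_
        ring
    _ ≤ (1 - r⁻¹)⁻¹ * ∑ p ∈ U, B * 2 ^ e * A * ∑ k ∈ K with lg k = p,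
        ((k : ℕ) : ℝ) ^ (10 * (2 * b - 1) + 2 * μ) * Γ k := by
        exact mul_le_mul_of_nonneg_left (Finset.sum_le_sum hp) hgeom.le
    _ = _ := by
        rw [← Finset.mul_sum, Finset.sum_fiberwise_of_maps_to hmaps]; ring

/-- The bilinear estimate for finitely many coefficients. -/
theorem exists_sum_bilinear_le (hs0 : 0 ≤ s) (hs1 : s ≤ 1) {b μ : ℝ} (hb : 1 / 2 < b)
    (hb1 : b ≤ 1) (hμ : 0 < μ) : ∃ B : ℝ, 0 < B ∧
    ∀ (K S L : Finset ℕ+) (J J' : Finset ℤ), (∀ n ∈ S, ∀ k ∈ K, k < n) →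
    ∀ (F : ℕ+ → ℤ → ℂ) (G : ℕ+ → ℤ → ℂ) (Γ : ℕ+ → ℝ),
    (∀ k ∈ K, ∀ Q : Finset ℤ, ∑ m ∈ Q, ‖G k m‖ ^ 2 ≤ Γ k) →
    ∑ l ∈ L, ∑ j' ∈ J', bracket (z l) ^ (2 * s) * bracket (j' : ℝ) ^ (2 * b - 2) *
      ‖∑ n ∈ S, ∑ j ∈ J, F n j * ∑ k ∈ K, (triple n k l : ℂ)
        * G k (freq l + j' - freq n - j)‖ ^ 2
      ≤ B * ((∑ n ∈ S, ∑ j ∈ J, bracket (z n) ^ (2 * s) * bracket (j : ℝ) ^ (2 * b) * ‖F n j‖ ^ 2)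
        * ∑ k ∈ K, ((k : ℕ) : ℝ) ^ (10 * (2 * b - 1) + 2 * μ) * Γ k) := by
  obtain ⟨B, hB, hfix⟩ := exists_sum_fixed_modulation_le hs0 hs1 hb hb1 hμ
  -- This is where `b > 1 / 2` enters: `⟨j⟩ ^ (-2 b)` is summable, so Cauchy-Schwarz reduces the sum
  -- to a fixed `j`, which merely translates `G`.
  obtain ⟨B', hB', hbr⟩ := exists_sum_bracket_rpow_neg_le (β := 2 * b) (by linarith)
  refine ⟨B' * B, by positivity, fun K S L J J' hKS F G Γ hΓ => ?_⟩
  set a : ℤ → ℕ+ → ℂ := fun j n => ((bracket (z n) ^ s : ℝ) : ℂ) * F n j with ha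
  set y : ℤ → ℕ+ → ℤ → ℂ := fun j l j' => ∑ n ∈ S, a j n * ∑ k ∈ K,
    ((weight s n l * triple n k l : ℝ) : ℂ) * G k (freq l + j' - freq n - j) with hy
  have hbs : ∀ x : ℝ, bracket x ^ (2 * s) = (bracket x ^ s) ^ 2 := fun x => by
    rw [mul_comm, Real.rpow_mul (bracket_pos x).le]; norm_cast
  have hw : ∀ n l, ((bracket (z l) ^ s : ℝ) : ℂ)
      = ((bracket (z n) ^ s : ℝ) : ℂ) * ((weight s n l : ℝ) : ℂ) := fun n l => by
    rw [weight, Real.div_rpow (bracket_pos _).le (bracket_pos _).le, ← Complex.ofReal_mul,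
      mul_div_cancel₀]
    exact (Real.rpow_pos_of_pos (bracket_pos _) s).ne'
  have hX : ∀ l j', bracket (z l) ^ (2 * s) * ‖∑ n ∈ S, ∑ j ∈ J, F n j * ∑ k ∈ K, (triple n k l : ℂ)
        * G k (freq l + j' - freq n - j)‖ ^ 2 = ‖∑ j ∈ J, y j l j'‖ ^ 2 := by
    intro l j'
    have h1 : bracket (z l) ^ s = ‖((bracket (z l) ^ s : ℝ) : ℂ)‖ := by
      rw [Complex.norm_real, Real.norm_of_nonneg (Real.rpow_nonneg (bracket_pos _).le _)]
    rw [hbs, h1, ← mul_pow, ← norm_mul]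
    congr 2
    simp only [hy, ha]
    rw [Finset.sum_comm, Finset.mul_sum]
    refine Finset.sum_congr rfl fun j _ => ?_
    rw [Finset.mul_sum]
    refine Finset.sum_congr rfl fun n _ => ?_
    rw [Finset.mul_sum, Finset.mul_sum, Finset.mul_sum]
    refine Finset.sum_congr rfl fun k _ => ?_
    rw [hw n l]; push_cast; ring
  have hfin : ∀ j, ∑ l ∈ L, ∑ j' ∈ J', bracket (j' : ℝ) ^ (2 * b - 2) * ‖y j l j'‖ ^ 2
      ≤ B * ((∑ n ∈ S, ‖a j n‖ ^ 2)
        * ∑ k ∈ K, ((k : ℕ) : ℝ) ^ (10 * (2 * b - 1) + 2 * μ) * Γ k) := fun j =>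
    hfix K S L J' hKS (a j) (fun k m => G k (m - j)) Γ fun k hk Q => by
      simpa [sub_eq_add_neg] using sum_shift_le (hΓ k hk) (-j) Q
  have hwpos : ∀ j : ℤ, 0 < bracket (j : ℝ) ^ (2 * b) := fun j => Real.rpow_pos_of_pos (bracket_pos _) _
  calc _ = ∑ l ∈ L, ∑ j' ∈ J', bracket (j' : ℝ) ^ (2 * b - 2) * ‖∑ j ∈ J, y j l j'‖ ^ 2 := by
        refine Finset.sum_congr rfl fun l _ => Finset.sum_congr rfl fun j' _ => ?_
        rw [← hX]; ring
    _ ≤ ∑ l ∈ L, ∑ j' ∈ J', bracket (j' : ℝ) ^ (2 * b - 2) *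
        (B' * ∑ j ∈ J, bracket (j : ℝ) ^ (2 * b) * ‖y j l j'‖ ^ 2) := by
        refine Finset.sum_le_sum fun l _ => Finset.sum_le_sum fun j' _ =>
          mul_le_mul_of_nonneg_left ?_ (Real.rpow_nonneg (bracket_pos _).le _)
        refine (norm_sum_sq_le_weighted J hwpos _).trans ?_
        refine mul_le_mul_of_nonneg_right ?_ (Finset.sum_nonneg fun j _ => ?_)
        · refine le_trans (le_of_eq ?_) (hbr J)
          refine Finset.sum_congr rfl fun j _ => ?_
          rw [Real.rpow_neg (bracket_pos _).le]
        · have := (hwpos j).le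
          positivity
    _ = B' * ∑ j ∈ J, bracket (j : ℝ) ^ (2 * b) * ∑ l ∈ L, ∑ j' ∈ J',
        bracket (j' : ℝ) ^ (2 * b - 2) * ‖y j l j'‖ ^ 2 := by
        simp_rw [Finset.mul_sum]
        rw [Finset.sum_comm (s := J)]
        refine Finset.sum_congr rfl fun l _ => ?_
        rw [Finset.sum_comm (s := J)]
        refine Finset.sum_congr rfl fun j _ => Finset.sum_congr rfl fun p _ => ?_
        ring
    _ ≤ B' * ∑ j ∈ J, bracket (j : ℝ) ^ (2 * b) * (B * ((∑ n ∈ S, ‖a j n‖ ^ 2)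
        * ∑ k ∈ K, ((k : ℕ) : ℝ) ^ (10 * (2 * b - 1) + 2 * μ) * Γ k)) := by
        gcongr with j _
        · exact (hwpos j).le
        · exact hfin j
    _ = _ := by
        rw [Finset.sum_comm (s := S)]
        generalize ∑ k ∈ K, ((k : ℕ) : ℝ) ^ (10 * (2 * b - 1) + 2 * μ) * Γ k = Z
        have e : ∀ j : ℤ, bracket (j : ℝ) ^ (2 * b) * (B * ((∑ n ∈ S, ‖a j n‖ ^ 2) * Z))
            = B * Z * ∑ n ∈ S, bracket (z n) ^ (2 * s) * bracket (j : ℝ) ^ (2 * b) * ‖F n j‖ ^ 2 := by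
          intro j
          have e1 : ∀ n, ‖a j n‖ ^ 2 = bracket (z n) ^ (2 * s) * ‖F n j‖ ^ 2 := fun n => by
            rw [ha, norm_mul, mul_pow, Complex.norm_real,
              Real.norm_of_nonneg (Real.rpow_nonneg (bracket_pos _).le _), hbs]
          simp_rw [e1]
          rw [Finset.sum_mul, Finset.mul_sum, Finset.mul_sum, Finset.mul_sum]
          refine Finset.sum_congr rfl fun n _ => ?_
          ring
        simp_rw [e]
        rw [← Finset.mul_sum]; ring

end

/-! ### Fourier coefficients on the time interval -/

lemma hasSum_conj_fourierCoeffOn_mul {a b : ℝ} {f g : ℝ → ℂ} (hab : a < b)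
    (hf : MemLp f 2 (volume.restrict (Set.Ioc a b))) (hg : MemLp g 2 (volume.restrict (Set.Ioc a b))) :
    HasSum (fun i => (starRingEnd ℂ) (fourierCoeffOn hab f i) * fourierCoeffOn hab g i)
      ((b - a)⁻¹ • ∫ x in a..b, (starRingEnd ℂ) (f x) * g x) := by
  have := Fact.mk (by linarith : 0 < b - a)
  rw [← add_sub_cancel a b] at hf hg
  have h1 := hf.memLp_liftIoc.haarAddCircle
  have h2 := hg.memLp_liftIoc.haarAddCircle
  have key := (fourierBasis (T := b - a)).hasSum_inner_mul_inner h1.toLp h2.toLp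
  have e1 : ∀ i, inner ℂ h1.toLp (fourierBasis (T := b - a) i)
      = (starRingEnd ℂ) (fourierCoeffOn hab f i) := fun i => by
    rw [← inner_conj_symm, ← HilbertBasis.repr_apply_apply, fourierBasis_repr,
      fourierCoeff_congr_ae h1.coeFn_toLp, fourierCoeff_liftIoc_eq]
    simp
  have e2 : ∀ i, inner ℂ (fourierBasis (T := b - a) i) h2.toLp = fourierCoeffOn hab g i := fun i => by
    rw [← HilbertBasis.repr_apply_apply, fourierBasis_repr,
      fourierCoeff_congr_ae h2.coeFn_toLp, fourierCoeff_liftIoc_eq]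
    simp
  simp_rw [e1, e2] at key
  have e3 : inner ℂ h1.toLp h2.toLp
      = (b - a)⁻¹ • ∫ x in a..(a + (b - a)), (starRingEnd ℂ) (f x) * g x := ?_
  · rwa [e3, add_sub_cancel] at key
  rw [MeasureTheory.L2.inner_def, ← AddCircle.integral_liftIoc_eq_intervalIntegral, ← AddCircle.integral_haarAddCircle]
  refine integral_congr_ae ?_
  filter_upwards [h1.coeFn_toLp, h2.coeFn_toLp] with x hx hy
  rw [hx, hy, RCLike.inner_apply, mul_comm]
  rfl

lemma timeMeasure_eq (T : ℝ) : timeMeasure T = volume.restrict (Set.Ioc 0 T) :=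
  Measure.restrict_congr_set Ico_ae_eq_Ioc

/-- The Fourier coefficients of a function on the time interval, extended by zero to a period. -/
def timeCoeff (T : ℝ) (g : ℝ → ℂ) (p : ℤ) : ℂ :=
  (2 * Real.pi : ℂ)⁻¹ * ∫ t, Complex.exp (Complex.I * p * t) * g t ∂(timeMeasure T)

lemma integral_indicator_Ioc {T : ℝ} (hT : T ≤ 2 * Real.pi) (F : ℝ → ℂ) :
    ∫ x in (0 : ℝ)..(2 * Real.pi), (Set.Ioc 0 T).indicator F x = ∫ t, F t ∂(timeMeasure T) := by
  rw [intervalIntegral.integral_of_le (by positivity), setIntegral_indicator measurableSet_Ioc,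
    timeMeasure_eq, Set.Ioc_inter_Ioc, max_self, min_eq_right hT]

lemma fourier_two_pi_coe (n : ℤ) (x : ℝ) :
    fourier n (x : AddCircle (2 * Real.pi - 0)) = Complex.exp (Complex.I * n * x) := by
  rw [fourier_coe_apply]
  congr 1
  have : (Real.pi : ℂ) ≠ 0 := by exact_mod_cast Real.pi_ne_zero
  push_cast
  field_simp
  ring

lemma fourierCoeffOn_indicator {T : ℝ} (hT : T ≤ 2 * Real.pi) (g : ℝ → ℂ) (p : ℤ) :
    fourierCoeffOn Real.two_pi_pos ((Set.Ioc 0 T).indicator g) p = timeCoeff T g (-p) := by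
  rw [fourierCoeffOn_eq_integral, timeCoeff, ← integral_indicator_Ioc hT]
  rw [Complex.real_smul]
  congr 1
  · push_cast; simp
  · refine intervalIntegral.integral_congr fun x _ => ?_
    simp only [smul_eq_mul, Set.indicator]
    rw [fourier_two_pi_coe]
    split_ifs <;> simp

lemma memLp_indicator {T : ℝ} (hT : T ≤ 2 * Real.pi) {g : ℝ → ℂ} (hg : MemLp g 2 (timeMeasure T)) :
    MemLp ((Set.Ioc 0 T).indicator g) 2 (volume.restrict (Set.Ioc 0 (2 * Real.pi))) := by
  rw [memLp_indicator_iff_restrict measurableSet_Ioc, Measure.restrict_restrict measurableSet_Ioc,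
    Set.Ioc_inter_Ioc, max_self, min_eq_left hT, ← timeMeasure_eq]
  exact hg

lemma sum_norm_sq_timeCoeff_le {T : ℝ} (hT : T ≤ 2 * Real.pi) {g : ℝ → ℂ}
    (hg : MemLp g 2 (timeMeasure T)) (Q : Finset ℤ) :
    ∑ p ∈ Q, ‖timeCoeff T g p‖ ^ 2 ≤ ∫ t, ‖g t‖ ^ 2 ∂(timeMeasure T) := by
  have h := hasSum_sq_fourierCoeffOn Real.two_pi_pos (memLp_indicator hT hg)
  have h2 : HasSum (fun p => ‖timeCoeff T g p‖ ^ 2)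
      ((2 * Real.pi - 0)⁻¹ • ∫ x in (0 : ℝ)..2 * Real.pi, ‖(Set.Ioc 0 T).indicator g x‖ ^ 2) := by
    rw [← (Equiv.neg ℤ).hasSum_iff]
    refine h.congr_fun fun p => ?_
    rw [fourierCoeffOn_indicator hT]; rfl
  refine (sum_le_hasSum Q (fun _ _ => sq_nonneg _) h2).trans ?_
  have e : ∫ x in (0 : ℝ)..2 * Real.pi, ‖(Set.Ioc 0 T).indicator g x‖ ^ 2
      = ∫ t, ‖g t‖ ^ 2 ∂(timeMeasure T) := by
    rw [intervalIntegral.integral_of_le (by positivity), timeMeasure_eq]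
    have : (fun x => ‖(Set.Ioc 0 T).indicator g x‖ ^ 2)
        = (Set.Ioc 0 T).indicator fun x => ‖g x‖ ^ 2 := by
      ext x; simp only [Set.indicator]; split_ifs <;> simp
    rw [this, setIntegral_indicator measurableSet_Ioc, Set.Ioc_inter_Ioc, max_self, min_eq_right hT]
  rw [e, smul_eq_mul]
  have h0 : 0 ≤ ∫ t, ‖g t‖ ^ 2 ∂(timeMeasure T) := integral_nonneg fun _ => sq_nonneg _
  refine mul_le_of_le_one_left h0 (inv_le_one_of_one_le₀ ?_)
  linarith [Real.pi_gt_three]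

/-- Parseval's identity against an exponential on `[0, t]`. -/
lemma hasSum_timeCoeff_mul {T : ℝ} (hT : T ≤ 2 * Real.pi) {g : ℝ → ℂ}
    (hg : MemLp g 2 (timeMeasure T)) (δ : ℝ) {t : ℝ} (ht0 : 0 ≤ t) (ht : t ≤ T) :
    HasSum (fun j : ℤ => timeCoeff T g j * ∫ τ in (0 : ℝ)..t, Complex.exp (Complex.I * (δ - j) * τ))
      (∫ τ in (0 : ℝ)..t, Complex.exp (Complex.I * δ * τ) * g τ) := by
  set x : ℝ → ℂ := fun τ => Complex.exp (-(Complex.I * δ * τ)) with hx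
  have hxc : Continuous x := by rw [hx]; fun_prop
  have hxm : MemLp x 2 (timeMeasure t) := by
    rw [timeMeasure_eq]
    have : IsFiniteMeasure (volume.restrict (Set.Ioc 0 t)) := inferInstance
    refine MemLp.of_bound hxc.aestronglyMeasurable 1 (Eventually.of_forall fun τ => ?_)
    rw [hx]
    simp only [Complex.norm_exp]
    simp
  have h := hasSum_conj_fourierCoeffOn_mul Real.two_pi_pos (memLp_indicator (ht.trans hT) hxm)
    (memLp_indicator hT hg)
  have hconj : ∀ (y : ℝ) , (starRingEnd ℂ) (Complex.exp (-(Complex.I * δ * y)))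
      = Complex.exp (Complex.I * δ * y) := fun y => by
    rw [← Complex.exp_conj]; simp
  have e1 : ∀ j : ℤ, (starRingEnd ℂ) (fourierCoeffOn Real.two_pi_pos ((Set.Ioc 0 t).indicator x) (-j))
      = (2 * Real.pi : ℂ)⁻¹ * ∫ τ in (0 : ℝ)..t, Complex.exp (Complex.I * (δ - j) * τ) := fun j => by
    rw [fourierCoeffOn_indicator (ht.trans hT), timeCoeff, map_mul, ← integral_conj,
      timeMeasure_eq, intervalIntegral.integral_of_le ht0]
    congr 1
    · simp [map_ofNat]
    · refine integral_congr_ae (Eventually.of_forall fun τ => ?_)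
      simp only [hx]
      rw [map_mul, hconj, ← Complex.exp_conj, ← Complex.exp_add]
      congr 1
      simp; ring
  have e2 : ∫ y in (0 : ℝ)..2 * Real.pi, (starRingEnd ℂ) ((Set.Ioc 0 t).indicator x y)
        * (Set.Ioc 0 T).indicator g y = ∫ τ in (0 : ℝ)..t, Complex.exp (Complex.I * δ * τ) * g τ := by
    rw [intervalIntegral.integral_of_le ht0, ← timeMeasure_eq,
      ← integral_indicator_Ioc (ht.trans hT)]
    refine intervalIntegral.integral_congr fun y _ => ?_
    simp only [Set.indicator]
    by_cases hy : y ∈ Set.Ioc 0 t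
    · rw [if_pos hy, if_pos hy, if_pos ⟨hy.1, hy.2.trans ht⟩, hx, hconj]
    · rw [if_neg hy, if_neg hy]; simp
  rw [e2, ← (Equiv.neg ℤ).hasSum_iff] at h
  have hpi : (2 * Real.pi : ℂ) ≠ 0 := by
    exact_mod_cast Real.two_pi_pos.ne'
  have h3 := h.mul_left (2 * Real.pi : ℂ)
  rw [Complex.real_smul] at h3
  push_cast at h3
  rw [sub_zero, ← mul_assoc, mul_inv_cancel₀ hpi, one_mul] at h3
  refine h3.congr_fun fun j => ?_
  simp only [Function.comp_apply, Equiv.neg_apply]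
  rw [e1, fourierCoeffOn_indicator hT, neg_neg]
  field_simp

/-! ### Expansion of smooth functions into time modes -/

lemma integral_mul_cos_eq {ψ ψ' ψ'' : ℝ → ℂ} (h1 : ∀ t, HasDerivAt ψ (ψ' t) t)
    (h2 : ∀ t, HasDerivAt ψ' (ψ'' t) t) (h3 : Continuous ψ'') {n : ℤ} (hn : n ≠ 0) :
    ∫ t in (0 : ℝ)..Real.pi, Real.cos (n * t) * ψ t
      = (1 / (n : ℂ) ^ 2) * (Real.cos (n * Real.pi) * ψ' Real.pi - ψ' 0
        - ∫ t in (0 : ℝ)..Real.pi, Real.cos (n * t) * ψ'' t) := by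
  have hn' : (n : ℂ) ≠ 0 := by exact_mod_cast hn
  have hc1 : Continuous ψ := continuous_iff_continuousAt.2 fun t => (h1 t).continuousAt
  have hcos : ∀ t : ℝ, HasDerivAt (fun t : ℝ => ((Real.cos (n * t) : ℝ) : ℂ))
      (((-(Real.sin (n * t) * n)) : ℝ) : ℂ) t := fun t => by
    have : HasDerivAt (fun t : ℝ => Real.cos (n * t)) (-(Real.sin (n * t) * n)) t := by
      have := ((hasDerivAt_id t).const_mul (n : ℝ)).cos
      simpa using this
    exact this.ofReal_comp
  have hsin : ∀ t : ℝ, HasDerivAt (fun t : ℝ => ((Real.sin (n * t) : ℝ) : ℂ))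
      (((Real.cos (n * t) * n) : ℝ) : ℂ) t := fun t => by
    have : HasDerivAt (fun t : ℝ => Real.sin (n * t)) (Real.cos (n * t) * n) t := by
      have := ((hasDerivAt_id t).const_mul (n : ℝ)).sin
      simpa using this
    exact this.ofReal_comp
  have hd : ∀ t ∈ Set.uIcc 0 Real.pi, HasDerivAt (fun t : ℝ => (1 / (n : ℂ)) * (((Real.sin (n * t) : ℝ) : ℂ) * ψ t)
      + (1 / (n : ℂ) ^ 2) * (((Real.cos (n * t) : ℝ) : ℂ) * ψ' t))
      (Real.cos (n * t) * ψ t + (1 / (n : ℂ) ^ 2) * (Real.cos (n * t) * ψ'' t)) t := fun t _ => by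
    have := (((hsin t).mul (h1 t)).const_mul (1 / (n : ℂ))).add
      (((hcos t).mul (h2 t)).const_mul (1 / (n : ℂ) ^ 2))
    refine this.congr_deriv ?_
    push_cast
    field_simp
    ring
  have hi1 : IntervalIntegrable (fun t : ℝ => (Real.cos (n * t) : ℂ) * ψ t) volume 0 Real.pi :=
    Continuous.intervalIntegrable (by fun_prop) _ _
  have hi2 : IntervalIntegrable (fun t : ℝ => (1 / (n : ℂ) ^ 2) * ((Real.cos (n * t) : ℂ) * ψ'' t))
      volume 0 Real.pi := Continuous.intervalIntegrable (by fun_prop) _ _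
  have hint := intervalIntegral.integral_eq_sub_of_hasDerivAt hd (hi1.add hi2)
  rw [intervalIntegral.integral_add hi1 hi2, intervalIntegral.integral_const_mul] at hint
  have hs : Real.sin (n * Real.pi) = 0 := Real.sin_int_mul_pi n
  rw [hs] at hint
  simp only [mul_zero, Real.sin_zero, Real.cos_zero, Complex.ofReal_zero, Complex.ofReal_one,
    zero_mul, one_mul, zero_add] at hint
  linear_combination hint

lemma norm_integral_mul_cos_le {ψ ψ' ψ'' : ℝ → ℂ} (h1 : ∀ t, HasDerivAt ψ (ψ' t) t)
    (h2 : ∀ t, HasDerivAt ψ' (ψ'' t) t) (h3 : Continuous ψ'') {Q : ℝ}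
    (hQ : ∀ t ∈ Set.Icc 0 Real.pi, ‖ψ t‖ ≤ Q ∧ ‖ψ' t‖ ≤ Q ∧ ‖ψ'' t‖ ≤ Q) (n : ℤ) :
    bracket n ^ 2 * ‖∫ t in (0 : ℝ)..Real.pi, Real.cos (n * t) * ψ t‖ ≤ 14 * Q := by
  have hpi := Real.pi_pos
  have hpi4 := Real.pi_le_four
  have hQ0 : 0 ≤ Q := (norm_nonneg _).trans (hQ 0 ⟨le_rfl, hpi.le⟩).1
  have hbd : ∀ φ : ℝ → ℂ, (∀ t ∈ Set.Icc 0 Real.pi, ‖φ t‖ ≤ Q) →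
      ‖∫ t in (0 : ℝ)..Real.pi, Real.cos (n * t) * φ t‖ ≤ 4 * Q := by
    intro φ hφ
    refine (intervalIntegral.norm_integral_le_of_norm_le_const (C := Q) fun t ht => ?_).trans ?_
    · rw [Set.uIoc_of_le hpi.le] at ht
      rw [norm_mul, Complex.norm_real]
      have h4 := hφ t ⟨ht.1.le, ht.2⟩
      have h5 : ‖Real.cos (n * t)‖ ≤ 1 := Real.abs_cos_le_one _
      calc _ ≤ 1 * Q := by gcongr
        _ = Q := one_mul Q
    · rw [sub_zero, abs_of_pos hpi]; nlinarith
  rw [bracket_sq]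
  rcases eq_or_ne n 0 with rfl | hn
  · have := hbd ψ fun t ht => (hQ t ht).1
    simp only [Int.cast_zero] at this ⊢
    linarith
  · have hn1 : (1 : ℝ) ≤ (n : ℝ) ^ 2 := by
      have := Int.one_le_abs hn
      have h5 : (1 : ℝ) ≤ |(n : ℝ)| := by exact_mod_cast this
      rw [← sq_abs]; nlinarith
    rw [integral_mul_cos_eq h1 h2 h3 hn, norm_mul]
    have h4 := hbd ψ'' fun t ht => (hQ t ht).2.2
    have h5 : ‖(Real.cos (n * Real.pi) : ℂ) * ψ' Real.pi‖ ≤ Q := by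
      rw [norm_mul, Complex.norm_real]
      have h5 : ‖Real.cos (n * Real.pi)‖ ≤ 1 := Real.abs_cos_le_one _
      have h6 := (hQ Real.pi ⟨hpi.le, le_rfl⟩).2.1
      calc _ ≤ 1 * Q := by gcongr
        _ = Q := one_mul Q
    have h6 := (hQ 0 ⟨le_rfl, hpi.le⟩).2.1
    have h7 := norm_sub_le ((Real.cos (n * Real.pi) : ℂ) * ψ' Real.pi - ψ' 0)
      (∫ t in (0 : ℝ)..Real.pi, Real.cos (n * t) * ψ'' t)
    have h8 := norm_sub_le ((Real.cos (n * Real.pi) : ℂ) * ψ' Real.pi) (ψ' 0)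
    have h9 : ‖(1 / (n : ℂ) ^ 2)‖ = 1 / (n : ℝ) ^ 2 := by
      rw [norm_div, norm_one, norm_pow, ← Complex.ofReal_intCast, Complex.norm_real,
        Real.norm_eq_abs, sq_abs]
    rw [h9]
    have h10 : (1 + (n : ℝ) ^ 2) * (1 / (n : ℝ) ^ 2) ≤ 2 := by
      rw [mul_one_div, div_le_iff₀ (by positivity)]; linarith
    calc _ = (1 + (n : ℝ) ^ 2) * (1 / (n : ℝ) ^ 2) * ‖(Real.cos (n * Real.pi) : ℂ) * ψ' Real.pi - ψ' 0
          - ∫ t in (0 : ℝ)..Real.pi, Real.cos (n * t) * ψ'' t‖ := by ring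
      _ ≤ 2 * (Q + Q + 4 * Q) := by
          gcongr
          linarith
      _ ≤ _ := by linarith

/-- A smooth function on `[0, π]` has an absolutely convergent expansion into time modes. -/
lemma exists_timeMode_expansion {ψ ψ' ψ'' : ℝ → ℂ} (h1 : ∀ t, HasDerivAt ψ (ψ' t) t)
    (h2 : ∀ t, HasDerivAt ψ' (ψ'' t) t) (h3 : Continuous ψ'') {Q : ℝ}
    (hQ : ∀ t ∈ Set.Icc 0 Real.pi, ‖ψ t‖ ≤ Q ∧ ‖ψ' t‖ ≤ Q ∧ ‖ψ'' t‖ ≤ Q) :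
    ∃ a : ℤ → ℂ, (∀ j : ℤ, bracket j ^ 2 * ‖a j‖ ≤ 5 * Q) ∧
      ∀ t ∈ Set.Icc 0 Real.pi, HasSum (fun j => a j * timeMode j t) (ψ t) := by
  have hpi := Real.pi_pos
  have : Fact (0 < 2 * Real.pi) := ⟨Real.two_pi_pos⟩
  have hc1 : Continuous ψ := continuous_iff_continuousAt.2 fun t => (h1 t).continuousAt
  -- The even extension to `[-π, π]` is continuous and closes up periodically. Its coefficients
  -- therefore decay like `n ^ (-2)` without any boundary condition on `ψ`.
  set f : ℝ → ℂ := fun t => ψ |t| with hf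
  have hfc : Continuous f := hc1.comp continuous_abs
  have hper : f (-Real.pi) = f (-Real.pi + 2 * Real.pi) := by
    simp only [hf]; rw [abs_neg]; congr 2; ring
  have hQ0 : 0 ≤ Q := (norm_nonneg _).trans (hQ 0 ⟨le_rfl, hpi.le⟩).1
  set F : C(AddCircle (2 * Real.pi), ℂ) :=
    ⟨AddCircle.liftIco (2 * Real.pi) (-Real.pi) f, AddCircle.liftIco_continuous hper hfc.continuousOn⟩
    with hF
  have hcoef : ∀ n : ℤ, fourierCoeff F n
      = (Real.pi : ℂ)⁻¹ * ∫ t in (0 : ℝ)..Real.pi, Real.cos (n * t) * ψ t := by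
    intro n
    have e1 : fourierCoeff F n = _ := fourierCoeff_liftIco_eq (T := 2 * Real.pi) (a := -Real.pi) f n
    rw [e1, fourierCoeffOn_eq_integral]
    have e2 : ∀ x : ℝ, fourier (-n) (x : AddCircle (-Real.pi + 2 * Real.pi - -Real.pi)) • f x
        = Complex.exp (-(Complex.I * n * x)) * f x := fun x => by
      rw [fourier_coe_apply, smul_eq_mul]
      congr 2
      have : (Real.pi : ℂ) ≠ 0 := by exact_mod_cast Real.pi_ne_zero
      have h' : (((-Real.pi + 2 * Real.pi - -Real.pi : ℝ)) : ℂ) = 2 * Real.pi := by push_cast; ring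
      rw [h']
      push_cast
      field_simp
    simp_rw [e2]
    rw [show -Real.pi + 2 * Real.pi = Real.pi by ring]
    have hc : Continuous fun x : ℝ => Complex.exp (-(Complex.I * n * x)) * f x := by fun_prop
    rw [← intervalIntegral.integral_add_adjacent_intervals (b := 0) (hc.intervalIntegrable _ _)
      (hc.intervalIntegrable _ _)]
    have e3 := intervalIntegral.integral_comp_neg (a := 0) (b := Real.pi)
      fun x : ℝ => Complex.exp (-(Complex.I * n * x)) * f x
    rw [neg_zero] at e3
    rw [← e3, ← intervalIntegral.integral_add
      (Continuous.intervalIntegrable (by fun_prop) _ _) (hc.intervalIntegrable _ _)]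
    have e4 : ∫ x in (0 : ℝ)..Real.pi, (Complex.exp (-(Complex.I * n * ((-x : ℝ) : ℂ))) * f (-x)
        + Complex.exp (-(Complex.I * n * x)) * f x)
        = 2 * ∫ t in (0 : ℝ)..Real.pi, Real.cos (n * t) * ψ t := by
      rw [← intervalIntegral.integral_const_mul]
      refine intervalIntegral.integral_congr fun x hx => ?_
      rw [Set.uIcc_of_le hpi.le] at hx
      simp only [hf, abs_neg, abs_of_nonneg hx.1]
      rw [Complex.ofReal_cos, Complex.cos]
      push_cast
      rw [show -(Complex.I * n * -(x : ℂ)) = n * x * Complex.I by ring,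
        show -(Complex.I * n * (x : ℂ)) = -(n * x) * Complex.I by ring]
      ring
    rw [e4, Complex.real_smul]
    have : (Real.pi : ℂ) ≠ 0 := by exact_mod_cast Real.pi_ne_zero
    push_cast
    field_simp
    ring
  have hdecay : ∀ n : ℤ, bracket n ^ 2 * ‖fourierCoeff F n‖ ≤ 5 * Q := by
    intro n
    have h := norm_integral_mul_cos_le h1 h2 h3 hQ n
    rw [hcoef, norm_mul, norm_inv, Complex.norm_real, Real.norm_of_nonneg hpi.le,
      mul_left_comm, inv_mul_le_iff₀ hpi]
    nlinarith [Real.pi_gt_three]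
  have hsum : Summable (fourierCoeff F) := by
    refine Summable.of_norm_bounded (g := fun n : ℤ => 5 * Q * bracket n ^ (-(2 : ℝ))) ?_ fun n => ?_
    · obtain ⟨B, -, hB⟩ := exists_sum_bracket_rpow_neg_le (β := 2) one_lt_two
      exact (summable_of_sum_le (fun n => Real.rpow_nonneg (bracket_pos _).le _) hB).mul_left _
    · rw [Real.rpow_neg (bracket_pos _).le, ← div_eq_mul_inv, le_div_iff₀
        (Real.rpow_pos_of_pos (bracket_pos _) _), mul_comm]
      exact_mod_cast hdecay n
  refine ⟨fun j => fourierCoeff F (-j), fun j => ?_, fun t ht => ?_⟩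
  · have := hdecay (-j)
    have e : bracket ((-j : ℤ) : ℝ) = bracket j := by simp [bracket]
    rwa [e] at this
  · have h := has_pointwise_sum_fourier_series_of_summable hsum ((t : ℝ) : AddCircle (2 * Real.pi))
    have hval : F ((t : ℝ) : AddCircle (2 * Real.pi)) = ψ t := by
      have e : F ((t : ℝ) : AddCircle (2 * Real.pi)) = f t := by
        rcases ht.2.lt_or_eq with hlt | heq
        · exact AddCircle.liftIco_coe_apply (p := 2 * Real.pi) (a := -Real.pi) (f := f) ⟨by linarith [ht.1], by linarith⟩
        · have e1 : ((t : ℝ) : AddCircle (2 * Real.pi)) = ((-Real.pi : ℝ) : AddCircle (2 * Real.pi)) := by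
            rw [heq, ← AddCircle.coe_add_period (2 * Real.pi) (-Real.pi)]
            congr 1; ring
          rw [e1, heq]
          refine (AddCircle.liftIco_coe_apply (p := 2 * Real.pi) (a := -Real.pi) (f := f) ⟨le_rfl, by linarith⟩).trans ?_
          simp [hf]
      rw [e, hf]
      simp only [abs_of_nonneg ht.1]
    rw [hval, ← (Equiv.neg ℤ).hasSum_iff] at h
    refine h.congr_fun fun j => ?_
    simp only [Function.comp_apply, Equiv.neg_apply, smul_eq_mul]
    rw [fourier_coe_apply, timeMode]
    congr 2
    have : (Real.pi : ℂ) ≠ 0 := by exact_mod_cast Real.pi_ne_zero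
    push_cast
    field_simp

/-! ### The scalar Duhamel integral -/

lemma one_le_two_mul_abs_sub {δ : ℝ} (hδ : |δ| ≤ 1 / 2) {j : ℤ} (hj : j ≠ 0) :
    bracket j ≤ 4 * |δ - j| := by
  have h1 : (1 : ℝ) ≤ |(j : ℝ)| := by exact_mod_cast Int.one_le_abs hj
  have h2 : |(j : ℝ)| - |δ| ≤ |δ - j| := by
    rw [abs_sub_comm]; exact abs_sub_abs_le_abs_sub _ _
  have h3 : bracket j ≤ 2 * |(j : ℝ)| := by
    rw [bracket, Real.sqrt_le_left (by positivity), mul_pow, sq_abs]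
    rw [← sq_abs]; nlinarith
  linarith

/-- Write `⟨j⟩⁻¹ = ⟨j⟩ ^ (-b) ⟨j⟩ ^ (b - 1)` and use the summability of `⟨j⟩ ^ (-2 b)`. -/
lemma summable_of_bracket_bound {b : ℝ} (hb : 1 / 2 < b) : ∃ B : ℝ, 0 < B ∧
    ∀ (c : ℤ → ℂ) (R : ℝ), (∀ J : Finset ℤ, ∑ j ∈ J, bracket j ^ (2 * b - 2) * ‖c j‖ ^ 2 ≤ R) →
    ∀ J : Finset ℤ, ∑ j ∈ J, ‖c j‖ / bracket j ≤ √(B * R) := by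
  obtain ⟨B, hB, hbr⟩ := exists_sum_bracket_rpow_neg_le (β := 2 * b) (by linarith)
  refine ⟨B, hB, fun c R hR J => Real.le_sqrt_of_sq_le ?_⟩
  have e : ∀ j : ℤ, ‖c j‖ / bracket j = bracket j ^ (-b) * (bracket j ^ (b - 1) * ‖c j‖) := fun j => by
    rw [← mul_assoc, ← Real.rpow_add (bracket_pos _), show -b + (b - 1) = -1 by ring,
      Real.rpow_neg_one]
    ring
  have e2 : ∀ (x : ℝ) (y : ℝ), (bracket x ^ y) ^ 2 = bracket x ^ (2 * y) := fun x y => by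
    rw [mul_comm, Real.rpow_mul (bracket_pos x).le]; norm_cast
  simp_rw [e]
  refine (Finset.sum_mul_sq_le_sq_mul_sq _ _ _).trans ?_
  simp_rw [mul_pow, e2]
  have h1 := hbr J
  have h2 := hR J
  simp only [show 2 * (b - 1) = 2 * b - 2 by ring, show 2 * -b = -(2 * b) by ring]
  refine mul_le_mul h1 h2 (Finset.sum_nonneg fun j _ => ?_) hB.le
  exact mul_nonneg (Real.rpow_nonneg (bracket_pos _).le _) (sq_nonneg _)

lemma timeMode_eq (j : ℤ) (t : ℝ) : timeMode j t = Complex.exp (-(Complex.I * j * t)) := rfl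

lemma norm_timeMode (j : ℤ) (t : ℝ) : ‖timeMode j t‖ = 1 := by
  rw [timeMode, Complex.norm_exp]; simp

lemma norm_exp_neg_I_mul (δ t : ℝ) : ‖Complex.exp (-(Complex.I * δ * t))‖ = 1 := by
  rw [Complex.norm_exp]; simp

lemma norm_exp_I_mul_mul (δ t : ℝ) : ‖Complex.exp (Complex.I * δ * t)‖ = 1 := by
  rw [Complex.norm_exp]; simp

/-- Each mode `j ≠ 0` produces a pure time mode and a free solution, both divided by `δ - j`. For `j
= 0` the denominator could vanish, and that mode is treated apart. -/
lemma exp_mul_integral_exp {δ : ℝ} (hδ : |δ| ≤ 1 / 2) {j : ℤ} (hj : j ≠ 0) (t : ℝ) :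
    Complex.exp (-(Complex.I * δ * t)) * ∫ τ in (0 : ℝ)..t, Complex.exp (Complex.I * (δ - j) * τ)
      = (Complex.I * (δ - j))⁻¹ * (timeMode j t - Complex.exp (-(Complex.I * δ * t))) := by
  have h0 : δ - j ≠ 0 := by
    have h1 := one_le_two_mul_abs_sub hδ hj
    have := one_le_bracket j
    intro h0
    rw [h0, abs_zero] at h1
    linarith
  have h1 : Complex.I * ((δ : ℂ) - j) ≠ 0 :=
    mul_ne_zero Complex.I_ne_zero (by exact_mod_cast h0)
  rw [integral_exp_mul_complex h1, timeMode_eq]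
  have : Complex.exp (-(Complex.I * j * t))
      = Complex.exp (-(Complex.I * δ * t)) * Complex.exp (Complex.I * (δ - j) * t) := by
    rw [← Complex.exp_add]; congr 1; ring
  rw [this]
  simp only [Complex.ofReal_zero, mul_zero, Complex.exp_zero]
  field_simp

/-- The smooth part of the scalar Duhamel integral. -/
lemma exists_smooth_part_expansion {δ : ℝ} (hδ : |δ| ≤ 1 / 2) (c κ : ℂ) {q : ℝ} (hc : ‖c‖ ≤ q)
    (hκ : ‖κ‖ ≤ 4 * q) : ∃ a : ℤ → ℂ, (∀ j : ℤ, bracket j ^ 2 * ‖a j‖ ≤ 40 * q) ∧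
      ∀ t ∈ Set.Icc 0 Real.pi, HasSum (fun j => a j * timeMode j t)
        (Complex.exp (-(Complex.I * δ * t)) * (c * (∫ τ in (0 : ℝ)..t, Complex.exp (Complex.I * δ * τ))
          - κ)) := by
  have hq : 0 ≤ q := (norm_nonneg c).trans hc
  set E : ℝ → ℂ := fun t => ∫ τ in (0 : ℝ)..t, Complex.exp (Complex.I * δ * τ) with hE
  have hcont : Continuous fun τ : ℝ => Complex.exp (Complex.I * δ * τ) := by fun_prop
  have hEd : ∀ t : ℝ, HasDerivAt E (Complex.exp (Complex.I * δ * t)) t := fun t =>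
    intervalIntegral.integral_hasDerivAt_right (hcont.intervalIntegrable _ _)
      (hcont.stronglyMeasurableAtFilter _ _) hcont.continuousAt
  have hexp : ∀ t : ℝ, HasDerivAt (fun t : ℝ => Complex.exp (-(Complex.I * δ * t)))
      (-(Complex.I * δ) * Complex.exp (-(Complex.I * δ * t))) t := fun t => by
    have h : HasDerivAt (fun t : ℝ => -(Complex.I * δ * t)) (-(Complex.I * δ)) t := by
      have := (Complex.ofRealCLM.hasDerivAt (x := t)).const_mul (-(Complex.I * δ))
      simpa using this
    exact h.cexp.congr_deriv (by ring)
  set ψ : ℝ → ℂ := fun t => Complex.exp (-(Complex.I * δ * t)) * (c * E t - κ) with hψ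
  -- Since `ψ' = -i δ ψ + c` with `|δ| ≤ 1 / 2`, the higher derivatives are controlled by the same
  -- bound as `ψ`.
  have h1 : ∀ t, HasDerivAt ψ (-(Complex.I * δ) * ψ t + c) t := fun t => by
    refine ((hexp t).mul (((hEd t).const_mul c).sub_const κ)).congr_deriv ?_
    have : Complex.exp (-(Complex.I * δ * t)) * Complex.exp (Complex.I * δ * t) = 1 := by
      rw [← Complex.exp_add]; simp
    simp only [hψ]
    linear_combination c * this
  have h2 : ∀ t, HasDerivAt (fun t => -(Complex.I * δ) * ψ t + c)
      (-(Complex.I * δ) * (-(Complex.I * δ) * ψ t + c)) t := fun t =>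
    ((h1 t).const_mul _).add_const c
  have hψc : Continuous ψ := continuous_iff_continuousAt.2 fun t => (h1 t).continuousAt
  have hδn : ‖-(Complex.I * (δ : ℂ))‖ ≤ 1 / 2 := by simpa using hδ
  obtain ⟨a, ha1, ha2⟩ := exists_timeMode_expansion (Q := 8 * q) h1 h2 (by fun_prop) fun t ht => by
    have hb1 : ‖ψ t‖ ≤ 8 * q := by
      have hEt : ‖E t‖ ≤ 4 := by
        refine (intervalIntegral.norm_integral_le_of_norm_le_const (C := 1) fun τ _ =>
          (norm_exp_I_mul_mul δ τ).le).trans ?_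
        rw [sub_zero, abs_of_nonneg ht.1]
        linarith [ht.2, Real.pi_le_four]
      simp only [hψ]
      rw [norm_mul, norm_exp_neg_I_mul, one_mul]
      refine (norm_sub_le _ _).trans ?_
      rw [norm_mul]
      have : ‖c‖ * ‖E t‖ ≤ q * 4 := by gcongr
      linarith
    have hb2 : ‖-(Complex.I * δ) * ψ t + c‖ ≤ 8 * q := by
      refine (norm_add_le _ _).trans ?_
      rw [norm_mul]
      have : ‖-(Complex.I * (δ : ℂ))‖ * ‖ψ t‖ ≤ 1 / 2 * (8 * q) := by gcongr
      linarith
    refine ⟨hb1, hb2, ?_⟩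
    rw [norm_mul]
    calc _ ≤ 1 / 2 * (8 * q) := by gcongr
      _ ≤ _ := by linarith
  exact ⟨a, fun j => (ha1 j).trans_eq (by ring), ha2⟩

/-- The scalar Duhamel integral gains one power of the modulation. -/
theorem exists_duhamel_expansion {b : ℝ} (hb : 1 / 2 < b) (hb1 : b ≤ 1) : ∃ B : ℝ, 0 < B ∧
    ∀ (T : ℝ), T < 1 / 2 → ∀ G : ℝ → ℂ, MemLp G 2 (timeMeasure T) → ∀ δ : ℝ, |δ| ≤ 1 / 2 →
    ∀ R : ℝ, (∀ J : Finset ℤ, ∑ j ∈ J, bracket j ^ (2 * b - 2) * ‖timeCoeff T G j‖ ^ 2 ≤ R) →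
    ∃ a : ℤ → ℂ, (∀ J : Finset ℤ, ∑ j ∈ J, bracket j ^ (2 * b) * ‖a j‖ ^ 2 ≤ B * R) ∧
      ∀ t ∈ Set.Ico 0 T, HasSum (fun j => a j * timeMode j t)
        (∫ τ in (0 : ℝ)..t, Complex.exp (-(Complex.I * δ * (t - τ))) * G τ) := by
  obtain ⟨B₀, hB₀, hsum⟩ := summable_of_bracket_bound hb
  obtain ⟨B₂, hB₂, hbr⟩ := exists_sum_bracket_rpow_neg_le (β := 2) one_lt_two
  refine ⟨32 + 3200 * B₀ * B₂, by positivity, fun T hT G hG δ hδ R hR => ?_⟩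
  have hR0 : 0 ≤ R := by simpa using hR ∅
  set c : ℤ → ℂ := timeCoeff T G with hc
  set q : ℝ := √(B₀ * R) with hq
  have hq2 : q ^ 2 = B₀ * R := Real.sq_sqrt (by positivity)
  have hcq := hsum c R hR
  have hsc : Summable fun j : ℤ => ‖c j‖ / bracket j :=
    summable_of_sum_le (fun j => div_nonneg (norm_nonneg _) (bracket_pos _).le) hcq
  set u : ℤ → ℂ := fun j => if j = 0 then 0 else c j * (Complex.I * (δ - j))⁻¹ with hu
  have hule : ∀ j, ‖u j‖ ≤ 4 * (‖c j‖ / bracket j) := by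
    intro j
    simp only [hu]
    split_ifs with hj
    · rw [norm_zero]; have := (bracket_pos j).le; positivity
    · have h1 := one_le_two_mul_abs_sub hδ hj
      have h2 := bracket_pos j
      have e : ‖(Complex.I * ((δ : ℂ) - j))⁻¹‖ = |δ - j|⁻¹ := by
        rw [norm_inv, norm_mul, Complex.norm_I, one_mul, ← Complex.ofReal_intCast,
          ← Complex.ofReal_sub, Complex.norm_real, Real.norm_eq_abs]
      rw [norm_mul, e, mul_div_assoc', mul_comm 4, mul_div_assoc]
      refine mul_le_mul_of_nonneg_left ?_ (norm_nonneg _)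
      rw [inv_le_comm₀ (by linarith) (by positivity), inv_div]
      linarith
  have hus : Summable u := Summable.of_norm_bounded (hsc.mul_left 4) hule
  -- `κ` collects the amplitudes of the free solution `e^{-i δ t}` coming from all `j ≠ 0`. Together
  -- with the mode `j = 0` it forms a smooth function of time, expanded separately with coefficients
  -- decaying like `⟨j⟩ ^ (-2)`.
  set κ := ∑' j, u j with hκ
  have hκle : ‖κ‖ ≤ 4 * q := by
    refine (tsum_of_norm_bounded (hsc.mul_left 4).hasSum hule).trans ?_
    rw [tsum_mul_left]
    have := hsc.tsum_le_of_sum_le hcq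
    linarith
  have hc0 : ‖c 0‖ ≤ q := by
    have := hcq {0}
    simpa [bracket] using this
  obtain ⟨a', ha1, ha2⟩ := exists_smooth_part_expansion hδ (c 0) κ hc0 hκle
  refine ⟨fun j => u j + a' j, fun J => ?_, fun t ht => ?_⟩
  · have h1 : ∀ j ∈ J, bracket j ^ (2 * b) * ‖u j + a' j‖ ^ 2
        ≤ 32 * (bracket j ^ (2 * b - 2) * ‖c j‖ ^ 2) + 3200 * B₀ * R * bracket j ^ (-(2 : ℝ)) := by
      intro j _
      have hbj := bracket_pos j
      have k1 : ‖u j + a' j‖ ^ 2 ≤ 2 * ‖u j‖ ^ 2 + 2 * ‖a' j‖ ^ 2 := by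
        have := pow_le_pow_left₀ (norm_nonneg _) (norm_add_le (u j) (a' j)) 2
        nlinarith [sq_nonneg (‖u j‖ - ‖a' j‖)]
      have k2 : ‖u j‖ ^ 2 ≤ 16 * (‖c j‖ ^ 2 * bracket j ^ (-(2 : ℝ))) := by
        refine (pow_le_pow_left₀ (norm_nonneg _) (hule j) 2).trans_eq ?_
        rw [Real.rpow_neg hbj.le, mul_pow, div_pow]
        norm_num; ring
      have k3 : ‖a' j‖ ^ 2 ≤ 1600 * B₀ * R * bracket j ^ (-(4 : ℝ)) := by
        have h3 : ‖a' j‖ ≤ 40 * q / bracket j ^ 2 := by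
          rw [le_div_iff₀ (by positivity), mul_comm]; exact ha1 j
        refine (pow_le_pow_left₀ (norm_nonneg _) h3 2).trans_eq ?_
        rw [Real.rpow_neg hbj.le, div_pow, mul_pow, hq2]
        norm_num
        rw [← Real.rpow_natCast (bracket j ^ 2), ← Real.rpow_natCast (bracket j), ← Real.rpow_mul hbj.le]
        norm_num
        ring
      have k4 : bracket j ^ (2 * b) * bracket j ^ (-(4 : ℝ)) ≤ bracket j ^ (-(2 : ℝ)) := by
        rw [← Real.rpow_add hbj]
        exact Real.rpow_le_rpow_of_exponent_le (one_le_bracket _) (by linarith)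
      have k5 : bracket j ^ (2 * b) * bracket j ^ (-(2 : ℝ)) = bracket j ^ (2 * b - 2) := by
        rw [← Real.rpow_add hbj]; ring_nf
      have k6 : 0 ≤ bracket j ^ (2 * b) := Real.rpow_nonneg hbj.le _
      calc _ ≤ bracket j ^ (2 * b) * (2 * (16 * (‖c j‖ ^ 2 * bracket j ^ (-(2 : ℝ))))
            + 2 * (1600 * B₀ * R * bracket j ^ (-(4 : ℝ)))) := by
            gcongr; linarith
        _ = 32 * ((bracket j ^ (2 * b) * bracket j ^ (-(2 : ℝ))) * ‖c j‖ ^ 2)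
            + 3200 * B₀ * R * (bracket j ^ (2 * b) * bracket j ^ (-(4 : ℝ))) := by ring
        _ ≤ _ := by rw [k5]; gcongr
    refine (Finset.sum_le_sum h1).trans ?_
    rw [Finset.sum_add_distrib, ← Finset.mul_sum, ← Finset.mul_sum]
    calc _ ≤ 32 * R + 3200 * B₀ * R * B₂ := by
          gcongr
          · exact hR J
          · exact hbr J
      _ = _ := by ring
  · have hpi3 := Real.pi_gt_three
    have hP := (hasSum_timeCoeff_mul (by linarith : T ≤ 2 * Real.pi) hG δ ht.1 ht.2.le).mul_left
      (Complex.exp (-(Complex.I * δ * t)))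
    have hA := ha2 t ⟨ht.1, by linarith [ht.2]⟩
    have hK := hus.hasSum.mul_right (Complex.exp (-(Complex.I * δ * t)))
    set E := ∫ τ in (0 : ℝ)..t, Complex.exp (Complex.I * δ * τ) with hE
    set X := Complex.exp (-(Complex.I * δ * t)) with hX
    have h0 : HasSum (fun j : ℤ => if j = 0 then X * (c 0 * E) else 0) (X * (c 0 * E)) := by
      exact hasSum_ite_eq (0 : ℤ) _
    have hsumm := ((hP.add hK).sub h0).add hA
    have hval : ∫ τ in (0 : ℝ)..t, Complex.exp (-(Complex.I * δ * (t - τ))) * G τ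
        = X * (∫ τ in (0 : ℝ)..t, Complex.exp (Complex.I * δ * τ) * G τ) + (∑' j, u j) * X
          - X * (c 0 * E) + X * (c 0 * E - κ) := by
      rw [← intervalIntegral.integral_const_mul, ← hκ]
      have : ∀ τ : ℝ, X * (Complex.exp (Complex.I * δ * τ) * G τ)
          = Complex.exp (-(Complex.I * δ * (t - τ))) * G τ := fun τ => by
        rw [← mul_assoc, hX, ← Complex.exp_add]; congr 2; ring
      simp_rw [this]
      ring
    rw [hval]
    refine hsumm.congr_fun fun j => ?_
    rw [add_mul]
    congr 1
    simp only [hu]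
    split_ifs with hj
    · subst hj
      simp only [Int.cast_zero, sub_zero, hE, zero_mul, hc]; ring
    · rw [mul_left_comm X, hX, exp_mul_integral_exp hδ hj t]; ring

/-! ### Series in `L²(B)` -/

section
variable {ι E : Type*} [NormedAddCommGroup E]

/-- Cauchy's criterion. Series of orthogonal type are controlled by their square sums and need not
converge absolutely. -/
lemma summable_of_norm_sum_sq_le [CompleteSpace E] {v : ι → E} {r : ι → ℝ} (hr : Summable r) {B : ℝ}
    (hB : 0 ≤ B) (h : ∀ S : Finset ι, ‖∑ p ∈ S, v p‖ ^ 2 ≤ B * ∑ p ∈ S, r p) : Summable v := by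
  rw [summable_iff_vanishing_norm] at hr ⊢
  intro ε hε
  obtain ⟨s, hs⟩ := hr (ε ^ 2 / (B + 1)) (by positivity)
  refine ⟨s, fun t ht => ?_⟩
  have h1 := h t
  have h2 := (Real.norm_eq_abs _ ▸ (hs t ht) : |∑ p ∈ t, r p| < _)
  have h3 : ‖∑ p ∈ t, v p‖ ^ 2 < ε ^ 2 := by
    have h4 : B * ∑ p ∈ t, r p ≤ B * (ε ^ 2 / (B + 1)) :=
      mul_le_mul_of_nonneg_left ((le_abs_self _).trans h2.le) hB
    have h5 : B * (ε ^ 2 / (B + 1)) < ε ^ 2 := by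
      rw [mul_div_assoc', div_lt_iff₀ (by positivity)]
      nlinarith [pow_pos hε 2]
    linarith
  exact lt_of_pow_lt_pow_left₀ 2 hε.le h3

lemma norm_hasSum_sub_sq_le {v : ι → E} {r : ι → ℝ} (hr0 : ∀ p, 0 ≤ r p) (hr : Summable r) {B : ℝ}
    (hB : 0 ≤ B) (h : ∀ S : Finset ι, ‖∑ p ∈ S, v p‖ ^ 2 ≤ B * ∑ p ∈ S, r p) {V : E}
    (hV : HasSum v V) (S : Finset ι) :
    ‖V - ∑ p ∈ S, v p‖ ^ 2 ≤ B * (∑' p, r p - ∑ p ∈ S, r p) := by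
  classical
  have h1 : Tendsto (fun S' : Finset ι => ‖∑ p ∈ S', v p - ∑ p ∈ S, v p‖ ^ 2) atTop
      (𝓝 (‖V - ∑ p ∈ S, v p‖ ^ 2)) := ((hV.sub_const _).norm).pow 2
  refine le_of_tendsto h1 ?_
  filter_upwards [eventually_ge_atTop S] with S' hS'
  rw [← Finset.sum_sdiff hS', add_sub_cancel_right]
  refine (h _).trans (mul_le_mul_of_nonneg_left ?_ hB)
  have h2 := Finset.sum_sdiff (f := r) hS'
  have h3 := hr.sum_le_tsum S' fun p _ => hr0 p
  linarith

end

lemma norm_sum_smul_e_sq (S : Finset ℕ+) (a : ℕ+ → ℂ) :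
    ‖∑ n ∈ S, a n • e n‖ ^ 2 = ∑ n ∈ S, ‖a n‖ ^ 2 := by
  have := orthonormal_e.inner_sum a a S
  rw [inner_self_eq_norm_sq_to_K] at this
  have h3 : ((‖∑ n ∈ S, a n • e n‖ ^ 2 : ℝ) : ℂ) = ((∑ n ∈ S, ‖a n‖ ^ 2 : ℝ) : ℂ) := by
    push_cast
    refine (by simpa using this : ((‖∑ n ∈ S, a n • e n‖ : ℂ)) ^ 2 = _).trans ?_
    refine Finset.sum_congr rfl fun n _ => ?_
    rw [Complex.conj_mul']
  exact_mod_cast h3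

lemma inner_e_e (l n : ℕ+) : inner ℂ (e l) (e n) = if l = n then (1 : ℂ) else 0 :=
  orthonormal_iff_ite.1 orthonormal_e l n

lemma inner_e_of_hasSum {a : ℕ+ → ℂ} {V : L2Ball} (hV : HasSum (fun n => a n • e n) V) (l : ℕ+) :
    inner ℂ (e l) V = a l := by
  have h := (innerSL ℂ (e l)).hasSum hV
  simp only [innerSL_apply_apply, inner_smul_right, inner_e_e] at h
  refine h.unique ?_
  have := hasSum_ite_eq l (a l)
  refine this.congr_fun fun n => ?_
  by_cases hn : n = l
  · subst hn; simp
  · rw [if_neg hn, if_neg (Ne.symm hn), mul_zero]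

/-! ### The propagator -/

/-- The phase of the propagator. -/
def phase (t : ℝ) (n : ℕ+) : ℂ := Complex.exp (-(Complex.I * (t : ℂ) * ((z n ^ 2 : ℝ) : ℂ)))

lemma norm_phase (t : ℝ) (n : ℕ+) : ‖phase t n‖ = 1 := by
  rw [phase, Complex.norm_exp, Complex.neg_re, mul_assoc, ← Complex.ofReal_mul, Complex.I_mul_re,
    Complex.ofReal_im, neg_zero, neg_zero, Real.exp_zero]

lemma hasSum_propagator (t : ℝ) (h : L2Ball) :
    HasSum (fun n : ℕ+ => (phase t n * inner ℂ (e n) h) • e n) (propagator t h) := by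
  refine Summable.hasSum (summable_of_norm_sum_sq_le (r := fun n => ‖inner ℂ (e n) h‖ ^ 2)
    (orthonormal_e.inner_products_summable h) zero_le_one fun S => ?_)
  rw [norm_sum_smul_e_sq, one_mul]
  simp [norm_phase]

lemma inner_e_propagator (t : ℝ) (h : L2Ball) (l : ℕ+) :
    inner ℂ (e l) (propagator t h) = phase t l * inner ℂ (e l) h :=
  inner_e_of_hasSum (hasSum_propagator t h) l

lemma norm_propagator_le (t : ℝ) (h : L2Ball) : ‖propagator t h‖ ≤ ‖h‖ := by
  have h1 := ((hasSum_propagator t h).norm).pow 2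
  refine (sq_le_sq₀ (norm_nonneg _) (norm_nonneg _)).1 (le_of_tendsto h1 (Eventually.of_forall fun S => ?_))
  rw [norm_sum_smul_e_sq]
  refine le_trans (le_of_eq ?_) (orthonormal_e.sum_inner_products_le h (s := S))
  simp [norm_phase]

lemma inner_propagator_of_orthogonal {v : L2Ball} (hv : ∀ n, inner ℂ v (e n) = 0) (t : ℝ) (h : L2Ball) :
    inner ℂ v (propagator t h) = 0 := by
  have h1 := (innerSL ℂ v).hasSum (hasSum_propagator t h)
  simp only [innerSL_apply_apply, inner_smul_right, hv, mul_zero] at h1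
  exact h1.unique hasSum_zero

lemma aestronglyMeasurable_propagator {μ : Measure ℝ} {h : ℝ → L2Ball} (hh : AEStronglyMeasurable h μ)
    (t : ℝ) : AEStronglyMeasurable (fun τ => propagator (t - τ) (h τ)) μ := by
  refine aestronglyMeasurable_of_tendsto_ae (atTop : Filter (Finset ℕ+))
    (f := fun S τ => ∑ n ∈ S, (phase (t - τ) n * inner ℂ (e n) (h τ)) • e n) (fun S => ?_)
    (Eventually.of_forall fun τ => hasSum_propagator (t - τ) (h τ))
  refine Finset.aestronglyMeasurable_fun_sum _ fun n _ => ?_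
  refine AEStronglyMeasurable.smul_const ?_ (e n)
  refine AEStronglyMeasurable.mul (Continuous.aestronglyMeasurable ?_)
    ((innerSL ℂ (e n)).continuous.comp_aestronglyMeasurable hh)
  unfold phase; fun_prop

lemma intervalIntegrable_propagator {T : ℝ} {h : ℝ → L2Ball} (hh : Integrable h (timeMeasure T))
    {t : ℝ} (ht : t ∈ Set.Ico 0 T) :
    IntervalIntegrable (fun τ => propagator (t - τ) (h τ)) volume 0 t := by
  rw [intervalIntegrable_iff_integrableOn_Ioc_of_le ht.1, IntegrableOn]
  have hh' : Integrable h (volume.restrict (Set.Ioc 0 t)) := by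
    rw [timeMeasure_eq] at hh
    exact IntegrableOn.mono_set hh (Set.Ioc_subset_Ioc_right ht.2.le)
  exact hh'.mono (aestronglyMeasurable_propagator hh'.aestronglyMeasurable t)
    (Eventually.of_forall fun τ => norm_propagator_le _ _)

lemma inner_e_integral_propagator {T : ℝ} {h : ℝ → L2Ball} (hh : Integrable h (timeMeasure T))
    {t : ℝ} (ht : t ∈ Set.Ico 0 T) (l : ℕ+) :
    inner ℂ (e l) (∫ τ in (0 : ℝ)..t, propagator (t - τ) (h τ))
      = ∫ τ in (0 : ℝ)..t, phase (t - τ) l * inner ℂ (e l) (h τ) := by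
  have := (innerSL ℂ (e l)).intervalIntegral_comp_comm (intervalIntegrable_propagator hh ht)
  simp only [innerSL_apply_apply, inner_e_propagator] at this
  exact this.symm

lemma inner_integral_propagator_of_orthogonal {T : ℝ} {h : ℝ → L2Ball}
    (hh : Integrable h (timeMeasure T)) {t : ℝ} (ht : t ∈ Set.Ico 0 T) {v : L2Ball}
    (hv : ∀ n, inner ℂ v (e n) = 0) :
    inner ℂ v (∫ τ in (0 : ℝ)..t, propagator (t - τ) (h τ)) = 0 := by
  have := (innerSL ℂ v).intervalIntegral_comp_comm (intervalIntegrable_propagator hh ht)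
  simp only [innerSL_apply_apply, inner_propagator_of_orthogonal hv] at this
  rw [← this]; simp

/-- The `e n` span only the radial part of `L²(B)`, and their completeness there is not needed:
lying in the closed span is expressed by orthogonality to every vector orthogonal to all `e n`. -/
lemma eq_of_inner_e_eq {u w : L2Ball} (h : ∀ l, inner ℂ (e l) u = inner ℂ (e l) w)
    (hu : ∀ v, (∀ n, inner ℂ v (e n) = 0) → inner ℂ v u = 0)
    (hw : ∀ v, (∀ n, inner ℂ v (e n) = 0) → inner ℂ v w = 0) : u = w := by
  rw [← sub_eq_zero, ← inner_self_eq_zero (𝕜 := ℂ)]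
  have hv : ∀ n, inner ℂ (u - w) (e n) = 0 := fun n => by
    rw [← inner_conj_symm, inner_sub_right, h, sub_self, map_zero]
  rw [inner_sub_right, hu _ hv, hw _ hv, sub_zero]

/-! ### Representations -/

lemma bracket_le_two_mul {x y : ℝ} (h : |x - y| ≤ 1 / 2) : bracket x ≤ 2 * bracket y := by
  have h1 := (abs_le.1 (abs_bracket_sub_le x y)).2
  have h2 := one_le_bracket y
  linarith

/-- The modulation weight. -/
def modWeight (b : ℝ) (p : ℕ+ × ℤ) : ℝ := bracket (z p.1 ^ 2 - (p.2 : ℝ)) ^ (2 * b)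

lemma modWeight_pos (b : ℝ) (p : ℕ+ × ℤ) : 0 < modWeight b p := Real.rpow_pos_of_pos (bracket_pos _) _

lemma exists_sum_modWeight_inv_le {b : ℝ} (hb : 1 / 2 < b) : ∃ B : ℝ, 0 < B ∧
    ∀ (l : ℕ+) (S : Finset (ℕ+ × ℤ)), (∀ p ∈ S, p.1 = l) → ∑ p ∈ S, (modWeight b p)⁻¹ ≤ B := by
  classical
  obtain ⟨B, hB, h⟩ := exists_sum_bracket_rpow_neg_le (β := 2 * b) (by linarith)
  refine ⟨2 ^ (2 * b) * B, by positivity, fun l S hS => ?_⟩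
  have h1 : ∀ p ∈ S, (modWeight b p)⁻¹
      ≤ 2 ^ (2 * b) * bracket ((p.2 - freq l : ℤ) : ℝ) ^ (-(2 * b)) := by
    intro p hp
    have h2 : bracket ((p.2 - freq l : ℤ) : ℝ) ≤ 2 * bracket (z p.1 ^ 2 - (p.2 : ℝ)) := by
      have e : bracket ((p.2 - freq l : ℤ) : ℝ) = bracket ((freq l - p.2 : ℤ) : ℝ) := by
        simp only [bracket]; push_cast; ring_nf
      rw [e]
      refine bracket_le_two_mul ?_
      rw [hS p hp]
      have := abs_sub_freq_le l
      rw [abs_sub_comm] at this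
      push_cast
      rwa [sub_sub_sub_cancel_right]
    rw [modWeight, Real.rpow_neg (bracket_pos _).le, ← div_eq_mul_inv,
      inv_le_comm₀ (Real.rpow_pos_of_pos (bracket_pos _) _)
        (div_pos (by positivity) (Real.rpow_pos_of_pos (bracket_pos _) _)), inv_div,
      div_le_iff₀ (by positivity),
      mul_comm (bracket (z p.1 ^ 2 - (p.2 : ℝ)) ^ (2 * b)), ← Real.mul_rpow two_pos.le (bracket_pos _).le]
    exact Real.rpow_le_rpow (bracket_pos _).le h2 (by linarith)
  refine (Finset.sum_le_sum h1).trans ?_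
  rw [← Finset.mul_sum]
  refine mul_le_mul_of_nonneg_left ?_ (by positivity)
  rw [← Finset.sum_image (s := S) (g := fun p : ℕ+ × ℤ => p.2 - freq l)
    (f := fun j : ℤ => bracket (j : ℝ) ^ (-(2 * b)))]
  · exact h _
  · intro p hp p' hp' hpp
    exact Prod.ext ((hS p hp).trans (hS p' hp').symm) (sub_left_injective hpp)

/-- For `b > 1 / 2` the inverse modulation weights are summable along each row, so the weighted norm
controls the `L²(B)` norm uniformly in time. Hence series of finite norm converge at every time. -/
lemma exists_norm_sum_timeMode_sq_le {b : ℝ} (hb : 1 / 2 < b) : ∃ B : ℝ, 0 < B ∧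
    ∀ (d : ℕ+ × ℤ → ℂ) (t : ℝ) (S : Finset (ℕ+ × ℤ)),
    ‖∑ p ∈ S, (d p * timeMode p.2 t) • e p.1‖ ^ 2 ≤ B * ∑ p ∈ S, modWeight b p * ‖d p‖ ^ 2 := by
  classical
  obtain ⟨B, hB, h⟩ := exists_sum_modWeight_inv_le hb
  refine ⟨B, hB, fun d t S => ?_⟩
  have hmaps : ∀ p ∈ S, p.1 ∈ S.image Prod.fst := fun p hp => Finset.mem_image_of_mem _ hp
  have e1 : ∑ p ∈ S, (d p * timeMode p.2 t) • e p.1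
      = ∑ l ∈ S.image Prod.fst, (∑ p ∈ S with p.1 = l, d p * timeMode p.2 t) • e l := by
    rw [← Finset.sum_fiberwise_of_maps_to hmaps]
    refine Finset.sum_congr rfl fun l _ => ?_
    rw [Finset.sum_smul]
    refine Finset.sum_congr rfl fun p hp => ?_
    rw [(Finset.mem_filter.1 hp).2]
  rw [e1, norm_sum_smul_e_sq, ← Finset.sum_fiberwise_of_maps_to hmaps, Finset.mul_sum]
  refine Finset.sum_le_sum fun l _ => ?_
  refine (norm_sum_sq_le_weighted _ (modWeight_pos b) _).trans ?_
  simp_rw [norm_mul, norm_timeMode, mul_one]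
  refine mul_le_mul_of_nonneg_right (h l _ fun p hp => (Finset.mem_filter.1 hp).2)
    (Finset.sum_nonneg fun p _ => ?_)
  have := (modWeight_pos b p).le
  positivity

lemma summable_timeMode {b : ℝ} (hb : 1 / 2 < b) {d : ℕ+ × ℤ → ℂ}
    (hd : Summable fun p => modWeight b p * ‖d p‖ ^ 2) (t : ℝ) :
    Summable fun p : ℕ+ × ℤ => (d p * timeMode p.2 t) • e p.1 := by
  obtain ⟨B, hB, h⟩ := exists_norm_sum_timeMode_sq_le hb
  exact summable_of_norm_sum_sq_le hd hB.le (h d t)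

/-- A series with finite weighted norm that converges at each time is a representation. -/
lemma isRepresentation_of_hasSum {b : ℝ} (hb : 1 / 2 < b) {d : ℕ+ × ℤ → ℂ}
    (hd : Summable fun p => modWeight b p * ‖d p‖ ^ 2) {T : ℝ} {u : ℝ → L2Ball}
    (hu : ∀ t ∈ Set.Ico 0 T, HasSum (fun p : ℕ+ × ℤ => (d p * timeMode p.2 t) • e p.1) (u t)) :
    IsRepresentation T d u := by
  obtain ⟨B, hB, h⟩ := exists_norm_sum_timeMode_sq_le hb
  have hr0 : ∀ p, 0 ≤ modWeight b p * ‖d p‖ ^ 2 := fun p =>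
    mul_nonneg (modWeight_pos b p).le (sq_nonneg _)
  set ε : Finset (ℕ+ × ℤ) → ℝ := fun S =>
    √(B * (∑' p, modWeight b p * ‖d p‖ ^ 2 - ∑ p ∈ S, modWeight b p * ‖d p‖ ^ 2)) with hε
  have hae : ∀ᵐ t ∂(timeMeasure T), t ∈ Set.Ico 0 T := ae_restrict_mem measurableSet_Ico
  have hfin : IsFiniteMeasure (timeMeasure T) := by
    unfold timeMeasure; infer_instance
  have hbound : ∀ S, ∀ᵐ t ∂(timeMeasure T), ‖u t - ∑ p ∈ S, (d p * timeMode p.2 t) • e p.1‖ ≤ ε S := by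
    intro S
    filter_upwards [hae] with t ht
    exact Real.le_sqrt_of_sq_le (norm_hasSum_sub_sq_le hr0 hd hB.le (h d t) (hu t ht) S)
  have hmeas : AEStronglyMeasurable u (timeMeasure T) := by
    refine aestronglyMeasurable_of_tendsto_ae (atTop : Filter (Finset (ℕ+ × ℤ)))
      (f := fun S t => ∑ p ∈ S, (d p * timeMode p.2 t) • e p.1) (fun S => ?_) ?_
    · refine Continuous.aestronglyMeasurable ?_
      unfold timeMode; fun_prop
    · filter_upwards [hae] with t ht
      exact hu t ht
  refine ⟨MemLp.of_bound hmeas (ε ∅) ?_, ?_⟩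
  · filter_upwards [hbound ∅] with t ht
    simpa using ht
  · have hlim : Tendsto ε atTop (𝓝 0) := by
      have h1 := (hd.hasSum.const_sub (∑' p, modWeight b p * ‖d p‖ ^ 2)).const_mul B
      rw [sub_self, mul_zero] at h1
      have := h1.sqrt
      rwa [Real.sqrt_zero] at this
    have hlim2 : Tendsto (fun S => (timeMeasure T) Set.univ ^ (2 : ℝ≥0∞).toReal⁻¹ * ENNReal.ofReal (ε S))
        atTop (𝓝 0) := by
      have h2 := ENNReal.tendsto_ofReal hlim
      rw [ENNReal.ofReal_zero] at h2
      have := ENNReal.Tendsto.const_mul (a := (timeMeasure T) Set.univ ^ (2 : ℝ≥0∞).toReal⁻¹) h2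
        (Or.inr (ENNReal.rpow_ne_top_of_nonneg (by positivity) (measure_ne_top _ _)))
      rwa [mul_zero] at this
    exact tendsto_of_tendsto_of_tendsto_of_le_of_le tendsto_const_nhds hlim2 (fun _ => zero_le)
      fun S => eLpNorm_le_of_ae_bound (hbound S)

instance isFiniteMeasure_timeMeasure (T : ℝ) : IsFiniteMeasure (timeMeasure T) := by
  unfold timeMeasure; infer_instance

/-! ### The weighted norm of the coefficients -/

/-- The weight of the norm of `X^{s,b}`. -/
def xsbWeight (s b : ℝ) (p : ℕ+ × ℤ) : ℝ := bracket (z p.1) ^ (2 * s) * modWeight b p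

lemma xsbWeight_pos (s b : ℝ) (p : ℕ+ × ℤ) : 0 < xsbWeight s b p :=
  mul_pos (Real.rpow_pos_of_pos (bracket_pos _) _) (modWeight_pos b p)

lemma modWeight_le_xsbWeight {s : ℝ} (hs : 0 ≤ s) (b : ℝ) (p : ℕ+ × ℤ) :
    modWeight b p ≤ xsbWeight s b p :=
  le_mul_of_one_le_left (modWeight_pos b p).le
    (Real.one_le_rpow (one_le_bracket _) (by linarith))

lemma coeffNorm_le {s b : ℝ} {c : ℕ+ × ℤ → ℂ} {A : ℝ}
    (h : ∀ S : Finset (ℕ+ × ℤ), ∑ p ∈ S, xsbWeight s b p * ‖c p‖ ^ 2 ≤ A) :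
    coeffNorm s b c ≤ ENNReal.ofReal √A := by
  have hA : 0 ≤ A := by simpa using h ∅
  have h1 : ∑' p : ℕ+ × ℤ, ENNReal.ofReal (xsbWeight s b p * ‖c p‖ ^ 2) ≤ ENNReal.ofReal A := by
    rw [ENNReal.tsum_eq_iSup_sum]
    refine iSup_le fun S => ?_
    rw [← ENNReal.ofReal_sum_of_nonneg fun p _ => mul_nonneg (xsbWeight_pos s b p).le (sq_nonneg _)]
    exact ENNReal.ofReal_le_ofReal (h S)
  rw [coeffNorm, Real.sqrt_eq_rpow, ← ENNReal.ofReal_rpow_of_nonneg hA (by norm_num)]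
  exact ENNReal.rpow_le_rpow h1 (by norm_num)

lemma summable_of_coeffNorm_lt_top {s b : ℝ} {c : ℕ+ × ℤ → ℂ} (h : coeffNorm s b c < ⊤) :
    (Summable fun p => xsbWeight s b p * ‖c p‖ ^ 2) ∧
      ENNReal.ofReal √(∑' p, xsbWeight s b p * ‖c p‖ ^ 2) = coeffNorm s b c := by
  have h0 : ∀ p, 0 ≤ xsbWeight s b p * ‖c p‖ ^ 2 := fun p =>
    mul_nonneg (xsbWeight_pos s b p).le (sq_nonneg _)
  have h1 : ∑' p, ENNReal.ofReal (xsbWeight s b p * ‖c p‖ ^ 2) ≠ ⊤ := by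
    intro h2
    unfold coeffNorm at h
    change (∑' p, ENNReal.ofReal (xsbWeight s b p * ‖c p‖ ^ 2)) ^ (1 / 2 : ℝ) < ⊤ at h
    rw [h2, ENNReal.top_rpow_of_pos (by norm_num)] at h
    exact lt_irrefl _ h
  have h2 : Summable fun p => xsbWeight s b p * ‖c p‖ ^ 2 := by
    have := ENNReal.summable_toReal h1
    exact this.congr fun p => ENNReal.toReal_ofReal (h0 p)
  refine ⟨h2, ?_⟩
  rw [Real.sqrt_eq_rpow, ← ENNReal.ofReal_rpow_of_nonneg (tsum_nonneg h0) (by norm_num),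
    ENNReal.ofReal_tsum_of_nonneg h0 h2]
  rfl

/-! ### Bounded operators applied to a representation -/

section
variable {F : Type*} [NormedAddCommGroup F] [NormedSpace ℂ F]

lemma IsRepresentation.tendsto_clm {T : ℝ} {c : ℕ+ × ℤ → ℂ} {f : ℝ → L2Ball}
    (h : IsRepresentation T c f) (A : L2Ball →L[ℂ] F) :
    Tendsto (fun S : Finset (ℕ+ × ℤ) => eLpNorm (fun t => A (f t) -
      ∑ p ∈ S, (c p * timeMode p.2 t) • A (e p.1)) 2 (timeMeasure T)) atTop (𝓝 0) := by
  have h1 := ENNReal.Tendsto.const_mul (a := (‖A‖₊ : ℝ≥0∞)) h.2 (Or.inr ENNReal.coe_ne_top)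
  rw [mul_zero] at h1
  refine tendsto_of_tendsto_of_tendsto_of_le_of_le tendsto_const_nhds h1 (fun _ => zero_le)
    fun S => ?_
  have h2 := eLpNorm_le_nnreal_smul_eLpNorm_of_ae_le_mul (μ := timeMeasure T) (c := ‖A‖₊)
    (f := fun t => A (f t) - ∑ p ∈ S, (c p * timeMode p.2 t) • A (e p.1))
    (g := fun t => f t - ∑ p ∈ S, (c p * timeMode p.2 t) • e p.1)
    (Eventually.of_forall fun t => ?_) 2
  · exact h2
  · have e1 : A (f t) - ∑ p ∈ S, (c p * timeMode p.2 t) • A (e p.1)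
        = A (f t - ∑ p ∈ S, (c p * timeMode p.2 t) • e p.1) := by
      rw [map_sub, map_sum]; simp only [map_smul]
    rw [e1]
    exact A.le_opNNNorm _

lemma IsRepresentation.clm_ae_eq_zero {T : ℝ} {c : ℕ+ × ℤ → ℂ} {f : ℝ → L2Ball}
    (h : IsRepresentation T c f) (A : L2Ball →L[ℂ] F) (hA : ∀ p, c p ≠ 0 → A (e p.1) = 0) :
    ∀ᵐ t ∂(timeMeasure T), A (f t) = 0 := by
  have h1 := h.tendsto_clm A
  have h2 : ∀ (S : Finset (ℕ+ × ℤ)) t, ∑ p ∈ S, (c p * timeMode p.2 t) • A (e p.1) = 0 := by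
    intro S t
    refine Finset.sum_eq_zero fun p _ => ?_
    by_cases hp : c p = 0
    · rw [hp, zero_mul, zero_smul]
    · rw [hA p hp, smul_zero]
  simp only [h2, sub_zero] at h1
  have h3 := tendsto_nhds_unique tendsto_const_nhds h1
  rw [eLpNorm_eq_zero_iff (A.continuous.comp_aestronglyMeasurable h.1.aestronglyMeasurable)
    (by norm_num)] at h3
  exact h3

end

lemma IsRepresentation.ae_eq {T : ℝ} {c : ℕ+ × ℤ → ℂ} {f u : ℝ → L2Ball}
    (h : IsRepresentation T c f) (hu : IsRepresentation T c u) : f =ᵐ[timeMeasure T] u := by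
  have h1 := h.2.add hu.2
  rw [add_zero] at h1
  have h2 : eLpNorm (f - u) 2 (timeMeasure T) ≤ 0 := by
    refine ge_of_tendsto h1 (Eventually.of_forall fun S => ?_)
    have hm : AEStronglyMeasurable (fun t => ∑ p ∈ S, (c p * timeMode p.2 t) • e p.1)
        (timeMeasure T) := by
      refine Continuous.aestronglyMeasurable ?_
      unfold timeMode; fun_prop
    have h3 := eLpNorm_sub_le (h.1.aestronglyMeasurable.sub hm) (hu.1.aestronglyMeasurable.sub hm)
      (p := 2) (by norm_num)
    rw [sub_sub_sub_cancel_right] at h3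
    exact h3
  have h3 := (eLpNorm_eq_zero_iff (h.1.aestronglyMeasurable.sub hu.1.aestronglyMeasurable)
    (by norm_num)).1 (le_antisymm h2 zero_le)
  filter_upwards [h3] with t ht
  exact sub_eq_zero.1 ht

/-! ### The projection to low frequencies -/

/-- The orthogonal projection to the span of `e_n`, `n ≤ N`. -/
def lowProj (N : ℕ+) : L2Ball →L[ℂ] L2Ball :=
  ∑ n ∈ Finset.Iic N, (innerSL ℂ (e n)).smulRight (e n)

lemma lowProj_apply (N : ℕ+) (h : L2Ball) :
    lowProj N h = ∑ n ∈ Finset.Iic N, (inner ℂ (e n) h : ℂ) • e n := by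
  simp [lowProj]

lemma lowProj_e (N k : ℕ+) : lowProj N (e k) = if k ≤ N then e k else 0 := by
  simp only [lowProj_apply, inner_e_e, ite_smul, one_smul, zero_smul]
  rw [Finset.sum_ite_eq' (Finset.Iic N) k]
  simp

lemma IsRepresentation.lowProj_ae_eq_zero {T : ℝ} {c : ℕ+ × ℤ → ℂ} {f : ℝ → L2Ball}
    (h : IsRepresentation T c f) {N : ℕ+} (hc : ∀ n m, n ≤ N → c (n, m) = 0) :
    ∀ᵐ t ∂(timeMeasure T), lowProj N (f t) = 0 := by
  refine h.clm_ae_eq_zero _ fun p hp => ?_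
  rw [lowProj_e, if_neg fun hle => hp (hc _ _ hle)]

lemma IsRepresentation.lowProj_ae_eq_self {T : ℝ} {c : ℕ+ × ℤ → ℂ} {g : ℝ → L2Ball}
    (h : IsRepresentation T c g) {N : ℕ+} (hc : ∀ n m, N < n → c (n, m) = 0) :
    ∀ᵐ t ∂(timeMeasure T), lowProj N (g t) = g t := by
  have := h.clm_ae_eq_zero (ContinuousLinearMap.id ℂ L2Ball - lowProj N) fun p hp => by
    rw [sub_apply, lowProj_e,
      if_pos (not_lt.1 fun hlt => hp (hc _ _ hlt)), ContinuousLinearMap.id_apply, sub_self]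
  filter_upwards [this] with t ht
  rw [sub_apply, ContinuousLinearMap.id_apply, sub_eq_zero] at ht
  exact ht.symm

/-- Coefficients of low frequency can be dropped from any representation of a function without
low frequencies. -/
lemma IsRepresentation.truncate {T : ℝ} {c : ℕ+ × ℤ → ℂ} {f : ℝ → L2Ball}
    (h : IsRepresentation T c f) {N : ℕ+} (hf : ∀ᵐ t ∂(timeMeasure T), lowProj N (f t) = 0) :
    IsRepresentation T (fun p => if p.1 ≤ N then 0 else c p) f := by
  refine ⟨h.1, ?_⟩
  refine (h.tendsto_clm (ContinuousLinearMap.id ℂ L2Ball - lowProj N)).congr fun S =>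
    eLpNorm_congr_ae ?_
  filter_upwards [hf] with t ht
  rw [sub_apply, ht, ContinuousLinearMap.id_apply, sub_zero]
  congr 1
  refine Finset.sum_congr rfl fun p _ => ?_
  rw [sub_apply, lowProj_e, ContinuousLinearMap.id_apply]
  split_ifs <;> simp

lemma coeffNorm_truncate_le (s b : ℝ) (c : ℕ+ × ℤ → ℂ) (N : ℕ+) :
    coeffNorm s b (fun p => if p.1 ≤ N then 0 else c p) ≤ coeffNorm s b c := by
  refine ENNReal.rpow_le_rpow (ENNReal.tsum_le_tsum fun p => ENNReal.ofReal_le_ofReal ?_)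
    (by norm_num)
  refine mul_le_mul_of_nonneg_left ?_ (xsbWeight_pos s b p).le
  by_cases hp : p.1 ≤ N <;> simp [hp]

/-! ### Products with functions of low frequency -/

lemma inner_e_eq_zero_of_lowProj {N : ℕ+} {u : L2Ball} (hu : lowProj N u = u) {n : ℕ+} (hn : N < n) :
    inner ℂ (e n) u = (0 : ℂ) := by
  rw [← hu, lowProj_apply, inner_sum]
  refine Finset.sum_eq_zero fun k hk => ?_
  rw [inner_smul_right, inner_e_e, if_neg, mul_zero]
  rintro rfl
  exact absurd (Finset.mem_Iic.1 hk) (not_le.2 hn)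

lemma sum_smul_mulE_ae_eq (S : Finset ℕ+) (a : ℕ+ → ℂ) (h : L2Ball) :
    (fun x => h x * (∑ k ∈ S, a k • e k : L2Ball) x) =ᵐ[ballMeasure]
      (∑ k ∈ S, a k • mulE k h : L2Ball) := by
  classical
  induction S using Finset.induction_on with
  | empty =>
    simp only [Finset.sum_empty]
    filter_upwards [Lp.coeFn_zero ℂ 2 ballMeasure] with x hx
    rw [hx, Pi.zero_apply, mul_zero]
  | insert k S hk ih =>
    rw [Finset.sum_insert hk, Finset.sum_insert hk]
    filter_upwards [ih, Lp.coeFn_add (a k • e k) (∑ k ∈ S, a k • e k),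
      Lp.coeFn_add (a k • mulE k h) (∑ k ∈ S, a k • mulE k h), Lp.coeFn_smul (a k) (e k),
      Lp.coeFn_smul (a k) (mulE k h), mulE_ae_eq k h, e_ae_eq k] with x h1 h2 h3 h4 h5 h6 h7
    rw [h2, h3, Pi.add_apply, Pi.add_apply, mul_add, h1, h4, h5, Pi.smul_apply, Pi.smul_apply, h6,
      h7, smul_eq_mul, smul_eq_mul]
    ring

/-- A function fixed by the projection is a finite combination of the bounded functions `e k`. The
product with any `L²` function is thus in `L²`, and the default value of `mulL2` does not occur. -/
lemma mulL2_eq_sum {N : ℕ+} {u : L2Ball} (hu : lowProj N u = u) (h : L2Ball) :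
    MemLp (fun x => h x * u x) 2 ballMeasure ∧
      mulL2 h u = ∑ k ∈ Finset.Iic N, (inner ℂ (e k) u : ℂ) • mulE k h := by
  have h1 := sum_smul_mulE_ae_eq (Finset.Iic N) (fun k => inner ℂ (e k) u) h
  rw [← lowProj_apply, hu] at h1
  have h2 : MemLp (fun x => h x * u x) 2 ballMeasure := (memLp_congr_ae h1).2 (Lp.memLp _)
  refine ⟨h2, ?_⟩
  rw [mulL2, dif_pos h2]
  exact Lp.ext (h2.coeFn_toLp.trans h1)

/-- Only finitely many terms are nonzero, so no convergence question arises. -/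
lemma sqrtNegLaplacianPow_eq_sum {N : ℕ+} {u : L2Ball} (hu : lowProj N u = u) (γ : ℝ) :
    sqrtNegLaplacianPow γ u
      = ∑ k ∈ Finset.Iic N, (((z k ^ γ : ℝ) : ℂ) * inner ℂ (e k) u) • e k := by
  refine tsum_eq_sum fun n hn => ?_
  rw [inner_e_eq_zero_of_lowProj hu (not_le.1 (mt Finset.mem_Iic.2 hn)), mul_zero, zero_smul]

lemma memLp_inner_e {T : ℝ} {g : ℝ → L2Ball} (hg : MemLp g 2 (timeMeasure T)) (k : ℕ+) :
    MemLp (fun t => (inner ℂ (e k) (g t) : ℂ)) 2 (timeMeasure T) :=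
  (innerSL ℂ (e k)).comp_memLp' hg

lemma spaceTimeL2Norm_sqrtNegLaplacianPow {T : ℝ} {g : ℝ → L2Ball} (hg : MemLp g 2 (timeMeasure T))
    {N : ℕ+} (hgN : ∀ᵐ t ∂(timeMeasure T), lowProj N (g t) = g t) (γ : ℝ) :
    spaceTimeL2Norm T (fun t => sqrtNegLaplacianPow γ (g t)) =
      ENNReal.ofReal √(∑ k ∈ Finset.Iic N, z k ^ (2 * γ) *
        ∫ t, ‖(inner ℂ (e k) (g t) : ℂ)‖ ^ 2 ∂(timeMeasure T)) := by
  set G : ℝ → L2Ball := fun t => ∑ k ∈ Finset.Iic N, (((z k ^ γ : ℝ) : ℂ) * inner ℂ (e k) (g t)) • e k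
    with hG
  have h1 : spaceTimeL2Norm T (fun t => sqrtNegLaplacianPow γ (g t)) = eLpNorm G 2 (timeMeasure T) := by
    refine eLpNorm_congr_ae ?_
    filter_upwards [hgN] with t ht
    exact sqrtNegLaplacianPow_eq_sum ht γ
  have hGm : MemLp G 2 (timeMeasure T) := by
    refine memLp_finsetSum _ fun k _ => ?_
    exact ((ContinuousLinearMap.toSpanSingleton ℂ (e k)).comp_memLp'
      ((memLp_inner_e hg k).const_mul ((z k ^ γ : ℝ) : ℂ)))
  rw [h1, hGm.eLpNorm_eq_integral_rpow_norm (by norm_num) (by norm_num), Real.sqrt_eq_rpow]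
  congr 1
  have h2 : ∀ t, ‖G t‖ ^ (2 : ℝ≥0∞).toReal
      = ∑ k ∈ Finset.Iic N, z k ^ (2 * γ) * ‖(inner ℂ (e k) (g t) : ℂ)‖ ^ 2 := by
    intro t
    rw [ENNReal.toReal_ofNat, Real.rpow_ofNat, hG, norm_sum_smul_e_sq]
    refine Finset.sum_congr rfl fun k _ => ?_
    rw [norm_mul, mul_pow, Complex.norm_real, Real.norm_of_nonneg (Real.rpow_nonneg (z_pos k).le _),
      ← Real.rpow_ofNat, ← Real.rpow_mul (z_pos k).le, mul_comm γ]
  simp_rw [h2]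
  rw [integral_finsetSum _ fun k _ => ((memLp_inner_e hg k).integrable_norm_pow (by norm_num)).const_mul _]
  simp_rw [integral_const_mul]
  norm_num

lemma exists_natCast_rpow_le (β : ℝ) (hβ : 0 ≤ β) : ∃ B : ℝ, 0 < B ∧
    ∀ k : ℕ+, ((k : ℕ) : ℝ) ^ β ≤ B * z k ^ β := by
  obtain ⟨c, hc, -, h⟩ := exists_gap_z
  refine ⟨c⁻¹ ^ β, by positivity, fun k => ?_⟩
  rw [← Real.mul_rpow (by positivity) (z_pos k).le]
  refine Real.rpow_le_rpow (by positivity) ?_ hβ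
  rw [inv_mul_eq_div, le_div_iff₀ hc, mul_comm]
  exact h k

/-! ### Time coefficients of the product -/

section
variable {b : ℝ} {c : ℕ+ × ℤ → ℂ} {U : ℝ → L2Ball}

lemma exists_norm_partialSum_le (hb : 1 / 2 < b)
    (hc : Summable fun p => modWeight b p * ‖c p‖ ^ 2) :
    ∃ M : ℝ, 0 ≤ M ∧ ∀ t (S : Finset (ℕ+ × ℤ)), ‖∑ p ∈ S, (c p * timeMode p.2 t) • e p.1‖ ≤ M := by
  obtain ⟨B, hB, h⟩ := exists_norm_sum_timeMode_sq_le hb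
  refine ⟨√(B * ∑' p, modWeight b p * ‖c p‖ ^ 2), Real.sqrt_nonneg _, fun t S => ?_⟩
  refine Real.le_sqrt_of_sq_le ((h c t S).trans (mul_le_mul_of_nonneg_left ?_ hB.le))
  exact hc.sum_le_tsum S fun p _ => mul_nonneg (modWeight_pos b p).le (sq_nonneg _)

lemma aestronglyMeasurable_of_hasSum
    (hU : ∀ t, HasSum (fun p : ℕ+ × ℤ => (c p * timeMode p.2 t) • e p.1) (U t)) (ν : Measure ℝ) :
    AEStronglyMeasurable U ν := by
  refine aestronglyMeasurable_of_tendsto_ae (atTop : Filter (Finset (ℕ+ × ℤ)))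
    (f := fun S t => ∑ p ∈ S, (c p * timeMode p.2 t) • e p.1) (fun S => ?_)
    (Eventually.of_forall hU)
  refine Continuous.aestronglyMeasurable ?_
  unfold timeMode; fun_prop

lemma norm_inner_e_mulE_le (l k : ℕ+) (u : L2Ball) :
    ‖(inner ℂ (e l) (mulE k u) : ℂ)‖ ≤ √(z k) * ‖u‖ := by
  refine (norm_inner_le_norm _ _).trans ?_
  rw [orthonormal_e.1 l, one_mul]
  exact norm_mulE_le k u

/-- The product with a function of low frequency with coefficients `a k`. -/
def lowProduct (K : Finset ℕ+) (a : ℕ+ → ℝ → ℂ) (U : ℝ → L2Ball) (t : ℝ) : L2Ball :=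
  ∑ k ∈ K, a k t • mulE k (U t)

lemma memLp_lowProduct (hb : 1 / 2 < b) (hc : Summable fun p => modWeight b p * ‖c p‖ ^ 2)
    (hU : ∀ t, HasSum (fun p : ℕ+ × ℤ => (c p * timeMode p.2 t) • e p.1) (U t)) {T : ℝ}
    {a : ℕ+ → ℝ → ℂ} (ha : ∀ k, MemLp (a k) 2 (timeMeasure T)) (K : Finset ℕ+) :
    MemLp (lowProduct K a U) 2 (timeMeasure T) := by
  obtain ⟨M, hM, h⟩ := exists_norm_partialSum_le hb hc
  have hUM : ∀ t, ‖U t‖ ≤ M := fun t => le_of_tendsto (hU t).norm (Eventually.of_forall (h t))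
  refine memLp_finsetSum _ fun k _ => ?_
  refine (ha k).of_le_mul (c := √(z k) * M) ((ha k).aestronglyMeasurable.smul
    ((mulE k).continuous.comp_aestronglyMeasurable (aestronglyMeasurable_of_hasSum hU _)))
    (Eventually.of_forall fun t => ?_)
  rw [norm_smul, mul_comm]
  refine mul_le_mul_of_nonneg_right ?_ (norm_nonneg _)
  exact (norm_mulE_le k _).trans (mul_le_mul_of_nonneg_left (hUM t) (Real.sqrt_nonneg _))

lemma integrable_exp_mul {T : ℝ} {g : ℝ → ℂ} (hg : Integrable g (timeMeasure T)) (q : ℤ) :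
    Integrable (fun t : ℝ => Complex.exp (Complex.I * q * t) * g t) (timeMeasure T) := by
  refine hg.mono ((Continuous.aestronglyMeasurable (by fun_prop)).mul hg.aestronglyMeasurable)
    (Eventually.of_forall fun t => ?_)
  rw [norm_mul]
  have : ‖Complex.exp (Complex.I * q * t)‖ = 1 := by
    rw [mul_assoc, mul_comm, ← Complex.ofReal_intCast, ← Complex.ofReal_mul,
      Complex.norm_exp_ofReal_mul_I]
  rw [this, one_mul]

lemma exp_mul_timeMode (q m : ℤ) (t : ℝ) :
    Complex.exp (Complex.I * q * t) * timeMode m t = Complex.exp (Complex.I * ((q - m : ℤ) : ℂ) * t) := by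
  rw [timeMode, ← Complex.exp_add]
  congr 1
  push_cast; ring

/-- The partial sums for `U` are bounded uniformly in time, so dominated convergence applies. This
lets the estimate for finitely many coefficients pass to the limit. -/
lemma tendsto_timeCoeff_lowProduct (hb : 1 / 2 < b)
    (hc : Summable fun p => modWeight b p * ‖c p‖ ^ 2)
    (hU : ∀ t, HasSum (fun p : ℕ+ × ℤ => (c p * timeMode p.2 t) • e p.1) (U t)) {T : ℝ}
    {a : ℕ+ → ℝ → ℂ} (ha : ∀ k, MemLp (a k) 2 (timeMeasure T)) (K : Finset ℕ+) (l : ℕ+) (q : ℤ) :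
    Tendsto (fun S : Finset (ℕ+ × ℤ) => ∑ p ∈ S, c p * ∑ k ∈ K, (triple p.1 k l : ℂ) *
        timeCoeff T (a k) (q - p.2)) atTop
      (𝓝 (timeCoeff T (fun t => inner ℂ (e l) (lowProduct K a U t)) q)) := by
  obtain ⟨M, hM, h⟩ := exists_norm_partialSum_le hb hc
  have hai : ∀ k, Integrable (a k) (timeMeasure T) := fun k => (ha k).integrable (by norm_num)
  set F : Finset (ℕ+ × ℤ) → ℝ → ℂ := fun S t => Complex.exp (Complex.I * q * t) *
    ∑ k ∈ K, a k t * inner ℂ (e l) (mulE k (∑ p ∈ S, (c p * timeMode p.2 t) • e p.1)) with hF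
  have hFeq : ∀ S t, F S t = ∑ p ∈ S, c p * ∑ k ∈ K, (triple p.1 k l : ℂ) *
      (Complex.exp (Complex.I * ((q - p.2 : ℤ) : ℂ) * t) * a k t) := by
    intro S t
    simp only [hF, map_sum, map_smul, inner_sum, inner_smul_right, inner_e_mulE, Finset.mul_sum]
    rw [Finset.sum_comm]
    refine Finset.sum_congr rfl fun p _ => Finset.sum_congr rfl fun k _ => ?_
    rw [← exp_mul_timeMode]
    ring
  have hFint : ∀ S, (2 * Real.pi : ℂ)⁻¹ * ∫ t, F S t ∂(timeMeasure T)
      = ∑ p ∈ S, c p * ∑ k ∈ K, (triple p.1 k l : ℂ) * timeCoeff T (a k) (q - p.2) := by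
    intro S
    simp_rw [hFeq]
    rw [integral_finsetSum _ fun p _ => (integrable_finsetSum _ fun k _ =>
      (integrable_exp_mul (hai k) _).const_mul _).const_mul _, Finset.mul_sum]
    refine Finset.sum_congr rfl fun p _ => ?_
    rw [integral_const_mul, integral_finsetSum _ fun k _ =>
      (integrable_exp_mul (hai k) _).const_mul _, mul_left_comm, Finset.mul_sum]
    congr 1
    refine Finset.sum_congr rfl fun k _ => ?_
    rw [integral_const_mul, timeCoeff, mul_left_comm]
  simp_rw [← hFint]
  refine Tendsto.const_mul _ ?_
  refine tendsto_integral_filter_of_dominated_convergence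
    (fun t => ∑ k ∈ K, ‖a k t‖ * (√(z k) * M)) (Eventually.of_forall fun S => ?_)
    (Eventually.of_forall fun S => Eventually.of_forall fun t => ?_)
    (integrable_finsetSum _ fun k _ => (hai k).norm.mul_const _) (Eventually.of_forall fun t => ?_)
  · have : F S = fun t : ℝ => ∑ p ∈ S, c p * ∑ k ∈ K, (triple p.1 k l : ℂ) *
      (Complex.exp (Complex.I * ((q - p.2 : ℤ) : ℂ) * t) * a k t) := funext (hFeq S)
    rw [this]
    exact (integrable_finsetSum _ fun p _ => (integrable_finsetSum _ fun k _ =>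
      (integrable_exp_mul (hai k) _).const_mul _).const_mul _).aestronglyMeasurable
  · have h1 : ‖Complex.exp (Complex.I * q * t)‖ = 1 := by
      rw [mul_assoc, mul_comm, ← Complex.ofReal_intCast, ← Complex.ofReal_mul,
        Complex.norm_exp_ofReal_mul_I]
    simp only [hF]
    rw [norm_mul, h1, one_mul]
    refine (norm_sum_le _ _).trans (Finset.sum_le_sum fun k _ => ?_)
    rw [norm_mul]
    refine mul_le_mul_of_nonneg_left ?_ (norm_nonneg _)
    exact (norm_inner_e_mulE_le _ _ _).trans
      (mul_le_mul_of_nonneg_left (h t S) (Real.sqrt_nonneg _))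
  · refine Tendsto.const_mul _ ?_
    simp only [lowProduct, inner_sum, inner_smul_right]
    refine tendsto_finsetSum _ fun k _ => Tendsto.const_mul _ ?_
    exact (((innerSL ℂ (e l)).continuous.comp (mulE k).continuous).tendsto _).comp (hU t)

lemma timeCoeff_exp_mul {T : ℝ} (g : ℝ → ℂ) (q r : ℤ) :
    timeCoeff T (fun t => Complex.exp (Complex.I * q * t) * g t) r = timeCoeff T g (q + r) := by
  rw [timeCoeff, timeCoeff]
  congr 1
  refine integral_congr_ae (Eventually.of_forall fun t => ?_)
  simp only
  rw [← mul_assoc, ← Complex.exp_add]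
  congr 2
  push_cast; ring

end

/-- Summation of the coefficients of the product, against the weights of `X^{s,b-1}`. -/
theorem exists_sum_timeCoeff_lowProduct_le {s b μ : ℝ} (hs0 : 0 ≤ s) (hs1 : s ≤ 1)
    (hb : 1 / 2 < b) (hb1 : b ≤ 1) (hμ : 0 < μ) : ∃ B : ℝ, 0 < B ∧
    ∀ (T : ℝ), T < 1 / 2 → ∀ (N : ℕ+) (c : ℕ+ × ℤ → ℂ), (∀ n m, n ≤ N → c (n, m) = 0) →
    (Summable fun p => xsbWeight s b p * ‖c p‖ ^ 2) → ∀ U : ℝ → L2Ball,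
    (∀ t, HasSum (fun p : ℕ+ × ℤ => (c p * timeMode p.2 t) • e p.1) (U t)) →
    ∀ a : ℕ+ → ℝ → ℂ, (∀ k, MemLp (a k) 2 (timeMeasure T)) → ∀ (L : Finset ℕ+) (J' : Finset ℤ),
    ∑ l ∈ L, ∑ j' ∈ J', bracket (z l) ^ (2 * s) * (bracket (j' : ℝ) ^ (2 * b - 2) *
      ‖timeCoeff T (fun t => inner ℂ (e l) (lowProduct (Finset.Iic N) a U t)) (freq l + j')‖ ^ 2)
      ≤ B * ((∑' p, xsbWeight s b p * ‖c p‖ ^ 2) * ∑ k ∈ Finset.Iic N,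
        ((k : ℕ) : ℝ) ^ (10 * (2 * b - 1) + 2 * μ) * ∫ t, ‖a k t‖ ^ 2 ∂(timeMeasure T)) := by
  classical
  obtain ⟨B, hB, h⟩ := exists_sum_bilinear_le hs0 hs1 hb hb1 hμ
  -- The factor `2 ^ (2 b)` is the cost of replacing `z n ^ 2` by the nearest integer in the
  -- modulation weight.
  refine ⟨B * 2 ^ (2 * b), by positivity, fun T hT N c hcN hc U hU a ha L J' => ?_⟩
  have hc' : Summable fun p => modWeight b p * ‖c p‖ ^ 2 :=
    Summable.of_nonneg_of_le (fun p => mul_nonneg (modWeight_pos b p).le (sq_nonneg _))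
      (fun p => mul_le_mul_of_nonneg_right (modWeight_le_xsbWeight hs0 b p) (sq_nonneg _)) hc
  set Γ : ℝ := ∑ k ∈ Finset.Iic N,
        ((k : ℕ) : ℝ) ^ (10 * (2 * b - 1) + 2 * μ) * ∫ t, ‖a k t‖ ^ 2 ∂(timeMeasure T) with hΓ
  have hΓ0 : 0 ≤ Γ := Finset.sum_nonneg fun k _ =>
    mul_nonneg (by positivity) (integral_nonneg fun t => sq_nonneg _)
  have hlim := tendsto_finsetSum L fun l _ => tendsto_finsetSum J' fun j' _ =>
    (((((tendsto_timeCoeff_lowProduct hb hc' hU ha (Finset.Iic N) l (freq l + j')).norm.pow 2).const_mul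
      (bracket (j' : ℝ) ^ (2 * b - 2))).const_mul (bracket (z l) ^ (2 * s))))
  refine le_of_tendsto hlim (Eventually.of_forall fun R => ?_)
  -- The finite estimate is stated for products of index sets. In the variables `n` and `m - freq n`
  -- the set `R` is enclosed in such a product and the coefficients are extended by zero.
  set S : Finset ℕ+ := R.image Prod.fst with hS
  set J : Finset ℤ := R.image fun p => p.2 - freq p.1 with hJ
  set F : ℕ+ → ℤ → ℂ := fun n j => if (n, freq n + j) ∈ R then c (n, freq n + j) else 0 with hF
  have reindex : ∀ {M : Type} [AddCommMonoid M] (w : ℕ+ → ℤ → M),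
      (∀ n j, (n, freq n + j) ∉ R → w n j = 0) →
      ∑ n ∈ S, ∑ j ∈ J, w n j = ∑ p ∈ R, w p.1 (p.2 - freq p.1) := by
    intro M _ w hw
    rw [← Finset.sum_product']
    symm
    refine Finset.sum_of_injOn (fun p : ℕ+ × ℤ => (p.1, p.2 - freq p.1)) ?_ ?_ ?_ ?_
    · rintro ⟨n, m⟩ _ ⟨n', m'⟩ _ hpp
      simp only [Prod.mk.injEq] at hpp
      obtain ⟨rfl, h2⟩ := hpp
      exact Prod.ext rfl (sub_left_injective h2)
    · intro p hp
      have h1 : p.1 ∈ S := Finset.mem_image_of_mem Prod.fst (Finset.mem_coe.1 hp)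
      have h2 : p.2 - freq p.1 ∈ J :=
        Finset.mem_image_of_mem (fun p : ℕ+ × ℤ => p.2 - freq p.1) (Finset.mem_coe.1 hp)
      exact Finset.mem_coe.2 (Finset.mem_product.2 ⟨h1, h2⟩)
    · rintro ⟨n, j⟩ _ hnot
      refine hw n j fun hmem => hnot ⟨(n, freq n + j), hmem, ?_⟩
      simp
    · intro p _; rfl
  have hval : ∀ p ∈ R, F p.1 (p.2 - freq p.1) = c p := by
    intro p hp
    simp only [hF, add_sub_cancel, Prod.mk.eta, if_pos hp]
  have hFN : ∀ n ∈ S, n ∉ S.filter (N < ·) → ∀ j, F n j = 0 := by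
    intro n hn hn' j
    have : n ≤ N := not_lt.1 fun hlt => hn' (Finset.mem_filter.2 ⟨hn, hlt⟩)
    simp only [hF, hcN n _ this, ite_self]
  have key := h (Finset.Iic N) (S.filter (N < ·)) L J J'
    (fun n hn k hk => lt_of_le_of_lt (Finset.mem_Iic.1 hk) (Finset.mem_filter.1 hn).2) F
    (fun k => timeCoeff T (a k)) (fun k => ∫ t, ‖a k t‖ ^ 2 ∂(timeMeasure T))
    fun k _ Q => sum_norm_sq_timeCoeff_le (by linarith [Real.pi_gt_three]) (ha k) Q
  have e1 : ∀ l j', ∑ n ∈ S.filter (N < ·), ∑ j ∈ J, F n j * ∑ k ∈ Finset.Iic N,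
      (triple n k l : ℂ) * timeCoeff T (a k) (freq l + j' - freq n - j)
      = ∑ p ∈ R, c p * ∑ k ∈ Finset.Iic N, (triple p.1 k l : ℂ) *
        timeCoeff T (a k) (freq l + j' - p.2) := by
    intro l j'
    rw [Finset.sum_subset (Finset.filter_subset _ S) fun n hn hn' =>
      Finset.sum_eq_zero fun j _ => by rw [hFN n hn hn', zero_mul], reindex]
    · refine Finset.sum_congr rfl fun p hp => ?_
      rw [hval p hp]
      congr 1
      refine Finset.sum_congr rfl fun k _ => ?_
      congr 2
      ring
    · intro n j hnot
      simp only [hF, if_neg hnot, zero_mul]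
  have e2 : ∑ n ∈ S.filter (N < ·), ∑ j ∈ J,
      bracket (z n) ^ (2 * s) * bracket (j : ℝ) ^ (2 * b) * ‖F n j‖ ^ 2
      ≤ 2 ^ (2 * b) * ∑' p, xsbWeight s b p * ‖c p‖ ^ 2 := by
    rw [Finset.sum_subset (Finset.filter_subset _ S) fun n hn hn' =>
      Finset.sum_eq_zero fun j _ => by rw [hFN n hn hn']; simp, reindex]
    · refine le_trans ?_ (mul_le_mul_of_nonneg_left (hc.sum_le_tsum R fun p _ =>
        mul_nonneg (xsbWeight_pos s b p).le (sq_nonneg _)) (by positivity))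
      rw [Finset.mul_sum]
      refine Finset.sum_le_sum fun p hp => ?_
      rw [hval p hp, xsbWeight, modWeight, ← mul_assoc]
      refine mul_le_mul_of_nonneg_right ?_ (sq_nonneg _)
      rw [mul_left_comm]
      refine mul_le_mul_of_nonneg_left ?_ (Real.rpow_pos_of_pos (bracket_pos _) _).le
      rw [← Real.mul_rpow two_pos.le (bracket_pos _).le]
      refine Real.rpow_le_rpow (bracket_pos _).le ?_ (by linarith)
      have e3 : bracket ((p.2 - freq p.1 : ℤ) : ℝ) = bracket ((freq p.1 - p.2 : ℤ) : ℝ) := by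
        simp only [bracket]; push_cast; ring_nf
      rw [e3]
      refine bracket_le_two_mul ?_
      have := abs_sub_freq_le p.1
      rw [abs_sub_comm] at this
      push_cast
      rwa [sub_sub_sub_cancel_right]
    · intro n j hnot
      simp only [hF, if_neg hnot]; simp
  simp only [e1, mul_assoc (bracket _ ^ (2 * s))] at key
  refine key.trans ?_
  rw [mul_assoc B]
  refine mul_le_mul_of_nonneg_left ?_ hB.le
  rw [← mul_assoc]
  refine mul_le_mul_of_nonneg_right ?_ hΓ0
  simpa only [mul_assoc] using e2

/-! ### Representation of the Duhamel term -/

lemma phase_eq (l : ℕ+) (t τ : ℝ) :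
    phase (t - τ) l = timeMode (freq l) t *
      (Complex.exp (-(Complex.I * ((z l ^ 2 - freq l : ℝ) : ℂ) * (t - τ))) *
        Complex.exp (Complex.I * (freq l : ℂ) * τ)) := by
  rw [phase, timeMode, ← Complex.exp_add, ← Complex.exp_add]
  congr 1
  push_cast; ring

lemma timeMode_add (m j : ℤ) (t : ℝ) : timeMode (m + j) t = timeMode m t * timeMode j t := by
  rw [timeMode, timeMode, timeMode, ← Complex.exp_add]
  congr 1
  push_cast; ring

lemma modWeight_le {b : ℝ} (hb : 0 ≤ b) (p : ℕ+ × ℤ) :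
    modWeight b p ≤ 2 ^ (2 * b) * bracket ((p.2 - freq p.1 : ℤ) : ℝ) ^ (2 * b) := by
  rw [modWeight, ← Real.mul_rpow two_pos.le (bracket_pos _).le]
  refine Real.rpow_le_rpow (bracket_pos _).le ?_ (by linarith)
  have e3 : bracket ((p.2 - freq p.1 : ℤ) : ℝ) = bracket ((freq p.1 - p.2 : ℤ) : ℝ) := by
    simp only [bracket]; push_cast; ring_nf
  rw [e3]
  refine bracket_le_two_mul ?_
  push_cast
  rw [sub_sub_sub_cancel_right]
  exact abs_sub_freq_le p.1

/-- After removing `timeMode (freq l)`, the component of the Duhamel term along `e l` is a scalar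
Duhamel integral with `δ = z l ^ 2 - freq l`, `|δ| ≤ 1 / 2`. The scalar expansions, shifted back by
`freq l`, are the rows of `d`. -/
theorem exists_duhamel_representation (s : ℝ) {b : ℝ} (hs : 0 ≤ s) (hb : 1 / 2 < b) (hb1 : b ≤ 1) :
    ∃ B : ℝ, 0 < B ∧ ∀ (T : ℝ), T < 1 / 2 → ∀ H : ℝ → L2Ball, MemLp H 2 (timeMeasure T) →
    ∀ R : ℝ, (∀ (L : Finset ℕ+) (J : Finset ℤ), ∑ l ∈ L, ∑ j ∈ J, bracket (z l) ^ (2 * s) *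
      (bracket (j : ℝ) ^ (2 * b - 2) *
        ‖timeCoeff T (fun t => inner ℂ (e l) (H t)) (freq l + j)‖ ^ 2) ≤ R) →
    ∃ d : ℕ+ × ℤ → ℂ, (∀ S : Finset (ℕ+ × ℤ), ∑ p ∈ S, xsbWeight s b p * ‖d p‖ ^ 2 ≤ B * R) ∧
      ∀ u : ℝ → L2Ball, (∀ t ∈ Set.Ico 0 T, u t = ∫ τ in (0 : ℝ)..t, propagator (t - τ) (H τ)) →
        IsRepresentation T d u := by
  classical
  obtain ⟨B, hB, hduh⟩ := exists_duhamel_expansion hb hb1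
  refine ⟨2 ^ (2 * b) * B, by positivity, fun T hT H hH R hR => ?_⟩
  set G : ℕ+ → ℝ → ℂ := fun l t => Complex.exp (Complex.I * (freq l : ℂ) * t) * inner ℂ (e l) (H t)
    with hG
  have hGm : ∀ l, MemLp (G l) 2 (timeMeasure T) := fun l => by
    refine (memLp_inner_e hH l).of_le
      ((Continuous.aestronglyMeasurable (by fun_prop)).mul (memLp_inner_e hH l).aestronglyMeasurable)
      (Eventually.of_forall fun t => ?_)
    have h1 : ‖Complex.exp (Complex.I * (freq l : ℂ) * t)‖ = 1 := by
      rw [mul_assoc, mul_comm, ← Complex.ofReal_intCast, ← Complex.ofReal_mul,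
        Complex.norm_exp_ofReal_mul_I]
    simp only [hG]
    rw [norm_mul, h1, one_mul]
  set y : ℕ+ → ℤ → ℝ := fun l j => bracket (j : ℝ) ^ (2 * b - 2) * ‖timeCoeff T (G l) j‖ ^ 2 with hy
  have hy0 : ∀ l j, 0 ≤ y l j := fun l j =>
    mul_nonneg (Real.rpow_pos_of_pos (bracket_pos _) _).le (sq_nonneg _)
  have hβ : ∀ l, 0 < bracket (z l) ^ (2 * s) := fun l => Real.rpow_pos_of_pos (bracket_pos _) _
  have hyR : ∀ (L : Finset ℕ+) (J : Finset ℤ), ∑ l ∈ L, ∑ j ∈ J, bracket (z l) ^ (2 * s) * y l j ≤ R := by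
    intro L J
    simpa only [hy, hG, timeCoeff_exp_mul] using hR L J
  have hysum : ∀ l, Summable (y l) := fun l => by
    refine summable_of_sum_le (c := (bracket (z l) ^ (2 * s))⁻¹ * R) (hy0 l) fun J => ?_
    have := hyR {l} J
    rw [Finset.sum_singleton, ← Finset.mul_sum] at this
    rwa [inv_mul_eq_div, le_div_iff₀ (hβ l), mul_comm]
  have hyL : ∀ L : Finset ℕ+, ∑ l ∈ L, bracket (z l) ^ (2 * s) * ∑' j, y l j ≤ R := fun L => by
    have := tendsto_finsetSum L fun l _ => ((hysum l).hasSum.mul_left (bracket (z l) ^ (2 * s)))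
    exact le_of_tendsto this (Eventually.of_forall (hyR L))
  -- Each row is bounded by its own weighted sum rather than by `R`, so that the bounds can be added
  -- over `l`.
  have hex := fun l => hduh T hT (G l) (hGm l) (z l ^ 2 - freq l) (abs_sub_freq_le l) (∑' j, y l j)
    fun J => (hysum l).sum_le_tsum J fun j _ => hy0 l j
  choose a ha hat using hex
  set d : ℕ+ × ℤ → ℂ := fun p => a p.1 (p.2 - freq p.1) with hd
  have hdS : ∀ S : Finset (ℕ+ × ℤ), ∑ p ∈ S, xsbWeight s b p * ‖d p‖ ^ 2 ≤ 2 ^ (2 * b) * B * R := by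
    intro S
    have hmaps : ∀ p ∈ S, p.1 ∈ S.image Prod.fst := fun p hp => Finset.mem_image_of_mem _ hp
    rw [← Finset.sum_fiberwise_of_maps_to hmaps]
    refine le_trans ?_ (mul_le_mul_of_nonneg_left (hyL (S.image Prod.fst)) (by positivity))
    rw [Finset.mul_sum]
    refine Finset.sum_le_sum fun l _ => ?_
    have h1 : ∀ p ∈ S.filter (fun p => p.1 = l), xsbWeight s b p * ‖d p‖ ^ 2 ≤
        2 ^ (2 * b) * bracket (z l) ^ (2 * s) *
          (bracket ((p.2 - freq l : ℤ) : ℝ) ^ (2 * b) * ‖a l (p.2 - freq l)‖ ^ 2) := by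
      intro p hp
      have hp1 := (Finset.mem_filter.1 hp).2
      have h2 := modWeight_le (by linarith : 0 ≤ b) p
      rw [xsbWeight, hd]
      simp only
      rw [hp1] at h2 ⊢
      have h3 := mul_le_mul_of_nonneg_right (mul_le_mul_of_nonneg_left h2 (hβ l).le)
        (sq_nonneg ‖a l (p.2 - freq l)‖)
      refine h3.trans (le_of_eq ?_)
      ring
    refine (Finset.sum_le_sum h1).trans ?_
    rw [← Finset.mul_sum, ← Finset.sum_image (g := fun p : ℕ+ × ℤ => p.2 - freq l)
      (f := fun j : ℤ => bracket (j : ℝ) ^ (2 * b) * ‖a l j‖ ^ 2)]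
    · refine (mul_le_mul_of_nonneg_left (ha l _)
        (mul_pos (by positivity) (hβ l)).le).trans (le_of_eq ?_)
      ring
    · intro p hp p' hp' hpp
      exact Prod.ext ((Finset.mem_filter.1 hp).2.trans (Finset.mem_filter.1 hp').2.symm)
        (sub_left_injective hpp)
  have hdsum : Summable fun p => modWeight b p * ‖d p‖ ^ 2 := by
    refine summable_of_sum_le (c := 2 ^ (2 * b) * B * R)
      (fun p => mul_nonneg (modWeight_pos b p).le (sq_nonneg _)) fun S => ?_
    exact (Finset.sum_le_sum fun p _ => mul_le_mul_of_nonneg_right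
      (modWeight_le_xsbWeight hs b p) (sq_nonneg _)).trans (hdS S)
  refine ⟨d, hdS, fun u hu => isRepresentation_of_hasSum hb hdsum fun t ht => ?_⟩
  have hHi : Integrable H (timeMeasure T) := hH.integrable (by norm_num)
  have hV := (summable_timeMode hb hdsum t).hasSum
  set V := ∑' p : ℕ+ × ℤ, (d p * timeMode p.2 t) • e p.1 with hVdef
  have hVu : V = u t := by
    rw [hu t ht]
    refine eq_of_inner_e_eq (fun l => ?_) (fun v hv => ?_) fun v hv =>
      inner_integral_propagator_of_orthogonal hHi ht hv
    · rw [inner_e_integral_propagator hHi ht]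
      have h1 := (innerSL ℂ (e l)).hasSum hV
      simp only [innerSL_apply_apply, inner_smul_right, inner_e_e] at h1
      have hinj : Function.Injective fun j : ℤ => (l, freq l + j) := fun j j' hj =>
        add_right_injective _ (Prod.mk.inj hj).2
      rw [← hinj.hasSum_iff] at h1
      · have h2 := (hat l t ht).mul_left (timeMode (freq l) t)
        have h3 : ∫ τ in (0 : ℝ)..t, phase (t - τ) l * inner ℂ (e l) (H τ) = timeMode (freq l) t *
            ∫ τ in (0 : ℝ)..t, Complex.exp
              (-(Complex.I * ((z l ^ 2 - freq l : ℝ) : ℂ) * (t - τ))) * G l τ := by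
          rw [← intervalIntegral.integral_const_mul]
          refine intervalIntegral.integral_congr fun τ _ => ?_
          simp only [hG]
          rw [phase_eq]
          ring
        rw [h3]
        refine h1.unique (h2.congr_fun fun j => ?_)
        simp only [Function.comp_apply, hd, if_pos, add_sub_cancel_left, timeMode_add, mul_one]
        ring
      · rintro ⟨n, m⟩ hnm
        have : l ≠ n := by
          rintro rfl
          exact hnm ⟨m - freq l, by simp⟩
        simp only [if_neg this, mul_zero]
    · have h1 := (innerSL ℂ v).hasSum hV
      simp only [innerSL_apply_apply, inner_smul_right, hv, mul_zero] at h1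
      exact h1.unique hasSum_zero
  rwa [hVu] at hV

/-! ### The bilinear estimate for one representation -/

lemma duhamel_eq {T : ℝ} {f g H : ℝ → L2Ball}
    (h : ∀ᵐ τ ∂(timeMeasure T), mulL2 (f τ) (g τ) = H τ) {t : ℝ} (ht : t ∈ Set.Ico 0 T) :
    duhamel f g t = ∫ τ in (0 : ℝ)..t, propagator (t - τ) (H τ) := by
  rw [duhamel, intervalIntegral.integral_of_le ht.1, intervalIntegral.integral_of_le ht.1]
  rw [timeMeasure_eq] at h
  refine integral_congr_ae ?_
  filter_upwards [ae_restrict_of_ae_restrict_of_subset (Set.Ioc_subset_Ioc_right ht.2.le) h]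
    with τ hτ
  rw [hτ]

/-- The estimate for one representation of `f`; the infimum is taken afterwards. The frequency
conditions are put on `f` and `g` through the projection, so that they do not depend on the
representation. -/
theorem exists_xsbNorm_duhamel_le {s b μ : ℝ} (hs0 : 0 ≤ s) (hs1 : s ≤ 1) (hb : 1 / 2 < b)
    (hb1 : b ≤ 1) (hμ : 0 < μ) : ∃ C : ℝ, 0 < C ∧ ∀ T : ℝ, T < 1 / 2 → ∀ (N : ℕ+)
    (f g : ℝ → L2Ball), (∀ᵐ t ∂(timeMeasure T), lowProj N (f t) = 0) → MemLp g 2 (timeMeasure T) →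
    (∀ᵐ t ∂(timeMeasure T), lowProj N (g t) = g t) →
    ∀ c : ℕ+ × ℤ → ℂ, IsRepresentation T c f → coeffNorm s b c < ⊤ →
    Integrable (fun τ => mulL2 (f τ) (g τ)) (timeMeasure T) ∧
    xsbNorm T s b (duhamel f g) ≤ ENNReal.ofReal C * coeffNorm s b c *
      spaceTimeL2Norm T (fun t => sqrtNegLaplacianPow (5 * (2 * b - 1) + μ) (g t)) := by
  obtain ⟨B₁, hB₁, hsum⟩ := exists_sum_timeCoeff_lowProduct_le hs0 hs1 hb hb1 hμ
  obtain ⟨B₂, hB₂, hduh⟩ := exists_duhamel_representation s hs0 hb hb1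
  obtain ⟨B₃, hB₃, hz⟩ := exists_natCast_rpow_le (10 * (2 * b - 1) + 2 * μ) (by linarith)
  refine ⟨√(B₂ * B₁ * B₃), by positivity, fun T hT N f g hf hg hgN c hc hcfin => ?_⟩
  -- An arbitrary representation of `f` on the short interval may contain low frequencies although
  -- `f` has none. Dropping them leaves `f` unchanged and does not increase the norm.
  set c' : ℕ+ × ℤ → ℂ := fun p => if p.1 ≤ N then 0 else c p with hc'def
  have hc' : IsRepresentation T c' f := hc.truncate hf
  have hle : coeffNorm s b c' ≤ coeffNorm s b c := coeffNorm_truncate_le s b c N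
  obtain ⟨hA, hAeq⟩ := summable_of_coeffNorm_lt_top (hle.trans_lt hcfin)
  set A : ℝ := ∑' p, xsbWeight s b p * ‖c' p‖ ^ 2 with hAdef
  have hA0 : 0 ≤ A := tsum_nonneg fun p => mul_nonneg (xsbWeight_pos s b p).le (sq_nonneg _)
  have hmod : Summable fun p => modWeight b p * ‖c' p‖ ^ 2 :=
    Summable.of_nonneg_of_le (fun p => mul_nonneg (modWeight_pos b p).le (sq_nonneg _))
      (fun p => mul_le_mul_of_nonneg_right (modWeight_le_xsbWeight hs0 b p) (sq_nonneg _)) hA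
  obtain ⟨U, hU⟩ : ∃ U : ℝ → L2Ball,
      ∀ t, HasSum (fun p : ℕ+ × ℤ => (c' p * timeMode p.2 t) • e p.1) (U t) :=
    ⟨_, fun t => (summable_timeMode hb hmod t).hasSum⟩
  have hfU : f =ᵐ[timeMeasure T] U := hc'.ae_eq (isRepresentation_of_hasSum hb hmod fun t _ => hU t)
  set a : ℕ+ → ℝ → ℂ := fun k t => inner ℂ (e k) (g t) with ha
  have haL : ∀ k, MemLp (a k) 2 (timeMeasure T) := memLp_inner_e hg
  have hHL := memLp_lowProduct hb hmod hU haL (Finset.Iic N)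
  have hprod : ∀ᵐ τ ∂(timeMeasure T), mulL2 (f τ) (g τ) = lowProduct (Finset.Iic N) a U τ := by
    filter_upwards [hfU, hgN] with τ h1 h2
    rw [(mulL2_eq_sum h2 (f τ)).2, h1]; rfl
  refine ⟨(hHL.integrable (by norm_num)).congr (hprod.mono fun τ hτ => hτ.symm), ?_⟩
  obtain ⟨d, hd, hrep⟩ := hduh T hT _ hHL _ (hsum T hT N c'
    (fun n m hn => by simp only [hc'def, if_pos hn]) hA U hU a haL)
  have h1 : xsbNorm T s b (duhamel f g) ≤ coeffNorm s b d :=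
    iInf₂_le d (hrep _ fun t ht => duhamel_eq hprod ht)
  refine h1.trans ((coeffNorm_le hd).trans ?_)
  rw [spaceTimeL2Norm_sqrtNegLaplacianPow hg hgN]
  have hexp : 2 * (5 * (2 * b - 1) + μ) = 10 * (2 * b - 1) + 2 * μ := by ring
  rw [hexp]
  set Γ : ℝ := ∑ k ∈ Finset.Iic N, z k ^ (10 * (2 * b - 1) + 2 * μ) *
        ∫ t, ‖(inner ℂ (e k) (g t) : ℂ)‖ ^ 2 ∂(timeMeasure T) with hΓ
  have hΓle : ∑ k ∈ Finset.Iic N, ((k : ℕ) : ℝ) ^ (10 * (2 * b - 1) + 2 * μ) *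
      ∫ t, ‖a k t‖ ^ 2 ∂(timeMeasure T) ≤ B₃ * Γ := by
    rw [hΓ, Finset.mul_sum]
    refine Finset.sum_le_sum fun k _ => ?_
    rw [← mul_assoc]
    exact mul_le_mul_of_nonneg_right (hz k) (integral_nonneg fun t => sq_nonneg _)
  refine le_trans ?_ (mul_le_mul_left (mul_le_mul_right hle (ENNReal.ofReal √(B₂ * B₁ * B₃))) _)
  rw [← hAeq, ← ENNReal.ofReal_mul (by positivity), ← ENNReal.ofReal_mul (by positivity),
    ← Real.sqrt_mul (by positivity), ← Real.sqrt_mul (by positivity)]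
  refine ENNReal.ofReal_le_ofReal (Real.sqrt_le_sqrt ?_)
  have h2 := mul_le_mul_of_nonneg_left hΓle (by positivity : 0 ≤ B₂ * B₁ * A)
  calc _ = B₂ * B₁ * A * ∑ k ∈ Finset.Iic N, ((k : ℕ) : ℝ) ^ (10 * (2 * b - 1) + 2 * μ) *
      ∫ t, ‖a k t‖ ^ 2 ∂(timeMeasure T) := by ring
    _ ≤ _ := h2
    _ = _ := by ring

end RadialNLS

end

theorem proposition4p1 (s b μ : ℝ) (hs0 : 0 ≤ s) (hs1 : s ≤ 1) (hb : 1 / 2 < b) (hb1 : b ≤ 1)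
    (hμ : 0 < μ) :
    ∃ C : ℝ, 0 < C ∧
      ∀ (T : ℝ), 0 < T → T < 1 / 2 → ∀ (N : ℕ+) (f g : ℝ → RadialNLS.L2Ball),
        (∃ c : ℕ+ × ℤ → ℂ, (∀ n m, n ≤ N → c (n, m) = 0) ∧ RadialNLS.IsRepresentation T c f) →
        (∃ c : ℕ+ × ℤ → ℂ, (∀ n m, N < n → c (n, m) = 0) ∧ RadialNLS.IsRepresentation T c g) →
        RadialNLS.xsbNorm T s b f < ⊤ →
        -- the Duhamel term is well defined: the product is in `L²(B)` for almost every time and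
        -- the time integral converges
        (∀ᵐ τ ∂(RadialNLS.timeMeasure T),
          MeasureTheory.MemLp (fun x => f τ x * g τ x) 2 RadialNLS.ballMeasure) ∧
        (∀ t ∈ Set.Ico 0 T, IntervalIntegrable
          (fun τ => RadialNLS.propagator (t - τ) (RadialNLS.mulL2 (f τ) (g τ)))
          MeasureTheory.volume 0 t) ∧
        -- the bilinear estimate
        RadialNLS.xsbNorm T s b (RadialNLS.duhamel f g) ≤
          ENNReal.ofReal C * RadialNLS.xsbNorm T s b f *
            RadialNLS.spaceTimeL2Norm T
              (fun t => RadialNLS.sqrtNegLaplacianPow (5 * (2 * b - 1) + μ) (g t)) := by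
  obtain ⟨C, hC, h⟩ := RadialNLS.exists_xsbNorm_duhamel_le hs0 hs1 hb hb1 hμ
  refine ⟨C, hC, fun T _ hT N f g hf hg hfin => ?_⟩
  obtain ⟨cf, hcf, hf⟩ := hf
  obtain ⟨cg, hcg, hg⟩ := hg
  have hfN := hf.lowProj_ae_eq_zero hcf
  have hgN := hg.lowProj_ae_eq_self hcg
  have key := h T hT N f g hfN hg.1 hgN
  obtain ⟨c₀, hc₀⟩ := iInf_lt_iff.1 hfin
  obtain ⟨hr₀, hlt₀⟩ := iInf_lt_iff.1 hc₀
  refine ⟨?_, fun t ht => RadialNLS.intervalIntegrable_propagator (key c₀ hr₀ hlt₀).1 ht, ?_⟩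
  · filter_upwards [hgN] with τ hτ
    exact (RadialNLS.mulL2_eq_sum hτ (f τ)).1
  · set M := RadialNLS.spaceTimeL2Norm T
      (fun t => RadialNLS.sqrtNegLaplacianPow (5 * (2 * b - 1) + μ) (g t)) with hM
    have hMtop : M ≠ ⊤ := by
      rw [hM, RadialNLS.spaceTimeL2Norm_sqrtNegLaplacianPow hg.1 hgN]
      exact ENNReal.ofReal_ne_top
    rw [mul_right_comm]
    -- A factor may be moved into the infimum over representations only if it is neither zero nor
    -- infinite. If it is zero, a single representation of finite norm already gives the claim.
    by_cases hK : ENNReal.ofReal C * M = 0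
    · have := (key c₀ hr₀ hlt₀).2
      rw [mul_right_comm, hK, zero_mul] at this
      exact this.trans zero_le
    · have hK' : ENNReal.ofReal C * M ≠ ⊤ := ENNReal.mul_ne_top ENNReal.ofReal_ne_top hMtop
      rw [RadialNLS.xsbNorm.eq_def T s b f, ENNReal.mul_iInf_of_ne hK hK']
      refine le_iInf fun c => ?_
      rw [ENNReal.mul_iInf_of_ne hK hK']
      refine le_iInf fun hc => ?_
      -- For a representation of infinite norm the right side is infinite, the other factor being
      -- nonzero.
      by_cases hfinc : RadialNLS.coeffNorm s b c < ⊤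
      · rw [mul_right_comm]
        exact (key c hc hfinc).2
      · rw [not_lt_top_iff.1 hfinc, ENNReal.mul_top hK]
        exact le_top
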